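/- **Model.** Everything is indexed by a security parameter $m$. An efficient (polynomial-time) algorithm or party is a family of quantum circuits, one for each $m$, with $\mathrm{poly}(m)$ elementary gates (one- and two-qubit quantum operations, and intermediate measurements with feed-forward) acting on $\mathrm{poly}(m)$ qubits. A classical two-party functionality $\mathcal F$ is a conditional distribution $P_{XY|UV}$ on bit strings. A two-party quantum protocol $\pi=(\mathsf A,\mathsf B)$ for $\mathcal F$ is a family of interactive quantum circuits with classical inputs $U,V$ and classical outputs $X,Y$ for the honest players, in which both players get a common reference string (CRS) $\omega$ drawn from a distribution depending only on $m$. An *input sampler* is a family of circuits which on input $\omega$ produces Alice's classical input $U$, classical auxiliary information $W$ that stays with Alice, and classical information $Z$ and a quantum state $V'$ for dishonest Bob. It is *legitimate* if for every value of $\omega$ the state satisfies $\rho_{(W,U)ZV'}=\rho_{(W,U)\leftrightarrow Z\leftrightarrow V'}$, i.e. $V'$ is correlated with Alice's information only via $Z$. *Real world:* $\omega$ is drawn from its distribution and given to the sampler, to Alice and to $\mathsf B'$; then $\mathsf A$ on input $U$ and $\mathsf B'$ on input $(Z,V')$ run the protocol. *Ideal world:* $\hat{\mathsf B}'$ does not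 get the reference string; he chooses himself a string $\tilde\omega$, which is given to the sampler, keeps a private quantum state, then receives $(Z,V')$ and interacts with honest $\hat{\mathsf A}$ and with the functionality, where a call consists of producing a classical input $v$ and receiving the classical reply $y$. In both worlds the output $out$ is the joint state of $W$, Alice's classical output $X$ and Bob's quantum output $Y'$. Two families of states are q-indistinguishable ($\stackrel{q}{\approx}$) if every efficient quantum algorithm distinguishes them with advantage negligible in $m$. The protocol $\pi$ is a *computationally secure implementation of $\mathcal F$ against dishonest Bob* if for every efficient real-world $\mathsf B'$ there is an efficient ideal-world $\hat{\mathsf B}'$, not using the CRS, such that for every efficient legitimate input sampler $out^{\pi}_{\mathsf A,\mathsf B'}\stackrel{q}{\approx}out^{\mathcal F}_{\hat{\mathsf A},\hat{\mathsf B}'}$. A *classical oracle protocol* $\Sigma^{\mathcal F_1\cdots\mathcal F_\ell}=(\hat{\mathsf A},\hat{\mathsf B})$ has classical inputs and outputs for the honest players. It proceeds in rounds: the players exchange classical messages and then make at most one call to one of the functionalities $\mathcal F_i$; whether a call is made, and the index $i$ of the functionality called (made known to both players), may depend on the execution so far. The honest player's memory is classical at the time of a call. Local computations may be quantum. $\Sigma^{\pi_1\cdots\pi_\ell}$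 is obtained by replacing each call to $\mathcal F_i$ by an execution of $\pi_i$. Its CRS $\omega$ consists of independent parts, a separate one for every round and every $\pi_i$ that may be called in it, each drawn from the distribution prescribed by $\pi_i$; every execution uses its own part. **Theorem (Sequential Composition).** Let $\mathcal F_1,\dots,\mathcal F_\ell$ be functionalities that can be sampled by polynomial-size circuits up to a negligible error, uniformly in the inputs. Let $\Sigma^{\mathcal F_1\cdots\mathcal F_\ell}$ be a classical two-party oracle protocol with polynomial-time honest Alice and at most $\mathrm{poly}(m)$ rounds, hence at most $k=\mathrm{poly}(m)$ oracle calls. For every $i\in\{1,\dots,\ell\}$ let $\pi_i$, with polynomial-time honest Alice, be a computationally secure implementation of $\mathcal F_i$ against dishonest Bob. Then for every efficient real-world adversary $\mathsf B'$ attacking $\Sigma^{\pi_1\cdots\pi_\ell}$, who knows the whole reference string $\omega$ from the start, there is an efficient ideal-world adversary $\hat{\mathsf B}'$, not using the CRS, such that for every efficient legitimate input sampler $$out_{\mathsf A,\mathsf B'}^{\Sigma^{\pi_1\cdots\pi_\ell}}\ \stackrel{q}{\approx}\ out_{\hat{\mathsf A},\hat{\mathsf B}'}^{\Sigma^{\mathcal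 F_1\cdots\mathcal F_\ell}} .$$ -/

import Mathlib

open Filter
open scoped Matrix

namespace SeqComp

noncomputable section

/-! ### Registers, states and circuits -/

/-- A register: a finite set of wires, each carrying one (qu)bit. -/
structure Reg where
  Wire : Type
  [fin : Fintype Wire]
  [dec : DecidableEq Wire]

instance : CoeSort Reg Type := ⟨Reg.Wire⟩

attribute [instance] Reg.fin Reg.dec

/-- Bit strings on the wires `W`; they label the computational basis. -/
abbrev Bits (W : Type) : Type := W → Bool

/-- Operators (unnormalised density matrices) on the qubits `W`. -/
abbrev Op (W : Type) : Type := Matrix (Bits W) (Bits W) ℂ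

/-- The all-zero string. -/
def zeros {W : Type} : Bits W := fun _ => false

/-- An elementary gate: an arbitrary quantum operation (in Kraus form) on two distinct qubits.
Every such operation has at most 16 Kraus operators; unitaries, measurements, coin tosses and
resets of one or two qubits are special cases. -/
structure Gate (W : Type) where
  fst : W
  snd : W
  ne : fst ≠ snd
  kraus : Fin 16 → Matrix (Bool × Bool) (Bool × Bool) ℂ
  complete : ∑ i, (kraus i)ᴴ * kraus i = 1

/-- Quantum circuits with intermediate measurements and classical feed-forward:
`branch w C D` measures the qubit `w` in the computational basis and continues with `C` on
outcome 0 and with `D` on outcome 1. -/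
inductive Circuit (W : Type) : Type
  | skip : Circuit W
  | gate (g : Gate W) : Circuit W
  | seq (C D : Circuit W) : Circuit W
  | branch (w : W) (C D : Circuit W) : Circuit W

/-- The number of gates, those of all branches included; a branching measurement counts one. -/
def Circuit.size {W : Type} : Circuit W → ℕ
  | .skip => 0
  | .gate _ => 1
  | .seq C D => C.size + D.size
  | .branch _ C D => 1 + C.size + D.size

/-- Relabel the wires of a gate; in particular let it act on part of a larger register. -/
def Gate.map {W W' : Type} (f : W ↪ W') (g : Gate W) : Gate W' where
  fst := f g.fst
  snd := f g.snd
  ne := fun h => g.ne (f.injective h)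
  kraus := g.kraus
  complete := g.complete

/-- Let a circuit act on part of a larger register. -/
def Circuit.map {W W' : Type} (f : W ↪ W') : Circuit W → Circuit W'
  | .skip => .skip
  | .gate g => .gate (g.map f)
  | .seq C D => .seq (C.map f) (D.map f)
  | .branch w C D => .branch (f w) (C.map f) (D.map f)

section Semantics

variable {W A B : Type} [Fintype W] [DecidableEq W] [Fintype A] [DecidableEq A]
  [Fintype B] [DecidableEq B]

/-- The `i`-th Kraus operator of a gate, tensored with the identity on the other wires. -/
def Gate.lift (g : Gate W) (i : Fin 16) : Op W :=
  Matrix.of fun x y =>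
    if ∀ w, w ≠ g.fst → w ≠ g.snd → x w = y w then
      g.kraus i (x g.fst, x g.snd) (y g.fst, y g.snd)
    else 0

/-- Projection of the wire `w` on the value `b`. -/
def project (w : W) (b : Bool) (ρ : Op W) : Op W :=
  Matrix.of fun x y => if x w = b ∧ y w = b then ρ x y else 0

/-- The quantum operation that a circuit computes. -/
def Circuit.run : Circuit W → Op W → Op W
  | .skip, ρ => ρ
  | .gate g, ρ => ∑ i, g.lift i * ρ * (g.lift i)ᴴ
  | .seq C D, ρ => D.run (C.run ρ)
  | .branch w C D, ρ => C.run (project w false ρ) + D.run (project w true ρ)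

/-- The basis state `|b⟩⟨b|`. -/
def ket (b : Bits W) : Op W := Matrix.of fun x y => if x = b ∧ y = b then 1 else 0

/-- The tensor product `ρ ⊗ σ`. -/
def tensor (ρ : Op A) (σ : Op B) : Op (A ⊕ B) :=
  Matrix.of fun x y => ρ (x ∘ Sum.inl) (y ∘ Sum.inl) * σ (x ∘ Sum.inr) (y ∘ Sum.inr)

/-- The string `x` with the wires `f a` overwritten by `y a`. -/
def write (f : A ↪ W) (y : Bits A) (x : Bits W) : Bits W := Function.extend f y x

/-- The reduced state on the sub-register selected by `f`; the other wires are traced out. -/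
def reduce (f : A ↪ W) (ρ : Op W) : Op A :=
  Matrix.of fun y y' => ∑ x : Bits W, if x ∘ f = y then ρ x (write f y' x) else 0

/-- Measure the sub-register selected by `f` in the computational basis, forget the outcome. -/
def dephase (f : A ↪ W) (ρ : Op W) : Op W :=
  Matrix.of fun x y => if x ∘ f = y ∘ f then ρ x y else 0

/-- `⟨a|ρ|a⟩`: the unnormalised state of `B` given that measuring `A` yields `a`. -/
def block (a : Bits A) (ρ : Op (A ⊕ B)) : Op B :=
  Matrix.of fun y y' => ρ (Sum.elim a y) (Sum.elim a y')

end Semantics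

/-- The first two of three registers. -/
def front (A M B : Type) : A ⊕ M ↪ A ⊕ (M ⊕ B) :=
  Function.Embedding.inl.trans (Equiv.sumAssoc A M B).toEmbedding

/-- The middle one of three registers. -/
def middle (A M B : Type) : M ↪ A ⊕ (M ⊕ B) :=
  Function.Embedding.inl.trans Function.Embedding.inr

/-- Polynomially bounded. -/
def PolyBounded (f : ℕ → ℕ) : Prop := ∃ p : Polynomial ℕ, ∀ m, f m ≤ p.eval m

/-- Negligible: decays faster than every inverse polynomial. -/
def Negligible (ε : ℕ → ℝ) : Prop :=
  Asymptotics.SuperpolynomialDecay atTop (fun m : ℕ => (m : ℝ)) ε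

/-! ### Functionalities and quantum protocols -/

/-- A classical non-reactive two-party functionality: for each security parameter a conditional
distribution of the outputs `(X, Y)` of Alice and Bob given their inputs `U` and `V`. -/
structure Functionality where
  U : ℕ → Reg
  V : ℕ → Reg
  X : ℕ → Reg
  Y : ℕ → Reg
  law : ∀ m, Bits (U m) → Bits (V m) → PMF (Bits (X m) × Bits (Y m))

/-- The functionality can be sampled by polynomial-size circuits, up to a negligible error. -/
def Functionality.Efficient (F : Functionality) : Prop :=
  ∃ (anc : ℕ → Reg)
    (C : ∀ m, Circuit ((F.U m ⊕ F.V m) ⊕ ((F.X m ⊕ F.Y m) ⊕ anc m))) (ε : ℕ → ℝ),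
    PolyBounded (fun m => Fintype.card (F.U m) + Fintype.card (F.V m) + Fintype.card (F.X m)
      + Fintype.card (F.Y m) + Fintype.card (anc m) + (C m).size) ∧
    Negligible ε ∧
    ∀ m (u : Bits (F.U m)) (v : Bits (F.V m)),
      ∑ x : Bits (F.X m), ∑ y : Bits (F.Y m),
        |(reduce (middle _ _ _) ((C m).run (ket (Sum.elim (Sum.elim u v) zeros)))
            (Sum.elim x y) (Sum.elim x y)).re
          - (F.law m u v (x, y)).toReal| ≤ ε m

/-- One player of a quantum protocol with classical input on `U`, classical output on `X`,
reference string on `Ω` and quantum messages on `M`: an interactive quantum circuit. In round `t`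
it applies `step t` to its memory and to the message register. Its memory starts in the state
`|u, ω, 0⟩`, and its output is read off by measuring the wires `out` at the end. -/
structure Party (U X Ω M : Reg) where
  anc : Reg
  step : ℕ → Circuit ((U ⊕ (Ω ⊕ anc)) ⊕ M)
  out : X ↪ U ⊕ (Ω ⊕ anc)

/-- A two-party quantum protocol in the common-reference-string model, with the classical inputs
and outputs of the functionality `F`. In each round Alice acts first and Bob second, and the
message register is passed on after each action. -/
structure QProtocol (F : Functionality) where
  Ω : ℕ → Reg
  crs : ∀ m, PMF (Bits (Ω m))
  M : ℕ → Reg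
  rounds : ℕ → ℕ
  alice : ∀ m, Party (F.U m) (F.X m) (Ω m) (M m)
  bob : ∀ m, Party (F.V m) (F.Y m) (Ω m) (M m)

/-- Honest Alice is polynomial-time. -/
def QProtocol.PolyAlice {F : Functionality} (P : QProtocol F) : Prop :=
  PolyBounded fun m => Fintype.card (F.U m) + Fintype.card (P.Ω m) + Fintype.card (P.M m)
    + Fintype.card (P.alice m).anc + P.rounds m
    + ∑ t ∈ Finset.range (P.rounds m), ((P.alice m).step t).size

/-- Execution of honest Alice `P` with input `u` and reference string `ω` against a Bob with
memory `W` in state `β` who applies `b t` in round `t`: the state of Bob's memory at the end,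
jointly with the event that Alice outputs `x`. -/
def Party.exec {U X Ω M : Reg} {W : Type} [Fintype W] [DecidableEq W] (P : Party U X Ω M)
    (rounds : ℕ) (b : ℕ → Circuit (M ⊕ W)) (ω : Bits Ω) (u : Bits U) (β : Op W)
    (x : Bits X) : Op W :=
  let init : Op ((U ⊕ (Ω ⊕ P.anc)) ⊕ (M ⊕ W)) :=
    tensor (ket (Sum.elim u (Sum.elim ω zeros))) (tensor (ket zeros) β)
  let final : Op ((U ⊕ (Ω ⊕ P.anc)) ⊕ (M ⊕ W)) :=
    Nat.rec init (fun t ρ =>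
      ((b t).map Function.Embedding.inr).run (((P.step t).map (front _ _ _)).run ρ)) rounds
  ∑ s : Bits (U ⊕ (Ω ⊕ P.anc)),
    if s ∘ P.out = x then reduce Function.Embedding.inr (block s final) else 0

/-- Execution of the functionality with input `u` from honest Alice against a Bob with memory `W`
in state `β`. Bob applies `query` to his memory and a fresh register, which is then measured and
yields his input `v`; he gets his output `y` in a fresh register and applies `reply`. The result
is the state of Bob's memory, jointly with the event that Alice outputs `x`. -/
def Functionality.exec (F : Functionality) (m : ℕ) {W : Type} [Fintype W] [DecidableEq W]
    (query : Circuit (F.V m ⊕ W)) (reply : Circuit (F.Y m ⊕ W)) (u : Bits (F.U m)) (β : Op W)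
    (x : Bits (F.X m)) : Op W :=
  ∑ v : Bits (F.V m), ∑ y : Bits (F.Y m),
    ((F.law m u v (x, y)).toReal : ℂ) •
      reduce Function.Embedding.inr
        (reply.run (tensor (ket y) (block v (query.run (tensor (ket zeros) β)))))

/-! ### Input samplers, outputs, indistinguishability -/

/-- An input sampler: from the reference string `ω` it produces, with one circuit for each security
parameter, Alice's classical input `U` and classical auxiliary information `aux` that stays with
her, and Bob's classical information `Z` and quantum information `V`. -/
structure Sampler (Ω U Z V : ℕ → Reg) where
  aux : ℕ → Reg
  anc : ℕ → Reg
  circ : ∀ m, Circuit ((Ω m ⊕ anc m) ⊕ ((aux m ⊕ U m) ⊕ (Z m ⊕ V m)))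

section Sampler

variable {Ω U Z V : ℕ → Reg}

def Sampler.Poly (S : Sampler Ω U Z V) : Prop :=
  PolyBounded fun m => Fintype.card (S.aux m) + Fintype.card (S.anc m) + (S.circ m).size

/-- The state of Bob's registers `Z, V` (with `Z` classical), jointly with the event that Alice
gets auxiliary information `a` and input `u`. -/
def Sampler.state (S : Sampler Ω U Z V) (m : ℕ) (ω : Bits (Ω m)) (a : Bits (S.aux m))
    (u : Bits (U m)) : Op (Z m ⊕ V m) :=
  dephase Function.Embedding.inl
    (block (Sum.elim a u)
      (reduce Function.Embedding.inr
        ((S.circ m).run (tensor (ket (Sum.elim ω zeros)) (ket zeros)))))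

/-- The unnormalised state of `V` for the values `a, u, z` of the classical registers. -/
def Sampler.part (S : Sampler Ω U Z V) (m : ℕ) (ω : Bits (Ω m)) (a : Bits (S.aux m))
    (u : Bits (U m)) (z : Bits (Z m)) : Op (V m) :=
  block z (S.state m ω a u)

/-- The unnormalised state of `V` for the value `z` of `Z`. -/
def Sampler.marginal (S : Sampler Ω U Z V) (m : ℕ) (ω : Bits (Ω m)) (z : Bits (Z m)) :
    Op (V m) :=
  ∑ a, ∑ u, S.part m ω a u z

/-- Legitimate: for every reference string, `V` is correlated with Alice's information only via
the classical `Z`, that is, the normalised state of `V` given `a, u, z` is that given `z`. -/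
def Sampler.Legitimate (S : Sampler Ω U Z V) : Prop :=
  ∀ m (ω : Bits (Ω m)) (a : Bits (S.aux m)) (u : Bits (U m)) (z : Bits (Z m)),
    (S.marginal m ω z).trace • S.part m ω a u z = (S.part m ω a u z).trace • S.marginal m ω z

/-- The joint output of Alice (auxiliary information `a` and output `x`) and Bob (the quantum
register `Y`), as a family of unnormalised states of `Y`. The state `β ω` describes the reference
string `ω` handed to the sampler jointly with Bob's private memory `E`, and `exec ω` is the
execution of the protocol. -/
def Sampler.output (S : Sampler Ω U Z V) (m : ℕ) {X Y E : Type} [Fintype X] [DecidableEq X]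
    [Fintype Y] [DecidableEq Y] [Fintype E] [DecidableEq E] (β : Bits (Ω m) → Op E)
    (exec : Bits (Ω m) → Bits (U m) → Op ((Z m ⊕ V m) ⊕ E) → Bits X → Op ((Z m ⊕ V m) ⊕ E))
    (out : Y ↪ (Z m ⊕ V m) ⊕ E) (a : Bits (S.aux m)) (x : Bits X) : Op Y :=
  ∑ ω, ∑ u, reduce out (exec ω u (tensor (S.state m ω a u) (β ω)) x)

end Sampler

/-- A quantum algorithm that receives the classical registers `A, X` and the quantum register `Y`
and outputs one bit. -/
structure Distinguisher (A X Y : ℕ → Reg) where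
  anc : ℕ → Reg
  circ : ∀ m, Circuit (((A m ⊕ X m) ⊕ Y m) ⊕ anc m)
  bit : ∀ m, ((A m ⊕ X m) ⊕ Y m) ⊕ anc m

section Distinguisher

variable {A X Y : ℕ → Reg}

def Distinguisher.Poly (D : Distinguisher A X Y) : Prop :=
  PolyBounded fun m => Fintype.card (D.anc m) + (D.circ m).size

/-- The probability that the output bit is 1. -/
def Distinguisher.prob (D : Distinguisher A X Y) (m : ℕ)
    (ρ : Bits (A m) → Bits (X m) → Op (Y m)) : ℝ :=
  let τ := (D.circ m).run
    (tensor (∑ a, ∑ x, tensor (ket (Sum.elim a x)) (ρ a x)) (ket zeros))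
  (project (D.bit m) true τ).trace.re

/-- Quantum-computational indistinguishability. -/
def QIndist (ρ σ : ∀ m, Bits (A m) → Bits (X m) → Op (Y m)) : Prop :=
  ∀ D : Distinguisher A X Y, D.Poly →
    Negligible fun m => |D.prob m (ρ m) - D.prob m (σ m)|

end Distinguisher

/-! ### Computational security against dishonest Bob -/

/-- A real-world dishonest Bob attacking `P`. His memory holds his input `Z, V`, the reference
string and ancillas in state 0; `out` selects his output register. -/
structure Attack {F : Functionality} (P : QProtocol F) (Z V Y : ℕ → Reg) where
  anc : ℕ → Reg
  step : ∀ m, ℕ → Circuit (P.M m ⊕ ((Z m ⊕ V m) ⊕ (P.Ω m ⊕ anc m)))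
  out : ∀ m, Y m ↪ (Z m ⊕ V m) ⊕ (P.Ω m ⊕ anc m)

def Attack.Poly {F : Functionality} {P : QProtocol F} {Z V Y : ℕ → Reg}
    (B : Attack P Z V Y) : Prop :=
  PolyBounded fun m => Fintype.card (Z m) + Fintype.card (V m) + Fintype.card (B.anc m)
    + ∑ t ∈ Finset.range (P.rounds m), (B.step m t).size

/-- The joint output of the real protocol with dishonest Bob. -/
def Attack.realOut {F : Functionality} {P : QProtocol F} {Z V Y : ℕ → Reg}
    (B : Attack P Z V Y) (S : Sampler P.Ω F.U Z V) (m : ℕ) :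
    Bits (S.aux m) → Bits (F.X m) → Op (Y m) :=
  S.output m (fun ω => ((P.crs m ω).toReal : ℂ) • ket (Sum.elim ω zeros))
    (fun ω => (P.alice m).exec (P.rounds m) (B.step m) ω) (B.out m)

/-- An ideal-world dishonest Bob. He does not get the reference string; instead `init` chooses a
string on `Ω` himself (measured at the end of `init`), which is the one the input sampler sees, and
keeps some private memory `anc`. Then he gets his input `Z, V` and calls the functionality. -/
structure Simulator (F : Functionality) (Ω Z V Y : ℕ → Reg) where
  anc : ℕ → Reg
  init : ∀ m, Circuit (Ω m ⊕ anc m)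
  query : ∀ m, Circuit (F.V m ⊕ ((Z m ⊕ V m) ⊕ anc m))
  reply : ∀ m, Circuit (F.Y m ⊕ ((Z m ⊕ V m) ⊕ anc m))
  out : ∀ m, Y m ↪ (Z m ⊕ V m) ⊕ anc m

def Simulator.Poly {F : Functionality} {Ω Z V Y : ℕ → Reg} (B : Simulator F Ω Z V Y) : Prop :=
  PolyBounded fun m => Fintype.card (B.anc m)
    + (B.init m).size + (B.query m).size + (B.reply m).size

/-- The joint output of the ideal world with dishonest Bob. -/
def Simulator.idealOut {F : Functionality} {Ω Z V Y : ℕ → Reg} (B : Simulator F Ω Z V Y)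
    (S : Sampler Ω F.U Z V) (m : ℕ) : Bits (S.aux m) → Bits (F.X m) → Op (Y m) :=
  S.output m (fun ω => block ω ((B.init m).run (ket zeros)))
    (fun _ => F.exec m (B.query m) (B.reply m)) (B.out m)

/-- `P` implements `F` computationally securely against dishonest Bob in the CRS model. -/
def CompSecure (F : Functionality) (P : QProtocol F) : Prop :=
  ∀ (Z V Y : ℕ → Reg) (B : Attack P Z V Y), B.Poly →
    ∃ B' : Simulator F P.Ω Z V Y, B'.Poly ∧
      ∀ S : Sampler P.Ω F.U Z V, S.Poly → S.Legitimate →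
        QIndist (B.realOut S) (B'.idealOut S)

/-! ### Classical oracle protocols -/

/-- One player of a classical oracle protocol with classical input on `U`, classical output on `X`,
classical messages on `C`, and calls to oracles `i < ℓ` with inputs on `In i` and outputs on
`Out i`. In round `r` the player applies `step r` to his memory and to the message register. The
memory starts in `|u, 0⟩`. After the message exchange of a round, the first `i` whose `flag` is set
is called (no call is made if there is none); the input is read from the wires `callIn i`, and the
output is written to the wires `callOut i`. -/
structure OracleParty {ℓ : ℕ} (In Out : Fin ℓ → Reg) (U X C : Reg) where
  anc : Reg
  step : ℕ → Circuit ((U ⊕ anc) ⊕ C)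
  flag : Fin ℓ → U ⊕ anc
  callIn : ∀ i, In i → U ⊕ anc
  callOut : ∀ i, Out i ↪ U ⊕ anc
  out : X ↪ U ⊕ anc

/-- A classical two-party oracle protocol with oracles `F i`: in each of the `rounds` rounds,
the players exchange classical messages and then make at most one oracle call. -/
structure OracleProtocol {ℓ : ℕ} (F : Fin ℓ → Functionality) where
  U : ℕ → Reg
  V : ℕ → Reg
  X : ℕ → Reg
  Y : ℕ → Reg
  C : ℕ → Reg
  rounds : ℕ → ℕ
  alice : ∀ m, OracleParty (fun i => (F i).U m) (fun i => (F i).X m) (U m) (X m) (C m)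
  bob : ∀ m, OracleParty (fun i => (F i).V m) (fun i => (F i).Y m) (V m) (Y m) (C m)

/-- Honest Alice is polynomial-time; in particular there are polynomially many oracle calls. -/
def OracleProtocol.PolyAlice {ℓ : ℕ} {F : Fin ℓ → Functionality} (P : OracleProtocol F) : Prop :=
  PolyBounded fun m => Fintype.card (P.U m) + Fintype.card (P.C m)
    + Fintype.card (P.alice m).anc + P.rounds m
    + ∑ r ∈ Finset.range (P.rounds m), ((P.alice m).step r).size

namespace OracleParty

variable {ℓ : ℕ} {In Out : Fin ℓ → Reg} {U X C : Reg} (P : OracleParty In Out U X C)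

/-- The oracle called when the memory contents are `s`. -/
def callee (s : Bits (U ⊕ P.anc)) : Option (Fin ℓ) :=
  (List.finRange ℓ).find? fun i => s (P.flag i)

variable {W : Type} [Fintype W] [DecidableEq W]

/-- The call at the end of a round: the party's memory is classical when a call is made (`s`), and
so is the message register (`c`). The other player has memory `W`, on which, for input `u` of this
party, `call i u` acts with the event that this party gets output `x`. Without a call, the
state is unchanged. -/
def callRound (call : ∀ i, Bits (In i) → Op W → Bits (Out i) → Op W)
    (ρ : Op ((U ⊕ P.anc) ⊕ (C ⊕ W))) : Op ((U ⊕ P.anc) ⊕ (C ⊕ W)) :=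
  (Matrix.of fun x y =>
    if P.callee (x ∘ Sum.inl) = none ∧ P.callee (y ∘ Sum.inl) = none then ρ x y else 0) +
  ∑ i, ∑ s : Bits (U ⊕ P.anc), ∑ c : Bits C,
    if P.callee s = some i then
      ∑ x : Bits (Out i), tensor (ket (write (P.callOut i) x s))
        (tensor (ket c) (call i (s ∘ P.callIn i) (block c (block s ρ)) x))
    else 0

/-- One round against a Bob who applies `b` to the message register and his memory: Alice acts,
her message is sent (it is classical, hence measured), Bob acts, his message is sent, and
then the oracle call is made. -/
def round (r : ℕ) (b : Circuit (C ⊕ W))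
    (call : ∀ i, Bits (In i) → Op W → Bits (Out i) → Op W)
    (ρ : Op ((U ⊕ P.anc) ⊕ (C ⊕ W))) : Op ((U ⊕ P.anc) ⊕ (C ⊕ W)) :=
  P.callRound call
    (dephase (middle _ _ _)
      ((b.map Function.Embedding.inr).run
        (dephase (middle _ _ _) (((P.step r).map (front _ _ _)).run ρ))))

/-- Execution of honest Alice with input `u` against a Bob with memory `W` in state `β`: the state
of Bob's memory at the end, jointly with the event that Alice outputs `x`. -/
def exec (rounds : ℕ) (b : ℕ → Circuit (C ⊕ W))
    (call : ℕ → ∀ i, Bits (In i) → Op W → Bits (Out i) → Op W) (u : Bits U) (β : Op W)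
    (x : Bits X) : Op W :=
  let init : Op ((U ⊕ P.anc) ⊕ (C ⊕ W)) :=
    tensor (ket (Sum.elim u zeros)) (tensor (ket zeros) β)
  let final : Op ((U ⊕ P.anc) ⊕ (C ⊕ W)) :=
    Nat.rec init (fun r ρ => P.round r (b r) (call r) ρ) rounds
  ∑ s : Bits (U ⊕ P.anc),
    if s ∘ P.out = x then reduce Function.Embedding.inr (block s final) else 0

end OracleParty

/-! ### Real and ideal world of the composed protocol -/

section Composed

variable {ℓ : ℕ} {F : Fin ℓ → Functionality}

/-- The reference string of the composed protocol: a separate part for every round and every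
sub-protocol that may be called in it. -/
abbrev OracleProtocol.Ω (Pr : OracleProtocol F) (π : ∀ i, QProtocol (F i)) (m : ℕ) : Reg :=
  ⟨Fin (Pr.rounds m) × (Σ i : Fin ℓ, (π i).Ω m)⟩

/-- The part of the reference string for a call of `π i` in round `r`. -/
def OracleProtocol.part (Pr : OracleProtocol F) (π : ∀ i, QProtocol (F i)) {m : ℕ}
    (ω : Bits (Pr.Ω π m)) (r : ℕ) (i : Fin ℓ) : Bits ((π i).Ω m) :=
  fun w => if h : r < Pr.rounds m then ω (⟨r, h⟩, ⟨i, w⟩) else false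

/-- The probability of a reference string: all parts are independent, and each follows the
distribution prescribed by its sub-protocol. -/
def OracleProtocol.crsProb (Pr : OracleProtocol F) (π : ∀ i, QProtocol (F i)) {m : ℕ}
    (ω : Bits (Pr.Ω π m)) : ℝ :=
  ∏ r ∈ Finset.range (Pr.rounds m), ∏ i, ((π i).crs m (Pr.part π ω r i)).toReal

/-- A real-world dishonest Bob attacking the protocol in which every call to `F i` is replaced by
an execution of `π i`. He knows the whole reference string from the start; `step r` is his action
in round `r` of the outer protocol, and `call r i t` his action in round `t` of an execution of
`π i` at the end of round `r`. -/
structure ComposedAttack (Pr : OracleProtocol F) (π : ∀ i, QProtocol (F i))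
    (Z V Y : ℕ → Reg) where
  anc : ℕ → Reg
  step : ∀ m, ℕ → Circuit (Pr.C m ⊕ ((Z m ⊕ V m) ⊕ (Pr.Ω π m ⊕ anc m)))
  call : ∀ m, ℕ → ∀ i : Fin ℓ, ℕ →
    Circuit ((π i).M m ⊕ ((Z m ⊕ V m) ⊕ (Pr.Ω π m ⊕ anc m)))
  out : ∀ m, Y m ↪ (Z m ⊕ V m) ⊕ (Pr.Ω π m ⊕ anc m)

def ComposedAttack.Poly {Pr : OracleProtocol F} {π : ∀ i, QProtocol (F i)} {Z V Y : ℕ → Reg}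
    (B : ComposedAttack Pr π Z V Y) : Prop :=
  PolyBounded fun m => Fintype.card (Z m) + Fintype.card (V m) + Fintype.card (B.anc m)
    + ∑ r ∈ Finset.range (Pr.rounds m), ((B.step m r).size
      + ∑ i, ∑ t ∈ Finset.range ((π i).rounds m), (B.call m r i t).size)

/-- The joint output of the composed protocol with dishonest Bob in the real world. -/
def ComposedAttack.realOut {Pr : OracleProtocol F} {π : ∀ i, QProtocol (F i)}
    {Z V Y : ℕ → Reg} (B : ComposedAttack Pr π Z V Y) (S : Sampler (Pr.Ω π) Pr.U Z V) (m : ℕ) :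
    Bits (S.aux m) → Bits (Pr.X m) → Op (Y m) :=
  S.output m (fun ω => (Pr.crsProb π ω : ℂ) • ket (Sum.elim ω zeros))
    (fun ω => (Pr.alice m).exec (Pr.rounds m) (B.step m)
      (fun r i => ((π i).alice m).exec ((π i).rounds m) (B.call m r i) (Pr.part π ω r i)))
    (B.out m)

/-- An ideal-world dishonest Bob in the oracle protocol. He does not get the reference string but
chooses himself, with `init`, the string on `Ω` that the input sampler sees. -/
structure ComposedSimulator (Pr : OracleProtocol F) (Ω Z V Y : ℕ → Reg) where
  anc : ℕ → Reg
  init : ∀ m, Circuit (Ω m ⊕ anc m)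
  step : ∀ m, ℕ → Circuit (Pr.C m ⊕ ((Z m ⊕ V m) ⊕ anc m))
  query : ∀ m, ℕ → ∀ i : Fin ℓ, Circuit ((F i).V m ⊕ ((Z m ⊕ V m) ⊕ anc m))
  reply : ∀ m, ℕ → ∀ i : Fin ℓ, Circuit ((F i).Y m ⊕ ((Z m ⊕ V m) ⊕ anc m))
  out : ∀ m, Y m ↪ (Z m ⊕ V m) ⊕ anc m

def ComposedSimulator.Poly {Pr : OracleProtocol F} {Ω Z V Y : ℕ → Reg}
    (B : ComposedSimulator Pr Ω Z V Y) : Prop :=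
  PolyBounded fun m => Fintype.card (B.anc m) + (B.init m).size
    + ∑ r ∈ Finset.range (Pr.rounds m), ((B.step m r).size
      + ∑ i, ((B.query m r i).size + (B.reply m r i).size))

/-- The joint output of the oracle protocol with dishonest Bob in the ideal world. -/
def ComposedSimulator.idealOut {Pr : OracleProtocol F} {Ω Z V Y : ℕ → Reg}
    (B : ComposedSimulator Pr Ω Z V Y) (S : Sampler Ω Pr.U Z V) (m : ℕ) :
    Bits (S.aux m) → Bits (Pr.X m) → Op (Y m) :=
  S.output m (fun ω => block ω ((B.init m).run (ket zeros)))
    (fun _ => (Pr.alice m).exec (Pr.rounds m) (B.step m)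
      (fun r i => (F i).exec m (B.query m r i) (B.reply m r i)))
    (B.out m)

end Composed

end

end SeqComp

set_option linter.unusedSectionVars false
set_option synthInstance.maxSize 2048

namespace SeqComp

noncomputable section

open scoped ComplexOrder
open Finset (univ sum_congr sum_le_sum sum_nonneg smul_sum mul_sum sum_mul sum_product sum_sub_distrib
  sum_const sum_eq_zero sum_const_zero mem_filter card_univ abs_sum_le_sum_abs)
open Function (update update_of_ne update_self)
open Function.Embedding (inl inr refl)
open Sum (elim elim_inl elim_inr)
open Matrix (of of_apply trace trace_sum trace_smul PosSemidef)
open Finset (sum_comm sum_eq_single mem_univ sum_add_distrib single_le_sum sum_le_card_nsmul)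
open LinearMap (comp_apply comp_assoc)
open List (finRange map_cons)
open Submodule (span mem_span_singleton mem_span_singleton_self)
open Fintype (card card_sum card_fin card_le_of_embedding)

/-- Linear maps between operator spaces. -/
abbrev LM (A B : Type) : Type := Op A →ₗ[ℂ] Op B

theorem sum_ext {ι M : Type*} [Fintype ι] [AddCommMonoid M] {f g : ι → M} (h : ∀ i, f i = g i) :
    ∑ i, f i = ∑ i, g i := sum_congr rfl fun i _ => h i

abbrev Calls {ℓ : ℕ} (In Out : Fin ℓ → Reg) (W : Type) : Type :=
  ∀ i, Bits (In i) → Bits (Out i) → LM W W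

abbrev OracleParty.St {ℓ : ℕ} {In Out : Fin ℓ → Reg} {U X C : Reg} (P : OracleParty In Out U X C)
    (W : Type) : Type := (U ⊕ P.anc) ⊕ (C ⊕ W)

section Calculus

variable {W A B C D K : Type}

/-! ### Overwriting wires -/

@[simp] theorem write_mem (f : A ↪ W) (y : Bits A) (x : Bits W) (a : A) :
    write f y x (f a) = y a := f.injective.extend_apply _ _ _

theorem write_notMem (f : A ↪ W) (y : Bits A) (x : Bits W) {w : W}
    (h : ∀ a, f a ≠ w) : write f y x w = x w :=
  Function.extend_apply' _ _ _ fun ⟨a, ha⟩ => h a ha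

@[simp] theorem write_comp (f : A ↪ W) (y : Bits A) (x : Bits W) : write f y x ∘ f = y := by
  funext a; simp

theorem bits_ext_wire (f : A ↪ W) {x y : Bits W} (h₁ : x ∘ f = y ∘ f)
    (h₂ : ∀ w, (∀ a, f a ≠ w) → x w = y w) : x = y := by
  funext w; by_cases h : ∃ a, f a = w
  · obtain ⟨a, rfl⟩ := h; exact congrFun h₁ a
  exact h₂ w fun a ha => h ⟨a, ha⟩

@[simp] theorem write_self (f : A ↪ W) (x : Bits W) : write f (x ∘ f) x = x :=
  bits_ext_wire f (by simp) fun _ h => write_notMem f _ _ h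

@[simp] theorem write_write (f : A ↪ W) (y y' : Bits A) (x : Bits W) :
    write f y (write f y' x) = write f y x :=
  bits_ext_wire f (by simp) fun _ h => by simp [write_notMem f _ _ h]

theorem write_trans (f : A ↪ B) (g : B ↪ W) (y : Bits A) (x : Bits W) :
    write (f.trans g) y x = write g (write f y (x ∘ g)) x := by
  refine bits_ext_wire g ?_ ?_
  · rw [write_comp]; refine bits_ext_wire f ?_ ?_
    · rw [write_comp]; funext a; exact write_mem (f.trans g) y x a
    intro b hb; rw [write_notMem f _ _ hb]
    exact write_notMem (f.trans g) y x fun a h => hb a (g.injective h)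
  intro w hw; rw [write_notMem g _ _ hw, write_notMem]; exact fun a => hw (f a)

theorem write_disjoint (f : A ↪ W) (g : B ↪ W) (h : ∀ a b, f a ≠ g b) (y : Bits A)
    (x : Bits W) : write f y x ∘ g = x ∘ g := by
  funext b; exact write_notMem f _ _ fun a => h a b

theorem write_comm (f : A ↪ W) (g : B ↪ W) (h : ∀ a b, f a ≠ g b) (y : Bits A) (z : Bits B)
    (x : Bits W) : write f y (write g z x) = write g z (write f y x) := by
  refine bits_ext_wire f ?_ ?_
  · rw [write_comp, write_disjoint g f fun a b => (h b a).symm, write_comp]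
  intro w hw; rw [write_notMem f _ _ hw]; by_cases hg : ∃ b, g b = w
  · obtain ⟨b, rfl⟩ := hg; simp
  push Not at hg; rw [write_notMem g _ _ hg, write_notMem g _ _ hg, write_notMem f _ _ hw]

@[simp] theorem write_inl (y a : Bits A) (b : Bits B) : write inl y (elim a b) = elim y b := by
  refine bits_ext_wire inl (by rw [write_comp]; rfl) ?_
  rintro (w | w) hw
  · exact absurd rfl (hw w)
  exact write_notMem _ _ _ hw

@[simp] theorem write_inr (y b : Bits B) (a : Bits A) : write inr y (elim a b) = elim a y := by
  refine bits_ext_wire inr (by rw [write_comp]; rfl) ?_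
  rintro (w | w) hw
  · exact write_notMem _ _ _ hw
  exact absurd rfl (hw w)

@[simp] theorem elim_comp (x : Bits (A ⊕ B)) :
    (elim (x ∘ Sum.inl) (x ∘ Sum.inr) : Bits (A ⊕ B)) = x := Sum.elim_comp_inl_inr x

theorem elim_eq_iff {a a' : Bits A} {b b' : Bits B} :
    (elim a b : Bits (A ⊕ B)) = elim a' b' ↔ a = a' ∧ b = b' := by
  constructor
  · intro h
    exact ⟨by simpa using congrArg (· ∘ Sum.inl) h, by simpa using congrArg (· ∘ Sum.inr) h⟩
  rintro ⟨rfl, rfl⟩; rfl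

theorem elim_zeros : (elim zeros zeros : Bits (A ⊕ B)) = zeros := by
  funext w; rcases w with w | w <;> rfl

/-! ### Sections of operators and local actions -/

def sect (f : A ↪ W) (x y : Bits W) : LM W A where
  toFun ρ := of fun a b => ρ (write f a x) (write f b y)
  map_add' _ _ := rfl
  map_smul' _ _ := rfl

theorem sect_apply (f : A ↪ W) (x y : Bits W) (ρ : Op W) (a b : Bits A) :
    sect f x y ρ a b = ρ (write f a x) (write f b y) := rfl

theorem sect_self (f : A ↪ W) (x y : Bits W) (ρ : Op W) :
    sect f x y ρ (x ∘ f) (y ∘ f) = ρ x y := by simp [sect_apply]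

@[simp] theorem sect_write (f : A ↪ W) (a b : Bits A) (x y : Bits W) (ρ : Op W) :
    sect f (write f a x) (write f b y) ρ = sect f x y ρ := by
  ext; simp [sect_apply]

theorem op_ext_sect (f : A ↪ W) {ρ σ : Op W} (h : ∀ x y, sect f x y ρ = sect f x y σ) : ρ = σ := by
  ext x y; rw [← sect_self f x y ρ, h, sect_self]

theorem sect_trans (f : A ↪ B) (g : B ↪ W) (x y : Bits W) (ρ : Op W) :
    sect (f.trans g) x y ρ = sect f (x ∘ g) (y ∘ g) (sect g x y ρ) := by
  ext; simp [sect_apply, write_trans]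

def act (f : A ↪ W) (Φ : LM A A) : LM W W where
  toFun ρ := of fun x y => Φ (sect f x y ρ) (x ∘ f) (y ∘ f)
  map_add' _ _ := by ext; simp
  map_smul' _ _ := by ext; simp

theorem act_apply (f : A ↪ W) (Φ : LM A A) (ρ : Op W) (x y : Bits W) :
    act f Φ ρ x y = Φ (sect f x y ρ) (x ∘ f) (y ∘ f) := rfl

@[simp] theorem sect_act (f : A ↪ W) (Φ : LM A A) (ρ : Op W) (x y : Bits W) :
    sect f x y (act f Φ ρ) = Φ (sect f x y ρ) := by
  ext; simp [sect_apply, act_apply]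

theorem act_comp (f : A ↪ W) (Φ Ψ : LM A A) : act f (Φ ∘ₗ Ψ) = act f Φ ∘ₗ act f Ψ := by
  ext1 ρ; exact op_ext_sect f fun x y => by simp

@[simp] theorem act_id (f : A ↪ W) : act f LinearMap.id = LinearMap.id := by
  ext1 ρ; exact op_ext_sect f fun x y => by simp

theorem act_add (f : A ↪ W) (Φ Ψ : LM A A) : act f (Φ + Ψ) = act f Φ + act f Ψ := by
  ext1 ρ; exact op_ext_sect f fun x y => by simp

theorem act_trans (f : A ↪ B) (g : B ↪ W) (Φ : LM A A) : act (f.trans g) Φ = act g (act f Φ) := by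
  ext ρ x y; simp [act_apply, sect_trans]; rfl

def cut (a a' : Bits A) : LM (A ⊕ B) B where
  toFun ρ := of fun b b' => ρ (elim a b) (elim a' b')
  map_add' _ _ := rfl
  map_smul' _ _ := rfl

def ext (A : Type) (Φ : LM B C) : LM (A ⊕ B) (A ⊕ C) where
  toFun ρ := of fun x y =>
    Φ (cut (x ∘ Sum.inl) (y ∘ Sum.inl) ρ) (x ∘ Sum.inr) (y ∘ Sum.inr)
  map_add' _ _ := by ext; simp
  map_smul' _ _ := by ext; simp

theorem cut_apply (a a' : Bits A) (ρ : Op (A ⊕ B)) (b b' : Bits B) :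
    cut a a' ρ b b' = ρ (elim a b) (elim a' b') := rfl

theorem block_eq_cut (a : Bits A) (ρ : Op (A ⊕ B)) : block a ρ = cut a a ρ := rfl

@[simp] theorem cut_ext (Φ : LM B C) (a a' : Bits A) (ρ : Op (A ⊕ B)) :
    cut a a' (ext A Φ ρ) = Φ (cut a a' ρ) := by
  ext b b'; rfl

@[simp] theorem block_ext (Φ : LM B C) (a : Bits A) (ρ : Op (A ⊕ B)) :
    block a (ext A Φ ρ) = Φ (block a ρ) := cut_ext Φ a a ρ

theorem op_ext_cut {ρ σ : Op (A ⊕ B)} (h : ∀ a a', cut a a' ρ = cut a a' σ) : ρ = σ := by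
  ext x y; have := congrFun (congrFun (h (x ∘ Sum.inl) (y ∘ Sum.inl)) (x ∘ Sum.inr)) (y ∘ Sum.inr)
  simpa [cut_apply] using this

theorem ext_comp (Φ : LM C D) (Ψ : LM B C) : ext A (Φ ∘ₗ Ψ) = ext A Φ ∘ₗ ext A Ψ := by
  ext1 ρ; exact op_ext_cut fun a a' => by simp

theorem act_inr (Φ : LM B B) : act (inr : B ↪ A ⊕ B) Φ = ext A Φ := by
  ext ρ x y
  have : ∀ x y : Bits (A ⊕ B), sect inr x y ρ
      = cut (x ∘ Sum.inl) (y ∘ Sum.inl) ρ := by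
    intro x y; ext b b'
    rw [sect_apply, cut_apply, ← write_inr b (x ∘ Sum.inr), ← write_inr b' (y ∘ Sum.inr)]; simp
  rw [act_apply, this]; rfl

theorem ext_tensor (Φ : LM B C) (σ : Op A) (ρ : Op B) : ext A Φ (tensor σ ρ) = tensor σ (Φ ρ) := by
  refine op_ext_cut fun a a' => ?_
  have h : ∀ (E : Type) (τ : Op E), cut a a' (tensor σ τ) = σ a a' • τ := by
    intro E τ; ext b b'; simp [cut_apply, tensor]
  rw [cut_ext, h, h, map_smul]

theorem write_front (p : Bits (A ⊕ B)) (x : Bits (A ⊕ (B ⊕ C))) : write (front A B C) p x = elim (p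
    ∘ Sum.inl) (elim (p ∘ Sum.inr) (x ∘ Sum.inr ∘ Sum.inr)) := by
  refine bits_ext_wire (front A B C) ?_ ?_
  · rw [write_comp]; funext w; rcases w with w | w <;> rfl
  intro w hw; rw [write_notMem _ _ _ hw]; rcases w with w | w | w
  · exact absurd rfl (hw (Sum.inl w))
  · exact absurd rfl (hw (Sum.inr w))
  rfl

end Calculus

section

variable {A B C D E G H I J K M N O S T U V W W' W'' X Y Z Ω : Type} [Fintype A] [DecidableEq A]
  [Fintype B] [DecidableEq B] [Fintype C] [DecidableEq C] [Fintype D] [DecidableEq D] [Fintype E]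
  [DecidableEq E] [Fintype G] [DecidableEq G] [Fintype H] [DecidableEq H] [Fintype I] [DecidableEq
  I] [Fintype J] [DecidableEq J] [Fintype K] [DecidableEq K] [Fintype M] [DecidableEq M] [Fintype N]
  [DecidableEq N] [Fintype O] [DecidableEq O] [Fintype S] [DecidableEq S] [Fintype T] [DecidableEq
  T] [Fintype U] [DecidableEq U] [Fintype V] [DecidableEq V] [Fintype W] [DecidableEq W] [Fintype
  W'] [DecidableEq W'] [Fintype W''] [DecidableEq W''] [Fintype X] [DecidableEq X] [Fintype Y]
  [DecidableEq Y] [Fintype Z] [DecidableEq Z] [Fintype Ω] [DecidableEq Ω]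

theorem sum_bits {M : Type*} [AddCommMonoid M] (F : Bits (A ⊕ B) → M) :
    ∑ x, F x = ∑ a, ∑ b, F (elim a b) := by
  rw [← Fintype.sum_prod_type']
  exact Fintype.sum_equiv (Equiv.sumArrowEquivProdArrow A B Bool) _ _
    fun x => by simp [Equiv.sumArrowEquivProdArrow]

/-- Linear maps on different tensor factors commute. -/
theorem linearMap_swap (Φ : LM A B) (Ψ : LM C D) (X : Bits A → Bits A → Op C) (b b' : Bits B) (d
    d' : Bits D) : Φ (of fun a a' => Ψ (X a a') d d') b b' = Ψ (of fun c c' => Φ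
    (of fun a a' => X a a' c c') b b') d d' := by
  have hΦ : ∀ M : Op A, Φ M b b'
      = ∑ a, ∑ a', M a a' * Φ (Matrix.single a a' 1) b b' := by
    intro M
    conv_lhs => rw [Matrix.matrix_eq_sum_single M]
    simp only [map_sum, Matrix.sum_apply]; refine sum_ext fun a => sum_congr rfl fun a' _ => ?_
    rw [← mul_one (M a a'), ← smul_eq_mul, ← Matrix.smul_single, map_smul]; simp
  have h2 : (of fun c c' => Φ (of fun a a' => X a a' c c') b b' : Op C)
      = ∑ a, ∑ a', (Φ (Matrix.single a a' 1) b b') • X a a' := by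
    ext c c'; simp only [of_apply, Matrix.sum_apply, Matrix.smul_apply, smul_eq_mul]; rw [hΦ]
    exact sum_ext fun a => sum_congr rfl fun a' _ => by rw [of_apply, mul_comm]
  rw [hΦ, h2]
  simp only [map_sum, Matrix.sum_apply, map_smul, Matrix.smul_apply, smul_eq_mul, of_apply]
  exact sum_ext fun a => sum_congr rfl fun a' _ => by rw [mul_comm]

theorem act_comm (f : A ↪ W) (g : B ↪ W) (h : ∀ a b, f a ≠ g b) (Φ : LM A A) (Ψ : LM B B)
    (ρ : Op W) : act f Φ (act g Ψ ρ) = act g Ψ (act f Φ ρ) := by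
  ext x y
  have key := linearMap_swap Φ Ψ
    (fun a a' => sect g (write f a x) (write f a' y) ρ) (x ∘ f) (y ∘ f) (x ∘ g) (y ∘ g)
  have h' : ∀ a b, g b ≠ f a := fun a b => (h a b).symm
  have e1 : sect f x y (act g Ψ ρ) = of fun a a' =>
      Ψ (sect g (write f a x) (write f a' y) ρ) (x ∘ g) (y ∘ g) := by
    ext a a'; simp [sect_apply, act_apply, write_disjoint f g h]
  have e2 : sect g x y (act f Φ ρ) = of fun c c' =>
      Φ (of fun a a' => sect g (write f a x) (write f a' y) ρ c c') (x ∘ f) (y ∘ f) := by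
    ext c c'
    rw [sect_apply, act_apply, write_disjoint g f fun a b => (h b a).symm,
      write_disjoint g f fun a b => (h b a).symm]
    have : sect f (write g c x) (write g c' y) ρ
        = of fun a a' => sect g (write f a x) (write f a' y) ρ c c' := by
      ext a a'; simp [sect_apply, write_comm f g h]
    rw [this]; rfl
  rw [act_apply, act_apply, e1, e2]; exact key

theorem act_front_ext (Θ : LM (A ⊕ B) (A ⊕ B)) (Φ : LM C D) (ρ : Op (A ⊕ (B ⊕ C))) :
    act (front A B D) Θ (ext A (ext B Φ) ρ) = ext A (ext B Φ) (act (front A B C) Θ ρ) := by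
  ext x y
  have key := linearMap_swap Θ Φ
    (fun p p' => of fun c c' => ρ (elim (p ∘ Sum.inl) (elim (p ∘ Sum.inr) c)) (elim (p' ∘
      Sum.inl) (elim (p' ∘ Sum.inr) c')))
    (x ∘ front A B D) (y ∘ front A B D) (x ∘ Sum.inr ∘ Sum.inr) (y ∘ Sum.inr ∘ Sum.inr)
  have e1 : sect (front A B D) x y (ext A (ext B Φ) ρ) = of fun p p' =>
      Φ (of fun c c' => ρ (elim (p ∘ Sum.inl) (elim (p ∘ Sum.inr) c)) (elim (p' ∘ Sum.inl)
        (elim (p' ∘ Sum.inr) c')))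
        (x ∘ Sum.inr ∘ Sum.inr) (y ∘ Sum.inr ∘ Sum.inr) := by
    ext p p'; rw [sect_apply, write_front, write_front]; rfl
  rw [act_apply, e1, key]; change _ = Φ _ (x ∘ Sum.inr ∘ Sum.inr) (y ∘ Sum.inr ∘ Sum.inr)
  refine congrArg (fun M => Φ M (x ∘ Sum.inr ∘ Sum.inr) (y ∘ Sum.inr ∘ Sum.inr)) ?_; ext c c'
  change Θ _ _ _ = Θ (sect (front A B C) (elim (x ∘ Sum.inl) (elim ((x ∘ Sum.inr) ∘ Sum.inl) c))
    (elim (y ∘ Sum.inl) (elim ((y ∘ Sum.inr) ∘ Sum.inl) c')) ρ) _ _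
  have hb : ∀ (x : Bits (A ⊕ (B ⊕ D))) c, (elim (x ∘ Sum.inl)
      (elim ((x ∘ Sum.inr) ∘ Sum.inl) c) : Bits (A ⊕ (B ⊕ C))) ∘ front A B C
      = x ∘ front A B D := by
    intro x c; funext w; rcases w with w | w <;> rfl
  rw [hb, hb]; refine congrArg (fun M => Θ M (x ∘ front A B D) (y ∘ front A B D)) ?_; ext p p'
  rw [sect_apply, write_front, write_front]; rfl

/-! ### Linear versions of the basic operations -/

def reduceL (f : A ↪ W) : LM W A where
  toFun ρ := reduce f ρ
  map_add' ρ σ := by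
    ext; simp only [reduce, of_apply, Matrix.add_apply, ← sum_add_distrib]
    exact sum_ext fun _ => by split_ifs <;> simp
  map_smul' c ρ := by
    ext; simp only [reduce, of_apply, Matrix.smul_apply, smul_eq_mul, mul_sum, RingHom.id_apply]
    exact sum_ext fun _ => by split_ifs <;> simp

theorem reduce_eq (f : A ↪ W) (ρ : Op W) : reduce f ρ = reduceL f ρ := rfl

def dephaseL (f : A ↪ W) : LM W W where
  toFun ρ := dephase f ρ
  map_add' ρ σ := by ext; simp only [dephase, of_apply, Matrix.add_apply]; split_ifs <;> simp
  map_smul' c ρ := by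
    ext; simp only [dephase, of_apply, Matrix.smul_apply, RingHom.id_apply]; split_ifs <;> simp

theorem dephase_eq (f : A ↪ W) (ρ : Op W) : dephase f ρ = dephaseL f ρ := rfl

def projectL (w : W) (b : Bool) : LM W W where
  toFun ρ := project w b ρ
  map_add' ρ σ := by ext; simp only [project, of_apply, Matrix.add_apply]; split_ifs <;> simp
  map_smul' c ρ := by
    ext; simp only [project, of_apply, Matrix.smul_apply, RingHom.id_apply]; split_ifs <;> simp

theorem project_eq (w : W) (b : Bool) (ρ : Op W) : project w b ρ = projectL w b ρ := rfl

def Circuit.runL : Circuit W → LM W W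
  | .skip => LinearMap.id
  | .gate g =>
    { toFun := fun ρ => ∑ i, g.lift i * ρ * (g.lift i)ᴴ
      map_add' := fun ρ σ => by simp [mul_add, add_mul, sum_add_distrib]
      map_smul' := fun c ρ => by simp [smul_sum] }
  | .seq C D => D.runL ∘ₗ C.runL
  | .branch w C D => C.runL ∘ₗ projectL w false + D.runL ∘ₗ projectL w true

theorem run_eq (C : Circuit W) (ρ : Op W) : C.run ρ = C.runL ρ := by
  induction C generalizing ρ with
  | skip => rfl
  | gate g => rfl
  | seq C D hC hD => simp [Circuit.run, Circuit.runL, hC, hD]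
  | branch w C D hC hD => simp [Circuit.run, Circuit.runL, hC, hD, project_eq]

def tensorL (σ : Op A) : LM B (A ⊕ B) where
  toFun ρ := tensor σ ρ
  map_add' _ _ := by ext; simp [tensor, mul_add]
  map_smul' _ _ := by ext; simp [tensor, mul_left_comm]

theorem tensor_eq (σ : Op A) (ρ : Op B) : tensor σ ρ = tensorL σ ρ := rfl

def tensorR (σ : Op B) : LM A (A ⊕ B) where
  toFun ρ := tensor ρ σ
  map_add' _ _ := by ext; simp [tensor, add_mul]
  map_smul' _ _ := by ext; simp [tensor, mul_assoc]

theorem tensor_eq' (ρ : Op A) (σ : Op B) : tensor ρ σ = tensorR σ ρ := rfl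

abbrev trL : Op W →ₗ[ℂ] ℂ := Matrix.traceLinearMap _ ℂ ℂ

def replaceL (κ : Op A) : LM B A := LinearMap.smulRight trL κ

@[simp] theorem replaceL_apply (κ : Op A) (ρ : Op B) : replaceL κ ρ = ρ.trace • κ := rfl

/-! ### Partial traces -/

theorem reduceL_eq_sum (f : A ↪ W) (ρ : Op W) :
    reduceL f ρ = ∑ x : Bits W, if x ∘ f = zeros then sect f x x ρ else 0 := by
  ext y y'; simp only [Matrix.sum_apply]
  change ∑ x : Bits W, (if x ∘ f = y then ρ x (write f y' x) else 0) = _; rw [← Finset.sum_filter]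
  have : ∀ x : Bits W, (if x ∘ f = zeros then sect f x x ρ else 0) y y'
      = if x ∘ f = zeros then sect f x x ρ y y' else 0 := fun x => by split_ifs <;> rfl
  simp only [this]; rw [← Finset.sum_filter]
  refine Finset.sum_nbij' (fun x => write f zeros x) (fun x => write f y x) ?_ ?_ ?_ ?_ ?_
  · simp
  · simp
  · intro x hx; simp only [mem_filter, mem_univ, true_and] at hx; simp [← hx]
  · intro x hx; simp only [mem_filter, mem_univ, true_and] at hx; simp [← hx]
  intro x hx; simp only [mem_filter, mem_univ, true_and] at hx; simp [sect_apply, ← hx]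

theorem reduceL_act (f : A ↪ W) (Φ : LM A A) (ρ : Op W) :
    reduceL f (act f Φ ρ) = Φ (reduceL f ρ) := by
  simp only [reduceL_eq_sum, map_sum]; refine sum_ext fun x => ?_; split_ifs <;> simp

theorem reduceL_trans (f : A ↪ B) (g : B ↪ W) (ρ : Op W) :
    reduceL (f.trans g) ρ = reduceL f (reduceL g ρ) := by
  rw [reduceL_eq_sum f, reduceL_eq_sum, reduceL_eq_sum g]; simp only [← Finset.sum_filter, map_sum]
  rw [← Finset.sum_product']; symm
  refine Finset.sum_nbij' (fun p => write g p.1 p.2) (fun x => (x ∘ g, write g zeros x))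
    ?_ ?_ ?_ ?_ ?_
  · rintro ⟨y, x⟩ h; simp only [Finset.mem_product, mem_filter, mem_univ, true_and] at h ⊢
    rw [← h.1]; funext a; simp
  · intro x h; simp only [Finset.mem_product, mem_filter, mem_univ, true_and] at h ⊢
    exact ⟨h, by simp⟩
  · rintro ⟨y, x⟩ h; simp only [Finset.mem_product, mem_filter, mem_univ, true_and] at h
    ext1
    · simp
    simp [← h.2]
  · intro x h; simp
  rintro ⟨y, x⟩ h; ext a a'; simp [sect_apply, write_trans]

theorem reduceL_inl_apply (ρ : Op (A ⊕ B)) (a a' : Bits A) : reduceL (inl : A ↪ A ⊕ B) ρ a a' = ∑ b,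
    ρ (elim a b) (elim a' b) := by
  change ∑ x : Bits (A ⊕ B), (if x ∘ Sum.inl = a then ρ x (write _ a' x) else 0) = _
  rw [sum_bits, sum_eq_single a]
  · simp
  · intro c _ hc; simp [hc]
  simp

theorem reduceL_inr (ρ : Op (A ⊕ B)) : reduceL (inr : B ↪ A ⊕ B) ρ = ∑ a, block a ρ := by
  ext b b'; rw [Matrix.sum_apply]
  change ∑ x : Bits (A ⊕ B), (if x ∘ Sum.inr = b then ρ x (write _ b' x) else 0) = _; rw [sum_bits]
  refine sum_ext fun a => ?_; rw [sum_eq_single b]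
  · simp [block]
  · intro c _ hc; simp [hc]
  simp

theorem trace_op_sum (ρ : Op (A ⊕ B)) : ρ.trace = ∑ a, ∑ b, ρ (elim a b) (elim a b) := by
  simp only [trace, Matrix.diag]; rw [sum_bits]

theorem trace_reduceL (f : A ↪ W) (ρ : Op W) : (reduceL f ρ).trace = ρ.trace := by
  simp only [trace, Matrix.diag]
  change ∑ y, ∑ x : Bits W, (if x ∘ f = y then ρ x (write f y x) else 0) = _; rw [sum_comm]
  refine sum_ext fun x => ?_; simp

/-- The joint embedding of two disjoint families of wires. -/
def joint (f : A ↪ W) (g : B ↪ W) (h : ∀ a b, f a ≠ g b) : A ⊕ B ↪ W where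
  toFun := elim f g
  inj' := by
    rintro (a | a) (b | b) hab
    · exact congrArg _ (f.injective hab)
    · exact absurd hab (h a b)
    · exact absurd hab.symm (h b a)
    exact congrArg _ (g.injective hab)

@[simp] theorem joint_inl (f : A ↪ W) (g : B ↪ W) (h : ∀ a b, f a ≠ g b) :
    inl.trans (joint f g h) = f := rfl

@[simp] theorem joint_inr (f : A ↪ W) (g : B ↪ W) (h : ∀ a b, f a ≠ g b) :
    inr.trans (joint f g h) = g := rfl

def TP (Φ : LM A B) : Prop := ∀ ρ, (Φ ρ).trace = ρ.trace

theorem sect_inl (x y : Bits (A ⊕ B)) (ρ : Op (A ⊕ B)) (a a' : Bits A) : sect inl x y ρ a a' = ρ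
    (elim a (x ∘ Sum.inr)) (elim a' (y ∘ Sum.inr)) := by
  rw [sect_apply, ← elim_comp x, ← elim_comp y, write_inl, write_inl]; rfl

theorem reduceL_disjoint (f : A ↪ W) (g : B ↪ W) (h : ∀ a b, f a ≠ g b) {Φ : LM A A}
    (hΦ : TP Φ) (ρ : Op W) : reduceL g (act f Φ ρ) = reduceL g ρ := by
  have h1 : act f Φ ρ = act (joint f g h) (act inl Φ) ρ := by rw [← act_trans, joint_inl]
  have h2 : ∀ σ, reduceL g σ = reduceL inr (reduceL (joint f g h) σ) :=
    fun σ => by rw [← reduceL_trans, joint_inr]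
  rw [h1, h2, h2, reduceL_act]; generalize reduceL (joint f g h) ρ = σ
  rw [reduceL_inr, reduceL_inr]; ext b b'; simp only [Matrix.sum_apply, block, of_apply, act_apply]
  have hs : ∀ a, sect inl (elim a b) (elim a b') σ
      = sect inl (elim zeros b) (elim zeros b') σ := by
    intro a; ext c c'; simp [sect_inl]
  have h1 := hΦ (sect inl (elim zeros b) (elim zeros b') σ)
  simp only [trace, Matrix.diag, sect_inl] at h1
  calc _ = ∑ a, Φ (sect inl (elim zeros b) (elim zeros b') σ) a a :=
        sum_ext fun a => by rw [hs]; rfl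
    _ = _ := h1.trans (sum_ext fun a => rfl)

theorem TP.act {f : A ↪ W} {Φ : LM A A} (hΦ : TP Φ) : TP (act f Φ) := fun ρ => by
  rw [← trace_reduceL f, reduceL_act, hΦ, trace_reduceL]

theorem TP.comp {Φ : LM B C} {Ψ : LM A B} (hΦ : TP Φ) (hΨ : TP Ψ) : TP (Φ ∘ₗ Ψ) := fun ρ => by
  rw [comp_apply, hΦ, hΨ]

theorem TP.id : TP (LinearMap.id : LM A A) := fun _ => rfl

/-! ### Gates and circuits -/

def Gate.wires (g : Gate W) : Bool ↪ W where
  toFun b := if b then g.snd else g.fst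
  inj' := by
    intro a b h
    cases a <;> cases b <;> simp_all [g.ne, g.ne.symm]

/-- The Kraus operators of a gate on its own two wires. -/
def Gate.krausB (g : Gate W) (i : Fin 16) : Op Bool :=
  of fun x y => g.kraus i (x false, x true) (y false, y true)

def Gate.chan (g : Gate W) : LM Bool Bool where
  toFun ρ := ∑ i, g.krausB i * ρ * (g.krausB i)ᴴ
  map_add' ρ σ := by simp [mul_add, add_mul, sum_add_distrib]
  map_smul' c ρ := by simp [smul_sum]

theorem Gate.wires_false (g : Gate W) : g.wires false = g.fst := rfl

theorem Gate.wires_true (g : Gate W) : g.wires true = g.snd := rfl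

theorem Gate.krausB_complete (g : Gate W) : ∑ i, (g.krausB i)ᴴ * g.krausB i = 1 := by
  have e : ∀ i, (g.krausB i)ᴴ * g.krausB i
      = ((g.kraus i)ᴴ * g.kraus i).submatrix (Equiv.boolArrowEquivProd Bool)
        (Equiv.boolArrowEquivProd Bool) := by
    intro i; rw [← Matrix.submatrix_mul_equiv _ _ _ (Equiv.boolArrowEquivProd Bool) _]; rfl
  simp only [e]
  have : ∀ f : Fin 16 → Matrix (Bool × Bool) (Bool × Bool) ℂ,
      ∑ i, (f i).submatrix (Equiv.boolArrowEquivProd Bool) (Equiv.boolArrowEquivProd Bool)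
        = (∑ i, f i).submatrix (Equiv.boolArrowEquivProd Bool)
          (Equiv.boolArrowEquivProd Bool) := by
    intro f; ext; simp [Matrix.sum_apply]
  rw [this, g.complete, Matrix.submatrix_one_equiv]

theorem Gate.chan_tp (g : Gate W) : TP g.chan := by
  intro ρ; change (∑ i, g.krausB i * ρ * (g.krausB i)ᴴ).trace = _; rw [trace_sum]
  simp only [fun i => Matrix.trace_mul_comm (g.krausB i * ρ) (g.krausB i)ᴴ, ← mul_assoc]
  rw [← trace_sum, ← sum_mul, g.krausB_complete, one_mul]

theorem Gate.sum_lift (g : Gate W) (i : Fin 16) (x : Bits W) (F : Bits W → ℂ) :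
    ∑ z, g.lift i x z * F z = ∑ p, g.krausB i (x ∘ g.wires) p * F (write g.wires p x) := by
  symm
  have hw : ∀ w, (∀ a, g.wires a ≠ w) ↔ w ≠ g.fst ∧ w ≠ g.snd := by
    intro w; rw [Bool.forall_bool, ne_comm, ne_comm (b := w)]; rfl
  refine Fintype.sum_of_injective (fun p => write g.wires p x) ?_ _ _ ?_ ?_
  · intro p q h; simpa using congrArg (· ∘ g.wires) h
  · intro z hz
    have : ¬ ∀ w, w ≠ g.fst → w ≠ g.snd → x w = z w := by
      intro h; refine hz ⟨z ∘ g.wires, ?_⟩; refine bits_ext_wire g.wires (by simp) fun w h' => ?_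
      change write g.wires _ x w = _; rw [write_notMem _ _ _ h']
      exact h w ((hw w).1 h').1 ((hw w).1 h').2
    simp [Gate.lift, this]
  intro p
  have h1 : ∀ w, w ≠ g.fst → w ≠ g.snd → x w = write g.wires p x w := fun w h h' =>
    (write_notMem _ _ _ ((hw w).2 ⟨h, h'⟩)).symm
  have h2 : write g.wires p x g.fst = p false := write_mem g.wires p x false
  have h3 : write g.wires p x g.snd = p true := write_mem g.wires p x true
  simp only [Gate.lift, of_apply]; rw [if_pos h1, h2, h3]; rfl

theorem Gate.runL_eq (g : Gate W) : (Circuit.gate g).runL = act g.wires g.chan := by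
  ext ρ x y
  change (∑ i, g.lift i * ρ * (g.lift i)ᴴ) x y
    = (∑ i, g.krausB i * sect g.wires x y ρ * (g.krausB i)ᴴ) (x ∘ g.wires) (y ∘ g.wires)
  simp only [Matrix.sum_apply]; refine sum_ext fun i => ?_; simp only [Matrix.mul_assoc]
  rw [Matrix.mul_apply, Matrix.mul_apply, g.sum_lift]; refine sum_ext fun p => ?_; congr 1
  have key := g.sum_lift i y fun z => star (ρ (write g.wires p x) z); have key' := congrArg star key
  simp only [star_sum, star_mul', star_star] at key'; rw [Matrix.mul_apply, Matrix.mul_apply]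
  simp only [Matrix.conjTranspose_apply, sect_apply]; simp only [mul_comm] at key' ⊢; exact key'

def single (w : W) : Unit ↪ W := ⟨fun _ => w, fun _ _ _ => rfl⟩

@[simp] theorem single_apply (w : W) (u : Unit) : single w u = w := rfl

theorem projectL_eq (w : W) (b : Bool) : projectL w b = act (single w) (projectL () b) := by
  ext ρ x y; change (if x w = b ∧ y w = b then ρ x y else 0) = if x w = b ∧ y w = b then _ else 0
  rw [sect_self]

theorem projectL_map (f : A ↪ W) (a : A) (b : Bool) : projectL (f a) b = act f (projectL a b) := by
  rw [projectL_eq, projectL_eq a, ← act_trans]; rfl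

/-- A relabelled circuit acts locally. -/
theorem runL_map (f : A ↪ W) (C : Circuit A) : (C.map f).runL = act f C.runL := by
  induction C with
  | skip => simp [Circuit.map, Circuit.runL]
  | gate g =>
    rw [Circuit.map, Gate.runL_eq, Gate.runL_eq, ← act_trans]; congr 1; ext b; cases b <;> rfl
  | seq C D hC hD => simp [Circuit.map, Circuit.runL, hC, hD, act_comp]
  | branch w C D hC hD =>
    simp [Circuit.map, Circuit.runL, hC, hD, act_comp, act_add, projectL_map]

theorem size_map (f : A ↪ W) (C : Circuit A) : (C.map f).size = C.size := by
  induction C with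
  | skip => rfl
  | gate g => rfl
  | seq C D hC hD => simp [Circuit.map, Circuit.size, hC, hD]
  | branch w C D hC hD => simp [Circuit.map, Circuit.size, hC, hD]

theorem trace_project_add (w : W) (ρ : Op W) :
    (projectL w false ρ).trace + (projectL w true ρ).trace = ρ.trace := by
  simp only [trace, Matrix.diag, ← sum_add_distrib]; refine sum_ext fun x => ?_
  change (if x w = false ∧ x w = false then ρ x x else 0)
    + (if x w = true ∧ x w = true then ρ x x else 0) = _
  cases x w <;> simp

theorem runL_tp (C : Circuit W) : TP C.runL := by
  induction C with
  | skip => exact TP.id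
  | gate g => rw [Gate.runL_eq]; exact g.chan_tp.act
  | seq C D hC hD => exact hD.comp hC
  | branch w C D hC hD =>
    intro ρ; simp only [Circuit.runL, LinearMap.add_apply, comp_apply, Matrix.trace_add]
    rw [hC, hD, trace_project_add]

/-! ### Embedded states -/

def emb (f : A ↪ W) (b : Bits W) : LM A W where
  toFun β := of fun x y =>
    if ∀ w, (∀ a, f a ≠ w) → x w = b w ∧ y w = b w then β (x ∘ f) (y ∘ f) else 0
  map_add' _ _ := by ext; simp only [of_apply, Matrix.add_apply]; split_ifs <;> simp
  map_smul' _ _ := by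
    ext; simp only [of_apply, Matrix.smul_apply, RingHom.id_apply]; split_ifs <;> simp

theorem emb_apply (f : A ↪ W) (b : Bits W) (β : Op A) (x y : Bits W) : emb f b β x y = if ∀ w, (∀ a,
    f a ≠ w) → x w = b w ∧ y w = b w then β (x ∘ f) (y ∘ f) else 0 := rfl

theorem emb_congr (f : A ↪ W) {b b' : Bits W} (h : ∀ w, (∀ a, f a ≠ w) → b w = b' w) :
    emb f b = emb f b' := by
  ext β x y; simp only [emb_apply]; refine if_congr (forall_congr' fun w => ?_) rfl rfl
  exact forall_congr' fun hw => by rw [h w hw]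

theorem emb_trans (f : A ↪ B) (g : B ↪ W) (b : Bits W) (β : Op A) :
    emb (f.trans g) b β = emb g b (emb f (b ∘ g) β) := by
  ext x y; rw [emb_apply, emb_apply, emb_apply, ← ite_and]
  refine if_congr ⟨fun h => ⟨fun w hw => h w fun a => hw (f a), fun v hv => ?_⟩, ?_⟩ rfl rfl
  · exact h (g v) fun a ha => hv a (g.injective ha)
  rintro ⟨h1, h2⟩ w hw; by_cases hg : ∃ v, g v = w
  · obtain ⟨v, rfl⟩ := hg; exact h2 v fun a ha => hw a (congrArg g ha)
  exact h1 w fun v hv => hg ⟨v, hv⟩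

theorem act_emb (g : A ↪ W) (Φ : LM A A) (b : Bits W) (β : Op A) :
    act g Φ (emb g b β) = emb g b (Φ β) := by
  refine op_ext_sect g fun x y => ?_
  have h : ∀ γ : Op A, sect g x y (emb g b γ)
      = if ∀ w, (∀ a, g a ≠ w) → x w = b w ∧ y w = b w then γ else 0 := by
    intro γ; ext a a'; rw [sect_apply, emb_apply, write_comp, write_comp]
    have : (∀ w, (∀ a, g a ≠ w) → write g a x w = b w ∧ write g a' y w = b w)
        ↔ ∀ w, (∀ a, g a ≠ w) → x w = b w ∧ y w = b w :=
      forall_congr' fun w => forall_congr' fun hw => by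
        rw [write_notMem g _ _ hw, write_notMem g _ _ hw]
    simp only [this]; split_ifs <;> rfl
  rw [sect_act, h, h]; split_ifs <;> simp

theorem act_trans_emb (f : A ↪ B) (g : B ↪ W) (Φ : LM A A) (b : Bits W) (β : Op B) :
    act (f.trans g) Φ (emb g b β) = emb g b (act f Φ β) := by
  rw [act_trans, act_emb]

theorem reduceL_emb (g : A ↪ W) (b : Bits W) (β : Op A) : reduceL g (emb g b β) = β := by
  ext y y'; change ∑ x : Bits W, (if x ∘ g = y then _ else 0) = _; rw [sum_eq_single (write g y b)]
  · rw [if_pos (by simp), emb_apply, if_pos]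
    · simp
    intro w hw; simp [write_notMem g _ _ hw]
  · intro x _ hx; split_ifs with h
    · rw [emb_apply, if_neg]; intro h'; refine hx (bits_ext_wire g (by simp [h]) fun w hw => ?_)
      rw [write_notMem g _ _ hw]; exact (h' w hw).1
    rfl
  simp

theorem reduceL_emb_trans (f : A ↪ B) (g : B ↪ W) (b : Bits W) (β : Op A) :
    reduceL g (emb (f.trans g) b β) = emb f (b ∘ g) β := by
  rw [emb_trans, reduceL_emb]

theorem emb_inr (b : Bits (A ⊕ B)) (β : Op B) : emb inr b β = tensor (ket (b ∘ Sum.inl)) β := by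
  ext x y; rw [emb_apply]; simp only [tensor, ket, of_apply]
  have : (∀ w : A ⊕ B, (∀ a, inr a ≠ w) → x w = b w ∧ y w = b w)
      ↔ (x ∘ Sum.inl = b ∘ Sum.inl ∧ y ∘ Sum.inl = b ∘ Sum.inl) := by
    constructor
    · intro h; constructor <;> funext a
      · exact (h (Sum.inl a) (by simp)).1
      exact (h (Sum.inl a) (by simp)).2
    rintro ⟨h1, h2⟩ (a | a) ha
    · exact ⟨congrFun h1 a, congrFun h2 a⟩
    exact absurd rfl (ha a)
  simp only [this]; split_ifs <;> simp <;> rfl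

theorem emb_inl (b : Bits (A ⊕ B)) (β : Op A) : emb inl b β = tensor β (ket (b ∘ Sum.inr)) := by
  ext x y; rw [emb_apply]; simp only [tensor, ket, of_apply]
  have : (∀ w : A ⊕ B, (∀ a, inl a ≠ w) → x w = b w ∧ y w = b w)
      ↔ (x ∘ Sum.inr = b ∘ Sum.inr ∧ y ∘ Sum.inr = b ∘ Sum.inr) := by
    constructor
    · intro h; constructor <;> funext a
      · exact (h (Sum.inr a) (by simp)).1
      exact (h (Sum.inr a) (by simp)).2
    rintro ⟨h1, h2⟩ (a | a) ha
    · exact absurd rfl (ha a)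
    exact ⟨congrFun h1 a, congrFun h2 a⟩
  simp only [this]; split_ifs <;> simp <;> rfl

theorem emb_refl (b : Bits W) (β : Op W) : emb (refl W) b β = β := by
  ext x y; rw [emb_apply, if_pos]
  · rfl
  exact fun w hw => absurd rfl (hw w)

theorem emb_ket (f : A ↪ W) (b : Bits W) (a : Bits A) : emb f b (ket a) = ket (write f a b) := by
  ext x y; simp only [emb_apply, ket, of_apply, ← ite_and]; refine if_congr ⟨?_, ?_⟩ rfl rfl
  · rintro ⟨h1, h2, h3⟩
    exact ⟨bits_ext_wire f (by simp [h2]) fun w hw => by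
        rw [write_notMem f _ _ hw, (h1 w hw).1],
      bits_ext_wire f (by simp [h3]) fun w hw => by
        rw [write_notMem f _ _ hw, (h1 w hw).2]⟩
  rintro ⟨rfl, rfl⟩; exact ⟨fun w hw => by simp [write_notMem f _ _ hw], by simp, by simp⟩

theorem tensor_ket_ket (a : Bits A) (b : Bits B) : tensor (ket a) (ket b) = ket (elim a b) := by
  rw [← write_inr b b a, ← emb_ket, emb_inr]; rfl

/-! ### Measurements -/

theorem dephaseL_apply (f : A ↪ W) (ρ : Op W) (x y : Bits W) :
    dephaseL f ρ x y = if x ∘ f = y ∘ f then ρ x y else 0 := rfl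

theorem dephaseL_trans (f : A ↪ B) (g : B ↪ W) : dephaseL (f.trans g) = act g (dephaseL f) := by
  ext ρ x y; rw [dephaseL_apply, act_apply, dephaseL_apply, sect_self]; rfl

theorem dephaseL_tp (f : A ↪ W) : TP (dephaseL f) := fun ρ => by simp [trace, dephaseL_apply]

theorem sum_emb_inr_block (ρ : Op (A ⊕ B)) : dephaseL inl ρ = ∑ a, tensor (ket a) (block a ρ) := by
  ext x y; rw [dephaseL_apply, Matrix.sum_apply]
  simp only [tensor, ket, block, of_apply, ite_mul, one_mul, zero_mul]; split_ifs with h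
  · rw [sum_eq_single (x ∘ Sum.inl)]
    · have h' : x ∘ Sum.inl = y ∘ Sum.inl := h; rw [if_pos ⟨rfl, h'.symm⟩, elim_comp]
      rw [h', elim_comp]
    · intro a _ ha; rw [if_neg fun h' => ha h'.1.symm]
    simp
  refine (sum_eq_zero fun a _ => ?_).symm; rw [if_neg]; rintro ⟨h1, h2⟩; exact h (h1.trans h2.symm)

theorem emb_tensor_ket (F : D ⊕ A ↪ W) (b : Bits W) (d : Bits D) (β : Op A) : emb F b (tensor (ket
    d) β) = emb (inr.trans F) (write (inl.trans F) d b) β := by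
  rw [emb_trans, emb_inr]
  have h1 : (write (inl.trans F) d b ∘ F) ∘ Sum.inl = d :=
    write_comp (inl.trans F) d b
  rw [h1]; refine congrArg (fun L : LM (D ⊕ A) W => L _) (emb_congr F fun w hw => ?_)
  exact (write_notMem _ _ _ fun a => hw (Sum.inl a)).symm

/-- Measured wires become classical. -/
theorem dephaseL_emb (F : D ⊕ A ↪ W) (b : Bits W) (ρ : Op (D ⊕ A)) : dephaseL (inl.trans F) (emb F b
    ρ) = ∑ d, emb (inr.trans F) (write (inl.trans F) d b) (block d ρ) := by
  rw [dephaseL_trans, act_emb, sum_emb_inr_block, map_sum]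
  exact sum_ext fun d => emb_tensor_ket F b d _

theorem emb_zeros_tensor (F : D ⊕ A ↪ W) (b : Bits W) (β : Op A) : emb (inr.trans F) b β = emb F b
    (tensor (ket (b ∘ inl.trans F)) β) := by
  rw [emb_tensor_ket]; refine congrArg (fun L : LM A W => L β) (emb_congr _ fun w _ => ?_)
  rw [write_self]

def Circuit.ofList : List (Circuit W) → Circuit W
  | [] => .skip
  | C :: l => .seq C (Circuit.ofList l)

theorem Circuit.size_ofList (l : List (Circuit W)) :
    (Circuit.ofList l).size = (l.map Circuit.size).sum := by
  induction l with
  | nil => rfl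
  | cons C l ih => simp [Circuit.ofList, Circuit.size, ih]

def measureC (f : A ↪ W) : Circuit W :=
  Circuit.ofList ((univ : Finset A).toList.map fun a => .branch (f a) .skip .skip)

theorem size_measureC (f : A ↪ W) : (measureC f).size = card A := by
  simp [measureC, Circuit.size_ofList, Function.comp_def, Circuit.size]

theorem runL_measureC (f : A ↪ W) : (measureC f).runL = dephaseL f := by
  have key : ∀ (l : List A) (ρ : Op W) (x y : Bits W),
      (Circuit.ofList (l.map fun a => .branch (f a) .skip .skip)).runL ρ x y
        = if ∀ a ∈ l, x (f a) = y (f a) then ρ x y else 0 := by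
    intro l
    induction l with
    | nil => intro ρ x y; simp [Circuit.ofList, Circuit.runL]
    | cons a l ih =>
      intro ρ x y
      simp only [map_cons, Circuit.ofList, Circuit.runL, comp_apply, ih,
        List.forall_mem_cons, LinearMap.add_apply, LinearMap.id_comp, Matrix.add_apply]
      have : ∀ b, projectL (f a) b ρ x y = if x (f a) = b ∧ y (f a) = b then ρ x y else 0 :=
        fun _ => rfl
      rw [this, this]
      cases x (f a) <;> cases y (f a) <;> simp
  ext ρ x y; rw [measureC, key, dephaseL_apply]; refine if_congr ?_ rfl rfl; rw [funext_iff]; simp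

/-! ### Classical gates -/

def permGate (w w' : W) (h : w ≠ w') (π : Equiv.Perm (Bool × Bool)) : Gate W where
  fst := w
  snd := w'
  ne := h
  kraus i := if i = 0 then of fun p q => if q = π p then 1 else 0 else 0
  complete := by
    rw [sum_eq_single 0]
    · ext p q
      simp only [if_true, Matrix.mul_apply, Matrix.conjTranspose_apply, of_apply, Matrix.one_apply]
      rw [sum_eq_single (π.symm p)]
      · simp [eq_comm]
      · intro r _ hr; rw [if_neg fun h' => hr (by simp [h'])]
        simp
      simp
    · intro i _ hi; simp [hi]
    simp

def setPair (w w' : W) (p : Bool × Bool) (x : Bits W) : Bits W :=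
  update (update x w' p.2) w p.1

theorem write_wires (g : Gate W) (p : Bits Bool) (x : Bits W) :
    write g.wires p x = setPair g.fst g.snd (p false, p true) x := by
  refine bits_ext_wire g.wires ?_ ?_
  · rw [write_comp]; funext b
    cases b
    · simp [setPair, Gate.wires_false]
    simp [setPair, Gate.wires_true, update_of_ne g.ne.symm]
  intro w hw; have h1 : g.fst ≠ w := hw false; have h2 : g.snd ≠ w := hw true
  rw [write_notMem _ _ _ hw, setPair, update_of_ne h1.symm, update_of_ne h2.symm]

theorem gate_runL_apply (g : Gate W) (ρ : Op W) (x y : Bits W) : (Circuit.gate g).runL ρ x y = ∑ i,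
    ∑ p, ∑ q, g.kraus i (x g.fst, x g.snd) p * ρ (setPair g.fst g.snd p x) (setPair g.fst g.snd q y)
    * star (g.kraus i (y g.fst, y g.snd) q) := by
  rw [Gate.runL_eq, act_apply]
  change (∑ i, g.krausB i * sect g.wires x y ρ * (g.krausB i)ᴴ) (x ∘ g.wires) (y ∘ g.wires) = _
  rw [Matrix.sum_apply]; refine sum_ext fun i => ?_; rw [Matrix.mul_assoc, Matrix.mul_apply]
  refine Fintype.sum_equiv (Equiv.boolArrowEquivProd Bool) _ _ fun p => ?_
  rw [Matrix.mul_apply, mul_sum]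
  refine Fintype.sum_equiv (Equiv.boolArrowEquivProd Bool) _ _ fun q => ?_
  rw [sect_apply, write_wires, write_wires, mul_assoc]; rfl

theorem permGate_runL (w w' : W) (h : w ≠ w') (π : Equiv.Perm (Bool × Bool)) (ρ : Op W) (x y : Bits
    W) : (Circuit.gate (permGate w w' h π)).runL ρ x y = ρ (setPair w w' (π (x w, x w')) x) (setPair
    w w' (π (y w, y w')) y) := by
  rw [gate_runL_apply, sum_eq_single 0]
  · rw [sum_eq_single (π (x w, x w')), sum_eq_single (π (y w, y w'))]
    · simp [permGate]
    · intro q _ hq; simp [permGate, hq]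
    · simp
    · intro q _ hq; simp [permGate, hq]
    simp
  · intro i _ hi; simp [permGate, hi]
  simp

def swapC (w w' : W) (h : w ≠ w') : Circuit W := .gate (permGate w w' h (Equiv.prodComm _ _))

theorem runL_swapC (w w' : W) (h : w ≠ w') (ρ : Op W) (x y : Bits W) :
    (swapC w w' h).runL ρ x y = ρ (x ∘ Equiv.swap w w') (y ∘ Equiv.swap w w') := by
  rw [swapC, permGate_runL]
  have : ∀ x : Bits W, setPair w w' (Equiv.prodComm _ _ (x w, x w')) x = x ∘ Equiv.swap w w' := by
    intro x; funext v
    simp only [setPair, Equiv.prodComm_apply, Prod.swap_prod_mk, Function.comp_apply]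
    by_cases h1 : v = w
    · subst h1; simp
    by_cases h2 : v = w'
    · subst h2; simp [update_of_ne h.symm]
    rw [update_of_ne h1, update_of_ne h2, Equiv.swap_apply_of_ne_of_ne h1 h2]
  rw [this, this]

def cnotC (c w : W) (h : w ≠ c) : Circuit W :=
  .gate (permGate w c h
    ⟨fun p => (xor p.1 p.2, p.2), fun p => (xor p.1 p.2, p.2),
      fun p => by simp, fun p => by simp⟩)

theorem runL_cnotC (c w : W) (h : w ≠ c) (ρ : Op W) (x y : Bits W) : (cnotC c w h).runL ρ x y = ρ
    (update x w (xor (x w) (x c))) (update y w (xor (y w) (y c))) := by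
  rw [cnotC, permGate_runL]; simp [setPair]

def notC (w w' : W) (h : w ≠ w') : Circuit W :=
  .gate (permGate w w' h
    ⟨fun p => (!p.1, p.2), fun p => (!p.1, p.2), fun p => by simp, fun p => by simp⟩)

theorem runL_notC (w w' : W) (h : w ≠ w') (ρ : Op W) (x y : Bits W) : (notC w w' h).runL ρ x y = ρ
    (update x w (!(x w))) (update y w (!(y w))) := by
  rw [notC, permGate_runL]; simp [setPair]

def resetC (w w' : W) (h : w ≠ w') : Circuit W :=
  .gate
  { fst := w
    snd := w'
    ne := h
    kraus := fun i => if i = 0 then of fun p q => if p = (false, p.2) ∧ q = p then 1 else 0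
      else if i = 1 then of fun p q => if p = (false, p.2) ∧ q = (true, p.2) then 1 else 0
      else 0
    complete := by
      rw [← Finset.sum_subset (Finset.subset_univ ({0, 1} : Finset (Fin 16)))]
      · rw [Finset.sum_pair (by decide)]
        ext ⟨p1, p2⟩ ⟨q1, q2⟩
        simp only [Matrix.add_apply, Matrix.mul_apply, Matrix.conjTranspose_apply,
          Fintype.sum_prod_type, Fintype.sum_bool, Matrix.one_apply]
        cases p1 <;> cases p2 <;> cases q1 <;> cases q2 <;> simp
      intro i _ hi; simp only [Finset.mem_insert, Finset.mem_singleton, not_or] at hi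
      simp [hi.1, hi.2] }

theorem runL_resetC (w w' : W) (h : w ≠ w') :
    (resetC w w' h).runL = act (single w) (replaceL (ket zeros)) := by
  ext ρ x y; rw [resetC, gate_runL_apply, act_apply]
  have hx : ∀ (b : Bool) (x : Bits W), write (single w) (fun _ => b) x
      = setPair w w' (b, x w') x := by
    intro b x; refine bits_ext_wire (single w) ?_ ?_
    · rw [write_comp]; funext u; simp [setPair]
    intro v hv; rw [write_notMem _ _ _ hv]; have : w ≠ v := hv ()
    rw [setPair, update_of_ne this.symm]; by_cases h2 : v = w'
    · subst h2; simp
    rw [update_of_ne h2]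
  have htr : ∀ σ : Op Unit, σ.trace = σ (fun _ => false) (fun _ => false)
      + σ (fun _ => true) (fun _ => true) := by
    intro σ
    rw [trace, Fintype.sum_equiv (Equiv.funUnique Unit Bool) _
      (fun b => σ (fun _ => b) (fun _ => b)), Fintype.sum_bool, add_comm]
    intro x; have : x = fun _ => x () := by funext u; rfl
    rw [this]; rfl
  rw [replaceL_apply, htr, Matrix.smul_apply, sect_apply, sect_apply]; simp only [hx]
  rw [← Finset.sum_subset (Finset.subset_univ ({0, 1} : Finset (Fin 16)))]
  · rw [Finset.sum_pair (by decide)]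
    simp only [Fintype.sum_prod_type, Fintype.sum_bool]
    have hk : (ket zeros : Op Unit) (x ∘ (single w))
        (y ∘ (single w))
        = if x w = false ∧ y w = false then 1 else 0 := by
      simp only [ket, of_apply, zeros, funext_iff]; simp
    rw [hk]
    cases hxw : x w <;> cases hyw : y w <;> cases hxw' : x w' <;> cases hyw' : y w' <;> simp
  intro i _ hi; simp only [Finset.mem_insert, Finset.mem_singleton, not_or] at hi; simp [hi.1, hi.2]

/-! ### Overwriting wires by classical values -/

theorem replaceL_tp {κ : Op A} (h : κ.trace = 1) : TP (replaceL κ : LM B A) := fun ρ => by simp [h]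

@[simp] theorem trace_ket (b : Bits A) : (ket b : Op A).trace = 1 := by simp [trace, ket]

@[simp] theorem trace_tensor (ρ : Op A) (σ : Op B) : (tensor ρ σ).trace = ρ.trace * σ.trace := by
  rw [trace_op_sum]; simp [tensor, trace, Finset.sum_mul_sum]

def other [Nontrivial W] (w : W) : W := (exists_ne w).choose

theorem ne_other [Nontrivial W] (w : W) : w ≠ other w := (exists_ne w).choose_spec.symm

def resetAllC [Nontrivial W] (g : A ↪ W) : Circuit W :=
  Circuit.ofList ((univ : Finset A).toList.map fun a => resetC (g a) _ (ne_other (g a)))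

theorem runL_resetAllC [Nontrivial W] (g : A ↪ W) :
    (resetAllC g).runL = act g (replaceL (ket zeros)) := by
  let R : A → LM A A := fun a => act (single a) (replaceL (ket zeros))
  have h2 : ∀ (S : A → Prop) (ρ : Op A) (b : A),
      (∀ x y, (∃ a, S a ∧ (x a = true ∨ y a = true)) → ρ x y = 0) →
      ∀ x y, (∃ a, (a = b ∨ S a) ∧ (x a = true ∨ y a = true)) → R b ρ x y = 0 := by
    rintro S ρ b hρ x y ⟨a, ha, hxy⟩
    simp only [R, act_apply, replaceL_apply, Matrix.smul_apply, smul_eq_mul]; by_cases hab : a = b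
    · subst hab; refine mul_eq_zero_of_right _ ?_; simp only [ket, of_apply]; rw [if_neg]
      rintro ⟨h, h'⟩; have h1 : x a = false := congrFun h ()
      have h2 : y a = false := congrFun h' (); simp [h1, h2] at hxy
    refine mul_eq_zero_of_left (sum_eq_zero fun u _ => hρ _ _ ⟨a, ha.resolve_left hab, ?_⟩) _
    have (u : Unit) : single b u ≠ a := Ne.symm hab
    rwa [write_notMem _ _ _ this, write_notMem _ _ _ this]
  have h3 : ∀ l : List A, ∃ Φ : LM A A, (Circuit.ofList (l.map fun a => resetC (g a) _ (ne_other (g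
      a)))).runL = act g Φ ∧ TP Φ ∧ ∀ (S : A → Prop) ρ,
      (∀ x y, (∃ a, S a ∧ (x a = true ∨ y a = true)) → ρ x y = 0) →
      ∀ x y, (∃ a, (a ∈ l ∨ S a) ∧ (x a = true ∨ y a = true)) → Φ ρ x y = 0 := by
    intro l
    induction l with
    | nil => exact ⟨LinearMap.id, (act_id g).symm, TP.id, fun S ρ h => by simpa using h⟩
    | cons a l ih =>
      obtain ⟨Φ, h, htp, hz⟩ := ih
      refine ⟨Φ ∘ₗ R a, ?_, htp.comp (replaceL_tp (trace_ket _)).act, fun S ρ hρ x y h => ?_⟩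
      · rw [map_cons, Circuit.ofList, Circuit.runL, h, runL_resetC, act_comp, ← act_trans]; rfl
      refine hz _ _ (h2 S ρ a hρ) x y ?_; obtain ⟨b, hb, hxy⟩ := h
      exact ⟨b, (or_assoc.1 (by simpa [or_comm, or_left_comm] using hb)), hxy⟩
  obtain ⟨Φ, h1, htp, hz⟩ := h3 univ.toList; rw [resetAllC, h1]; congr 1
  replace hz := fun ρ => hz (fun _ => False) ρ (by simp)
  simp only [Finset.mem_toList, mem_univ, true_or, true_and] at hz; ext ρ x y
  have hnz : ∀ x : Bits A, x ≠ zeros → ∃ a, x a = true := by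
    intro x hx; by_contra! h; exact hx (funext fun a => by simpa [zeros] using h a)
  rw [replaceL_apply, Matrix.smul_apply, ket, of_apply]; by_cases hx : x = zeros ∧ y = zeros
  · rw [if_pos hx, ← htp ρ, trace, sum_eq_single zeros]
    · simp [hx.1, hx.2]
    · intro b _ hb; obtain ⟨a, ha⟩ := hnz b hb; exact hz ρ b b ⟨a, Or.inl ha⟩
    simp
  rw [if_neg hx]; simp only [smul_zero]; rw [not_and_or] at hx; obtain hx | hx := hx
  · obtain ⟨a, ha⟩ := hnz x hx; exact hz ρ x y ⟨a, Or.inl ha⟩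
  obtain ⟨a, ha⟩ := hnz y hx; exact hz ρ x y ⟨a, Or.inr ha⟩

def loadL (g : A ↪ W) (v : Bits W → Bits A) : LM W W where
  toFun ρ := of fun x y =>
    if x ∘ g = v x ∧ y ∘ g = v y then ∑ t, ρ (write g t x) (write g t y) else 0
  map_add' _ _ := by
    ext; simp only [of_apply, Matrix.add_apply, sum_add_distrib]; split_ifs <;> simp
  map_smul' _ _ := by
    ext; simp only [of_apply, Matrix.smul_apply, ← smul_sum, RingHom.id_apply]; split_ifs <;> simp

theorem loadL_apply (g : A ↪ W) (v : Bits W → Bits A) (ρ : Op W) (x y : Bits W) : loadL g v ρ x y =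
    if x ∘ g = v x ∧ y ∘ g = v y then ∑ t, ρ (write g t x) (write g t y) else 0 := rfl

def srcVal (s : W ⊕ Bool) (x : Bits W) : Bool := elim x id s

def xorC [Nontrivial W] (w : W) : W ⊕ Bool → Circuit W
  | .inl c => if h : w ≠ c then cnotC c w h else .skip
  | .inr b => if b then notC w _ (ne_other w) else .skip

theorem size_xorC [Nontrivial W] (w : W) (s : W ⊕ Bool) : (xorC w s).size ≤ 1 := by
  rcases s with c | b <;> simp only [xorC] <;> split_ifs <;> simp [Circuit.size, cnotC, notC]

theorem runL_xorC [Nontrivial W] (w : W) (s : W ⊕ Bool) (hs : s ≠ .inl w) (ρ : Op W) (x y : Bits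
    W) : (xorC w s).runL ρ x y = ρ (update x w (xor (x w) (srcVal s x))) (update y w (xor (y w)
    (srcVal s y))) := by
  rcases s with c | b
  · have h : w ≠ c := fun h => hs (by rw [h])
    rw [xorC, dif_pos h, runL_cnotC]; rfl
  cases b
  · simp [xorC, srcVal, Circuit.runL]
  simp [xorC, srcVal, runL_notC]

def loadC [Nontrivial W] (g : A ↪ W) (src : A → W ⊕ Bool) : Circuit W :=
  .seq (resetAllC g)
    (Circuit.ofList ((univ : Finset A).toList.map fun a => xorC (g a) (src a)))

theorem size_loadC [Nontrivial W] (g : A ↪ W) (src : A → W ⊕ Bool) :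
    (loadC g src).size ≤ 2 * card A := by
  have h : ((univ : Finset A).toList.map fun a => (xorC (g a) (src a)).size).sum
      ≤ card A := by
    refine (List.sum_le_card_nsmul _ 1 ?_).trans (by simp)
    intro n hn; obtain ⟨a, -, rfl⟩ := List.mem_map.1 hn; exact size_xorC _ _
  simp only [loadC, Circuit.size, resetAllC, Circuit.size_ofList, List.map_map, Function.comp_def,
    resetC, List.map_const', List.sum_replicate, Finset.length_toList, card_univ, smul_eq_mul]
  omega

theorem runL_loadC [Nontrivial W] (g : A ↪ W) (src : A → W ⊕ Bool) (hs : ∀ a b, src a ≠ .inl (g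
    b)) : (loadC g src).runL = loadL g fun x a => srcVal (src a) x := by
  have hv : ∀ a t x, srcVal (src a) (write g t x) = srcVal (src a) x := by
    intro a t x; rcases h : src a with c | b
    · refine write_notMem _ _ _ fun b hb => hs a b (by rw [h, hb])
    rfl
  let φ : List A → Bits W → Bits W := fun l x =>
    write g (fun a => if a ∈ l then xor (x (g a)) (srcVal (src a) x) else x (g a)) x
  have key : ∀ l : List A, l.Nodup → ∀ (ρ : Op W) (x y : Bits W),
      (Circuit.ofList (l.map fun a => xorC (g a) (src a))).runL ρ x y = ρ (φ l x) (φ l y) := by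
    intro l
    induction l with
    | nil =>
      intro _ ρ x y
      have : ∀ x, φ [] x = x := fun x => by
        simp only [φ, List.not_mem_nil, if_false]; exact write_self g x
      simp [Circuit.ofList, Circuit.runL, this]
    | cons a l ih =>
      intro hl ρ x y; rw [List.nodup_cons] at hl
      simp only [map_cons, Circuit.ofList, Circuit.runL, comp_apply]
      rw [ih hl.2, runL_xorC _ _ (hs a a)]
      have : ∀ x, update (φ l x) (g a) (xor (φ l x (g a)) (srcVal (src a) (φ l x)))
          = φ (a :: l) x := by
        intro x; refine bits_ext_wire g ?_ ?_
        · funext b; simp only [φ, Function.comp_apply, write_mem, hv]; by_cases hb : b = a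
          · subst hb; simp [hl.1]
          rw [update_of_ne (fun h => hb (g.injective h)), write_mem]; simp [hb]
        intro w hw; rw [update_of_ne (hw a).symm]; change write g _ x w = write g _ x w
        rw [write_notMem _ _ _ hw, write_notMem _ _ _ hw]
      rw [this, this]
  ext ρ x y; simp only [loadC, Circuit.runL, comp_apply]
  rw [key _ (Finset.nodup_toList _), runL_resetAllC, act_apply, replaceL_apply, Matrix.smul_apply]
  simp only [φ, Finset.mem_toList, mem_univ, if_true, write_comp, sect_write]
  change _ = if _ then _ else _
  have hiff : ∀ x : Bits W, (fun a => xor (x (g a)) (srcVal (src a) x)) = zeros ↔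
      (x ∘ g = fun a => srcVal (src a) x) := by
    intro x; simp only [funext_iff, zeros, Function.comp_apply]
    exact forall_congr' fun a => by cases x (g a) <;> cases srcVal (src a) x <;> simp
  simp only [ket, of_apply, hiff]; split_ifs with h
  · simp [trace, sect_apply]
  simp

theorem loadL_const (g : A ↪ W) (b : Bits A) : (loadL g fun _ => b) = act g (replaceL (ket b)) := by
  ext ρ x y; rw [act_apply, replaceL_apply, Matrix.smul_apply]; change (if _ then _ else _) = _
  simp only [ket, of_apply]; split_ifs <;> simp [trace, sect_apply]

theorem loadL_emb (f : B ↪ W) (g : A ↪ W) (h : ∀ b a, f b ≠ g a) (v : Bits W → Bits A) (hv : ∀ x x',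
    (∀ w, (∀ b, f b ≠ w) → (∀ a, g a ≠ w) → x w = x' w) → v x = v x') (b : Bits W) (β : Op B) :
    loadL g v (emb f b β) = emb f (write g (v b) b) β := by
  ext x y; change (if _ then ∑ t, emb f b β (write g t x) (write g t y) else 0) = _
  have h' : ∀ a b, g a ≠ f b := fun a b => (h b a).symm
  simp only [emb_apply, write_disjoint g f h']
  by_cases hc : ∀ w, (∀ b, f b ≠ w) → (∀ a, g a ≠ w) → x w = b w ∧ y w = b w
  · have hx : v x = v b := hv _ _ fun w h1 h2 => (hc w h1 h2).1
    have hy : v y = v b := hv _ _ fun w h1 h2 => (hc w h1 h2).2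
    have hiff : (∀ w, (∀ a, f a ≠ w) → x w = write g (v b) b w ∧ y w = write g (v b) b w)
        ↔ x ∘ g = v x ∧ y ∘ g = v y := by
      rw [hx, hy]; constructor
      · intro hw; constructor <;> funext a
        · simpa using (hw (g a) fun b => h b a).1
        simpa using (hw (g a) fun b => h b a).2
      rintro ⟨h1, h2⟩ w hw; by_cases hg : ∃ a, g a = w
      · obtain ⟨a, rfl⟩ := hg; rw [write_mem]; exact ⟨congrFun h1 a, congrFun h2 a⟩
      push Not at hg; rw [write_notMem _ _ _ hg]; exact hc w hw hg
    simp only [hiff]; refine if_congr Iff.rfl ?_ rfl; rw [sum_eq_single (b ∘ g)]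
    · rw [if_pos]; intro w hw; by_cases hg : ∃ a, g a = w
      · obtain ⟨a, rfl⟩ := hg; simp
      push Not at hg; rw [write_notMem _ _ _ hg, write_notMem _ _ _ hg]; exact hc w hw hg
    · intro t _ ht; rw [if_neg]; intro hw; refine ht (funext fun a => ?_)
      simpa using (hw (g a) fun b => h b a).1
    simp
  have hn : ¬ ∀ w, (∀ a, f a ≠ w) → x w = write g (v b) b w ∧ y w = write g (v b) b w := by
    intro hw; refine hc fun w h1 h2 => ?_; simpa [write_notMem _ _ _ h2] using hw w h1
  rw [if_neg hn]; split_ifs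
  · refine sum_eq_zero fun t _ => if_neg fun hw => hc fun w h1 h2 => ?_
    simpa [write_notMem _ _ _ h2] using hw w h1
  rfl

theorem loadL_tensor_ket (g : A ↪ W) (v : Bits C → Bits A) (c : Bits C) (β : Op W) : loadL (g.trans
    inr) (fun x : Bits (C ⊕ W) => v (x ∘ Sum.inl)) (tensor (ket c) β) = tensor (ket c) (act g
    (replaceL (ket (v c))) β) := by
  rw [← loadL_const]; ext x y; simp only [loadL_apply, write_trans, tensor, of_apply, ket]
  have hw : ∀ (t : Bits W) (x : Bits (C ⊕ W)), write (inr : W ↪ C ⊕ W) t x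
      = elim (x ∘ Sum.inl) t := fun t x => by
    conv_lhs => rw [← elim_comp x]
    rw [write_inr]
  simp only [hw, Sum.elim_comp_inl, Sum.elim_comp_inr]
  by_cases h : x ∘ Sum.inl = c ∧ y ∘ Sum.inl = c
  · simp only [h, if_true, one_mul, and_self]; rfl
  simp [h]

/-! ### Permutations of wires -/

def permL (σ : Equiv.Perm W) : LM W W where
  toFun ρ := of fun x y => ρ (x ∘ σ) (y ∘ σ)
  map_add' _ _ := rfl
  map_smul' _ _ := rfl

theorem exists_permC (f g : A ↪ W) : ∃ (σ : Equiv.Perm W) (C : Circuit W),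
    C.size ≤ card A ∧ C.runL = permL σ ∧ ∀ a, σ (g a) = f a := by
  have key : ∀ S : Finset A, ∃ (σ : Equiv.Perm W) (C : Circuit W),
      C.size ≤ S.card ∧ C.runL = permL σ ∧ ∀ a ∈ S, σ (g a) = f a := by
    intro S
    induction S using Finset.induction_on with
    | empty => exact ⟨1, .skip, by simp [Circuit.size], rfl, by simp⟩
    | insert a S ha ih =>
      obtain ⟨σ, C, h1, h2, h3⟩ := ih
      have hS : ∀ b ∈ S, Equiv.swap (σ (g a)) (f a) (σ (g b)) = f b := by
        intro b hb; have hab : b ≠ a := fun h => ha (h ▸ hb)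
        rw [Equiv.swap_apply_of_ne_of_ne, h3 b hb]
        · exact fun h => hab (g.injective (σ.injective h))
        rw [h3 b hb]; exact fun h => hab (f.injective h)
      refine ⟨Equiv.swap (σ (g a)) (f a) * σ,
        if h : σ (g a) ≠ f a then .seq C (swapC _ _ h) else C, ?_, ?_, ?_⟩
      · rw [Finset.card_insert_of_notMem ha]; split_ifs
        · simp only [Circuit.size, swapC]; omega
        omega
      · split_ifs with h
        · ext ρ x y; simp only [Circuit.runL, comp_apply, runL_swapC, h2]; rfl
        push Not at h; rw [h2, h, Equiv.swap_self]; rfl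
      intro b hb; rw [Finset.mem_insert] at hb; obtain rfl | hb := hb
      · simp
      exact hS b hb
  obtain ⟨σ, C, h1, h2, h3⟩ := key univ; exact ⟨σ, C, h1, h2, fun a => h3 a (mem_univ a)⟩

theorem reduceL_permL (σ : Equiv.Perm W) (f g : A ↪ W) (h : ∀ a, σ (g a) = f a) (ρ : Op W) :
    reduceL f (permL σ ρ) = reduceL g ρ := by
  have hf : f = g.trans σ.toEmbedding := by ext a; exact (h a).symm
  ext y y'
  change ∑ x : Bits W, (if x ∘ f = y then ρ (x ∘ σ) (write f y' x ∘ σ) else 0)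
    = ∑ x : Bits W, (if x ∘ g = y then ρ x (write g y' x) else 0)
  refine Fintype.sum_equiv (Equiv.arrowCongr σ.symm (Equiv.refl Bool)) _ _ fun x => ?_
  have h1 : (Equiv.arrowCongr σ.symm (Equiv.refl Bool)) x = x ∘ σ := rfl
  have h2 : (x ∘ σ) ∘ g = x ∘ f := by funext a; simp [← h]
  have h3 : write f y' x ∘ σ = write g y' (x ∘ σ) := by
    refine bits_ext_wire g ?_ fun w hw => ?_
    · rw [write_comp]; funext a; simp only [Function.comp_apply, h, write_mem]
    rw [write_notMem _ _ _ hw]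
    exact write_notMem _ _ _ fun a ha => hw a (σ.injective (by rw [h, ha]))
  rw [h1, h2, h3]

/-! ### Maps and functionals computed by circuits -/

/-- `Φ` is computed by a circuit of size at most `n` with at most `n` ancillas, whatever the
initial state of the ancillas. -/
def Impl (Φ : LM G G) (n : ℕ) : Prop :=
  ∃ (T : Reg) (C : Circuit (G ⊕ T)), card T ≤ n ∧ C.size ≤ n ∧
    ∀ ρ, reduceL inl (C.runL ρ) = Φ (reduceL inl ρ)

/-- `φ` is the probability of the output bit 1 of a circuit of size at most `n` with at most `n`
ancillas, whatever the initial state of the ancillas. -/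
def Test (φ : Op G →ₗ[ℂ] ℂ) (n : ℕ) : Prop :=
  ∃ (T : Reg) (C : Circuit (G ⊕ T)) (w : G ⊕ T), card T ≤ n ∧ C.size ≤ n ∧
    ∀ ρ, (projectL w true (C.runL ρ)).trace = φ (reduceL inl ρ)

theorem Impl.mono {Φ : LM G G} {n n' : ℕ} (h : Impl Φ n) (hn : n ≤ n') : Impl Φ n' := by
  obtain ⟨T, C, h1, h2, h3⟩ := h; exact ⟨T, C, h1.trans hn, h2.trans hn, h3⟩

theorem Test.mono {φ : Op G →ₗ[ℂ] ℂ} {n n' : ℕ} (h : Test φ n) (hn : n ≤ n') : Test φ n' := by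
  obtain ⟨T, C, w, h1, h2, h3⟩ := h; exact ⟨T, C, w, h1.trans hn, h2.trans hn, h3⟩

theorem Impl.circuit (C : Circuit G) : Impl C.runL C.size :=
  ⟨⟨Empty⟩, C.map inl, by simp, by rw [size_map], fun ρ => by
    rw [runL_map, reduceL_act]⟩

theorem Impl.id : Impl (LinearMap.id : LM G G) 0 := Impl.circuit .skip

abbrev onSnd (G : Type) (f : A ↪ B) : G ⊕ A ↪ G ⊕ B := (refl G).sumMap f

theorem Impl.comp {Φ Ψ : LM G G} {n k : ℕ} (hΦ : Impl Φ n) (hΨ : Impl Ψ k) :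
    Impl (Φ ∘ₗ Ψ) (n + k) := by
  obtain ⟨T, C, h1, h2, h3⟩ := hΦ; obtain ⟨T', C', h1', h2', h3'⟩ := hΨ
  refine ⟨⟨T ⊕ T'⟩, .seq (C'.map (onSnd G inr)) (C.map (onSnd G inl)), ?_, ?_, fun ρ => ?_⟩
  · simp only [card_sum]; omega
  · simp only [Circuit.size, size_map]; omega
  have e1 : (inl : G ↪ G ⊕ (T ⊕ T'))
      = (inl : G ↪ G ⊕ T).trans (onSnd G inl) := by
    ext; rfl
  have e2 : (inl : G ↪ G ⊕ (T ⊕ T'))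
      = (inl : G ↪ G ⊕ T').trans (onSnd G inr) := by
    ext; rfl
  simp only [Circuit.runL, comp_apply, runL_map]
  rw [e1, reduceL_trans, reduceL_act, h3, ← reduceL_trans, ← e1]
  rw [e2, reduceL_trans, reduceL_act, h3', ← reduceL_trans]

theorem Test.comp {φ : Op G →ₗ[ℂ] ℂ} {Ψ : LM G G} {n k : ℕ} (hφ : Test φ n) (hΨ : Impl Ψ k) :
    Test (φ ∘ₗ Ψ) (n + k) := by
  obtain ⟨T, C, w, h1, h2, h3⟩ := hφ; obtain ⟨T', C', h1', h2', h3'⟩ := hΨ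
  refine ⟨⟨T ⊕ T'⟩, .seq (C'.map (onSnd G inr)) (C.map (onSnd G inl)), onSnd G inl w, ?_, ?_, fun ρ
    => ?_⟩
  · simp only [card_sum]; omega
  · simp only [Circuit.size, size_map]; omega
  have e1 : (inl : G ↪ G ⊕ (T ⊕ T'))
      = (inl : G ↪ G ⊕ T).trans (onSnd G inl) := by
    ext; rfl
  have e2 : (inl : G ↪ G ⊕ (T ⊕ T'))
      = (inl : G ↪ G ⊕ T').trans (onSnd G inr) := by
    ext; rfl
  simp only [Circuit.runL, comp_apply, runL_map]
  rw [projectL_map, ← trace_reduceL (onSnd G inl), reduceL_act,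
    reduceL_act, h3, ← reduceL_trans, ← e1]
  rw [e2, reduceL_trans, reduceL_act, h3', ← reduceL_trans]

theorem reduceL_sumMap_act (f : G ↪ H) (T : Type) [Fintype T] [DecidableEq T] {Θ : LM (G ⊕ T) (G ⊕
    T)} {Φ : LM G G} (h : ∀ ρ, reduceL inl (Θ ρ) = Φ (reduceL inl ρ)) (ρ : Op (H ⊕ T)) : reduceL inl
    (act (f.sumMap (refl T)) Θ ρ) = act f Φ (reduceL inl ρ) := by
  have hw : ∀ (a : Bits G) (x : Bits H) (z t : Bits T),
      write (f.sumMap (refl T)) (elim a t) (elim x z)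
        = elim (write f a x) t := by
    intro a x z t; refine bits_ext_wire (f.sumMap (refl T)) ?_ ?_
    · rw [write_comp]; funext w; rcases w with w | w
      · exact (write_mem f a x w).symm
      rfl
    rintro (w | w) hw
    · rw [write_notMem _ _ _ hw]
      exact (write_notMem f a x fun v hv => hw (Sum.inl v) (congrArg Sum.inl hv)).symm
    exact absurd rfl (hw (Sum.inr w))
  have hs : ∀ (x y : Bits H) (z : Bits T) (σ : Op (H ⊕ T)),
      sect f x y (reduceL inl σ) = reduceL inl
        (sect (f.sumMap (refl T)) (elim x z) (elim y z) σ) := by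
    intro x y z σ; ext a b; rw [sect_apply, reduceL_inl_apply, reduceL_inl_apply]
    exact sum_ext fun t => by rw [sect_apply, hw, hw]
  refine op_ext_sect f fun x y => ?_; rw [hs x y zeros, sect_act, sect_act, h, ← hs]

theorem Impl.act {Φ : LM G G} {n : ℕ} (h : Impl Φ n) (f : G ↪ H) : Impl (act f Φ) n := by
  obtain ⟨T, C, h1, h2, h3⟩ := h
  refine ⟨T, C.map (f.sumMap (refl T)), h1, by rw [size_map]; exact h2,
    fun ρ => ?_⟩
  rw [runL_map]; exact reduceL_sumMap_act f T h3 ρ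

theorem Test.reduce {φ : Op G →ₗ[ℂ] ℂ} {n : ℕ} (h : Test φ n) (f : G ↪ H) :
    Test (φ ∘ₗ reduceL f) n := by
  obtain ⟨T, C, w, h1, h2, h3⟩ := h
  refine ⟨T, C.map (f.sumMap (refl T)), f.sumMap (refl T) w,
    h1, by rw [size_map]; exact h2, fun ρ => ?_⟩
  rw [runL_map, projectL_map, ← trace_reduceL (f.sumMap (refl T)),
    reduceL_act, reduceL_act, h3, comp_apply]
  rw [← reduceL_trans, ← reduceL_trans]; rfl

theorem Impl.branch {Φ Ψ : LM G G} {n k : ℕ} (w : G) (hΦ : Impl Φ n) (hΨ : Impl Ψ k) :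
    Impl (Φ ∘ₗ projectL w false + Ψ ∘ₗ projectL w true) (n + k + 1) := by
  obtain ⟨T, C, h1, h2, h3⟩ := hΦ; obtain ⟨T', C', h1', h2', h3'⟩ := hΨ
  refine ⟨⟨T ⊕ T'⟩, .branch (Sum.inl w) (C.map (onSnd G inl))
    (C'.map (onSnd G inr)), ?_, ?_, fun ρ => ?_⟩
  · simp only [card_sum]; omega
  · simp only [Circuit.size, size_map]; omega
  have e1 : (inl : G ↪ G ⊕ (T ⊕ T'))
      = (inl : G ↪ G ⊕ T).trans (onSnd G inl) := by
    ext; rfl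
  have e2 : (inl : G ↪ G ⊕ (T ⊕ T'))
      = (inl : G ↪ G ⊕ T').trans (onSnd G inr) := by
    ext; rfl
  have hp : ∀ b, projectL (Sum.inl w : G ⊕ (T ⊕ T')) b
      = SeqComp.act inl (projectL w b) := fun b =>
    projectL_map (inl : G ↪ G ⊕ (T ⊕ T')) w b
  simp only [Circuit.runL, comp_apply, LinearMap.add_apply, runL_map, map_add]; congr 1
  · rw [e1, reduceL_trans, reduceL_act, h3, ← reduceL_trans, ← e1]
    exact congrArg Φ ((congrArg _ (by rw [← hp])).trans (reduceL_act _ _ ρ))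
  rw [e2, reduceL_trans, reduceL_act, h3', ← reduceL_trans, ← e2]
  exact congrArg Ψ ((congrArg _ (by rw [← hp])).trans (reduceL_act _ _ ρ))

theorem act_inr_replaceL (κ : Op B) (ρ : Op (A ⊕ B)) :
    act inr (replaceL κ) ρ = tensor (reduceL inl ρ) κ := by
  rw [act_inr]; ext x y; change (cut _ _ ρ).trace * κ _ _ = _ * _; rw [reduceL_inl_apply]; rfl

theorem loadL_trans (f : A ↪ H) (e : H ↪ K) (v : Bits H → Bits A) :
    loadL (f.trans e) (fun x => v (x ∘ e)) = act e (loadL f v) := by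
  ext ρ x y; rw [act_apply, loadL_apply, loadL_apply]; simp only [write_trans, sect_apply]; rfl

def Sourced (g : A ↪ H) (v : Bits H → Bits A) : Prop :=
  ∀ a, ∃ s : H ⊕ Bool, (∀ b, s ≠ .inl (g b)) ∧ ∀ x, v x a = srcVal s x

theorem Sourced.const (g : A ↪ H) (b : Bits A) : Sourced g fun _ => b := fun a =>
  ⟨.inr (b a), by simp, fun _ => rfl⟩

theorem Sourced.comp {g : A ↪ H} (f : A → H) (h : ∀ a b, f a ≠ g b) :
    Sourced g fun x => x ∘ f := fun a =>
  ⟨.inl (f a), fun b hb => h a b (Sum.inl.inj hb), fun _ => rfl⟩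

theorem Sourced.exists_circuit [Nontrivial H] {g : A ↪ H} {v : Bits H → Bits A}
    (h : Sourced g v) : ∃ C : Circuit H, C.size ≤ 2 * card A ∧ C.runL = loadL g v := by
  choose s hs hv using h
  refine ⟨loadC g s, size_loadC g s, ?_⟩; rw [runL_loadC g s hs]; congr 1
  funext x a; exact (hv a x).symm

theorem Impl.load {g : A ↪ H} {v : Bits H → Bits A} (h : Sourced g v) :
    Impl (loadL g v) (2 * card A + 2) := by
  have : Nontrivial (H ⊕ Bool) := ⟨Sum.inr false, Sum.inr true, by simp⟩
  have h' : Sourced (g.trans (inl : H ↪ H ⊕ Bool)) (fun x => v (x ∘ Sum.inl)) := by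
    intro a; obtain ⟨s, h1, h2⟩ := h a; rcases s with c | b
    · exact ⟨.inl (Sum.inl c), fun b hb => h1 b (congrArg Sum.inl (Sum.inl.inj (Sum.inl.inj hb))),
        fun x => h2 (x ∘ Sum.inl)⟩
    exact ⟨.inr b, by simp, fun x => h2 (x ∘ Sum.inl)⟩
  obtain ⟨C, h1, h2⟩ := h'.exists_circuit; refine ⟨⟨Bool⟩, C, ?_, by omega, fun ρ => ?_⟩
  · change card Bool ≤ _; simp
  have e := loadL_trans g (inl : H ↪ H ⊕ Bool) v; rw [h2]
  exact (congrArg _ (LinearMap.congr_fun e ρ)).trans (reduceL_act _ _ ρ)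

theorem Impl.dephase (f : A ↪ G) : Impl (dephaseL f) (card A) := by
  rw [← runL_measureC, ← size_measureC f]; exact Impl.circuit _

/-- A circuit may use ancillas in state 0. -/
theorem Impl.fresh {Ψ : LM (G ⊕ K) (G ⊕ K)} {Φ : LM G G} {n : ℕ} (h : Impl Ψ n) (hΦ : ∀ ρ, reduceL
    inl (Ψ (emb inl zeros ρ)) = Φ ρ) : Impl Φ (n + 3 * card K + 2) := by
  obtain ⟨T, C, h1, h2, h3⟩ := h.comp
    (Impl.load (Sourced.const (inr : K ↪ G ⊕ K) zeros))
  refine ⟨⟨K ⊕ T⟩, C.map (Equiv.sumAssoc G K T).toEmbedding, ?_, ?_, fun ρ => ?_⟩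
  · simp only [card_sum]; omega
  · rw [size_map]; omega
  have e1 : (inl : G ↪ G ⊕ (K ⊕ T))
      = ((inl : G ↪ G ⊕ K).trans inl).trans
        (Equiv.sumAssoc G K T).toEmbedding := by
    ext; rfl
  rw [runL_map]
  change reduceL (inl : G ↪ G ⊕ (K ⊕ T)) _
    = Φ (reduceL (inl : G ↪ G ⊕ (K ⊕ T)) _)
  rw [e1, reduceL_trans, reduceL_act, reduceL_trans, h3, comp_apply, loadL_const, act_inr_replaceL]
  have e2 : ∀ σ : Op G, tensor σ (ket (zeros : Bits K))
      = emb inl zeros σ := fun σ => by rw [emb_inl]; rfl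
  rw [e2, hΦ, ← reduceL_trans, ← reduceL_trans]

theorem Test.fresh {ψ : Op (G ⊕ K) →ₗ[ℂ] ℂ} {φ : Op G →ₗ[ℂ] ℂ} {n : ℕ} (h : Test ψ n) (hφ : ∀ ρ, ψ
    (emb inl zeros ρ) = φ ρ) : Test φ (n + 3 * card K + 2) := by
  obtain ⟨T, C, w, h1, h2, h3⟩ := h.comp
    (Impl.load (Sourced.const (inr : K ↪ G ⊕ K) zeros))
  refine ⟨⟨K ⊕ T⟩, C.map (Equiv.sumAssoc G K T).toEmbedding, Equiv.sumAssoc G K T w, ?_, ?_,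
    fun ρ => ?_⟩
  · simp only [card_sum]; omega
  · rw [size_map]; omega
  have e1 : (inl : G ↪ G ⊕ (K ⊕ T))
      = ((inl : G ↪ G ⊕ K).trans inl).trans
        (Equiv.sumAssoc G K T).toEmbedding := by
    ext; rfl
  rw [runL_map]
  change (projectL ((Equiv.sumAssoc G K T).toEmbedding w) true _).trace
    = φ (reduceL (inl : G ↪ G ⊕ (K ⊕ T)) _)
  rw [projectL_map, ← trace_reduceL (Equiv.sumAssoc G K T).toEmbedding, reduceL_act,
    reduceL_act, h3, comp_apply, loadL_const, act_inr_replaceL]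
  have e2 : ∀ σ : Op G, tensor σ (ket (zeros : Bits K))
      = emb inl zeros σ := fun σ => by rw [emb_inl]; rfl
  rw [e2, hφ, e1, reduceL_trans, reduceL_trans]

def bitL (w : G) : Op G →ₗ[ℂ] ℂ := trL ∘ₗ projectL w true

theorem Test.bit (w : G) : Test (bitL w) 0 :=
  ⟨⟨Empty⟩, .skip, .inl w, by simp, by simp [Circuit.size], fun ρ => by
    have hp : projectL (Sum.inl w : G ⊕ Empty) true
        = act inl (projectL w true) :=
      projectL_map (inl : G ↪ G ⊕ Empty) w true
    have := trace_reduceL (inl : G ↪ G ⊕ Empty)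
      (act inl (projectL w true) ρ)
    rw [reduceL_act] at this
    exact (congrArg trace (LinearMap.congr_fun hp ρ)).trans this.symm⟩

def iter (Φ : ℕ → LM G G) : ℕ → LM G G
  | 0 => LinearMap.id
  | n + 1 => Φ n ∘ₗ iter Φ n

theorem iter_add (Φ : ℕ → LM G G) (a n : ℕ) :
    iter Φ (a + n) = iter (fun t => Φ (a + t)) n ∘ₗ iter Φ a := by
  induction n with
  | zero => rfl
  | succ n ih => rw [← add_assoc, iter, ih, iter, comp_assoc]

theorem iter_congr {Φ Ψ : ℕ → LM G G} {n : ℕ} (h : ∀ t < n, Φ t = Ψ t) : iter Φ n = iter Ψ n := by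
  induction n with
  | zero => rfl
  | succ n ih => rw [iter, iter, h n (by omega), ih fun t ht => h t (by omega)]

theorem iter_intertwine {Φ : ℕ → LM G G} {Ψ : ℕ → LM H H} {R : LM G H} {n : ℕ}
    (h : ∀ t < n, R ∘ₗ Φ t = Ψ t ∘ₗ R) : R ∘ₗ iter Φ n = iter Ψ n ∘ₗ R := by
  induction n with
  | zero => rfl
  | succ n ih =>
    rw [iter, ← comp_assoc, h n (by omega), comp_assoc,
      ih fun t ht => h t (by omega), iter, comp_assoc]

theorem act_iter (f : G ↪ H) (Φ : ℕ → LM G G) (n : ℕ) :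
    act f (iter Φ n) = iter (fun t => act f (Φ t)) n := by
  induction n with
  | zero => simp [iter]
  | succ n ih => rw [iter, act_comp, ih, iter]

theorem iter_tp {Φ : ℕ → LM G G} (h : ∀ t, TP (Φ t)) (n : ℕ) : TP (iter Φ n) := by
  induction n with
  | zero => exact TP.id
  | succ n ih => exact (h n).comp ih

theorem Impl.iter {Φ : ℕ → LM G G} {k n : ℕ} (h : ∀ t < n, Impl (Φ t) k) :
    Impl (iter Φ n) (n * k) := by
  induction n with
  | zero => exact Impl.id.mono (by simp)
  | succ n ih =>
    exact ((h n (by omega)).comp (ih fun t ht => h t (by omega))).mono (by ring_nf; omega)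

theorem Impl.congr {Φ Ψ : LM G G} {n : ℕ} (h : Impl Φ n) (e : ∀ ρ, Φ ρ = Ψ ρ) : Impl Ψ n := by
  have : Φ = Ψ := LinearMap.ext e; exact this ▸ h

def listL : List (LM G G) → LM G G
  | [] => LinearMap.id
  | Φ :: l => listL l ∘ₗ Φ

/-! ### Executions as linear maps -/

theorem cut_dephaseL_inl (c c' : Bits C) (ρ : Op (C ⊕ B)) :
    cut c c' (dephaseL inl ρ) = if c = c' then cut c c' ρ else 0 := by
  ext x y; rw [cut_apply, dephaseL_apply]
  have : (elim c x : Bits (C ⊕ B)) ∘ inl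
      = (elim c' y : Bits (C ⊕ B)) ∘ inl ↔ c = c' := Iff.rfl
  simp only [this]; split_ifs <;> rfl

theorem dephaseL_middle : dephaseL (middle A C B) = ext A (dephaseL inl) := by
  ext ρ x y; change (if _ then _ else _) = if x ∘ middle A C B = y ∘ middle A C B then _ else _
  rw [cut_apply, elim_comp, elim_comp]

theorem dephaseL_inl_ext (R : LM B D) : dephaseL inl ∘ₗ ext C R = ext C R ∘ₗ dephaseL inl := by
  ext1 ρ
  refine op_ext_cut fun c c' => ?_; simp only [comp_apply, cut_dephaseL_inl, cut_ext]
  split_ifs <;> simp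

def selL (p : Bits A → Prop) [DecidablePred p] : LM (A ⊕ B) (A ⊕ B) where
  toFun ρ := of fun x y => if p (x ∘ Sum.inl) ∧ p (y ∘ Sum.inl) then ρ x y else 0
  map_add' _ _ := by ext; simp only [of_apply, Matrix.add_apply]; split_ifs <;> simp
  map_smul' _ _ := by
    ext; simp only [of_apply, Matrix.smul_apply, RingHom.id_apply]; split_ifs <;> simp

theorem cut_selL (p : Bits A → Prop) [DecidablePred p] (a a' : Bits A) (ρ : Op (A ⊕ B)) :
    cut a a' (selL p ρ) = if p a ∧ p a' then cut a a' ρ else 0 := by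
  ext x y; change (if p a ∧ p a' then ρ _ _ else 0) = _; split_ifs <;> rfl

theorem selL_ext (p : Bits A → Prop) [DecidablePred p] (R : LM B D) :
    selL p ∘ₗ ext A R = ext A R ∘ₗ selL p := by
  ext1 ρ
  refine op_ext_cut fun c c' => ?_; simp only [comp_apply, cut_selL, cut_ext]; split_ifs <;> simp

theorem cut_tensor (a a' : Bits A) (σ : Op A) (τ : Op B) : cut a a' (tensor σ τ) = σ a a' • τ := by
  ext b b'; simp [cut_apply, tensor]

theorem reduceL_inr_ext (R : LM B D) (ρ : Op (A ⊕ B)) :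
    reduceL inr (ext A R ρ) = R (reduceL inr ρ) := by
  simp [reduceL_inr, map_sum]

theorem reduceL_onSnd (f : A ↪ B) : reduceL (onSnd C f) = ext C (reduceL f) := by
  ext ρ x y
  change ∑ z : Bits (C ⊕ B), (if z ∘ onSnd C f = x then ρ z (write (onSnd C f) y z) else 0)
    = ∑ z : Bits B, (if z ∘ f = x ∘ Sum.inr then
        ρ (elim (x ∘ Sum.inl) z) (elim (y ∘ Sum.inl) (write f (y ∘ Sum.inr) z)) else 0)
  rw [sum_bits, sum_eq_single (x ∘ Sum.inl)]
  · refine sum_ext fun z => if_congr ?_ ?_ rfl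
    · have : (elim (x ∘ Sum.inl) z : Bits (C ⊕ B)) ∘ onSnd C f
          = elim (x ∘ Sum.inl) (z ∘ f) := by
        funext w; rcases w with w | w <;> rfl
      rw [this]
      conv_lhs => rhs; rw [← elim_comp x]
      rw [elim_eq_iff]; simp
    congr 1; refine bits_ext_wire (onSnd C f) ?_ ?_
    · rw [write_comp]; funext w; rcases w with w | w
      · rfl
      exact (write_mem f (y ∘ Sum.inr) z w).symm
    rintro (w | w) hw
    · exact absurd rfl (hw (Sum.inl w))
    rw [write_notMem _ _ _ hw]
    exact (write_notMem f _ _ fun a ha =>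
      hw (Sum.inr a) (congrArg Sum.inr ha)).symm
  · intro c _ hc; refine sum_eq_zero fun z _ => if_neg fun h => hc ?_
    funext w; exact congrFun h (Sum.inl w)
  simp

section Party

variable {U X Ω M : Reg}

def Party.roundL (P : Party U X Ω M) (t : ℕ) (b : LM (M ⊕ W) (M ⊕ W)) :
    LM ((U ⊕ (Ω ⊕ P.anc)) ⊕ (M ⊕ W)) ((U ⊕ (Ω ⊕ P.anc)) ⊕ (M ⊕ W)) :=
  ext _ b ∘ₗ act (front _ _ _) (P.step t).runL

def Party.initL (P : Party U X Ω M) (ω : Bits Ω) (u : Bits U) :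
    LM W ((U ⊕ (Ω ⊕ P.anc)) ⊕ (M ⊕ W)) :=
  tensorL (ket (elim u (elim ω zeros))) ∘ₗ tensorL (ket zeros)

def Party.finL (P : Party U X Ω M) (x : Bits X) : LM ((U ⊕ (Ω ⊕ P.anc)) ⊕ (M ⊕ W)) W :=
  ∑ s, if s ∘ P.out = x then reduceL inr ∘ₗ cut s s else 0

def Party.execL (P : Party U X Ω M) (rounds : ℕ) (b : ℕ → LM (M ⊕ W) (M ⊕ W)) (ω : Bits Ω)
    (u : Bits U) (x : Bits X) : LM W W :=
  P.finL x ∘ₗ iter (fun t => P.roundL t (b t)) rounds ∘ₗ P.initL ω u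

theorem Party.exec_eq (P : Party U X Ω M) (rounds : ℕ) (b : ℕ → Circuit (M ⊕ W)) (ω : Bits Ω)
    (u : Bits U) (β : Op W) (x : Bits X) :
    P.exec rounds b ω u β x = P.execL rounds (fun t => (b t).runL) ω u x β := by
  simp only [Party.exec, Party.execL, Party.finL, comp_apply, LinearMap.sum_apply]
  refine sum_ext fun s => ?_; split_ifs
  · rw [comp_apply, reduce_eq, block_eq_cut]; congr 2
    induction rounds with
    | zero => rfl
    | succ n ih =>
      simp only [iter, comp_apply, ← ih]; rw [run_eq, run_eq, runL_map, runL_map, act_inr]; rfl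
  rfl

theorem Party.execL_intertwine (P : Party U X Ω M) (rounds : ℕ) (b : ℕ → LM (M ⊕ W) (M ⊕ W))
    (b' : ℕ → LM (M ⊕ W') (M ⊕ W')) (R : LM W W')
    (h : ∀ t < rounds, ext M R ∘ₗ b t = b' t ∘ₗ ext M R) (ω : Bits Ω) (u : Bits U) (x : Bits X) :
    R ∘ₗ P.execL rounds b ω u x = P.execL rounds b' ω u x ∘ₗ R := by
  have h1 : ext _ (ext M R) ∘ₗ iter (fun t => P.roundL t (b t)) rounds
      = iter (fun t => P.roundL t (b' t)) rounds ∘ₗ ext _ (ext M R) := by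
    refine iter_intertwine fun t ht => ?_
    ext1 ρ
    simp only [Party.roundL, comp_apply]
    rw [act_front_ext, ← comp_apply, ← ext_comp, h t ht, ext_comp]; rfl
  have h2 : R ∘ₗ P.finL x = P.finL x ∘ₗ ext _ (ext M R) := by
    ext1 ρ
    simp only [Party.finL, comp_apply, LinearMap.sum_apply, map_sum]; refine sum_ext fun s => ?_
    split_ifs
    · simp [reduceL_inr_ext]
    simp
  have h3 : ext _ (ext M R) ∘ₗ P.initL ω u = P.initL ω u ∘ₗ R := by
    ext1 ρ
    simp only [Party.initL, comp_apply, ← tensor_eq, ext_tensor]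
  ext1 β
  have h1' := fun σ => LinearMap.congr_fun h1 σ; have h2' := fun σ => LinearMap.congr_fun h2 σ
  have h3' := fun σ => LinearMap.congr_fun h3 σ; simp only [comp_apply] at h1' h2' h3'
  simp only [Party.execL, comp_apply]; rw [h2', h1', h3']

end Party

def fexecL (L : Bits U → Bits V → Bits X → Bits Y → ℝ) (query : LM (V ⊕ W) (V ⊕ W))
    (reply : LM (Y ⊕ W) (Y ⊕ W)) (u : Bits U) (x : Bits X) : LM W W :=
  ∑ v, ∑ y, (L u v x y : ℂ) • (reduceL inr ∘ₗ reply ∘ₗ tensorL (ket y) ∘ₗ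
    cut v v ∘ₗ query ∘ₗ tensorL (ket zeros))

def Functionality.kernel (F : Functionality) (m : ℕ) (u : Bits (F.U m)) (v : Bits (F.V m))
    (x : Bits (F.X m)) (y : Bits (F.Y m)) : ℝ := (F.law m u v (x, y)).toReal

theorem Functionality.exec_eq (F : Functionality) (m : ℕ) (query : Circuit (F.V m ⊕ W))
    (reply : Circuit (F.Y m ⊕ W)) (u : Bits (F.U m)) (β : Op W) (x : Bits (F.X m)) :
    F.exec m query reply u β x = fexecL (F.kernel m) query.runL reply.runL u x β := by
  simp only [Functionality.exec, fexecL, LinearMap.sum_apply]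
  refine sum_ext fun v => sum_ext fun y => ?_; simp only [run_eq]; rfl

theorem fexecL_intertwine (L : Bits U → Bits V → Bits X → Bits Y → ℝ) {query : LM (V ⊕ W) (V ⊕ W)}
    {reply : LM (Y ⊕ W) (Y ⊕ W)} {query' : LM (V ⊕ W') (V ⊕ W')} {reply' : LM (Y ⊕ W') (Y ⊕ W')}
    (R : LM W W') (hq : ext V R ∘ₗ query = query' ∘ₗ ext V R) (hr : ext Y R ∘ₗ reply = reply' ∘ₗ ext
    Y R) (u : Bits U) (x : Bits X) : R ∘ₗ fexecL L query reply u x = fexecL L query' reply' u x ∘ₗ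
    R := by
  ext1 ρ
  simp only [fexecL, comp_apply, LinearMap.sum_apply, map_sum, LinearMap.smul_apply, map_smul]
  refine sum_ext fun v => sum_ext fun y => ?_; have hq' := fun σ => LinearMap.congr_fun hq σ
  have hr' := fun σ => LinearMap.congr_fun hr σ; simp only [comp_apply] at hq' hr'
  rw [← reduceL_inr_ext, hr', ← tensor_eq, ext_tensor, ← cut_ext, hq', ← tensor_eq, ext_tensor]; rfl

namespace OracleParty

variable {ℓ : ℕ} {In Out : Fin ℓ → Reg} {U X C : Reg} (P : OracleParty In Out U X C)

def calledL (i : Fin ℓ) (call : Bits (In i) → Bits (Out i) → LM W W') :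
    LM (P.St W) ((U ⊕ P.anc) ⊕ (C ⊕ W')) :=
  ∑ s, ∑ c, if P.callee s = some i then
    ∑ x, tensorL (ket (write (P.callOut i) x s)) ∘ₗ tensorL (ket c) ∘ₗ
      call (s ∘ P.callIn i) x ∘ₗ cut c c ∘ₗ cut s s
  else 0

def callRoundL (call : Calls In Out W) : LM (P.St W) (P.St W) :=
  selL (fun s => P.callee s = none) + ∑ i, P.calledL i (call i)

def preL (r : ℕ) (b : LM (C ⊕ W) (C ⊕ W)) : LM (P.St W) (P.St W) :=
  ext _ (dephaseL inl ∘ₗ b ∘ₗ dephaseL inl) ∘ₗ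
    act (front _ _ _) (P.step r).runL

def roundL (r : ℕ) (b : LM (C ⊕ W) (C ⊕ W)) (call : Calls In Out W) : LM (P.St W) (P.St W) :=
  P.callRoundL call ∘ₗ P.preL r b

def initL (u : Bits U) : LM W (P.St W) :=
  tensorL (ket (elim u zeros)) ∘ₗ tensorL (ket zeros)

def finL (x : Bits X) : LM (P.St W) W :=
  ∑ s, if s ∘ P.out = x then reduceL inr ∘ₗ cut s s else 0

theorem round_eq (r : ℕ) (b : Circuit (C ⊕ W)) (call : ∀ i, Bits (In i) → Op W → Bits (Out i) → Op
    W) (callL : Calls In Out W) (h : ∀ i u x β, call i u β x = callL i u x β) (ρ : Op (P.St W)) :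
    P.round r b call ρ = P.roundL r b.runL callL ρ := by
  have hc : ∀ σ, P.callRound call σ = P.callRoundL callL σ := by
    intro σ; simp only [callRound, callRoundL, calledL, LinearMap.add_apply, LinearMap.sum_apply]
    congr 1
    refine sum_ext fun i => sum_ext fun s =>
      sum_ext fun c => ?_
    split_ifs
    · simp only [LinearMap.sum_apply, comp_apply, h]; rfl
    rfl
  rw [round, hc, roundL, preL, comp_apply, comp_apply, ext_comp, ext_comp, ← dephaseL_middle]
  simp only [run_eq, runL_map, act_inr, dephase_eq]; rfl

theorem exec_eq (rounds : ℕ) (b : ℕ → Circuit (C ⊕ W)) (call : ℕ → ∀ i, Bits (In i) → Op W → Bits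
    (Out i) → Op W) (callL : ℕ → Calls In Out W) (h : ∀ r i u x β, call r i u β x = callL r i u x β)
    (u : Bits U) (β : Op W) (x : Bits X) : P.exec rounds b call u β x = P.finL x (iter (fun r =>
    P.roundL r (b r).runL (callL r)) rounds (P.initL u β)) := by
  simp only [exec, finL, LinearMap.sum_apply]; refine sum_ext fun s => ?_; split_ifs
  · rw [comp_apply, reduce_eq, block_eq_cut]; congr 2
    induction rounds with
    | zero => rfl
    | succ n ih =>
      simp only [iter, comp_apply, ← ih]; rw [round_eq P n (b n) (call n) (callL n) (h n)]
  rfl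

theorem preL_intertwine (r : ℕ) {b : LM (C ⊕ W) (C ⊕ W)} {b' : LM (C ⊕ W') (C ⊕ W')} (R : LM W W')
    (hb : ext C R ∘ₗ (dephaseL inl ∘ₗ b ∘ₗ dephaseL inl) = (dephaseL inl ∘ₗ b' ∘ₗ dephaseL inl) ∘ₗ
    ext C R) : ext _ (ext C R) ∘ₗ P.preL r b = P.preL r b' ∘ₗ ext _ (ext C R) := by
  ext1 ρ
  simp only [preL, comp_apply]
  rw [act_front_ext, ← comp_apply (ext _ (ext C R)), ← ext_comp, hb, ext_comp]; rfl

theorem calledL_comp (i : Fin ℓ) (call : Bits (In i) → Bits (Out i) → LM W W') (R : LM W' W'') : ext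
    _ (ext C R) ∘ₗ P.calledL i call = P.calledL i fun u x => R ∘ₗ call u x := by
  ext1 ρ
  simp only [calledL, comp_apply, LinearMap.sum_apply, map_sum]
  refine sum_ext fun s => sum_ext fun c => ?_; split_ifs
  · simp only [LinearMap.sum_apply, map_sum, comp_apply, ← tensor_eq, ext_tensor]
  simp

theorem calledL_ext (i : Fin ℓ) (call : Bits (In i) → Bits (Out i) → LM W' W'') (R : LM W W') :
    P.calledL i call ∘ₗ ext _ (ext C R) = P.calledL i fun u x => call u x ∘ₗ R := by
  ext1 ρ
  simp only [calledL, comp_apply, LinearMap.sum_apply]; refine sum_ext fun s => sum_ext fun c => ?_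
  split_ifs
  · simp only [LinearMap.sum_apply, comp_apply, cut_ext]
  simp

theorem callRoundL_intertwine {call : Calls In Out W} {call' : ∀ i, Bits (In i) → Bits (Out i) → LM
    W' W'} (R : LM W W') (h : ∀ i u x, R ∘ₗ call i u x = call' i u x ∘ₗ R) : ext _ (ext C R) ∘ₗ
    P.callRoundL call = P.callRoundL call' ∘ₗ ext _ (ext C R) := by
  rw [callRoundL, callRoundL, LinearMap.comp_add, LinearMap.add_comp, selL_ext]; congr 1
  ext1 ρ
  simp only [comp_apply, LinearMap.sum_apply, map_sum]; refine sum_ext fun i => ?_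
  rw [← comp_apply, ← comp_apply (P.calledL i (call' i)), calledL_comp, calledL_ext]; simp only [h]

theorem roundL_intertwine (r : ℕ) {b : LM (C ⊕ W) (C ⊕ W)} {b' : LM (C ⊕ W') (C ⊕ W')} {call : Calls
    In Out W} {call' : ∀ i, Bits (In i) → Bits (Out i) → LM W' W'} (R : LM W W') (hb : ext C R ∘ₗ
    (dephaseL inl ∘ₗ b ∘ₗ dephaseL inl) = (dephaseL inl ∘ₗ b' ∘ₗ dephaseL inl) ∘ₗ ext C R) (h : ∀ i
    u x, R ∘ₗ call i u x = call' i u x ∘ₗ R) : ext _ (ext C R) ∘ₗ P.roundL r b call = P.roundL r b'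
    call' ∘ₗ ext _ (ext C R) := by
  rw [roundL, ← comp_assoc, callRoundL_intertwine P R h, comp_assoc,
    preL_intertwine P r R hb]
  rfl

theorem finL_intertwine (x : Bits X) (R : LM W W') :
    R ∘ₗ P.finL x = P.finL x ∘ₗ ext _ (ext C R) := by
  ext1 ρ
  simp only [finL, comp_apply, LinearMap.sum_apply, map_sum]; refine sum_ext fun s => ?_; split_ifs
  · simp [reduceL_inr_ext]
  simp

theorem initL_intertwine (u : Bits U) (R : LM W W') :
    ext _ (ext C R) ∘ₗ P.initL u = P.initL u ∘ₗ R := by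
  ext1 ρ
  simp only [initL, comp_apply, ← tensor_eq, ext_tensor]

end OracleParty

/-! ### Executions as circuits -/

@[simp] theorem elim_comp_einl (a : Bits A) (b : Bits B) :
    (elim a b : Bits (A ⊕ B)) ∘ (inl : A ↪ A ⊕ B) = a := rfl

@[simp] theorem elim_comp_einr (a : Bits A) (b : Bits B) :
    (elim a b : Bits (A ⊕ B)) ∘ (inr : B ↪ A ⊕ B) = b := rfl

theorem comp_trans_eq (f : A ↪ B) (g : B ↪ C) (x : Bits C) : x ∘ (f.trans g) = (x ∘ g) ∘ f := rfl

def instL (κ : Bits A → Bits B → LM W W) : LM (A ⊕ (B ⊕ W)) (A ⊕ (B ⊕ W)) :=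
  ∑ a, ∑ b, tensorL (ket a) ∘ₗ tensorL (ket b) ∘ₗ κ a b ∘ₗ reduceL inr ∘ₗ cut a a

theorem instL_apply (κ : Bits A → Bits B → LM W W) (ρ : Op (A ⊕ (B ⊕ W))) : instL κ ρ = ∑ a, ∑ b,
    tensor (ket a) (tensor (ket b) (κ a b (reduceL inr (cut a a ρ)))) := by
  simp only [instL, LinearMap.sum_apply]; rfl

theorem instL_ket (κ : Bits A → Bits B → LM W W) (a : Bits A) (b : Bits B) (β : Op W) : instL κ
    (tensor (ket a) (tensor (ket b) β)) = ∑ x, tensor (ket a) (tensor (ket x) (κ a x β)) := by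
  rw [instL_apply, sum_eq_single a]
  · refine sum_ext fun x => ?_; have h1 : (ket a : Op A) a a = 1 := by simp [ket]
    rw [cut_tensor, h1, one_smul, reduceL_inr, sum_eq_single b]
    · have h2 : (ket b : Op B) b b = 1 := by simp [ket]
      rw [block_eq_cut, cut_tensor, h2, one_smul]
    · intro c _ hc; have h2 : (ket b : Op B) c c = 0 := by simp [ket, hc]
      rw [block_eq_cut, cut_tensor, h2, zero_smul]
    simp
  · intro c _ hc; have h2 : (ket a : Op A) c c = 0 := by simp [ket, hc]
    refine sum_eq_zero fun x _ => ?_; rw [cut_tensor, h2, zero_smul]; simp [tensor_eq]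
  simp

theorem emb_inr_inr (b : Bits (A ⊕ (B ⊕ W))) (β : Op W) : emb (inr.trans inr) b β = tensor (ket (b ∘
    Sum.inl)) (tensor (ket (b ∘ Sum.inr ∘ Sum.inl)) β) := by
  rw [emb_trans, emb_inr, emb_inr]; rfl

theorem dephaseL_emb_two (F : A ⊕ (B ⊕ W) ↪ K) (b : Bits K) (ρ : Op (A ⊕ (B ⊕ W))) : dephaseL
    (inl.trans (inr.trans F)) (dephaseL (inl.trans F) (emb F b ρ)) = ∑ a, ∑ x, emb (inr.trans
    (inr.trans F)) (write (inl.trans (inr.trans F)) x (write (inl.trans F) a b)) (cut x x (cut a a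
    ρ)) := by
  rw [dephaseL_emb, map_sum]; refine sum_ext fun a => ?_; rw [dephaseL_emb]; rfl

theorem emb_inr_inr_ket (F : A ⊕ (B ⊕ W) ↪ K) (b : Bits K) (β : Op W) : emb (inr.trans (inr.trans
    F)) b β = emb F b (tensor (ket (b ∘ inl.trans F)) (tensor (ket (b ∘ inl.trans (inr.trans F)))
    β)) := by
  rw [emb_zeros_tensor, emb_zeros_tensor]

theorem write_write_zeros (u : Bits U) (x : Bits X) : write (inl.trans (inr.trans inl)) x (write
    (inl.trans inl) u (zeros : Bits ((U ⊕ (X ⊕ W)) ⊕ (A ⊕ B)))) = elim (elim u (elim x zeros)) (elim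
    zeros zeros) := by
  rw [← elim_zeros, ← elim_zeros (A := U), ← elim_zeros (A := X), ← elim_zeros (A := A)]
  simp [write_trans, comp_trans_eq]

theorem write_joint (f : A ↪ W) (g : B ↪ W) (h : ∀ a b, f a ≠ g b) (p : Bits (A ⊕ B)) (b : Bits W) :
    write (joint f g h) p b = write f (p ∘ Sum.inl) (write g (p ∘ Sum.inr) b) := by
  refine bits_ext_wire (joint f g h) ?_ fun w hw => ?_
  · rw [write_comp]; funext w; rcases w with w | w
    · exact (write_mem f (p ∘ Sum.inl) _ w).symm
    change _ = write f _ _ (g w); rw [write_notMem _ _ _ fun a => h a w, write_mem]; rfl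
  rw [write_notMem _ _ _ hw, write_notMem _ _ _ fun a => hw (Sum.inl a),
    write_notMem _ _ _ fun a => hw (Sum.inr a)]

section Party

variable {U X Ω M : Reg}

theorem Impl.party (P : Party U X Ω M) (rounds : ℕ) (b : ℕ → LM (M ⊕ W) (M ⊕ W)) (ω : Bits Ω) {N k :
    ℕ} (hN : card U + card X + card Ω + card P.anc + card M + rounds ≤ N) (hs : ∀ t < rounds,
    (P.step t).size ≤ N) (hb : ∀ t < rounds, Impl (b t) k) : Impl (instL fun u x => P.execL rounds b
    ω u x) ((N + 1) * (k + 20 * (N + 1))) := by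
  let I := (inl : (U ⊕ (X ⊕ W)) ↪ (U ⊕ (X ⊕ W)) ⊕ ((U ⊕ (Ω ⊕ P.anc)) ⊕ M))
  let J := (inr : ((U ⊕ (Ω ⊕ P.anc)) ⊕ M) ↪ (U ⊕ (X ⊕ W)) ⊕ ((U ⊕ (Ω ⊕ P.anc)) ⊕ M))
  let eW := (inr.trans (inr.trans I)); let eM := inr.trans J; let eP := inl.trans J
  let eU := inl.trans I; let eX := inl.trans (inr.trans I)
  let F := joint eP (joint eM eW nofun) fun a b h => by rcases b with b | b <;> cases h
  let v₁ : Bits ((U ⊕ (X ⊕ W)) ⊕ ((U ⊕ (Ω ⊕ P.anc)) ⊕ M)) → Bits (U ⊕ (Ω ⊕ P.anc)) :=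
    fun x => elim (x ∘ eU) (elim ω zeros)
  have hv₁ : Sourced eP v₁ := by
    rintro (a | a | a)
    · exact ⟨.inl (eU a), nofun, fun _ => rfl⟩
    · exact ⟨.inr (ω a), nofun, fun _ => rfl⟩
    exact ⟨.inr false, nofun, fun _ => rfl⟩
  have hv₂ : Sourced eX fun x => x ∘ (P.out.trans eP) :=
    Sourced.comp _ nofun
  have h := (((((Impl.dephase eM).comp (Impl.load hv₂)).comp (Impl.dephase eP)).comp
    (Impl.iter (Φ := fun t => SeqComp.act F (P.roundL t (b t))) (k := k + N) (n := rounds)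
      fun t ht => Impl.act (((hb t ht).act (inr)).comp
        (((Impl.circuit (P.step t)).act (front _ _ _)).mono (hs t ht)) |>.congr
          fun ρ => by rw [act_inr]; exact rfl) F)).comp (Impl.load hv₁)).comp
      ((Impl.dephase eX).comp (Impl.dephase eU))
  refine (h.fresh (K := (U ⊕ (Ω ⊕ P.anc)) ⊕ M)
    (Φ := instL fun u x => P.execL rounds b ω u x) fun ρ => ?_).mono ?_
  · simp only [comp_apply]; rw [dephaseL_emb_two]
    have hload₁ := loadL_emb eW eP nofun v₁ fun x x' h => by
      funext w; rcases w with w | w | w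
      exacts [h _ nofun nofun, rfl, rfl]
    have hload₂ := loadL_emb (inr.trans F) eX (fun a b h => by rcases a with a | a <;> cases h)
      (fun x => x ∘ (P.out.trans eP)) fun x x' h => funext fun w =>
        h _ (fun b h => by rcases b with a | a <;> cases h) nofun
    rw [instL_apply]; simp only [map_sum]; rw [sum_congr rfl]; intro u _
    have step : ∀ x₀ : Bits X, ∀ β : Op W,
        reduceL inl (dephaseL eM (loadL eX (fun x => x ∘ (P.out.trans eP)) (dephaseL eP
          (SeqComp.iter (fun t => SeqComp.act F (P.roundL t (b t))) rounds (loadL eP v₁ (emb eW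
          (write eX x₀ (write eU u zeros)) β))))))
        = ∑ s : Bits (U ⊕ (Ω ⊕ P.anc)), tensor (ket u) (tensor (ket (s ∘ P.out))
            (reduceL inr (cut s s
              (SeqComp.iter (fun t => P.roundL t (b t)) rounds (P.initL ω u β))))) := by
      intro x₀ β
      rw [write_write_zeros, hload₁]
      let z : Bits ((U ⊕ (X ⊕ W)) ⊕ ((U ⊕ (Ω ⊕ P.anc)) ⊕ M)) :=
        elim (elim u (elim x₀ zeros)) (elim (elim u (elim ω zeros)) zeros)
      have e2 : write eP (v₁ (elim (elim u (elim x₀ zeros)) (elim zeros zeros)))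
          (elim (elim u (elim x₀ zeros)) (elim zeros zeros)) = z := by
        simp [eP, J, write_trans]; rfl
      rw [e2, show emb eW z β = emb F z (P.initL ω u β) from emb_inr_inr_ket F _ β, ← act_iter,
        act_emb, show eP = inl.trans F from rfl, dephaseL_emb F, map_sum, map_sum, map_sum]
      refine sum_ext fun s => ?_
      rw [show inl.trans F = eP from rfl, hload₂, show eM = inl.trans (inr.trans F) from rfl,
        dephaseL_emb, map_sum, reduceL_inr]
      simp only [tensor_eq, map_sum]; refine sum_ext fun μ => ?_
      rw [show inr.trans (inr.trans F) = (inr.trans inr).trans (inl : (U ⊕ (X ⊕ W)) ↪ _) from rfl,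
        reduceL_emb_trans, emb_inr_inr, show inl.trans (inr.trans F) = eM from rfl]
      have e6 : write eM μ (write eX (write eP s z ∘ (P.out.trans eP)) (write eP s z))
          = elim (elim u (elim (s ∘ P.out) zeros)) (elim s μ) := by
        simp [eM, eP, eX, I, J, z, write_trans, comp_trans_eq]
      rw [e6]; rfl
    refine (sum_ext fun x => step x _).trans ?_
    simp only [Party.execL, Party.finL, comp_apply, LinearMap.sum_apply]; rw [sum_comm]
    simp only [tensor_eq, map_sum, ite_apply]; rw [sum_comm (s := univ (α := Bits X))]
    refine sum_ext fun s => ?_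
    refine Eq.trans ?_ (sum_eq_single (s ∘ P.out) (fun x _ hx => ?_)
      fun h => absurd (mem_univ _) h).symm
    · rw [if_pos rfl]; simp only [reduceL_inr, map_sum, comp_apply, block_eq_cut]
    rw [if_neg hx.symm]; simp
  simp only [card_sum] at hN ⊢
  have : rounds * (k + N) ≤ N * (k + N) := Nat.mul_le_mul_right _ (by omega)
  nlinarith

end Party

/-! ### Positivity -/

def PP (Φ : LM A B) : Prop := ∀ ρ, ρ.PosSemidef → (Φ ρ).PosSemidef

theorem PP.id : PP (LinearMap.id : LM A A) := fun _ h => h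

theorem PP.comp {Φ : LM B C} {Ψ : LM A B} (h : PP Φ) (h' : PP Ψ) : PP (Φ ∘ₗ Ψ) :=
  fun ρ hρ => h _ (h' ρ hρ)

theorem PP.zero : PP (0 : LM A B) := fun _ _ => Matrix.PosSemidef.zero

theorem PP.add {Φ Ψ : LM A B} (h : PP Φ) (h' : PP Ψ) : PP (Φ + Ψ) :=
  fun ρ hρ => (h ρ hρ).add (h' ρ hρ)

theorem PP.sum {ι : Type*} {s : Finset ι} {Φ : ι → LM A B} (h : ∀ i ∈ s, PP (Φ i)) :
    PP (∑ i ∈ s, Φ i) := by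
  intro ρ hρ; rw [LinearMap.sum_apply]; exact Matrix.posSemidef_sum s fun i hi => h i hi ρ hρ

theorem PP.smul {Φ : LM A B} (h : PP Φ) {c : ℝ} (hc : 0 ≤ c) : PP ((c : ℂ) • Φ) :=
  fun ρ hρ => (h ρ hρ).smul (by exact_mod_cast hc)

theorem PP.iter {Φ : ℕ → LM A A} (h : ∀ t, PP (Φ t)) (n : ℕ) : PP (iter Φ n) := by
  induction n with
  | zero => exact PP.id
  | succ n ih => exact (h n).comp ih

theorem pp_sect (f : A ↪ W) (x : Bits W) : PP (sect f x x) :=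
  fun _ h => h.submatrix fun a => write f a x

theorem pp_cut (a : Bits A) : PP (cut a a : LM (A ⊕ B) B) :=
  fun _ h => h.submatrix fun b => elim a b

theorem pp_reduceL (f : A ↪ W) : PP (reduceL f) := by
  intro ρ hρ; rw [reduceL_eq_sum]; refine Matrix.posSemidef_sum _ fun x _ => ?_; split_ifs
  · exact pp_sect f x ρ hρ
  exact Matrix.PosSemidef.zero

theorem posSemidef_mask {ρ : Op W} (h : ρ.PosSemidef) (p : Bits W → Prop) [DecidablePred p] :
    (of fun x y => if p x ∧ p y then ρ x y else 0 : Op W).PosSemidef := by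
  have := h.mul_mul_conjTranspose_same (Matrix.diagonal fun x => if p x then (1 : ℂ) else 0)
  convert this using 1; ext x y
  rw [Matrix.diagonal_conjTranspose, Matrix.mul_diagonal, Matrix.diagonal_mul, of_apply]
  by_cases hx : p x <;> by_cases hy : p y <;> simp [hx, hy]

theorem pp_projectL (w : W) (b : Bool) : PP (projectL w b) := fun _ h =>
  posSemidef_mask h fun x => x w = b

theorem pp_selL (p : Bits A → Prop) [DecidablePred p] : PP (selL p : LM (A ⊕ B) (A ⊕ B)) :=
  fun _ h => posSemidef_mask h fun x => p (x ∘ Sum.inl)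

theorem pp_runL (C : Circuit W) : PP C.runL := by
  induction C with
  | skip => exact PP.id
  | gate g =>
    intro ρ hρ; exact Matrix.posSemidef_sum _ fun i _ => hρ.mul_mul_conjTranspose_same _
  | seq C D hC hD => exact hD.comp hC
  | branch w C D hC hD => exact (hC.comp (pp_projectL w _)).add (hD.comp (pp_projectL w _))

theorem pp_dephaseL (f : A ↪ W) : PP (dephaseL f) := by rw [← runL_measureC]; exact pp_runL _

theorem pp_act_runL (f : A ↪ W) (C : Circuit A) : PP (act f C.runL) := by
  rw [← runL_map]; exact pp_runL _

theorem pp_ext_runL (C : Circuit B) : PP (ext A C.runL) := by rw [← act_inr]; exact pp_act_runL _ C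

theorem posSemidef_tensor {σ : Op A} {ρ : Op B} (hσ : σ.PosSemidef) (hρ : ρ.PosSemidef) :
    (tensor σ ρ).PosSemidef :=
  (hσ.kronecker hρ).submatrix fun x : Bits (A ⊕ B) => (x ∘ Sum.inl, x ∘ Sum.inr)

theorem posSemidef_ket (b : Bits W) : (ket b).PosSemidef := by
  have := Matrix.PosSemidef.one (n := Bits W) (R := ℂ)
  convert posSemidef_mask this (fun x => x = b) using 1; ext x y
  simp only [ket, of_apply, Matrix.one_apply]
  by_cases hx : x = b <;> by_cases hy : y = b <;> simp [hx, hy]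

theorem pp_tensorL {σ : Op A} (hσ : σ.PosSemidef) : PP (tensorL σ : LM B (A ⊕ B)) :=
  fun _ h => posSemidef_tensor hσ h

theorem pp_ite {p : Prop} [Decidable p] {Φ : LM A B} (h : PP Φ) : PP (if p then Φ else 0) := by
  split_ifs; exacts [h, PP.zero]

theorem trace_nonneg {ρ : Op W} (h : ρ.PosSemidef) : 0 ≤ ρ.trace.re :=
  (Complex.nonneg_iff.1 h.trace_nonneg).1

theorem norm_trace {ρ : Op W} (h : ρ.PosSemidef) : ‖ρ.trace‖ = ρ.trace.re :=
  (Complex.eq_re_of_ofReal_le (r := 0) (by simpa using h.trace_nonneg)) ▸ by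
    simp [abs_of_nonneg (trace_nonneg h)]

/-- A functional that is bounded by the trace on positive semidefinite operators. -/
def Bounded (g : Op W →ₗ[ℂ] ℂ) : Prop := ∀ ρ : Op W, ρ.PosSemidef → ‖g ρ‖ ≤ ρ.trace.re

theorem Bounded.comp {g : Op B →ₗ[ℂ] ℂ} (h : Bounded g) {Φ : LM A B} (hΦ : PP Φ) (ht : TP Φ) :
    Bounded (g ∘ₗ Φ) := fun ρ hρ => (h _ (hΦ ρ hρ)).trans_eq (by rw [ht])

theorem trace_split (a : Op (A ⊕ B)) : a.trace = ∑ x, (cut x x a).trace := by rw [trace_op_sum]; rfl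

theorem bounded_bitL (w : W) : Bounded (bitL w) := by
  intro ρ hρ; change ‖(projectL w true ρ).trace‖ ≤ _
  rw [norm_trace (pp_projectL w _ ρ hρ), ← trace_project_add w ρ, Complex.add_re]
  have := trace_nonneg (pp_projectL w false ρ hρ); linarith

theorem iter_close {Φ Ψ : ℕ → LM A A} (hΦ : ∀ t, PP (Φ t)) (hΦt : ∀ t, TP (Φ t)) (hΨ : ∀ t, PP (Ψ
    t)) (hΨt : ∀ t, TP (Ψ t)) {ε : ℝ} (h : ∀ t, ∀ g : Op A →ₗ[ℂ] ℂ, Bounded g → ∀ ρ : Op A,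
    ρ.PosSemidef → ‖g (Φ t ρ) - g (Ψ t ρ)‖ ≤ ε * ρ.trace.re) (n : ℕ) (g : Op A →ₗ[ℂ] ℂ) (hg :
    Bounded g) (ρ : Op A) (hρ : ρ.PosSemidef) : ‖g (iter Φ n ρ) - g (iter Ψ n ρ)‖ ≤ n * ε *
    ρ.trace.re := by
  induction n generalizing g with
  | zero => simp [iter]
  | succ n ih =>
    have h1 := h n g hg (iter Φ n ρ) (PP.iter hΦ n ρ hρ); rw [iter_tp hΦt n ρ] at h1
    have h2 := ih (g ∘ₗ Ψ n) (hg.comp (hΨ n) (hΨt n)); simp only [comp_apply] at h2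
    simp only [iter, comp_apply]
    push_cast
    calc _ ≤ ‖g (Φ n (iter Φ n ρ)) - g (Ψ n (iter Φ n ρ))‖
          + ‖g (Ψ n (iter Φ n ρ)) - g (Ψ n (iter Ψ n ρ))‖ := norm_sub_le_norm_sub_add_norm_sub _ _ _
      _ ≤ _ := by nlinarith

section Party

variable {U X Ω M : Reg}

theorem Party.pp_execL (P : Party U X Ω M) (rounds : ℕ) (b : ℕ → Circuit (M ⊕ W)) (ω : Bits Ω)
    (u : Bits U) (x : Bits X) : PP (P.execL rounds (fun t => (b t).runL) ω u x) := by
  refine PP.comp ?_ (PP.comp (PP.iter (fun t => ?_) _) ?_)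
  · exact PP.sum fun s _ => pp_ite ((pp_reduceL _).comp (pp_cut s))
  · exact (pp_ext_runL _).comp (pp_act_runL _ _)
  exact (pp_tensorL (posSemidef_ket _)).comp (pp_tensorL (posSemidef_ket _))

theorem sum_trace_fin (o : Bits S → Bits O) (ρ : Op (S ⊕ (C ⊕ W))) : ∑ x, ((∑ s, if o s = x then
    reduceL inr ∘ₗ cut s s else 0 : LM (S ⊕ (C ⊕ W)) W) ρ).trace = ρ.trace := by
  simp only [LinearMap.sum_apply, trace_sum]; rw [sum_comm, trace_split ρ]
  refine sum_ext fun s => ?_; rw [sum_eq_single (o s)]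
  · rw [if_pos rfl, comp_apply, trace_reduceL]
  · intro x _ hx; rw [if_neg hx.symm]; simp
  simp

theorem trace_tensor_ket (b : Bits A) (ρ : Op B) : (tensor (ket b) ρ).trace = ρ.trace := by
  rw [trace_tensor, trace_ket, one_mul]

theorem Party.sum_trace_execL (P : Party U X Ω M) (rounds : ℕ) (b : ℕ → Circuit (M ⊕ W))
    (ω : Bits Ω) (u : Bits U) (β : Op W) :
    ∑ x, (P.execL rounds (fun t => (b t).runL) ω u x β).trace = β.trace := by
  have h : ∀ t, TP (P.roundL t (b t).runL) := fun t => by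
    unfold Party.roundL; rw [← act_inr]; exact (runL_tp _).act.comp (runL_tp _).act
  simp only [Party.execL, comp_apply, Party.finL]; rw [sum_trace_fin, iter_tp h]
  simp only [Party.initL, comp_apply, ← tensor_eq, trace_tensor_ket]

end Party

/-- Conditional distributions. -/
def Markov (L : Bits U → Bits V → Bits X → Bits Y → ℝ) : Prop :=
  (∀ u v x y, 0 ≤ L u v x y) ∧ ∀ u v, ∑ x, ∑ y, L u v x y = 1

theorem pp_fexecL {L : Bits U → Bits V → Bits X → Bits Y → ℝ} (hL : Markov L)
    (query : Circuit (V ⊕ W)) (reply : Circuit (Y ⊕ W)) (u : Bits U) (x : Bits X) :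
    PP (fexecL L query.runL reply.runL u x) := by
  refine PP.sum fun v _ => PP.sum fun y _ => PP.smul ?_ (hL.1 _ _ _ _)
  exact (pp_reduceL _).comp ((pp_runL _).comp ((pp_tensorL (posSemidef_ket _)).comp
    ((pp_cut v).comp ((pp_runL _).comp (pp_tensorL (posSemidef_ket _))))))

theorem fexec_branch_trace (query : Circuit (V ⊕ W)) (reply : Circuit (Y ⊕ W)) (v : Bits V) (y :
    Bits Y) (β : Op W) : (reduceL inr (reply.runL (tensor (ket y) (cut v v (query.runL (tensor (ket
    zeros) β)))))).trace = (cut v v (query.runL (tensor (ket zeros) β))).trace := by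
  rw [trace_reduceL, runL_tp, trace_tensor_ket]

theorem sum_trace_fexecL {L : Bits U → Bits V → Bits X → Bits Y → ℝ} (hL : Markov L)
    (query : Circuit (V ⊕ W)) (reply : Circuit (Y ⊕ W)) (u : Bits U) (β : Op W) :
    ∑ x, (fexecL L query.runL reply.runL u x β).trace = β.trace := by
  have h : ∀ x, (fexecL L query.runL reply.runL u x β).trace
      = ∑ v, (∑ y, (L u v x y : ℂ)) * (cut v v (query.runL (tensor (ket zeros) β))).trace := by
    intro x; simp only [fexecL, LinearMap.sum_apply, trace_sum, sum_mul]
    refine sum_ext fun v => sum_ext fun y => ?_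
    rw [LinearMap.smul_apply, trace_smul, smul_eq_mul]; congr 1
    exact fexec_branch_trace query reply v y β
  simp only [h]; rw [sum_comm]; simp only [← sum_mul]
  have h1 : ∀ v, ∑ x, ∑ y, (L u v x y : ℂ) = 1 := fun v => by exact_mod_cast hL.2 u v
  simp only [h1, one_mul]; rw [← trace_split, runL_tp, trace_tensor_ket]

theorem fexecL_close {L L' : Bits U → Bits V → Bits X → Bits Y → ℝ} {ε : ℝ} (h : ∀ u v, ∑ x, ∑ y, |L
    u v x y - L' u v x y| ≤ ε) (query : Circuit (V ⊕ W)) (reply : Circuit (Y ⊕ W)) (u : Bits U) (g :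
    Bits X → Op W →ₗ[ℂ] ℂ) (hg : ∀ x, Bounded (g x)) (β : Op W) (hβ : β.PosSemidef) : ∑ x, ‖g x
    (fexecL L query.runL reply.runL u x β) - g x (fexecL L' query.runL reply.runL u x β)‖ ≤ ε *
    β.trace.re := by
  let τ := fun v => cut v v (query.runL (tensor (ket zeros) β))
  have hτ : ∀ v, (τ v).PosSemidef := fun v =>
    pp_cut v _ (pp_runL _ _ (posSemidef_tensor (posSemidef_ket _) hβ))
  have h1 : ∀ x, ‖g x (fexecL L query.runL reply.runL u x β)
      - g x (fexecL L' query.runL reply.runL u x β)‖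
      ≤ ∑ v, (∑ y, |L u v x y - L' u v x y|) * (τ v).trace.re := by
    intro x; simp only [fexecL, LinearMap.sum_apply, map_sum, ← sum_sub_distrib, sum_mul]
    refine (norm_sum_le _ _).trans (sum_le_sum fun v _ =>
      (norm_sum_le _ _).trans (sum_le_sum fun y _ => ?_))
    simp only [LinearMap.smul_apply, map_smul, smul_eq_mul]
    rw [← sub_mul, norm_mul, ← Complex.ofReal_sub, Complex.norm_real, Real.norm_eq_abs]
    refine mul_le_mul_of_nonneg_left ?_ (abs_nonneg _); refine (hg x _ ?_).trans_eq ?_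
    · exact pp_reduceL _ _ (pp_runL _ _ (posSemidef_tensor (posSemidef_ket _) (hτ v)))
    exact congrArg _ (fexec_branch_trace query reply v y β)
  refine (sum_le_sum fun x _ => h1 x).trans ?_; rw [sum_comm]; simp only [← sum_mul]
  refine (sum_le_sum fun v _ =>
    mul_le_mul_of_nonneg_right (h u v) (trace_nonneg (hτ v))).trans_eq ?_
  rw [← mul_sum, ← Complex.re_sum, ← trace_split, runL_tp, trace_tensor_ket]

namespace OracleParty

variable {ℓ : ℕ} {In Out : Fin ℓ → Reg} {U X C : Reg} (P : OracleParty In Out U X C)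

theorem pp_callRoundL {call : Calls In Out W}
    (h : ∀ i u x, PP (call i u x)) : PP (P.callRoundL call : LM _ (P.St W)) := by
  refine (pp_selL _).add (PP.sum fun i _ => PP.sum fun s _ => PP.sum fun c _ => pp_ite
    (PP.sum fun x _ => ?_))
  exact (pp_tensorL (posSemidef_ket _)).comp ((pp_tensorL (posSemidef_ket _)).comp
    ((h i _ x).comp ((pp_cut c).comp (pp_cut s))))

theorem calledL_trace (i : Fin ℓ) {call : Bits (In i) → Bits (Out i) → LM W W}
    (h : ∀ u β, ∑ x, (call u x β).trace = β.trace) (ρ : Op (P.St W)) :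
    (P.calledL i call ρ).trace = ∑ s, if P.callee s = some i then (cut s s ρ).trace else 0 := by
  simp only [calledL, LinearMap.sum_apply, trace_sum]; refine sum_ext fun s => ?_; split_ifs
  · rw [trace_split (cut s s ρ)]; refine sum_ext fun c => ?_
    simp only [LinearMap.sum_apply, trace_sum, comp_apply, ← tensor_eq, trace_tensor_ket, h]
  simp

theorem callRoundL_tp {call : Calls In Out W} (h : ∀ i u β, ∑ x, (call i u x β).trace = β.trace) :
    TP (P.callRoundL call : LM _ (P.St W)) := by
  intro ρ
  simp only [callRoundL, LinearMap.add_apply, LinearMap.sum_apply, Matrix.trace_add,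
    trace_sum]
  rw [trace_split (selL _ ρ), sum_ext fun i => P.calledL_trace i (h i) ρ,
    sum_comm, ← sum_add_distrib, trace_split ρ]
  refine sum_ext fun s => ?_; rw [cut_selL]; rcases hc : P.callee s with _ | i
  · simp
  simp

theorem pp_preL (r : ℕ) (b : Circuit (C ⊕ W)) : PP (P.preL r b.runL) := by
  unfold preL; refine PP.comp ?_ (pp_act_runL _ _)
  rw [← runL_measureC, ← act_inr, act_comp, act_comp]
  exact (pp_act_runL _ _).comp ((pp_act_runL _ _).comp (pp_act_runL _ _))

theorem preL_tp (r : ℕ) (b : Circuit (C ⊕ W)) : TP (P.preL r b.runL) := by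
  unfold preL; refine TP.comp ?_ (runL_tp _).act; rw [← act_inr]
  exact ((dephaseL_tp _).comp ((runL_tp _).comp (dephaseL_tp _))).act

theorem roundL_close {r : ℕ} (b : Circuit (C ⊕ W)) {call call' : Calls In Out W} {ε : ℝ} (h : ∀ i u
    (g : Bits (Out i) → Op W →ₗ[ℂ] ℂ), (∀ x, Bounded (g x)) → ∀ β : Op W, β.PosSemidef → ∑ x, ‖g x
    (call i u x β) - g x (call' i u x β)‖ ≤ ε * β.trace.re) (hε : 0 ≤ ε) (g : Op (P.St W) →ₗ[ℂ] ℂ)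
    (hg : Bounded g) (ρ : Op (P.St W)) (hρ : ρ.PosSemidef) : ‖g (P.roundL r b.runL call ρ) - g
    (P.roundL r b.runL call' ρ)‖ ≤ ε * ρ.trace.re := by
  rw [← P.preL_tp r b ρ]; have hσ := P.pp_preL r b ρ hρ; simp only [roundL, comp_apply]
  generalize P.preL r b.runL ρ = σ at hσ
  simp only [callRoundL, LinearMap.add_apply, map_add, add_sub_add_left_eq_sub,
    LinearMap.sum_apply, map_sum, ← sum_sub_distrib]
  refine (norm_sum_le _ _).trans ?_
  have h1 : ∀ i, ‖g (P.calledL i (call i) σ) - g (P.calledL i (call' i) σ)‖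
      ≤ ∑ s, if P.callee s = some i then ε * (cut s s σ).trace.re else 0 := by
    intro i; simp only [calledL, LinearMap.sum_apply, map_sum, ← sum_sub_distrib]
    refine (norm_sum_le _ _).trans (sum_le_sum fun s _ => ?_); split_ifs
    · rw [trace_split (cut s s σ), Complex.re_sum, mul_sum]
      refine (norm_sum_le _ _).trans (sum_le_sum fun c _ => ?_)
      simp only [LinearMap.sum_apply, map_sum, ← sum_sub_distrib]; refine (norm_sum_le _ _).trans ?_
      exact h i _ (fun x => g ∘ₗ tensorL (ket (write (P.callOut i) x s)) ∘ₗ tensorL (ket c))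
        (fun x => hg.comp ((pp_tensorL (posSemidef_ket _)).comp (pp_tensorL (posSemidef_ket _)))
          fun τ => by simp only [comp_apply, ← tensor_eq, trace_tensor_ket])
        _ (pp_cut c _ (pp_cut s _ hσ))
    simp
  refine (sum_le_sum fun i _ => h1 i).trans ?_
  rw [sum_comm, trace_split σ, Complex.re_sum, mul_sum]; refine sum_le_sum fun s _ => ?_
  rcases hc : P.callee s with _ | i
  · simpa using mul_nonneg hε (trace_nonneg (pp_cut s _ hσ))
  simp

end OracleParty

/-! ### Executions with a kernel that is computed by a circuit -/

theorem sum_diag_comp {M : Type*} [AddCommGroup M] [Module ℂ M] (g : A ↪ W) (σ : Op W)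
    (f : Bits A → M) : ∑ c, σ c c • f (c ∘ g) = ∑ a, reduceL g σ a a • f a := by
  have h : ∀ a, reduceL g σ a a = ∑ c : Bits W, if c ∘ g = a then σ c c else 0 := by
    intro a; change (∑ c : Bits W, if c ∘ g = a then σ c (write g a c) else 0) = _
    refine sum_ext fun c => ?_; split_ifs with hc
    · rw [← hc, write_self]
    rfl
  simp only [h, Finset.sum_smul]; rw [sum_comm]; refine sum_ext fun c => ?_; simp [ite_smul]

def circKernel (C : Circuit ((U ⊕ V) ⊕ ((X ⊕ Y) ⊕ T))) (u : Bits U) (v : Bits V) (x : Bits X)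
    (y : Bits Y) : ℝ :=
  (reduceL (middle _ _ _) (C.runL (ket (elim (elim u v) zeros))) (elim x y) (elim x y)).re

theorem ofReal_circKernel (C : Circuit ((U ⊕ V) ⊕ ((X ⊕ Y) ⊕ T))) (u : Bits U) (v : Bits V) (x :
    Bits X) (y : Bits Y) : (circKernel C u v x y : ℂ) = reduceL (middle _ _ _) (C.runL (ket (elim
    (elim u v) zeros))) (elim x y) (elim x y) := by
  have h := (pp_reduceL (middle (U ⊕ V) (X ⊕ Y) T) _ (pp_runL C _ (posSemidef_ket
    (elim (elim u v) zeros)))).diag_nonneg (i := elim x y)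
  exact Complex.ext rfl (Complex.nonneg_iff.1 h).2

theorem markov_circKernel (C : Circuit ((U ⊕ V) ⊕ ((X ⊕ Y) ⊕ T))) : Markov (circKernel C) := by
  constructor
  · intro u v x y
    exact (Complex.nonneg_iff.1 (pp_reduceL (middle (U ⊕ V) (X ⊕ Y) T) _ (pp_runL C _
      (posSemidef_ket (elim (elim u v) zeros)))).diag_nonneg).1
  intro u v
  have h : (∑ x, ∑ y, (circKernel C u v x y : ℂ)) = 1 := by
    simp only [ofReal_circKernel]
    rw [← sum_bits fun z => reduceL (middle _ _ _) (C.runL (ket (elim (elim u v) zeros))) z z]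
    change (reduceL (middle (U ⊕ V) (X ⊕ Y) T) _).trace = 1; rw [trace_reduceL, runL_tp, trace_ket]
  exact_mod_cast h

theorem markov_kernel (F : Functionality) (m : ℕ) : Markov (F.kernel m) := by
  refine ⟨fun _ _ _ _ => ENNReal.toReal_nonneg, fun u v => ?_⟩
  have h : ∑ p : Bits (F.X m) × Bits (F.Y m), F.law m u v p = 1 := by
    rw [← tsum_fintype (L := .unconditional _)]; exact (F.law m u v).tsum_coe
  rw [← Fintype.sum_prod_type' (f := fun x y => F.kernel m u v x y)]
  have := congrArg ENNReal.toReal h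
  rwa [ENNReal.toReal_sum fun p _ => (F.law m u v).apply_ne_top p] at this

theorem fexec_sum (C : Circuit ((U ⊕ V) ⊕ ((X ⊕ Y) ⊕ T))) (query : LM (V ⊕ W) (V ⊕ W)) (reply : LM
    (Y ⊕ W) (Y ⊕ W)) (u : Bits U) (β : Op W) : ∑ v, ∑ c, C.runL (ket (elim (elim u v) zeros)) c c •
    tensor (ket u) (tensor (ket (c ∘ Sum.inr ∘ Sum.inl ∘ Sum.inl)) (reduceL inr (reply (tensor (ket
    (c ∘ Sum.inr ∘ Sum.inl ∘ Sum.inr)) (cut v v (query (tensor (ket zeros) β))))))) = ∑ x, tensor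
    (ket u) (tensor (ket x) (fexecL (circKernel C) query reply u x β)) := by
  simp only [fexecL, LinearMap.sum_apply, tensor_eq, map_sum]
  rw [sum_comm (s := univ (α := Bits X))]; refine sum_ext fun v => ?_
  refine (sum_diag_comp (middle (U ⊕ V) (X ⊕ Y) T) _ (fun p => tensorL (ket u) (tensorL (ket (p ∘
    Sum.inl)) (reduceL inr (reply (tensorL (ket (p ∘ Sum.inr)) (cut v v (query (tensorL (ket zeros)
    β))))))))).trans ?_
  rw [sum_bits]; refine sum_ext fun x => sum_ext fun y => ?_
  rw [← ofReal_circKernel, LinearMap.smul_apply, map_smul, map_smul]; rfl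

set_option maxHeartbeats 1000000 in
theorem Impl.fexec (C : Circuit ((U ⊕ V) ⊕ ((X ⊕ Y) ⊕ T))) (query : Circuit (V ⊕ W)) (reply :
    Circuit (Y ⊕ W)) {N : ℕ} (hN : card U + card V + card X + card Y + card T + C.size + query.size
    + reply.size ≤ N) : Impl (instL (fexecL (circKernel C) query.runL reply.runL)) (20 * (N +
    1)) := by
  let I := (inl : (U ⊕ (X ⊕ W)) ↪ (U ⊕ (X ⊕ W)) ⊕ ((V ⊕ Y) ⊕ ((U ⊕ V) ⊕ ((X ⊕ Y) ⊕ T))))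
  let J := (inr : ((V ⊕ Y) ⊕ ((U ⊕ V) ⊕ ((X ⊕ Y) ⊕ T))) ↪
    (U ⊕ (X ⊕ W)) ⊕ ((V ⊕ Y) ⊕ ((U ⊕ V) ⊕ ((X ⊕ Y) ⊕ T))))
  let eW := (inr.trans (inr.trans I)); let eU := inl.trans I; let eX := inl.trans (inr.trans I)
  let eV := inl.trans (inl.trans J); let eY := inr.trans (inl.trans J); let eC := inr.trans J
  let eI := inl.trans eC; let FV := joint eV eW nofun; let FY := joint eY eW nofun
  let FC := joint eC eW nofun; let FX := joint eX eY nofun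
  have hv₁ : Sourced eI fun x => elim (x ∘ eU) (x ∘ eV) := by
    rintro (a | a)
    · exact ⟨.inl (eU a), nofun, fun _ => rfl⟩
    exact ⟨.inl (eV a), nofun, fun _ => rfl⟩
  have hv₂ : Sourced FX fun x => x ∘ ((middle (U ⊕ V) (X ⊕ Y) T).trans eC) :=
    Sourced.comp _ fun a b h => by rcases b with b | b <;> cases h
  have h := ((((((((Impl.dephase eY).comp ((Impl.circuit reply).act FY)).comp (Impl.load hv₂)).comp
    (Impl.dephase eC)).comp ((Impl.circuit C).act eC)).comp (Impl.load hv₁)).comp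
    (Impl.dephase eV)).comp ((Impl.circuit query).act FV)).comp
      ((Impl.dephase eX).comp (Impl.dephase eU))
  refine (h.fresh (K := (V ⊕ Y) ⊕ ((U ⊕ V) ⊕ ((X ⊕ Y) ⊕ T)))
    (Φ := instL (fexecL (circKernel C) query.runL reply.runL)) fun ρ => ?_).mono ?_
  · simp only [comp_apply]; rw [dephaseL_emb_two]
    have hload₁ := loadL_emb eW eI nofun (fun x => elim (x ∘ eU) (x ∘ eV)) fun x x' h => by
      funext w; rcases w with w | w <;> exact h _ nofun nofun
    have hload₂ := loadL_emb eW FX (fun a b h => by rcases b with b | b <;> cases h)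
      (fun x => x ∘ ((middle (U ⊕ V) (X ⊕ Y) T).trans eC)) fun x x' h => funext fun w =>
        h _ nofun fun b h => by rcases b with b | b <;> cases h
    rw [instL_apply]; simp only [map_sum]; rw [sum_congr rfl]; intro u _
    have step : ∀ x₀ : Bits X, ∀ β : Op W,
        reduceL inl (dephaseL eY (SeqComp.act FY reply.runL (loadL FX (fun x => x ∘ ((middle (U ⊕ V) (X ⊕ Y) T).trans eC))
          (dephaseL eC (SeqComp.act eC C.runL (loadL eI (fun x => elim (x ∘ eU) (x ∘ eV)) (dephaseL eV
            (SeqComp.act FV query.runL (emb eW (write eX x₀ (write eU u zeros)) β)))))))))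
        = ∑ v, ∑ c, C.runL (ket (elim (elim u v) zeros)) c c •
            tensor (ket u) (tensor (ket (c ∘ Sum.inr ∘ Sum.inl ∘ Sum.inl))
            (reduceL inr (reply.runL (tensor
              (ket (c ∘ Sum.inr ∘ Sum.inl ∘ Sum.inr)) (cut v v
              (query.runL (tensor (ket zeros) β))))))) := by
      intro x₀ β
      let z : Bits ((U ⊕ (X ⊕ W)) ⊕ ((V ⊕ Y) ⊕ ((U ⊕ V) ⊕ ((X ⊕ Y) ⊕ T)))) :=
        elim (elim u (elim x₀ zeros)) (elim (elim zeros zeros) zeros)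
      rw [write_write_zeros, ← elim_zeros (A := V), show elim _ _ = z from rfl, show eW = inr.trans FV from rfl, emb_zeros_tensor, act_emb,
        show eV = inl.trans FV from rfl, dephaseL_emb]
      simp only [map_sum]; refine sum_ext fun v => ?_
      rw [show inl.trans FV = eV from rfl, show inr.trans FV = eW from rfl, hload₁]
      have e2 : ∀ v', write eI v' (write eV v z) = elim (elim u (elim x₀ zeros))
          (elim (elim v zeros) (elim v' zeros)) := by
        intro v'; simp only [z]; rw [← elim_zeros (A := U ⊕ V) (B := (X ⊕ Y) ⊕ T)]
        simp [eI, eC, eV, J, write_trans, comp_trans_eq]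
      have e3 : (elim (write eV v z ∘ eU) (write eV v z ∘ eV) : Bits (U ⊕ V)) = elim u v := by
        rw [write_comp, write_disjoint _ _ nofun]; rfl
      rw [e2, e3, show eW = inr.trans FC from rfl, emb_zeros_tensor,
        show eC = inl.trans FC from rfl, act_trans_emb, dephaseL_emb]
      simp only [map_sum]; refine sum_ext fun c => ?_
      rw [show inl.trans FC = eC from rfl, show inr.trans FC = eW from rfl]
      have e4 : ∀ (τ : Op W) (d : Bits ((U ⊕ V) ⊕ ((X ⊕ Y) ⊕ T))),
          block c (SeqComp.act inl C.runL (tensor (ket d) τ))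
            = C.runL (ket d) c c • τ := by
        intro τ d; ext y y'; change SeqComp.act _ _ _ _ _ = _; rw [act_apply]
        have : sect inl (elim c y) (elim c y') (tensor (ket d) τ)
            = τ y y' • ket d := by
          ext a a'; rw [sect_inl]; simp [tensor, mul_comm]
        rw [this, map_smul]; simp [Matrix.smul_apply, mul_comm]
      rw [e4, map_smul, map_smul, map_smul, map_smul, map_smul]; congr 1
      rw [hload₂, write_joint, show eW = inr.trans FY from rfl, emb_zeros_tensor,
        act_emb, show eY = inl.trans FY from rfl, dephaseL_emb]
      simp only [map_sum]; simp only [reduceL_inr, tensor_eq, map_sum]; refine sum_ext fun y => ?_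
      rw [show inl.trans FY = eY from rfl, show inr.trans FY = (inr.trans inr).trans (inl : (U ⊕
        (X ⊕ W)) ↪ _) from rfl, reduceL_emb_trans, emb_inr_inr]
      simp [eX, eY, eC, I, J, write_trans, comp_trans_eq]; rfl
    refine (sum_ext fun x => step x _).trans ?_; simp only [fexec_sum]; rw [sum_comm]
    refine sum_ext fun x => ?_; simp only [reduceL_inr, map_sum, tensor_eq, block_eq_cut]
  simp only [card_sum] at hN ⊢; omega

/-! ### Rounds of an oracle protocol as circuits -/

/-- A call with classical memory: the input is read from the wires `f`, the output written to the
wires `g`. -/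
def callL (f : I → A) (g : O ↪ A) (call : Bits I → Bits O → LM W W) :
    LM (A ⊕ (C ⊕ W)) (A ⊕ (C ⊕ W)) :=
  ∑ s, ∑ c, ∑ x, tensorL (ket (write g x s)) ∘ₗ tensorL (ket c) ∘ₗ call (s ∘ f) x ∘ₗ
    cut c c ∘ₗ cut s s

theorem Impl.call (f : I → A) (g : O ↪ A) (call : Bits I → Bits O → LM W W) {k N : ℕ} (hN : card A +
    card C + card I + card O ≤ N) (h : Impl (instL call) k) : Impl (callL f g call : LM (A ⊕ (C ⊕
    W)) (A ⊕ (C ⊕ W))) (k + 10 * N + 10) := by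
  let L := (inl : (A ⊕ (C ⊕ W)) ↪ (A ⊕ (C ⊕ W)) ⊕ (I ⊕ O))
  let J := (inr : (I ⊕ O) ↪ (A ⊕ (C ⊕ W)) ⊕ (I ⊕ O)); let eW := (inr.trans (inr.trans L))
  let eA := inl.trans L; let eC := inl.trans (inr.trans L); let eI := inl.trans J
  let eO := inr.trans J
  let F := joint eI (joint eO eW nofun) fun a b h => by rcases b with b | b <;> cases h
  have hv₁ : Sourced eI fun x => x ∘ (eA ∘ f) := Sourced.comp _ nofun
  have hv₂ : Sourced (g.trans eA) fun x => x ∘ eO := Sourced.comp _ nofun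
  have h := (((Impl.load hv₂).comp (h.act F)).comp (Impl.load hv₁)).comp
      ((Impl.dephase eC).comp (Impl.dephase eA))
  refine (h.fresh (K := I ⊕ O) (Φ := callL f g call) fun ρ => ?_).mono ?_
  · simp only [comp_apply]; rw [dephaseL_emb_two, callL]
    simp only [map_sum, LinearMap.sum_apply, comp_apply]
    refine sum_ext fun s => sum_ext fun c => ?_
    have hload₁ := loadL_emb eW eI nofun (fun x => x ∘ (eA ∘ f)) fun x x' h => funext fun w =>
      h _ nofun nofun
    have hload₂ := loadL_emb eW (g.trans eA) nofun (fun x => x ∘ eO) fun x x' h => funext fun w =>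
      h _ nofun nofun
    have e2 : ∀ i, write eI i (elim (elim s (elim c zeros)) (elim zeros zeros))
        = elim (elim s (elim c zeros)) (elim i zeros) := by
      intro i
      simp [eI, J, write_trans, comp_trans_eq]
    rw [write_write_zeros, show (inr.trans (inr.trans (inl : (A ⊕ (C ⊕ W)) ↪ (A ⊕ (C ⊕ W)) ⊕ (I ⊕ O)))) = eW from
      rfl, hload₁, e2]
    have e3 := emb_inr_inr_ket F (elim (elim s (elim c zeros)) (elim (s ∘ f) zeros))
      (cut c c (cut s s ρ))
    rw [show inr.trans (inr.trans F) = eW from rfl] at e3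
    refine (congrArg _ (congrArg _ (congrArg _ e3))).trans ?_; rw [act_emb, instL_ket]
    simp only [map_sum]; refine sum_ext fun x => ?_
    rw [emb_tensor_ket, emb_tensor_ket, show inr.trans (inr.trans F) = eW from rfl, show inl.trans
      (inr.trans F) = eO from rfl, show inl.trans F = eI from rfl, write_self, hload₂, write_comp]
    have e4 : write (g.trans eA) x (write eO x (elim (elim s (elim c zeros)) (elim (s ∘ f) zeros)))
        = elim (elim (write g x s) (elim c zeros)) (elim (s ∘ f) x) := by
      simp [eA, eO, J, L, write_trans, comp_trans_eq]
    rw [e4, show eW = (inr.trans inr).trans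
          (inl : (A ⊕ (C ⊕ W)) ↪ _) from rfl, reduceL_emb_trans, emb_inr_inr]
    rfl
  simp only [card_sum]; omega

def maskL (p : Bits A → Prop) [DecidablePred p] : LM A A where
  toFun ρ := of fun x y => if p x ∧ p y then ρ x y else 0
  map_add' _ _ := by ext; simp only [of_apply, Matrix.add_apply]; split_ifs <;> simp
  map_smul' _ _ := by
    ext; simp only [of_apply, Matrix.smul_apply, RingHom.id_apply]; split_ifs <;> simp

theorem maskL_apply (p : Bits A → Prop) [DecidablePred p] (ρ : Op A) (x y : Bits A) :
    maskL p ρ x y = if p x ∧ p y then ρ x y else 0 := rfl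

theorem maskL_maskL (p q : Bits A → Prop) [DecidablePred p] [DecidablePred q] (ρ : Op A) :
    maskL p (maskL q ρ) = maskL (fun s => q s ∧ p s) ρ := by
  ext x y; simp only [maskL_apply]; rw [← ite_and]; exact if_congr (by tauto) rfl rfl

theorem maskL_congr {p q : Bits A → Prop} [DecidablePred p] [DecidablePred q]
    (h : ∀ s, p s ↔ q s) : maskL p = maskL q := by
  ext ρ x y; exact if_congr (by rw [h, h]) rfl rfl

theorem maskL_true (ρ : Op A) : maskL (fun _ => True) ρ = ρ := by ext x y; simp [maskL_apply]

def chainL {ℓ : ℕ} (flag : Fin ℓ → A) (E : Fin ℓ → LM A A) (E₀ : LM A A) : List (Fin ℓ) → LM A A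
  | [] => E₀
  | i :: l => chainL flag E E₀ l ∘ₗ projectL (flag i) false + E i ∘ₗ projectL (flag i) true

theorem Impl.chain {ℓ : ℕ} (flag : Fin ℓ → A) {E : Fin ℓ → LM A A} {E₀ : LM A A} {k : ℕ}
    (h : ∀ i, Impl (E i) k) (h₀ : Impl E₀ k) (l : List (Fin ℓ)) :
    Impl (chainL flag E E₀ l) (k + l.length * (k + 1)) := by
  induction l with
  | nil => exact h₀.mono (by simp)
  | cons i l ih =>
    refine (Impl.branch _ ih (h i)).mono ?_; simp only [List.length_cons]; ring_nf; omega

theorem chainL_eq {ℓ : ℕ} (flag : Fin ℓ → A) (E : Fin ℓ → LM A A) (E₀ : LM A A) (l : List (Fin ℓ))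
    (p : Bits A → Prop) [DecidablePred p] (ρ : Op A) : chainL flag E E₀ l (maskL p ρ) = E₀ (maskL
    (fun s => p s ∧ l.find? (fun i => s (flag i)) = none) ρ) + ∑ i, E i (maskL (fun s => p s ∧
    l.find? (fun i => s (flag i)) = some i) ρ) := by
  induction l generalizing p with
  | nil =>
    have h : ∀ i : Fin ℓ, maskL (fun s => p s ∧ ([] : List (Fin ℓ)).find? (fun i => s (flag i))
        = some i) ρ = 0 := by
      intro i; ext x y; simp [maskL_apply]
    simp only [chainL, h, map_zero, sum_const_zero, add_zero]
    exact congrArg E₀ (LinearMap.congr_fun (maskL_congr fun s => by simp) ρ)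
  | cons i l ih =>
    have e1 : ∀ b, projectL (flag i) b (maskL p ρ) = maskL (fun s => p s ∧ s (flag i) = b) ρ :=
      fun b => maskL_maskL _ _ ρ
    simp only [chainL, LinearMap.add_apply, comp_apply, e1]; rw [ih, add_assoc]; congr 1
    · congr 1; refine LinearMap.congr_fun (maskL_congr fun s => ?_) ρ
      rcases h : s (flag i) <;> simp [h, List.find?_cons]
    have h2 : ∀ j : Fin ℓ, maskL (fun s => p s ∧ (i :: l).find? (fun i => s (flag i)) = some j) ρ
        = maskL (fun s => (p s ∧ s (flag i) = false) ∧ l.find? (fun i => s (flag i)) = some j) ρ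
          + if j = i then maskL (fun s => p s ∧ s (flag i) = true) ρ else 0 := by
      intro j; by_cases hj : j = i
      · subst hj
        have h3 : ∀ s : Bits A, (p s ∧ (j :: l).find? (fun i => s (flag i)) = some j) ↔
            ((p s ∧ s (flag j) = false) ∧ l.find? (fun i => s (flag i)) = some j)
              ∨ (p s ∧ s (flag j) = true) := by
          intro s; rcases h : s (flag j) <;> simp [h, List.find?_cons]
        have h4 : ∀ s : Bits A, ¬ (s (flag j) = false ∧ l.find? (fun i => s (flag i)) = some j) := by
          rintro s ⟨h, h'⟩; have := List.find?_some h'; simp [h] at this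
        have h5 : maskL (fun s => (p s ∧ s (flag j) = false) ∧
            l.find? (fun i => s (flag i)) = some j) ρ = 0 := by
          ext x y; rw [maskL_apply, if_neg fun h => h4 x ⟨h.1.1.2, h.1.2⟩]; rfl
        rw [if_pos rfl, h5, zero_add]; refine LinearMap.congr_fun (maskL_congr fun s => ?_) ρ
        rw [h3]; exact or_iff_right fun h => h4 s ⟨h.1.2, h.2⟩
      rw [if_neg hj, add_zero]; refine LinearMap.congr_fun (maskL_congr fun s => ?_) ρ
      rcases h : s (flag i) <;> simp [h, List.find?_cons, Ne.symm hj]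
    simp only [h2, map_add, sum_add_distrib]; congr 1; rw [sum_eq_single i]
    · simp
    · intro j _ hj; simp [hj]
    simp

theorem callL_selL (f : I → A) (g : O ↪ A) (call : Bits I → Bits O → LM W W) (p : Bits A → Prop)
    [DecidablePred p] (ρ : Op (A ⊕ (C ⊕ W))) : callL f g call (selL p ρ) = ∑ s, ∑ c, if p s then ∑
    x, tensor (ket (write g x s)) (tensor (ket c) (call (s ∘ f) x (cut c c (cut s s ρ)))) else
    0 := by
  simp only [callL, LinearMap.sum_apply, comp_apply, cut_selL]
  refine sum_ext fun s => sum_ext fun c => ?_; split_ifs with h h' h'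
  · rfl
  · exact absurd h.1 h'
  · exact absurd ⟨h', h'⟩ h
  simp

namespace OracleParty

variable {ℓ : ℕ} {In Out : Fin ℓ → Reg} {U X C : Reg} (P : OracleParty In Out U X C)

theorem callRoundL_eq (call : Calls In Out W) : (P.callRoundL call : LM _ (P.St W)) = chainL (fun i
    => Sum.inl (P.flag i)) (fun i => callL (P.callIn i) (P.callOut i) (call i)) LinearMap.id
    (finRange ℓ) := by
  ext1 ρ
  have h := chainL_eq (A := P.St W) (fun i => Sum.inl (P.flag i))
    (fun i => callL (P.callIn i) (P.callOut i) (call i)) LinearMap.id (finRange ℓ)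
    (fun _ => True) ρ
  rw [maskL_true] at h; rw [h, callRoundL, LinearMap.add_apply]; congr 1
  · ext x y; exact if_congr (by simp [callee]) rfl rfl
  simp only [LinearMap.sum_apply, calledL]; refine sum_ext fun i => ?_
  have h1 : maskL (fun s : Bits (P.St W) => True ∧
      (finRange ℓ).find? (fun i => s (Sum.inl (P.flag i))) = some i) ρ
      = selL (fun s => P.callee s = some i) ρ := by
    ext x y; exact if_congr (by simp [callee]) rfl rfl
  rw [h1, callL_selL]; refine sum_ext fun s => sum_ext fun c => ?_; split_ifs
  · simp only [LinearMap.sum_apply]; rfl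
  rfl

theorem implCallRound {call : Calls In Out W} {k N : ℕ} (hN : ∀ i, card U + card P.anc + card C +
    card (In i) + card (Out i) ≤ N) (h : ∀ i, Impl (instL (call i)) k) : Impl (P.callRoundL call :
    LM _ (P.St W)) ((ℓ + 1) * (k + 10 * N + 11)) := by
  rw [callRoundL_eq]
  refine (Impl.chain (fun i => Sum.inl (P.flag i)) (fun i => Impl.call (C := C) (P.callIn i)
    (P.callOut i) (call i) (N := N) (by simpa only [card_sum] using hN i) (h i))
    (Impl.id.mono (Nat.zero_le _)) _).mono ?_
  rw [List.length_finRange]; ring_nf; omega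

theorem implPre {r : ℕ} {b : LM (C ⊕ W) (C ⊕ W)} {k : ℕ} (h : Impl b k) :
    Impl (P.preL r b) (k + 2 * card C + (P.step r).size) := by
  refine (((((Impl.dephase inl).comp (h.comp (Impl.dephase inl))).act inr).comp ((Impl.circuit
    (P.step r)).act (front _ _ _))).congr (Ψ := P.preL r b) fun ρ => ?_).mono ?_
  · rw [act_inr]; rfl
  omega

theorem implRound {r : ℕ} {b : LM (C ⊕ W) (C ⊕ W)} {call : Calls In Out W} {k N : ℕ} (hN : ∀ i, card
    U + card P.anc + card C + card (In i) + card (Out i) ≤ N) (hs : 2 * card C + (P.step r).size ≤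
    N) (hb : Impl b k) (h : ∀ i, Impl (instL (call i)) k) : Impl (P.roundL r b call) ((ℓ + 2) * (k +
    10 * N + 11)) := by
  refine ((P.implCallRound hN h).comp (P.implPre (r := r) hb)).mono ?_; rw [add_mul, add_mul]; omega

end OracleParty

/-! ### Executions with part of the memory untouched -/

theorem write_onSnd (f : A ↪ W) (p : Bits (M ⊕ A)) (m : Bits M) (w : Bits W) :
    write (onSnd M f) p (elim m w) = elim (p ∘ Sum.inl) (write f (p ∘ Sum.inr) w) := by
  refine bits_ext_wire (onSnd M f) ?_ ?_
  · rw [write_comp]; funext v; rcases v with v | v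
    · rfl
    exact (write_mem f (p ∘ Sum.inr) w v).symm
  rintro (v | v) hv
  · exact absurd rfl (hv (Sum.inl v))
  rw [write_notMem _ _ _ hv]
  exact (write_notMem f _ _ fun a ha => hv (Sum.inr a) (congrArg Sum.inr ha)).symm

theorem ext_sect_act (f : A ↪ W) (x y : Bits W) (b : LM (M ⊕ A) (M ⊕ A)) :
    ext M (sect f x y) ∘ₗ act (onSnd M f) b = b ∘ₗ ext M (sect f x y) := by
  ext ρ z z'
  change act (onSnd M f) b ρ (elim (z ∘ Sum.inl) (write f (z ∘ Sum.inr) x))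
    (elim (z' ∘ Sum.inl) (write f (z' ∘ Sum.inr) y)) = _
  rw [act_apply]
  have h : ∀ (z : Bits (M ⊕ A)) (x : Bits W),
      (elim (z ∘ Sum.inl) (write f (z ∘ Sum.inr) x) : Bits (M ⊕ W)) ∘ onSnd M f = z := by
    intro z x; rw [← write_onSnd f z (z ∘ Sum.inl) x, write_comp]
  have h1 : sect (onSnd M f) (elim (z ∘ Sum.inl) (write f (z ∘ Sum.inr) x))
      (elim (z' ∘ Sum.inl) (write f (z' ∘ Sum.inr) y)) ρ = ext M (sect f x y) ρ := by
    ext p p'; rw [sect_apply, write_onSnd, write_onSnd, write_write, write_write]; rfl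
  rw [h, h, h1]; rfl

theorem eq_act_of_sect {f : A ↪ W} {Θ : LM W W} {Φ : LM A A}
    (h : ∀ x y, sect f x y ∘ₗ Θ = Φ ∘ₗ sect f x y) : Θ = act f Φ := by
  ext1 ρ
  refine op_ext_sect f fun x y => ?_; rw [sect_act]; exact LinearMap.congr_fun (h x y) ρ

theorem Party.execL_act {U X Ω M : Reg} (P : Party U X Ω M) (rounds : ℕ) (f : A ↪ W)
    (b : ℕ → LM (M ⊕ A) (M ⊕ A)) (ω : Bits Ω) (u : Bits U) (x : Bits X) :
    P.execL rounds (fun t => act (onSnd M f) (b t)) ω u x = act f (P.execL rounds b ω u x) :=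
  eq_act_of_sect fun p q => P.execL_intertwine rounds _ b (sect f p q)
    (fun _ _ => ext_sect_act f p q _) ω u x

theorem fexecL_act (L : Bits U → Bits V → Bits X → Bits Y → ℝ) (f : A ↪ W) (query : LM (V ⊕ A) (V ⊕
    A)) (reply : LM (Y ⊕ A) (Y ⊕ A)) (u : Bits U) (x : Bits X) : fexecL L (act (onSnd V f) query)
    (act (onSnd Y f) reply) u x = act f (fexecL L query reply u x) :=
  eq_act_of_sect fun p q => fexecL_intertwine L (sect f p q) (ext_sect_act f p q _)
    (ext_sect_act f p q _) u x

theorem cut_loadL (g : A ↪ W) (v : Bits C → Bits A) (c : Bits C) (ρ : Op (C ⊕ W)) : cut c c (loadL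
    (g.trans inr) (fun x : Bits (C ⊕ W) => v (x ∘ Sum.inl)) ρ) = act g (replaceL (ket (v c))) (cut c
    c ρ) := by
  ext x y; rw [cut_apply, loadL_apply, act_apply]
  change (if x ∘ g = v c ∧ y ∘ g = v c then _ else 0) = (sect g x y (cut c c ρ)).trace *
    (if x ∘ g = v c ∧ y ∘ g = v c then 1 else 0)
  simp [write_trans]; split_ifs <;> rfl

theorem act_replaceL_reduceL (f : A ↪ W) (g : B ↪ W) (h : ∀ a b, f a ≠ g b) (κ : Op A)
    (ρ : Op W) : reduceL g (act f (replaceL κ) ρ) = κ.trace • reduceL g ρ := by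
  let e := joint f g h; have e1 : f = inl.trans e := rfl; have e2 : g = inr.trans e := rfl
  rw [e2, reduceL_trans, reduceL_trans]
  conv_lhs => rw [e1, act_trans, reduceL_act]
  generalize reduceL e ρ = σ; ext x y
  simp only [reduceL_inr, Matrix.sum_apply, Matrix.smul_apply, smul_eq_mul]
  have h1 : ∀ a, block a (act inl (replaceL κ) σ) x y
      = κ a a * ∑ a', σ (elim a' x) (elim a' y) := by
    intro a; change (act inl (replaceL κ) σ) (elim a x) (elim a y) = _; rw [act_apply]
    change (sect inl _ _ σ).trace * _ = _; rw [mul_comm]; congr 1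
    exact sum_congr rfl fun a' _ => sect_inl _ _ _ _ _
  simp only [h1, ← sum_mul]; rfl

section Product

variable {ι : Type} [Fintype ι] [DecidableEq ι] {A : ι → Type} [∀ q, Fintype (A q)]
  [∀ q, DecidableEq (A q)]

/-! ### Product states -/

def prodOp (e : ∀ q, A q ↪ W) (κ : ∀ q, Op (A q)) : Op W :=
  of fun x y => ∏ q, κ q (x ∘ e q) (y ∘ e q)

theorem act_prodOp (e : ∀ q, A q ↪ W) (h : ∀ q q', q ≠ q' → ∀ a b, e q a ≠ e q' b)
    (κ : ∀ q, Op (A q)) (q : ι) (Φ : LM (A q) (A q)) :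
    act (e q) Φ (prodOp e κ) = prodOp e (update κ q (Φ (κ q))) := by
  ext x y; rw [act_apply]; let c := ∏ q' ∈ Finset.univ.erase q, κ q' (x ∘ e q') (y ∘ e q')
  have h1 : sect (e q) x y (prodOp e κ) = c • κ q := by
    ext a b; change ∏ q', κ q' (write (e q) a x ∘ e q') (write (e q) b y ∘ e q') = c * _
    rw [← Finset.prod_erase_mul _ _ (mem_univ q), write_comp, write_comp]; congr 1
    refine Finset.prod_congr rfl fun q' hq' => ?_
    rw [write_disjoint _ _ (h q q' (Finset.ne_of_mem_erase hq').symm),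
      write_disjoint _ _ (h q q' (Finset.ne_of_mem_erase hq').symm)]
  rw [h1, map_smul]; change c * _ = ∏ q', update κ q (Φ (κ q)) q' (x ∘ e q') (y ∘ e q')
  rw [← Finset.prod_erase_mul _ _ (mem_univ q), update_self]; congr 1
  refine Finset.prod_congr rfl fun q' hq' => ?_; rw [update_of_ne (Finset.ne_of_mem_erase hq')]

theorem listL_prodOp (e : ∀ q, A q ↪ W) (h : ∀ q q', q ≠ q' → ∀ a b, e q a ≠ e q' b) (Φ : ∀ q, LM (A
    q) (A q)) (l : List ι) (hl : l.Nodup) (κ : ∀ q, Op (A q)) : listL (l.map fun q => act (e q) (Φ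
    q)) (prodOp e κ) = prodOp e fun q => if q ∈ l then Φ q (κ q) else κ q := by
  induction l generalizing κ with
  | nil => simp [listL]
  | cons q l ih =>
    rw [List.nodup_cons] at hl; rw [map_cons, listL, comp_apply, act_prodOp e h, ih hl.2]
    congr 1; funext q'; by_cases hq : q' = q
    · subst hq; rw [if_neg hl.1, update_self, if_pos (by simp)]
    rw [update_of_ne hq]; simp [hq]

theorem prodOp_ket (e : ∀ q, A q ↪ W) (hs : ∀ w, ∃ q a, e q a = w) (b : Bits W) :
    prodOp e (fun q => ket (b ∘ e q)) = ket b := by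
  ext x y
  change (∏ q, if x ∘ e q = b ∘ e q ∧ y ∘ e q = b ∘ e q then (1 : ℂ) else 0)
    = if x = b ∧ y = b then 1 else 0
  have h : ∀ z : Bits W, z = b ↔ ∀ q, z ∘ e q = b ∘ e q := by
    intro z; refine ⟨fun h q => by rw [h], fun h => funext fun w => ?_⟩
    obtain ⟨q, a, rfl⟩ := hs w; exact congrFun (h q) a
  rw [Finset.prod_ite_zero]; simp only [Finset.prod_const_one]; refine if_congr ?_ rfl rfl
  rw [h x, h y]; simp [forall_and]

def bitsEquiv (e : ∀ q, A q ↪ W) (h : ∀ q q', q ≠ q' → ∀ a b, e q a ≠ e q' b)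
    (hs : ∀ w, ∃ q a, e q a = w) : Bits W ≃ ∀ q, Bits (A q) :=
  Equiv.ofBijective (fun x q => x ∘ e q) (by
    constructor
    · intro x y hxy; funext w; obtain ⟨q, a, rfl⟩ := hs w; exact congrFun (congrFun hxy q) a
    intro z
    choose q a hqa using hs
    refine ⟨fun w => z (q w) (a w), funext fun p => funext fun b => ?_⟩
    have h1 : q (e p b) = p := by by_contra hne; exact h _ _ hne _ _ (hqa (e p b))
    change z (q (e p b)) (a (e p b)) = z p b; have h2 := hqa (e p b)
    revert h2
    generalize a (e p b) = a'; generalize q (e p b) = q' at h1 a'; subst h1; intro h2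
    rw [(e q').injective h2])

theorem sum_prod_bits {R : Type*} [CommSemiring R] (e : ∀ q, A q ↪ W)
    (h : ∀ q q', q ≠ q' → ∀ a b, e q a ≠ e q' b) (hs : ∀ w, ∃ q a, e q a = w)
    (f : ∀ q, Bits (A q) → R) : ∑ x : Bits W, ∏ q, f q (x ∘ e q) = ∏ q, ∑ a, f q a := by
  rw [Finset.prod_univ_sum, Fintype.piFinset_univ]
  exact Fintype.sum_equiv (bitsEquiv e h hs) _ _ fun _ => rfl

theorem trace_prodOp (e : ∀ q, A q ↪ W) (h : ∀ q q', q ≠ q' → ∀ a b, e q a ≠ e q' b) (hs : ∀ w, ∃ q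
    a, e q a = w) (κ : ∀ q, Op (A q)) : (prodOp e κ).trace = ∏ q, (κ q).trace :=
  sum_prod_bits e h hs fun q a => κ q a a

open scoped MatrixOrder Matrix.Norms.L2Operator in
theorem exists_eq_conjTranspose_mul_self {ρ : Op W} (h : ρ.PosSemidef) :
    ∃ B : Op W, ρ = Bᴴ * B := CStarAlgebra.nonneg_iff_eq_star_mul_self.mp h.nonneg

theorem posSemidef_prodOp (e : ∀ q, A q ↪ W) (h : ∀ q q', q ≠ q' → ∀ a b, e q a ≠ e q' b)
    (hs : ∀ w, ∃ q a, e q a = w) {κ : ∀ q, Op (A q)} (hκ : ∀ q, (κ q).PosSemidef) :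
    (prodOp e κ).PosSemidef := by
  have h1 : ∀ q, ∃ B : Op (A q), κ q = Bᴴ * B := fun q =>
    exists_eq_conjTranspose_mul_self (hκ q)
  choose B hB using h1
  have h2 : prodOp e κ = (prodOp e B)ᴴ * prodOp e B := by
    ext x y
    change ∏ q, κ q (x ∘ e q) (y ∘ e q)
      = ∑ z, star (∏ q, B q (z ∘ e q) (x ∘ e q)) * ∏ q, B q (z ∘ e q) (y ∘ e q)
    simp only [hB, Matrix.mul_apply, Matrix.conjTranspose_apply]
    rw [← sum_prod_bits e h hs fun q a => star (B q a (x ∘ e q)) * B q a (y ∘ e q)]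
    refine sum_ext fun z => ?_; rw [Finset.prod_mul_distrib, star_prod]
  rw [h2]; exact Matrix.posSemidef_conjTranspose_mul_self _

end Product

theorem cut_act_tensorL (f : A ↪ W) (Θ : LM (M ⊕ A) (M ⊕ A)) (v v' : Bits M) (σ : Op M) :
    cut v v' ∘ₗ act (onSnd M f) Θ ∘ₗ tensorL σ = act f (cut v v' ∘ₗ Θ ∘ₗ tensorL σ) := by
  refine eq_act_of_sect fun p q => ?_
  ext1 ρ
  have h := fun τ => LinearMap.congr_fun (ext_sect_act f p q Θ) τ; simp only [comp_apply] at h ⊢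
  rw [← cut_ext, h, ← tensor_eq, ext_tensor]; rfl

theorem reduce_act_tensorL (f : A ↪ W) (Θ : LM (M ⊕ A) (M ⊕ A)) (σ : Op M) : reduceL inr ∘ₗ act
    (onSnd M f) Θ ∘ₗ tensorL σ = act f (reduceL inr ∘ₗ Θ ∘ₗ tensorL σ) := by
  refine eq_act_of_sect fun p q => ?_
  ext1 ρ
  have h := fun τ => LinearMap.congr_fun (ext_sect_act f p q Θ) τ; simp only [comp_apply] at h ⊢
  rw [← reduceL_inr_ext, h, ← tensor_eq, ext_tensor]; rfl

theorem act_sum {ι : Type*} (s : Finset ι) (f : A ↪ W) (Φ : ι → LM A A) :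
    act f (∑ i ∈ s, Φ i) = ∑ i ∈ s, act f (Φ i) := by
  ext ρ x y; simp [act_apply, LinearMap.sum_apply, Matrix.sum_apply]

theorem act_smul (c : ℂ) (f : A ↪ W) (Φ : LM A A) : act f (c • Φ) = c • act f Φ := by
  ext ρ x y; simp [act_apply]

theorem tensor_cut_ket (c : Bits C) (ρ : Op (C ⊕ W)) :
    dephaseL inl ρ = ∑ c, tensor (ket c) (cut c c ρ) :=
  sum_emb_inr_block ρ

theorem dephase_send (Θ : LM (C ⊕ W) (C ⊕ W)) (ρ : Op (C ⊕ W)) : dephaseL inl (Θ (dephaseL inl ρ)) =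
    ∑ c, ∑ c', tensor (ket c') ((cut c' c' ∘ₗ Θ ∘ₗ tensorL (ket c)) (cut c c ρ)) := by
  rw [tensor_cut_ket zeros ρ]; simp only [map_sum]; refine sum_ext fun c => ?_
  rw [tensor_cut_ket zeros]; rfl

theorem replaceL_ket_tp (b : Bits A) : TP (replaceL (ket b) : LM A A) := fun ρ => by
  rw [replaceL_apply, trace_smul, trace_ket, smul_eq_mul, mul_one]

theorem reduceL_joint_replaceL (f : A ↪ W) (e : B ↪ W) (h : ∀ a b, f a ≠ e b) (κ : Op B)
    (ρ : Op W) : reduceL (joint f e h) (act e (replaceL κ) ρ) = tensor (reduceL f ρ) κ := by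
  have h1 : act e (replaceL κ) = act (joint f e h) (act inr (replaceL κ)) := by
    rw [← act_trans, joint_inr]
  rw [h1, reduceL_act, act_inr_replaceL, ← reduceL_trans, joint_inl]

theorem maskL_act_comm (f : A ↪ W) (Φ : LM A A) (p : Bits W → Prop) [DecidablePred p] (hp : ∀ b x, p
    (write f b x) ↔ p x) (ρ : Op W) : maskL p (act f Φ ρ) = act f Φ (maskL p ρ) := by
  ext x y; rw [maskL_apply, act_apply, act_apply]
  have h : sect f x y (maskL p ρ) = if p x ∧ p y then sect f x y ρ else 0 := by
    ext a b; rw [sect_apply, maskL_apply]; by_cases h : p x ∧ p y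
    · rw [if_pos h, if_pos ⟨(hp _ _).2 h.1, (hp _ _).2 h.2⟩]; rfl
    rw [if_neg h, if_neg fun h' => h ⟨(hp _ _).1 h'.1, (hp _ _).1 h'.2⟩]; rfl
  rw [h]; split_ifs <;> simp

theorem act_inl_replaceL (κ : Op A) (ρ : Op (A ⊕ B)) :
    act inl (replaceL κ) ρ = tensor κ (reduceL inr ρ) := by
  ext x y; rw [act_apply, replaceL_apply, Matrix.smul_apply, smul_eq_mul, mul_comm]
  change _ = κ (x ∘ Sum.inl) (y ∘ Sum.inl) * reduceL inr ρ (x ∘ Sum.inr) (y ∘ Sum.inr); congr 1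
  rw [reduceL_inr, Matrix.sum_apply]; simp only [trace, Matrix.diag, sect_inl]; rfl

theorem reduceL_joint_replaceL' (f : A ↪ W) (e : B ↪ W) (h : ∀ a b, f a ≠ e b) (κ : Op A)
    (ρ : Op W) : reduceL (joint f e h) (act f (replaceL κ) ρ) = tensor κ (reduceL e ρ) := by
  have h1 : act f (replaceL κ) = act (joint f e h) (act inl (replaceL κ)) := by
    rw [← act_trans, joint_inl]
  rw [h1, reduceL_act, act_inl_replaceL, ← reduceL_trans, joint_inr]

theorem dephase_loadL_eq (f : A ↪ W) (g : B ↪ W) (h : ∀ a b, f a ≠ g b) {v : Bits B → Bits A} (hv :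
    Function.Injective v) (ρ : Op W) : dephaseL f (loadL f (fun x => v (x ∘ g)) ρ) = ∑ t, act f
    (replaceL (ket (v t))) (maskL (fun x => x ∘ g = t) ρ) := by
  ext x y; rw [dephaseL_apply, loadL_apply, Matrix.sum_apply]
  have e : ∀ t, act f (replaceL (ket (v t))) (maskL (fun x => x ∘ g = t) ρ) x y
      = if t = x ∘ g then (if x ∘ f = v (x ∘ g) ∧ y ∘ f = v (y ∘ g) ∧ x ∘ g = y ∘ g then
        ∑ s, ρ (write f s x) (write f s y) else 0) else 0 := by
    intro t; rw [act_apply, replaceL_apply, Matrix.smul_apply, smul_eq_mul]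
    simp only [trace, Matrix.diag, sect_apply, maskL_apply, write_disjoint f g h, ket, of_apply]
    by_cases h1 : t = x ∘ g
    · subst h1; by_cases h2 : x ∘ g = y ∘ g
      · simp [h2]
      simp [h2, Ne.symm h2]
    simp [h1, Ne.symm h1]
  rw [sum_ext fun t => e t, Finset.sum_ite_eq' univ, if_pos (mem_univ _)]
  by_cases h1 : x ∘ f = v (x ∘ g) ∧ y ∘ f = v (y ∘ g)
  · by_cases h2 : x ∘ g = y ∘ g
    · rw [if_pos (by rw [h1.1, h1.2, h2]), if_pos h1, if_pos ⟨h1.1, h1.2, h2⟩]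
    rw [if_neg (fun e => h2 (hv (by rw [← h1.1, ← h1.2, e]))), if_neg (fun e : _ ∧ _ ∧ _ => h2 e.2.2)]
  rw [if_neg h1, if_neg (fun e : _ ∧ _ ∧ _ => h1 ⟨e.1, e.2.1⟩), ite_self]

theorem maskL_false {p : Bits W → Prop} [DecidablePred p] (h : ∀ x, ¬ p x) (ρ : Op W) :
    maskL p ρ = 0 := by
  ext x y; rw [maskL_apply, if_neg fun e => h x e.1]; rfl

theorem maskL_replaceL (f : A ↪ W) (v : Bits A) (ρ : Op W) :
    maskL (fun x => x ∘ f = v) (act f (replaceL (ket v)) ρ) = act f (replaceL (ket v)) ρ := by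
  ext x y; rw [maskL_apply]; split_ifs with h
  · rfl
  rw [act_apply, replaceL_apply, Matrix.smul_apply]; simp only [ket, of_apply]
  rw [if_neg h, smul_zero]

theorem maskL_congr_of_supp {p q s : Bits W → Prop} [DecidablePred p] [DecidablePred q]
    [DecidablePred s] {ρ : Op W} (hs : maskL s ρ = ρ) (h : ∀ x, s x → (p x ↔ q x)) :
    maskL p ρ = maskL q ρ := by
  rw [← hs, maskL_maskL, maskL_maskL]
  exact LinearMap.congr_fun (maskL_congr fun x => and_congr_right (h x)) ρ

theorem maskL_and {p q : Bits W → Prop} [DecidablePred p] [DecidablePred q]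
    {ρ : Op W} (hp : maskL p ρ = ρ) (hq : maskL q ρ = ρ) : maskL (fun x => p x ∧ q x) ρ = ρ := by
  rw [← maskL_maskL, hp, hq]

theorem loadL_dephaseL_eq (f : A ↪ W) (g : B ↪ W) (h : ∀ a b, f a ≠ g b) (v : Bits B → Bits A) (ρ :
    Op W) : loadL f (fun x => v (x ∘ g)) (dephaseL g ρ) = ∑ t, act f (replaceL (ket (v t))) (maskL
    (fun x => x ∘ g = t) ρ) := by
  ext x y; rw [loadL_apply, Matrix.sum_apply]
  have e : ∀ t, act f (replaceL (ket (v t))) (maskL (fun x => x ∘ g = t) ρ) x y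
      = if t = x ∘ g then (if x ∘ f = v (x ∘ g) ∧ y ∘ f = v (y ∘ g) ∧ x ∘ g = y ∘ g then
        ∑ s, ρ (write f s x) (write f s y) else 0) else 0 := by
    intro t; rw [act_apply, replaceL_apply, Matrix.smul_apply, smul_eq_mul]
    simp only [trace, Matrix.diag, sect_apply, maskL_apply, write_disjoint f g h, ket, of_apply]
    by_cases h1 : t = x ∘ g
    · subst h1; by_cases h2 : x ∘ g = y ∘ g
      · simp [h2]
      simp [h2, Ne.symm h2]
    simp [h1, Ne.symm h1]
  rw [sum_ext fun t => e t, Finset.sum_ite_eq' univ, if_pos (mem_univ _)]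
  simp only [dephaseL_apply, write_disjoint f g h]; by_cases h2 : x ∘ g = y ∘ g
  · simp [h2]
  simp [h2]

/-- `Q ξ` maps `S` into a line. -/
def Lines {ι : Type} (Q : ι → LM W W') (S : Submodule ℂ (Op W)) : Prop :=
  ∀ ξ, ∃ σ, ∀ ρ ∈ S, Q ξ ρ ∈ span ℂ {σ}

theorem Lines.step {ι κ : Type} {Q : ι → LM W W'} {Q' : ι → LM W W''} {S S' : Submodule ℂ (Op W)}
    (hS : Lines Q S) (Ψ : κ → LM W W) (hle : S' ≤ ⨆ l, S.map (Ψ l)) (h : ∀ ξ, ∃ Θ : LM W' W'', ∀ l,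
    Q' ξ ∘ₗ Ψ l = 0 ∨ Q' ξ ∘ₗ Ψ l = Θ ∘ₗ Q ξ) : Lines Q' S' := by
  intro ξ; obtain ⟨Θ, hΘ⟩ := h ξ; obtain ⟨σ, hσ⟩ := hS ξ; refine ⟨Θ σ, fun ρ hρ => ?_⟩
  have : S' ≤ (span ℂ {Θ σ}).comap (Q' ξ) := by
    refine hle.trans (iSup_le fun l => ?_); rintro _ ⟨τ, hτ, rfl⟩
    rw [Submodule.mem_comap, ← comp_apply]; rcases hΘ l with e | e
    · rw [e]; exact zero_mem _
    rw [e, comp_apply]; obtain ⟨k, hk⟩ := Submodule.mem_span_singleton.1 (hσ τ hτ)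
    rw [← hk, map_smul]; exact Submodule.smul_mem _ _ (mem_span_singleton_self _)
  exact this hρ

/-- All slices of `τ` are in `S`. -/
def Slices (S : Submodule ℂ (Op W)) (τ : Op (A ⊕ (C ⊕ W))) : Prop :=
  ∀ s s' c c', cut c c' (cut s s' τ) ∈ S

theorem Slices.mono {S S' : Submodule ℂ (Op W)} {τ : Op (A ⊕ (C ⊕ W))} (h : Slices S τ)
    (hS : S ≤ S') : Slices S' τ := fun s s' c c' => hS (h s s' c c')

theorem Slices.act_front {S : Submodule ℂ (Op W)} {τ : Op (A ⊕ (C ⊕ W))} (h : Slices S τ)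
    (Θ : LM (A ⊕ C) (A ⊕ C)) : Slices S (act (front A C W) Θ τ) := by
  intro s s' c c'
  have e : cut c c' (cut s s' (act (front A C W) Θ τ))
      = ∑ p : Bits (A ⊕ C), ∑ p' : Bits (A ⊕ C),
        Θ (Matrix.single p p' 1) (elim s c) (elim s' c') •
          cut (p ∘ Sum.inr) (p' ∘ Sum.inr) (cut (p ∘ Sum.inl) (p' ∘ Sum.inl) τ) := by
    ext y y'; rw [cut_apply, cut_apply, act_apply, Matrix.matrix_eq_sum_single (sect _ _ _ τ)]
    simp only [map_sum, Matrix.sum_apply, Matrix.smul_apply, smul_eq_mul]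
    refine sum_ext fun p => sum_congr rfl fun p' _ => ?_
    have e1 : ∀ (a : Bits A) (b : Bits C) (y : Bits W),
        (elim a (elim b y) : Bits (A ⊕ (C ⊕ W))) ∘ front A C W = elim a b := by
      intro a b y; funext w; rcases w with w | w <;> rfl
    have e2 : ∀ z : ℂ, Matrix.single p p' z = z • (Matrix.single p p' 1 : Op (A ⊕ C)) := by
      intro z; rw [Matrix.smul_single, smul_eq_mul, mul_one]
    rw [e2, map_smul, Matrix.smul_apply, smul_eq_mul, mul_comm, e1, e1, sect_apply, write_front,
      write_front]
    rfl
  rw [e]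
  exact sum_mem fun p _ => sum_mem fun p' _ => Submodule.smul_mem _ _ (h _ _ _ _)

theorem maskL_tensor (p : Bits A → Prop) (q : Bits B → Prop) [DecidablePred p] [DecidablePred q]
    (ρ : Op A) (σ : Op B) : maskL (fun x => p (x ∘ Sum.inl) ∧ q (x ∘ Sum.inr)) (tensor ρ σ) = tensor
    (maskL p ρ) (maskL q σ) := by
  ext x y; simp only [maskL_apply, tensor, of_apply]
  by_cases h1 : p (x ∘ Sum.inl) <;> by_cases h2 : p (y ∘ Sum.inl) <;>
    by_cases h3 : q (x ∘ Sum.inr) <;> by_cases h4 : q (y ∘ Sum.inr) <;> simp [h1, h2, h3, h4]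

theorem runL_ofList (l : List (Circuit W)) :
    (Circuit.ofList l).runL = listL (l.map Circuit.runL) := by
  induction l with
  | nil => rfl
  | cons C l ih => rw [Circuit.ofList, Circuit.runL, ih]; rfl

theorem listL_emb (f : A ↪ W) (b : Bits W) (l : List (LM A A)) (ρ : Op A) :
    listL (l.map (act f)) (emb f b ρ) = emb f b (listL l ρ) := by
  induction l generalizing ρ with
  | nil => rfl
  | cons Φ l ih =>
    rw [map_cons, listL, listL, comp_apply, act_emb, ih, comp_apply]

theorem onSnd_range (f : A ↪ W) (w : W) :
    (∀ p : M ⊕ A, onSnd M f p ≠ Sum.inr w) ↔ ∀ a, f a ≠ w := by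
  constructor
  · exact fun h a e => h (Sum.inr a) (congrArg Sum.inr e)
  rintro h (m | a) e
  · cases e
  exact h a (Sum.inr_injective e)

theorem cut_emb_onSnd (f : A ↪ W) (b : Bits (M ⊕ W)) (c c' : Bits M) (ρ : Op (M ⊕ A)) :
    cut c c' (emb (onSnd M f) b ρ) = emb f (b ∘ Sum.inr) (cut c c' ρ) := by
  ext x y; rw [cut_apply, emb_apply, emb_apply, cut_apply]
  have e : ∀ (c : Bits M) (x : Bits W), (elim c x : Bits (M ⊕ W)) ∘ onSnd M f
      = elim c (x ∘ f) := fun c x => by funext p; rcases p with p | p <;> rfl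
  rw [e, e]
  refine if_congr ⟨fun h w hw => h (Sum.inr w) ((onSnd_range f w).2 hw), fun h w hw => ?_⟩ rfl rfl
  rcases w with w | w
  · exact absurd rfl (hw (Sum.inl w))
  exact h w ((onSnd_range f w).1 hw)

theorem act_replaceL_emb (f : A ↪ W) (e : B ↪ W) (h : ∀ a b, f a ≠ e b) (σ : Op A) (b : Bits W) (κ :
    Op B) : act f (replaceL σ) (emb e b κ) = emb (joint f e h) b (tensor σ κ) := by
  ext x y; rw [act_apply, replaceL_apply, Matrix.smul_apply, smul_eq_mul, emb_apply]
  simp only [trace, Matrix.diag, sect_apply, emb_apply]; rw [sum_eq_single (b ∘ f)]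
  · rw [write_disjoint f e h, write_disjoint f e h, ite_mul, zero_mul]
    refine if_congr ?_ (mul_comm _ _) rfl; constructor
    · intro hx w hw; have h1 := hx w fun p => hw (Sum.inr p)
      have h2 : ∀ a, f a ≠ w := fun p => hw (Sum.inl p)
      rwa [write_notMem _ _ _ h2, write_notMem _ _ _ h2] at h1
    intro hx w hw; by_cases h2 : ∀ a, f a ≠ w
    · rw [write_notMem _ _ _ h2, write_notMem _ _ _ h2]; exact hx w (Sum.rec h2 hw)
    push Not at h2; obtain ⟨a, rfl⟩ := h2; rw [write_mem, write_mem]; exact ⟨rfl, rfl⟩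
  · intro s _ hs; rw [if_neg]; intro hx; refine hs (funext fun a => ?_)
    have := (hx (f a) fun p e => h a p e.symm).1; rwa [write_mem] at this
  simp

theorem act_onSnd_block (f : A ↪ W) (m : Bits M) (Φ : LM A A) (ρ : Op (M ⊕ W)) :
    act (onSnd M f) (tensorL (ket m) ∘ₗ Φ ∘ₗ cut m m) ρ = tensor (ket m) (act f Φ (cut m m ρ)) := by
  ext x y; rw [act_apply]
  change (ket m : Op M) (x ∘ Sum.inl) (y ∘ Sum.inl) * _ = (ket m : Op M) _ _ * _
  refine congrArg _ ?_; rw [act_apply]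
  change Φ (cut m m (sect (onSnd M f) x y ρ)) (x ∘ Sum.inr ∘ f) (y ∘ Sum.inr ∘ f) = _
  refine congrArg (fun τ : Op A => Φ τ (x ∘ Sum.inr ∘ f) (y ∘ Sum.inr ∘ f)) ?_; ext a a'
  rw [cut_apply, sect_apply, sect_apply, cut_apply]; congr 1
  · rw [← elim_comp x, write_onSnd]; rfl
  rw [← elim_comp y, write_onSnd]; rfl

def prepL (σ : Bits Ω → Op O) : LM (Ω ⊕ O) (Ω ⊕ O) :=
  ∑ ω, tensorL (ket ω) ∘ₗ replaceL (σ ω) ∘ₗ cut ω ω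

theorem reduce_prepL (σ : Bits Ω → Op O) (f : O ↪ W) (ρ : Op (Ω ⊕ W)) : reduceL inr (act (onSnd Ω f)
    (prepL σ) ρ) = ∑ ω, act f (replaceL (σ ω)) (cut ω ω ρ) := by
  rw [prepL, act_sum, LinearMap.sum_apply, map_sum]; refine sum_ext fun ω => ?_
  rw [act_onSnd_block, reduceL_inr, sum_eq_single ω]
  · rw [block_eq_cut, cut_tensor]; simp [ket]
  · intro b _ hb; rw [block_eq_cut, cut_tensor]; simp [ket, hb]
  simp

theorem reduce_emb_swap (ω : Bits Ω) (K' : Bits K) (β : Op (K ⊕ O)) : reduceL (inl : Ω ⊕ O ↪ (Ω ⊕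
    O) ⊕ K) (emb (joint (inr : K ↪ (Ω ⊕ O) ⊕ K) (inr.trans inl) nofun) (elim (elim ω zeros) K') β) =
    tensor (ket ω) (reduceL inr β) := by
  ext x y; rw [reduceL_inl_apply, reduceL_inr]
  change _ = (ket ω : Op Ω) (x ∘ Sum.inl) (y ∘ Sum.inl) * _; rw [Matrix.sum_apply, mul_sum]
  refine sum_ext fun k => ?_; rw [emb_apply, block_eq_cut, cut_apply]
  have e : ∀ z : Bits (Ω ⊕ O), (elim z k : Bits ((Ω ⊕ O) ⊕ K)) ∘ (joint (inr : K ↪ (Ω ⊕ O) ⊕ K)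
      (inr.trans inl) nofun)
      = elim k (z ∘ Sum.inr) := fun z => by funext p; rcases p with p | p <;> rfl
  rw [e, e]; simp only [ket, of_apply, ite_mul, one_mul, zero_mul]
  refine if_congr ⟨fun h => ?_, fun h w hw => ?_⟩ rfl rfl
  · have h1 : ∀ o : Ω, _ := fun o => h (Sum.inl (Sum.inl o)) (by
      rintro (p | p) e <;> cases e)
    exact ⟨funext fun o => (h1 o).1, funext fun o => (h1 o).2⟩
  rcases w with (w | w) | w
  · exact ⟨congrFun h.1 w, congrFun h.2 w⟩
  · exact absurd rfl (hw (Sum.inr w))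
  exact absurd rfl (hw (Sum.inl w))

theorem Impl.prep (C : Circuit ((Ω ⊕ A) ⊕ O)) (D : LM O O) {k : ℕ} (hD : Impl D k) : Impl (prepL
    fun ω => D (reduceL inr (C.runL (tensor (ket (elim ω zeros)) (ket zeros))))) (10 * (card Ω +
    card A + card O + C.size + k + 1)) := by
  let F : (Ω ⊕ A) ⊕ O ↪ (Ω ⊕ O) ⊕ (Ω ⊕ A) := joint inr
    (inr.trans inl) nofun
  let G1 : O ↪ (Ω ⊕ O) ⊕ (Ω ⊕ A) := inr.trans inl; let G2 : Ω ↪ (Ω ⊕ O) ⊕ (Ω ⊕ A) := inl.trans inr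
  let G0 : Ω ↪ (Ω ⊕ O) ⊕ (Ω ⊕ A) := inl.trans inl
  have s1 : Sourced G1 fun _ => zeros := Sourced.const _ _
  have s2 : Sourced G2 fun x => x ∘ G0 := Sourced.comp G0 nofun
  have i1 := ((((Impl.circuit C).act F).comp ((Impl.load s1).comp
    ((Impl.load s2).comp (Impl.dephase G0)))))
  have i2 := Impl.comp (hD.act G1) i1; refine (i2.fresh fun ρ => ?_).mono ?_
  · simp only [comp_apply]
    have hG : SeqComp.act G1 D = SeqComp.act inl
        (SeqComp.act inr D) :=
      act_trans _ _ _
    rw [hG, reduceL_act]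
    have h0 : dephaseL G0 (emb inl zeros ρ)
        = ∑ ω, emb inl zeros (tensor (ket ω) (cut ω ω ρ)) := by
      have : dephaseL G0 = SeqComp.act inl (dephaseL inl) :=
        dephaseL_trans _ _
      rw [this, act_emb, tensor_cut_ket zeros, map_sum]
    rw [h0]; simp only [map_sum]; rw [prepL, LinearMap.sum_apply]; refine sum_ext fun ω => ?_
    let b : Bits ((Ω ⊕ O) ⊕ (Ω ⊕ A)) := elim (elim ω zeros) (elim ω zeros)
    have h1 : emb inl zeros (tensor (ket ω) (cut ω ω ρ))
        = emb G1 (elim (elim ω zeros) zeros) (cut ω ω ρ) := by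
      change _ = emb (inr.trans inl) _ _; rw [emb_trans, emb_inr]
      exact congrFun (congrArg DFunLike.coe (emb_congr _ fun w hw => by
        rcases w with w | w
        · exact absurd rfl (hw w)
        rfl)) _
    have h2 : loadL G2 (fun x => x ∘ G0) (emb G1 (elim (elim ω zeros) zeros) (cut ω ω ρ))
        = emb G1 b (cut ω ω ρ) := by
      rw [loadL_emb _ _ nofun _ (fun x x' h => by
        funext o
        exact h (G0 o) nofun nofun)]
      refine congrFun (congrArg DFunLike.coe (emb_congr _ fun w hw => ?_)) _
      rcases w with w | w | w
      · rw [write_notMem _ _ _ nofun]; rfl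
      · exact (write_mem G2 _ _ w).trans rfl
      rw [write_notMem _ _ _ nofun]; rfl
    have h3 : loadL G1 (fun _ => zeros) (emb G1 b (cut ω ω ρ)) = (cut ω ω ρ).trace • ket b := by
      rw [loadL_const, act_emb, replaceL_apply, map_smul, emb_ket]; congr 2; funext w
      rcases w with (w | w) | w
      · rw [write_notMem _ _ _ nofun]
      · exact (write_mem G1 _ _ w).trans rfl
      rw [write_notMem _ _ _ nofun]
    have h4 : (ket b : Op ((Ω ⊕ O) ⊕ (Ω ⊕ A)))
        = emb F b (tensor (ket (elim ω zeros)) (ket zeros)) := by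
      rw [tensor_ket_ket, emb_ket]; congr 1; funext w; rcases w with (w | w) | w
      · rw [write_notMem]; rintro (a | a) e <;> cases e
      · exact (write_mem F (elim (elim ω zeros) zeros) b (Sum.inr w)).symm
      exact (write_mem F (elim (elim ω zeros) zeros) b (Sum.inl w)).symm
    rw [h1, h2, h3, map_smul, h4, act_emb, map_smul, reduce_emb_swap, map_smul, act_inr, ext_tensor]
    simp only [comp_apply, replaceL_apply, map_smul]; rfl
  simp only [card_sum]; omega

theorem emb_inr_inr_inr {b : Bits (A ⊕ (B ⊕ (C ⊕ D)))} {x : Bits A} {y : Bits B} {z : Bits C} (hx :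
    b ∘ Sum.inl = x) (hy : (b ∘ Sum.inr) ∘ Sum.inl = y) (hz : ((b ∘ Sum.inr) ∘ Sum.inr) ∘ Sum.inl =
    z) (κ : Op D) : emb (inr.trans (inr.trans inr)) b κ = tensor (ket x) (tensor (ket y) (tensor
    (ket z) κ)) := by
  subst hx hy hz; rw [emb_trans, emb_trans, emb_inr, emb_inr, emb_inr]; rfl

def answerL (φ : Op G →ₗ[ℂ] ℂ) (b : Bits G) : LM G G :=
  φ.smulRight (ket b) + (trL - φ).smulRight (ket zeros)

theorem answerL_apply (φ : Op G →ₗ[ℂ] ℂ) (b : Bits G) (ρ : Op G) :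
    answerL φ b ρ = φ ρ • ket b + (ρ.trace - φ ρ) • ket zeros := rfl

theorem Impl.answer {φ : Op G →ₗ[ℂ] ℂ} {n : ℕ} (h : Test φ n) (b : Bits G) :
    Impl (answerL φ b) (4 * n + 4 * card G + 7) := by
  obtain ⟨T, C, w, hT, hC, hφ⟩ := h
  have l : ∀ b : Bits G, Impl (loadL (inl : G ↪ G ⊕ T) fun _ => b)
      (2 * card G + 2) := fun b => Impl.load (Sourced.const _ _)
  have i := ((l zeros).branch w (l b)).comp (Impl.circuit C)
  refine (i.fresh fun ρ => ?_).mono (by omega)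
  simp only [comp_apply, LinearMap.add_apply, map_add, loadL_const]
  rw [reduceL_act, reduceL_act, replaceL_apply, replaceL_apply, trace_reduceL, trace_reduceL,
    hφ, reduceL_emb, answerL_apply, add_comm]
  congr 2; have h1 := trace_project_add w (C.runL (emb inl zeros ρ))
  rw [hφ, reduceL_emb, runL_tp] at h1
  have h2 : (emb (inl : G ↪ G ⊕ T) zeros ρ).trace = ρ.trace := by
    rw [← trace_reduceL inl, reduceL_emb]
  rw [← h2, ← h1, add_sub_cancel_right]

theorem bitL_ket (w : G) (b : Bits G) : bitL w (ket b) = if b w = true then 1 else 0 := by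
  change (project w true (ket b)).trace = _; split_ifs with h
  · rw [← trace_ket b]; congr 1; ext x y; simp only [project, ket, of_apply]
    by_cases hx : x = b <;> by_cases hy : y = b <;> simp [hx, hy, h]
  rw [← Matrix.trace_zero (Bits G) ℂ]; congr 1; ext x y
  simp only [project, ket, of_apply, Matrix.zero_apply]; by_cases hx : x = b <;> simp [hx, h]

theorem Test.bounded {φ : Op G →ₗ[ℂ] ℂ} {n : ℕ} (h : Test φ n) : Bounded φ := by
  obtain ⟨T, C, w, -, -, hφ⟩ := h; intro ρ hρ
  have h1 := ((bounded_bitL w).comp (pp_runL C) (runL_tp C)) (tensor ρ (ket zeros))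
    (posSemidef_tensor hρ (posSemidef_ket _))
  have h2 : reduceL inl (tensor ρ (ket zeros) : Op (G ⊕ T)) = ρ := by
    have := reduceL_emb (inl : G ↪ G ⊕ T) zeros ρ; rwa [emb_inl] at this
  rw [trace_tensor, trace_ket, mul_one, comp_apply] at h1
  change ‖(projectL w true (C.runL _)).trace‖ ≤ _ at h1; rwa [hφ, h2] at h1

theorem reduceL_equiv (e : A ≃ W) (ρ : Op W) (x y : Bits A) :
    reduceL e.toEmbedding ρ x y = ρ (x ∘ e.symm) (y ∘ e.symm) := by
  change ∑ z : Bits W, (if z ∘ e.toEmbedding = x then ρ z (write e.toEmbedding y z) else 0) = _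
  have h : ∀ (y : Bits A) (z : Bits W), write e.toEmbedding y z = y ∘ e.symm := fun y z => by
    funext w; obtain ⟨a, rfl⟩ := e.surjective w
    exact (write_mem e.toEmbedding y z a).trans (by simp)
  rw [sum_eq_single (x ∘ e.symm)]
  · rw [if_pos (by funext a; simp), h]
  · intro z _ hz; refine if_neg fun h => hz ?_; rw [← h]; funext w; simp
  simp

theorem loadL_inl_tensor (v : Bits (A ⊕ B) → Bits A) (b : Bits A) (ρ : Op B) (hv : ∀ a a' y, v (elim
    a y) = v (elim a' y)) (x y : Bits (A ⊕ B)) : loadL inl v (tensor (ket b) ρ) x y = if x ∘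
    Sum.inl = v x ∧ y ∘ Sum.inl = v y then ρ (x ∘ Sum.inr) (y ∘ Sum.inr) else 0 := by
  rw [loadL_apply]; refine if_congr Iff.rfl ?_ rfl; rw [sum_eq_single b]
  · rw [← elim_comp x, ← elim_comp y, write_inl, write_inl]; simp [tensor, ket]
  · intro c _ hc; rw [← elim_comp x, ← elim_comp y, write_inl, write_inl]; simp [tensor, ket, hc]
  simp

theorem permL_ket_write (σ : Equiv.Perm W) (f g : A ↪ W) (h : ∀ a, σ (g a) = f a) (ω : Bits A) :
    permL σ (ket (write g ω zeros)) = ket (write f ω zeros) := by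
  have e : ∀ x : Bits W, x ∘ σ = write g ω zeros ↔ x = write f ω zeros := fun x => by
    constructor
    · intro hx; refine bits_ext_wire f ?_ fun w hw => ?_
      · rw [write_comp]; funext a; have := congrFun hx (g a); rw [write_mem] at this; rw [← this]
        exact congrArg x (h a).symm
      rw [write_notMem f _ _ hw]; obtain ⟨v, rfl⟩ := σ.surjective w
      exact (congrFun hx v).trans
        (write_notMem g _ _ fun a ha => hw a (by rw [← h, ha]))
    rintro rfl; refine bits_ext_wire g ?_ fun w hw => ?_
    · rw [write_comp]; funext a
      exact (congrArg (write f ω zeros) (h a)).trans (write_mem f ω zeros a)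
    rw [write_notMem g _ _ hw]
    exact write_notMem f _ _ fun a ha => hw a (σ.injective (by rw [h, ha]))
  ext x y; change ket _ (x ∘ σ) (y ∘ σ) = _; simp only [ket, of_apply, e]

/-- From an efficient operation to an input sampler. -/
theorem exists_sampler_circuit {Θ : LM G G} {n : ℕ} (h : Impl Θ n) (i : A ↪ G) (o : B ↪ G) : ∃ (N :
    Reg) (C : Circuit ((A ⊕ N) ⊕ B)), card N ≤ card G + n ∧ C.size ≤ card A + card B + n ∧ ∀ ω,
    reduceL inr (C.runL (tensor (ket (elim ω zeros)) (ket zeros))) = reduceL o (Θ (ket (write i ω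
    zeros))) := by
  obtain ⟨T, C, hT, hC, hΘ⟩ := h; let N : G ⊕ T ↪ (A ⊕ (G ⊕ T)) ⊕ B := inr.trans inl
  let gA : A ↪ (A ⊕ (G ⊕ T)) ⊕ B := inl.trans inl
  let fA : A ↪ (A ⊕ (G ⊕ T)) ⊕ B := (i.trans inl).trans N
  let oB : B ↪ (A ⊕ (G ⊕ T)) ⊕ B := (o.trans inl).trans N
  obtain ⟨σ, C₁, s1, r1, h1⟩ := exists_permC fA gA
  obtain ⟨τ, C₂, s2, r2, h2⟩ := exists_permC inr oB
  refine ⟨⟨G ⊕ T⟩, .seq C₁ (.seq (C.map N) C₂), ?_, ?_, fun ω => ?_⟩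
  · simp only [card_sum]; omega
  · simp only [Circuit.size, size_map]; omega
  have e1 : (tensor (ket (elim ω zeros)) (ket zeros) : Op ((A ⊕ (G ⊕ T)) ⊕ B))
      = ket (write gA ω zeros) := by
    rw [tensor_ket_ket]; congr 1
    rw [write_trans, ← elim_zeros (A := A ⊕ (G ⊕ T)) (B := B), write_inl]; congr 1
    rw [elim_comp_einl, ← elim_zeros (A := A) (B := G ⊕ T), write_inl]
  have e2 : (ket (write fA ω zeros) : Op ((A ⊕ (G ⊕ T)) ⊕ B))
      = emb N zeros (emb inl zeros (ket (write i ω zeros))) := by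
    rw [emb_ket, emb_ket, write_trans (i.trans inl) N, write_trans i]; rfl
  change reduceL inr (C₂.runL ((C.map N).runL (C₁.runL _))) = _
  rw [r2, reduceL_permL τ _ _ h2, r1, e1, permL_ket_write σ _ _ h1, e2, runL_map, act_emb,
    reduceL_trans, reduceL_emb, reduceL_trans, hΘ, reduceL_emb]

theorem PolyBounded.mono {f g : ℕ → ℕ} (h : PolyBounded g) (hfg : ∀ m, f m ≤ g m) :
    PolyBounded f := by
  obtain ⟨p, hp⟩ := h; exact ⟨p, fun m => (hfg m).trans (hp m)⟩

theorem PolyBounded.add {f g : ℕ → ℕ} (hf : PolyBounded f) (hg : PolyBounded g) :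
    PolyBounded fun m => f m + g m := by
  obtain ⟨p, hp⟩ := hf; obtain ⟨q, hq⟩ := hg
  exact ⟨p + q, fun m => by rw [Polynomial.eval_add]; exact add_le_add (hp m) (hq m)⟩

theorem PolyBounded.mul {f g : ℕ → ℕ} (hf : PolyBounded f) (hg : PolyBounded g) :
    PolyBounded fun m => f m * g m := by
  obtain ⟨p, hp⟩ := hf; obtain ⟨q, hq⟩ := hg
  exact ⟨p * q, fun m => by rw [Polynomial.eval_mul]; exact Nat.mul_le_mul (hp m) (hq m)⟩

theorem PolyBounded.const (c : ℕ) : PolyBounded fun _ => c :=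
  ⟨Polynomial.C c, fun m => by simp⟩

theorem PolyBounded.sum {ι : Type*} (s : Finset ι) {f : ι → ℕ → ℕ}
    (h : ∀ i ∈ s, PolyBounded (f i)) : PolyBounded fun m => ∑ i ∈ s, f i m := by
  classical
  induction s using Finset.induction_on with
  | empty => exact PolyBounded.const 0
  | insert i s hi ih =>
    simp only [Finset.sum_insert hi]
    exact (h i (s.mem_insert_self i)).add (ih fun j hj => h j (Finset.mem_insert_of_mem hj))

theorem Negligible.mono {ε δ : ℕ → ℝ} (h : Negligible ε) (hδ : ∀ m, |δ m| ≤ |ε m|) : Negligible δ :=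
  Asymptotics.SuperpolynomialDecay.trans_eventually_abs_le h (Eventually.of_forall hδ)

section Legitimacy

variable {Ω U Z V : ℕ → Reg} (S : Sampler Ω U Z V)

theorem Sampler.part_eq (m : ℕ) (ω : Bits (Ω m)) (a : Bits (S.aux m)) (u : Bits (U m))
    (z : Bits (Z m)) : S.part m ω a u z = cut z z (S.state m ω a u) := rfl

theorem Sampler.legitimate_of_lines (h : ∀ m ω z, ∃ σ, ∀ a u, cut z z (S.state m ω a u) ∈
    span ℂ {σ}) : S.Legitimate := by
  intro m ω a u z; obtain ⟨σ, hσ⟩ := h m ω z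
  choose c hc using fun a u => Submodule.mem_span_singleton.1 (hσ a u)
  have hp : ∀ a u, S.part m ω a u z = c a u • σ := fun a u => (hc a u).symm
  have hm : S.marginal m ω z = (∑ a, ∑ u, c a u) • σ := by
    simp only [Sampler.marginal, hp, Finset.sum_smul]
  rw [hm, hp, trace_smul, trace_smul, smul_smul, smul_smul, smul_eq_mul, smul_eq_mul]
  congr 1; ring

theorem Sampler.posSemidef_state (m : ℕ) (ω : Bits (Ω m)) (a : Bits (S.aux m))
    (u : Bits (U m)) : (S.state m ω a u).PosSemidef := by
  have h : (ket (elim (elim ω zeros) zeros) :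
      Op ((Ω m ⊕ S.anc m) ⊕ ((S.aux m ⊕ U m) ⊕ (Z m ⊕ V m)))).PosSemidef := posSemidef_ket _
  have h1 := pp_dephaseL (inl : Z m ↪ Z m ⊕ V m) _
    (pp_cut (elim a u) _ (pp_reduceL inr _ (pp_runL (S.circ m) _ h)))
  rw [← tensor_ket_ket] at h1; rwa [Sampler.state, run_eq]

theorem Sampler.lines_of_legitimate (h : S.Legitimate) (m : ℕ) (ω : Bits (Ω m)) (z : Bits (Z m)) :
    ∃ σ, ∀ p : Bits (S.aux m) × Bits (U m), cut z z (S.state m ω p.1 p.2) ∈ span ℂ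
    {σ} := by
  have hp : ∀ a u, (S.part m ω a u z).PosSemidef := fun a u =>
    pp_cut z _ (S.posSemidef_state m ω a u)
  refine ⟨S.marginal m ω z, fun p => ?_⟩; have h1 := h m ω p.1 p.2 z
  by_cases h0 : (S.marginal m ω z).trace = 0
  · have h2 : (S.part m ω p.1 p.2 z).trace = 0 := by
      have h3 : ∑ p : Bits (S.aux m) × Bits (U m), (S.part m ω p.1 p.2 z).trace = 0 := by
        rw [← h0, Sampler.marginal, trace_sum, Fintype.sum_prod_type]
        exact sum_ext fun a => (trace_sum _ _).symm
      exact (Finset.sum_eq_zero_iff_of_nonneg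
        fun p _ => (hp p.1 p.2).trace_nonneg).1 h3 p (mem_univ _)
    have h4 := (hp p.1 p.2).trace_eq_zero_iff.1 h2; rw [S.part_eq] at h4; rw [h4]; exact zero_mem _
  rw [← S.part_eq]
  refine Submodule.mem_span_singleton.2
    ⟨(S.marginal m ω z).trace⁻¹ * (S.part m ω p.1 p.2 z).trace, ?_⟩
  rw [mul_smul, ← h1, smul_smul, inv_mul_cancel₀ h0, one_smul]

end Legitimacy

/-- An input sampler and a distinguisher for one value of the security parameter. -/
structure Trial (Ω U X Z V : Reg) (N : ℕ) where
  aux : Reg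
  G : Reg
  Θ : LM G G
  inp : Ω ↪ G
  out : (aux ⊕ U) ⊕ (Z ⊕ V) ↪ G
  ψ : Op ((aux ⊕ X) ⊕ V) →ₗ[ℂ] ℂ
  st : Bits Ω → Bits aux → Bits U → Op (Z ⊕ V)
  impl : Impl Θ N
  test : Test ψ N
  card_G : card G ≤ N
  eq : ∀ ω a u, dephaseL inl
    (cut (elim a u) (elim a u) (reduceL out (Θ (ket (write inp ω zeros))))) = st ω a u
  lines : ∀ ω z, ∃ σ, ∀ a u, cut z z (st ω a u) ∈ span ℂ {σ}

def Trial.value {Ω U X Z V : Reg} {N : ℕ} (T : Trial Ω U X Z V N)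
    (Ex : Bits Ω → Bits U → Bits X → LM (Z ⊕ V) V) : ℂ :=
  T.ψ (∑ a, ∑ x, tensor (ket (elim a x)) (∑ w, ∑ u, Ex w u x (T.st w a u)))

section Security

variable {F : Functionality} {P : QProtocol F}

theorem act_perm_out (L : Bits U → Bits E → Bits X → Bits M → ℝ) (query : Circuit (E ⊕ W)) (reply :
    Circuit (M ⊕ W)) (out out' : Y ↪ W) : ∃ reply' : Circuit (M ⊕ W), reply'.size ≤ reply.size +
    card Y ∧ ∀ u x β, reduceL out' (fexecL L query.runL reply'.runL u x β) = reduceL out (fexecL L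
    query.runL reply.runL u x β) := by
  obtain ⟨σ, C, hs, hr, h⟩ := exists_permC out' out
  refine ⟨.seq reply (C.map inr), ?_, fun u x β => ?_⟩
  · simp only [Circuit.size, size_map]; omega
  simp only [fexecL, LinearMap.sum_apply, map_sum, LinearMap.smul_apply, map_smul, comp_apply]
  refine sum_ext fun v => sum_ext fun y => ?_; congr 1
  change reduceL out' (reduceL _ ((C.map inr).runL (reply.runL _))) = _
  rw [runL_map, reduceL_act, hr, reduceL_permL σ _ _ h]

/-- The attack in which Bob does not use the reference string himself. -/
def localAttack {Z V : ℕ → Reg} (b : ∀ m, ℕ → Circuit (P.M m ⊕ (Z m ⊕ V m))) : Attack P Z V V where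
  anc _ := ⟨Empty⟩
  step m t := (b m t).map (onSnd _ inl)
  out _ := inr.trans inl

theorem reduceL_inl_tensor (ρ : Op A) (σ : Op B) : reduceL inl (tensor ρ σ) = σ.trace • ρ := by
  ext x y; rw [reduceL_inl_apply]; change ∑ b, ρ x y * σ b b = (∑ b, σ b b) * ρ x y
  rw [← mul_sum, mul_comm]

theorem execL_local {U X Ω M : Reg} (Q : Party U X Ω M) (n : ℕ) (b : ℕ → Circuit (M ⊕ (A ⊕ B))) (w :
    Bits Ω) (u : Bits U) (x : Bits X) (st : Op (A ⊕ B)) (c : ℂ) (e : Bits E) : reduceL (inr.trans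
    inl : B ↪ (A ⊕ B) ⊕ E) (Q.execL n (fun t => ((b t).map (onSnd _ inl)).runL) w u x (tensor st (c
    • ket e))) = c • reduceL inr (Q.execL n (fun t => (b t).runL) w u x st) := by
  simp only [runL_map]
  rw [Party.execL_act, reduceL_trans, reduceL_act, reduceL_inl_tensor, trace_smul, trace_ket, smul_eq_mul,
    mul_one, map_smul, map_smul]

theorem localAttack_realOut {Z V : ℕ → Reg} (b : ∀ m, ℕ → Circuit (P.M m ⊕ (Z m ⊕ V m))) (S :
    Sampler P.Ω F.U Z V) (m : ℕ) (a : Bits (S.aux m)) (x : Bits (F.X m)) : (localAttack b).realOut S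
    m a x = ∑ w, ∑ u, (((P.crs m w).toReal : ℂ) • (reduceL inr ∘ₗ (P.alice m).execL (P.rounds m)
    (fun t => (b m t).runL) w u x)) (S.state m w a u) := by
  refine sum_ext fun w => sum_ext fun u => ?_
  refine (reduce_eq _ _).trans ((congrArg _ (Party.exec_eq _ _ _ _ _ _ _)).trans ?_)
  exact execL_local _ _ _ _ _ _ _ _ _

/-- What computational security says about trials. -/
theorem CompSecure.trials (hsec : CompSecure F P) {Z V : ℕ → Reg} (b : ∀ m, ℕ → Circuit (P.M m ⊕ (Z
    m ⊕ V m))) (hb : PolyBounded fun m => card (Z m) + card (V m) + ∑ t ∈ Finset.range (P.rounds m),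
    (b m t).size) : ∃ (E : ℕ → Reg) (init : ∀ m, Circuit (P.Ω m ⊕ E m)) (query : ∀ m, Circuit (F.V
    m ⊕ ((Z m ⊕ V m) ⊕ E m))) (reply : ∀ m, Circuit (F.Y m ⊕ ((Z m ⊕ V m) ⊕ E m))), PolyBounded (fun
    m => card (E m) + (init m).size + (query m).size + (reply m).size) ∧ ∀ N : ℕ → ℕ, PolyBounded
    N → ∀ δ : ℕ → ℝ, (∀ m, ∃ T : Trial (P.Ω m) (F.U m) (F.X m) (Z m) (V m) (N m), |δ m| ≤ |(T.value
    fun w u x => ((P.crs m w).toReal : ℂ) • (reduceL inr ∘ₗ (P.alice m).execL (P.rounds m) (fun t =>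
    (b m t).runL) w u x)).re - (T.value fun w u x => reduceL (inr.trans inl) ∘ₗ fexecL (F.kernel m)
    (query m).runL (reply m).runL u x ∘ₗ tensorR (cut w w ((init m).runL (ket zeros)))).re|) →
    Negligible δ := by
  obtain ⟨B', hB', hS⟩ := hsec Z V V (localAttack b) (hb.mono fun m => by
    refine le_of_eq ?_; change _ + _ + card Empty + ∑ t ∈ _, ((b m t).map _).size = _
    simp only [size_map, Fintype.card_empty, add_zero])
  choose reply hr1 hr2 using fun m => act_perm_out (F.kernel m) (B'.query m) (B'.reply m)
    (B'.out m) (inr.trans inl)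
  refine ⟨B'.anc, B'.init, B'.query, reply, (hB'.add hb).mono fun m => ?_, fun N hN δ hδ => ?_⟩
  · have := hr1 m; omega
  choose T hT using hδ
  choose A C hA hC hCeq using fun m => exists_sampler_circuit (T m).impl (T m).inp (T m).out
  choose K Q bit hK hQ hψ using fun m => (T m).test
  let S : Sampler P.Ω F.U Z V := ⟨fun m => (T m).aux, A, C⟩
  let D : Distinguisher S.aux F.X V := ⟨K, Q, bit⟩
  have hst : ∀ m w a u, S.state m w a u = (T m).st w a u := fun m w a u => by
    rw [← (T m).eq, ← hCeq m w, ← run_eq]; rfl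
  have hN2 : ∀ m, card (T m).aux + card (F.U m) + (card (Z m)
      + card (V m)) ≤ N m := fun m => by
    have h1 := card_le_of_embedding (T m).out; simp only [card_sum] at h1
    exact h1.trans (T m).card_G
  have hN3 : ∀ m, card (P.Ω m) ≤ N m := fun m =>
    (card_le_of_embedding (T m).inp).trans (T m).card_G
  have hSp : S.Poly := ((PolyBounded.const 6).mul hN).mono fun m => by
    have h1 := hA m; have h2 := hC m; simp only [card_sum] at h2; have h3 := hN2 m; have h4 := hN3 m
    have h5 := (T m).card_G; change card (T m).aux + card (A m) + (C m).size ≤ 6 * N m; omega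
  have hSl : S.Legitimate := S.legitimate_of_lines fun m w z => by
    obtain ⟨σ, hσ⟩ := (T m).lines w z; exact ⟨σ, fun a u => by rw [hst]; exact hσ a u⟩
  have hDp : D.Poly := ((PolyBounded.const 2).mul hN).mono fun m => by
    have h1 := hK m; have h2 := hQ m; change card (K m) + (Q m).size ≤ 2 * N m; omega
  refine (hS S hSp hSl D hDp).mono fun m => ?_
  have hD : ∀ ρ, D.prob m ρ = ((T m).ψ (∑ a, ∑ x, tensor (ket (elim a x)) (ρ a x))).re :=
    fun ρ => by
      have h1 := hψ m (tensor (∑ a, ∑ x, tensor (ket (elim a x)) (ρ a x)) (ket zeros))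
      rw [reduceL_inl_tensor, trace_ket, one_smul] at h1; rw [← h1, ← run_eq]; rfl
  rw [abs_abs, hD, hD]; refine (hT m).trans (le_of_eq ?_)
  have e1 : ∀ a x, (localAttack b).realOut S m a x = ∑ w, ∑ u, (((P.crs m w).toReal : ℂ) •
      (reduceL inr ∘ₗ (P.alice m).execL (P.rounds m)
        (fun t => (b m t).runL) w u x)) ((T m).st w a u) := fun a x => by
    rw [localAttack_realOut]; simp only [hst]
  have e2 : ∀ a x, B'.idealOut S m a x = ∑ w, ∑ u,
      (reduceL (inr.trans inl)
        ∘ₗ fexecL (F.kernel m) (B'.query m).runL (reply m).runL u x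
        ∘ₗ tensorR (cut w w ((B'.init m).runL (ket zeros)))) ((T m).st w a u) := fun a x => by
    refine sum_ext fun w => sum_ext fun u => ?_
    refine (reduce_eq _ _).trans ((congrArg _ (Functionality.exec_eq _ _ _ _ _ _ _)).trans ?_)
    beta_reduce
    rw [hst, block_eq_cut, run_eq]; exact (hr2 m u x _).symm
  simp only [e1, e2]; rfl

end Security

theorem index_injective {ℓ : ℕ} {r r' : ℕ} {i i' : Fin ℓ} (h : r * ℓ + i = r' * ℓ + i') :
    r = r' ∧ i = i' := by
  have h1 : ∀ (r : ℕ) (i : Fin ℓ), (r * ℓ + i) / ℓ = r := fun r i => by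
    rw [Nat.add_comm, Nat.add_mul_div_right _ _ i.pos, Nat.div_eq_of_lt i.2, Nat.zero_add]
  have h2 : r = r' := by rw [← h1 r i, h, h1]
  subst h2; exact ⟨rfl, Fin.ext (by omega)⟩

namespace OracleParty

variable {ℓ : ℕ} {In Out : Fin ℓ → Reg} {U X C : Reg} (P : OracleParty In Out U X C)

def restL (i₀ : Fin ℓ) (call : Calls In Out W) : LM (P.St W) (P.St W) :=
  selL (fun s => P.callee s = none) + ∑ i, if i = i₀ then 0 else P.calledL i (call i)

theorem callRoundL_split (i₀ : Fin ℓ) (call : Calls In Out W) : (P.callRoundL call : LM _ (P.St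
    W)) = P.calledL i₀ (call i₀) + P.restL i₀ call := by
  rw [callRoundL, restL, add_left_comm]; congr 1
  rw [← Finset.add_sum_erase _ _ (mem_univ i₀), ← Finset.add_sum_erase _ (fun i => if i = i₀ then 0
    else P.calledL i (call i)) (mem_univ i₀), if_pos rfl, zero_add]
  congr 1; exact sum_congr rfl fun i hi => (if_neg (Finset.ne_of_mem_erase hi)).symm

theorem restL_intertwine (i₀ : Fin ℓ) {call : Calls In Out W} {call' : ∀ i, Bits (In i) → Bits (Out
    i) → LM W' W'} (R : LM W W') (h : ∀ i, i ≠ i₀ → ∀ u x, R ∘ₗ call i u x = call' i u x ∘ₗ R) : ext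
    _ (ext C R) ∘ₗ P.restL i₀ call = P.restL i₀ call' ∘ₗ ext _ (ext C R) := by
  rw [restL, restL, LinearMap.comp_add, LinearMap.add_comp, ← selL_ext]; congr 1
  ext1 ρ; simp only [comp_apply, LinearMap.sum_apply, map_sum]
  refine sum_ext fun i => ?_; split_ifs with hi
  · simp
  have h1 := P.calledL_comp i (call i) R; have h2 := P.calledL_ext i (call' i) R
  have h3 : (fun u x => R ∘ₗ call i u x) = fun u x => call' i u x ∘ₗ R :=
    funext fun u => funext fun x => h i hi u x
  rw [h3, ← h2] at h1; exact LinearMap.congr_fun h1 ρ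

end OracleParty

theorem tensor_tensor_eq_emb (d : Bits A) (ρ : Op B) (κ : Op C) (b : Bits ((A ⊕ B) ⊕ C)) (hb : (b ∘
    Sum.inl) ∘ Sum.inl = d) : tensor (tensor (ket d) ρ) κ = emb ((inr : B ↪ A ⊕ B).sumMap (refl C))
    b (tensor ρ κ) := by
  ext x y
  have h : (∀ w, (∀ a, (inr : B ↪ A ⊕ B).sumMap (refl C) a ≠ w) → x w = b w ∧ y w = b w)
      ↔ (x ∘ Sum.inl) ∘ Sum.inl = d ∧ (y ∘ Sum.inl) ∘ Sum.inl = d := by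
    subst hb; constructor
    · intro h
      have := fun a => h (Sum.inl (Sum.inl a)) fun c hc => by rcases c with c | c <;> cases hc
      exact ⟨funext fun a => (this a).1, funext fun a => (this a).2⟩
    rintro ⟨h1, h2⟩ ((w | w) | w) hw
    · exact ⟨congrFun h1 w, congrFun h2 w⟩
    · exact absurd rfl (hw (Sum.inl w))
    exact absurd rfl (hw (Sum.inr w))
  rw [emb_apply, if_congr h rfl rfl]; simp only [tensor, ket, of_apply, ite_mul, one_mul, zero_mul]
  rfl

def outEmb (K A U N C B D : Type) : (A ⊕ U) ⊕ B ↪ K ⊕ (A ⊕ ((U ⊕ N) ⊕ (C ⊕ (B ⊕ D)))) where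
  toFun := elim (elim (fun a => Sum.inr (Sum.inl a))
    fun u => Sum.inr (Sum.inr (Sum.inl (Sum.inl u))))
    fun b => Sum.inr (Sum.inr (Sum.inr (Sum.inr (Sum.inl b))))
  inj' := by rintro ((a | a) | a) ((b | b) | b) h <;> cases h <;> rfl

def ancEmb (K A U N C B D : Type) : D ↪ K ⊕ (A ⊕ ((U ⊕ N) ⊕ (C ⊕ (B ⊕ D)))) :=
  (inr.trans inr).trans
    ((inr.trans inr).trans inr)

theorem outEmb_ne (a : (A ⊕ U) ⊕ B) (b : D) : outEmb K A U N C B D a ≠ ancEmb K A U N C B D b := by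
  rcases a with (a | a) | a <;> intro h <;> cases h

theorem emb_out_anc (k : Bits K) (a : Bits A) (u : Bits U) (ρ : Op B) (κ : Op D) : emb (joint
    (outEmb K A U N C B D) (ancEmb K A U N C B D) outEmb_ne) (elim k zeros) (tensor (tensor (ket
    (elim a u)) ρ) κ) = tensor (ket k) (tensor (ket a) (tensor (ket (elim u zeros)) (tensor (ket
    zeros) (tensor ρ κ)))) := by
  let b : Bits (K ⊕ (A ⊕ ((U ⊕ N) ⊕ (C ⊕ (B ⊕ D))))) :=
    elim k (elim a (elim (elim u zeros) zeros))
  rw [emb_congr _ (b' := b), tensor_tensor_eq_emb (elim a u) ρ κ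
    (b ∘ joint (outEmb K A U N C B D) (ancEmb K A U N C B D) outEmb_ne), ← emb_trans]
  · have h : ∀ β, tensor (ket k) (tensor (ket a) (tensor (ket (elim u zeros)) (tensor (ket zeros)
        β))) = emb (((inr.trans inr).trans inr).trans inr)
            b β := fun β => by
      rw [emb_trans, emb_trans, emb_trans, emb_inr, emb_inr, emb_inr, emb_inr]; rfl
    rw [h]; congr 1; congr 1; ext w; rcases w with w | w <;> rfl
  · funext w; rcases w with w | w <;> rfl
  rintro (w | w | (w | w) | w | w | w) hw
  · rfl
  · exact absurd rfl (hw (Sum.inl (Sum.inl (Sum.inl w))))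
  · exact absurd rfl (hw (Sum.inl (Sum.inl (Sum.inr w))))
  · rfl
  · rfl
  · rfl
  rfl

theorem setup_eq (σ : Bits Ω → Bits A → Bits U → Op B) (Λ : LM (Ω ⊕ D) (Ω ⊕ D)) (b : Bits Ω) (k :
    Bits K) : reduceL inr (act (onSnd Ω (outEmb K A U N C B D)) (prepL fun η => ∑ a, ∑ u, tensor
    (ket (elim a u)) (σ η a u)) (act (onSnd Ω (ancEmb K A U N C B D)) Λ (ket (elim b (elim k
    zeros))))) = ∑ η, ∑ a, ∑ u, tensor (ket k) (tensor (ket a) (tensor (ket (elim u zeros)) (tensor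
    (ket zeros) (tensor (σ η a u) (cut η η (Λ (ket (elim b zeros)))))))) := by
  have h1 : ket (elim b (elim k zeros)) = emb (onSnd Ω (ancEmb K A U N C B D))
      (elim b (elim k zeros)) (ket (elim b zeros)) := by
    rw [emb_ket]
    conv_lhs => rw [← write_self (onSnd Ω (ancEmb K A U N C B D)) (elim b (elim k zeros))]
    congr 2; funext w; rcases w with w | w <;> rfl
  rw [h1, act_emb]; refine (reduce_prepL _ _ _).trans (sum_ext fun η => ?_); rw [cut_emb_onSnd]
  refine (act_replaceL_emb _ _ outEmb_ne _ _ _).trans ?_; rw [tensor_eq']; simp only [map_sum]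
  exact sum_ext fun a => sum_ext fun u => emb_out_anc _ _ _ _ _

theorem loadL_inl_ket (v : Bits B → Bits A) (b : Bits A) (y : Bits B) : loadL (inl : A ↪ A ⊕ B) (fun
    x => v (x ∘ Sum.inr)) (ket (elim b y)) = ket (elim (v y) y) := by
  rw [← tensor_ket_ket, ← tensor_ket_ket]; ext x z; rw [loadL_inl_tensor _ _ _ fun _ _ _ => rfl]
  simp only [tensor, ket, of_apply]
  by_cases hx : x ∘ Sum.inr = y <;> by_cases hz : z ∘ Sum.inr = y <;> simp [hx, hz]

theorem Impl.reset (b : Bits G) : Impl (replaceL (ket b) : LM G G) (2 * card G + 2) := by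
  refine (Impl.load (Sourced.const (refl G) b)).congr fun ρ => ?_; rw [loadL_const]
  have h := act_emb (refl G) (replaceL (ket b)) zeros ρ; rwa [emb_refl, emb_refl] at h

theorem bitL_answer (φ : Op G →ₗ[ℂ] ℂ) (b : G) (ρ : Op G) :
    bitL b (answerL φ (update zeros b true) ρ) = φ ρ := by
  rw [answerL_apply, map_add, map_smul, map_smul, bitL_ket, bitL_ket]; simp [zeros]

theorem Test.zero (b : G) : Test (0 : Op G →ₗ[ℂ] ℂ) (2 * card G + 2) := by
  have h : bitL b ∘ₗ (replaceL (ket zeros) : LM G G) = 0 := LinearMap.ext fun ρ => by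
    rw [comp_apply, replaceL_apply, map_smul, bitL_ket, if_neg (by simp [zeros]),
      smul_zero, LinearMap.zero_apply]
  rw [← h]; exact ((Test.bit b).comp (Impl.reset _)).mono (by omega)

theorem Test.chain {ℓ : ℕ} (flag : Fin ℓ → G) (b : G) {φ : Fin ℓ → Op G →ₗ[ℂ] ℂ} {φ₀ : Op G →ₗ[ℂ] ℂ}
    {k : ℕ} (h : ∀ i, Test (φ i) k) (h₀ : Test φ₀ k) : Test (φ₀ ∘ₗ maskL (fun s => (finRange
    ℓ).find? (fun i => s (flag i)) = none) + ∑ i, φ i ∘ₗ maskL (fun s => (finRange ℓ).find?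
    (fun i => s (flag i)) = some i)) ((ℓ + 1) * (4 * k + 4 * card G + 8)) := by
  have i := (Test.bit b).comp (Impl.chain flag (fun i => Impl.answer (h i) (update zeros b true))
    (Impl.answer h₀ (update zeros b true)) (finRange ℓ))
  have e : bitL b ∘ₗ chainL flag (fun i => answerL (φ i) (update zeros b true))
      (answerL φ₀ (update zeros b true)) (finRange ℓ)
      = φ₀ ∘ₗ maskL (fun s => (finRange ℓ).find? (fun i => s (flag i)) = none)
      + ∑ i, φ i ∘ₗ maskL (fun s => (finRange ℓ).find? (fun i => s (flag i)) = some i) := by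
    ext1 ρ
    have h1 := chainL_eq flag (fun i => answerL (φ i) (update zeros b true))
      (answerL φ₀ (update zeros b true)) (finRange ℓ) (fun _ => True) ρ
    rw [maskL_true] at h1; simp only [true_and] at h1; rw [comp_apply, h1]
    simp only [map_add, map_sum, bitL_answer, LinearMap.add_apply, LinearMap.sum_apply, comp_apply]
  rw [← e]; exact i.mono (by rw [List.length_finRange]; ring_nf; omega)

theorem maskL_ket_tensor (p : Bits A → Prop) [DecidablePred p] (d : Bits A) (β : Op B) : maskL (fun
    x : Bits (A ⊕ B) => p (x ∘ Sum.inl)) (tensor (ket d) β) = if p d then tensor (ket d) β else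
    0 := by
  ext x y; rw [maskL_apply]; by_cases hx : x ∘ Sum.inl = d
  · by_cases hy : y ∘ Sum.inl = d
    · by_cases hp : p d <;> simp [hx, hy, hp]
    by_cases hp : p d <;> simp [hx, hy, hp, tensor, ket]
  by_cases hp : p d <;> simp [hx, hp, tensor, ket]

theorem dephaseL_ket_tensor (d : Bits A) (β : Op B) :
    dephaseL inl (tensor (ket d) β) = tensor (ket d) β := by
  refine op_ext_cut fun a a' => ?_; rw [cut_dephaseL_inl, cut_tensor]; by_cases h : a = a'
  · rw [if_pos h]
  rw [if_neg h]; have : (ket d : Op A) a a' = 0 := if_neg fun hh => h (hh.1.trans hh.2.symm)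
  rw [this, zero_smul]

def gatherEquiv (A S C I W : Type) : (((A ⊕ (S ⊕ C)) ⊕ I) ⊕ W) ≃ (I ⊕ (A ⊕ (S ⊕ (C ⊕ W)))) where
  toFun := elim (elim (elim (fun a => .inr (.inl a)) (elim (fun s => .inr (.inr (.inl s))) fun c =>
    .inr (.inr (.inr (.inl c))))) fun i => .inl i) fun w => .inr (.inr (.inr (.inr w)))
  invFun := elim (fun i => .inl (.inr i)) (elim (fun a => .inl (.inl (.inl a))) (elim (fun s => .inl
    (.inl (.inr (.inl s)))) (elim (fun c => .inl (.inl (.inr (.inr c)))) fun w => .inr w)))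
  left_inv := by rintro (((a | s | c) | i) | w) <;> rfl
  right_inv := by rintro (i | a | s | c | w) <;> rfl

theorem cut_gather (f : I → S) (w : Bits N) (τ : Op (A ⊕ (S ⊕ (C ⊕ W)))) (a : Bits A) (s : Bits S)
    (c : Bits C) (u : Bits I) : cut (elim (elim a (elim s c)) u) (elim (elim a (elim s c)) u)
    (reduceL ((gatherEquiv A S C I W).toEmbedding.trans ((inr : I ↪ N ⊕ I).sumMap (refl _))) (loadL
    (inl.trans ((inr : I ↪ N ⊕ I).sumMap (refl _))) (fun x i => x (Sum.inr (Sum.inr (Sum.inl (f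
    i))))) (tensor (ket (elim w zeros)) τ))) = if u = s ∘ f then cut c c (cut s s (cut a a τ)) else
    0 := by
  let e : I ⊕ (A ⊕ (S ⊕ (C ⊕ W))) ↪ (N ⊕ I) ⊕ (A ⊕ (S ⊕ (C ⊕ W))) :=
    (inr : I ↪ N ⊕ I).sumMap (refl _)
  have h1 : loadL (inl.trans e)
      (fun x i => x (Sum.inr (Sum.inr (Sum.inl (f i)))))
      = act e (loadL inl fun x i => x (Sum.inr (Sum.inr (Sum.inl (f i))))) :=
    loadL_trans inl e
      (fun (x : Bits (I ⊕ (A ⊕ (S ⊕ (C ⊕ W))))) i => x (Sum.inr (Sum.inr (Sum.inl (f i)))))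
  rw [← tensor_ket_ket, tensor_tensor_eq_emb w (ket zeros) τ (elim (elim w zeros) zeros) rfl]
  refine (congrArg (fun Φ : LM _ _ => cut (elim (elim a (elim s c)) u) (elim (elim a (elim s c)) u)
    (reduceL ((gatherEquiv A S C I W).toEmbedding.trans e) (Φ (emb e (elim (elim w zeros) zeros)
    (tensor (ket zeros) τ))))) h1).trans ?_
  rw [act_emb, reduceL_trans, reduceL_emb]; ext x y
  rw [cut_apply, reduceL_equiv, loadL_inl_tensor _ _ _ fun _ _ _ => rfl]; by_cases hu : u = s ∘ f
  · subst hu; rw [if_pos rfl]; refine (if_pos ⟨rfl, rfl⟩).trans ?_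
    refine congrArg₂ τ ?_ ?_ <;> funext v <;> rcases v with v | v | v | v <;> rfl
  rw [if_neg hu]; exact if_neg fun h => hu h.1

def spreadEmb (A S C I W : Type) : A ⊕ (S ⊕ (C ⊕ W)) ↪ ((A ⊕ (S ⊕ C)) ⊕ I) ⊕ W :=
  inr.trans (gatherEquiv A S C I W).symm.toEmbedding

theorem spread_load (f : I ↪ S) (a : Bits A) (s : Bits S) (c : Bits C) (x : Bits I) (β : Op W) :
    reduceL (spreadEmb A S C I W) (loadL (((f.trans inl).trans inr).trans (spreadEmb A S C I W))
    (fun y i => y (Sum.inl (Sum.inr i))) (tensor (ket (elim (elim a (elim s c)) x)) β)) = tensor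
    (ket a) (tensor (ket (write f x s)) (tensor (ket c) β)) := by
  let b : Bits (((A ⊕ (S ⊕ C)) ⊕ I) ⊕ W) :=
    elim (elim (elim a (elim s c)) x) zeros
  let e : I ↪ A ⊕ (S ⊕ (C ⊕ W)) :=
    (f.trans inl).trans inr
  have h0 : tensor (ket (elim (elim a (elim s c)) x)) β
      = emb (inr : W ↪ ((A ⊕ (S ⊕ C)) ⊕ I) ⊕ W) b β := by
    rw [emb_inr]; rfl
  rw [h0, loadL_emb (inr : W ↪ ((A ⊕ (S ⊕ C)) ⊕ I) ⊕ W)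
    (e.trans (spreadEmb A S C I W)) nofun
    (fun y i => y (Sum.inl (Sum.inr i))) (fun y y' h => funext fun i =>
      h _ nofun nofun)]
  have h1 : (inr : W ↪ ((A ⊕ (S ⊕ C)) ⊕ I) ⊕ W)
      = (inr.trans (inr.trans inr)).trans
        (spreadEmb A S C I W) := rfl
  have h2 : write (e.trans (spreadEmb A S C I W)) (fun i => b (Sum.inl (Sum.inr i))) b
      ∘ spreadEmb A S C I W = elim a (elim (write f x s) (elim c zeros)) := by
    rw [write_trans, write_comp]
    have h3 : b ∘ spreadEmb A S C I W = elim a (elim s (elim c zeros)) := by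
      funext v; rcases v with v | v | v | v <;> rfl
    rw [h3, write_trans, write_inr, write_trans]; congr 1; exact write_inl _ _ _
  rw [h1]; refine (reduceL_emb_trans _ _ _ _).trans ?_; rw [h2]; exact emb_inr_inr_inr rfl rfl rfl β

theorem OracleParty.sum_calledL {ℓ : ℕ} {In Out : Fin ℓ → Reg} {U X C : Reg} (P : OracleParty In Out
    U X C) {W W' ι : Type} [Fintype W] [DecidableEq W] [Fintype W'] [DecidableEq W'] [Fintype ι]
    (i : Fin ℓ) (call : ι → Bits (In i) → Bits (Out i) → LM W W') (ρ : ι → Op (P.St W)) : ∑ w,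
    P.calledL i (call w) (ρ w) = ∑ s, ∑ c, ∑ x, if P.callee s = some i then tensor (ket (write
    (P.callOut i) x s)) (tensor (ket c) (∑ w, call w (s ∘ P.callIn i) x (cut c c (cut s s (ρ w)))))
    else 0 := by
  simp only [calledL, LinearMap.sum_apply]; rw [sum_comm]; refine sum_ext fun s => ?_; rw [sum_comm]
  refine sum_ext fun c => ?_; by_cases h : P.callee s = some i
  · simp only [if_pos h, LinearMap.sum_apply]; rw [sum_comm]; refine sum_ext fun x => ?_
    rw [tensor_eq, tensor_eq, map_sum, map_sum]; rfl
  simp [h]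

section Coins

theorem reduceL_inl_ket (b : Bits (A ⊕ B)) : reduceL inl (ket b) = ket (b ∘ Sum.inl) := by
  rw [← elim_comp b, ← tensor_ket_ket, reduceL_inl_tensor, trace_ket, one_smul]; rfl

theorem reduceL_inr_ket_tensor (a : Bits A) (ρ : Op B) : reduceL inr (tensor (ket a) ρ) = ρ := by
  have h := emb_inr (elim a zeros : Bits (A ⊕ B)) ρ
  rw [show ((elim a zeros : Bits (A ⊕ B)) ∘ Sum.inl) = a from rfl] at h; rw [← h, reduceL_emb]

theorem cut_ket (a b : Bits A) (c : Bits B) :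
    cut a a (ket (elim b c)) = if a = b then ket c else 0 := by
  rw [← tensor_ket_ket, cut_tensor]; by_cases h : a = b <;> simp [ket, h]

theorem ext_selL (p : Bits B → Prop) [DecidablePred p] :
    ext A (selL p : LM (B ⊕ C) (B ⊕ C)) = maskL fun x => p (fun b => x (Sum.inr (Sum.inl b))) := by
  ext1 ρ
  ext x y
  change (if p _ ∧ p _ then ρ (elim (x ∘ Sum.inl) (x ∘ Sum.inr))
    (elim (y ∘ Sum.inl) (y ∘ Sum.inr)) else 0) = _
  rw [elim_comp, elim_comp]; rfl

variable {Ω U X Z V G : Reg} {N : ℕ}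

def coin (U Z V G : Reg) (c : Bool) : Bits (((Unit ⊕ U) ⊕ (Z ⊕ V)) ⊕ G) :=
  fun w => w = Sum.inl (Sum.inl (Sum.inl ())) && c

theorem coin_false : coin U Z V G false = zeros := by funext w; exact Bool.and_false _

theorem coin_inl (c : Bool) : coin U Z V G c ∘ Sum.inl = elim (elim (fun _ => c) zeros) zeros := by
  funext w; rcases w with (w | w) | w
  · simp [coin]
  · simp [coin, zeros]
  simp [coin, zeros]

def coinΘ (U Z V : Reg) (Θ : LM G G) (χ : Op G →ₗ[ℂ] ℂ) :
    LM (((Unit ⊕ U) ⊕ (Z ⊕ V)) ⊕ G) (((Unit ⊕ U) ⊕ (Z ⊕ V)) ⊕ G) :=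
  answerL (χ ∘ₗ reduceL inr) (coin U Z V G true)
    ∘ₗ act inr Θ

def coinSt (U Z V : Reg) (Θ : LM G G) (inp : Ω ↪ G) (χ : Op G →ₗ[ℂ] ℂ) (w : Bits Ω)
    (a : Bits Unit) (u : Bits U) : Op (Z ⊕ V) :=
  if u = zeros then (if a () then χ (Θ (ket (write inp w zeros)))
    else (Θ (ket (write inp w zeros))).trace - χ (Θ (ket (write inp w zeros)))) • ket zeros else 0

theorem coinΘ_eq (Θ : LM G G) (inp : Ω ↪ G) (χ : Op G →ₗ[ℂ] ℂ) (w : Bits Ω) (a : Bits Unit) (u :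
    Bits U) : dephaseL inl (cut (elim a u) (elim a u) (reduceL inl (coinΘ U Z V Θ χ (ket (write
    (inp.trans inr) w zeros))))) = coinSt U Z V Θ inp χ w a u := by
  have h1 : (ket (write (inp.trans inr) w zeros) :
      Op (((Unit ⊕ U) ⊕ (Z ⊕ V)) ⊕ G)) = tensor (ket zeros) (ket (write inp w zeros)) := by
    rw [tensor_ket_ket, write_trans, ← write_inr (write inp w zeros) zeros zeros, elim_zeros]; rfl
  have h2 : ∀ c, cut (elim a u) (elim a u) (reduceL inl
      (ket (coin U Z V G c))) = if a () = c ∧ u = zeros then ket zeros else 0 := fun c => by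
    rw [reduceL_inl_ket, coin_inl]; refine (cut_ket _ _ _).trans (if_congr ?_ rfl rfl)
    rw [elim_eq_iff]
    exact and_congr_left fun _ => ⟨fun h => congrFun h (), fun h => funext fun _ => h⟩
  have h3 : dephaseL inl (ket zeros : Op (Z ⊕ V)) = ket zeros := by
    rw [← elim_zeros, ← tensor_ket_ket, dephaseL_ket_tensor]
  rw [coinΘ, comp_apply, act_inr, h1, ext_tensor, answerL_apply, comp_apply,
    reduceL_inr_ket_tensor, ← coin_false, trace_tensor, coin_false, trace_ket, one_mul]
  simp only [map_add, map_smul]; rw [← coin_false, h2, h2, coinSt]; by_cases hu : u = zeros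
  · rw [if_pos hu]
    cases ha : a () <;> simp [hu, h3]
  simp [hu]

/-- The trial with the coin. -/
def coinTrial (Θ : LM G G) (inp : Ω ↪ G) (χ : Op G →ₗ[ℂ] ℂ) {n : ℕ} (hΘ : Impl Θ n) (hχ : Test χ n)
    (hN : 5 * n + 4 * (1 + card U + (card Z + card V) + card G) + 7 ≤ N) : Trial Ω U X Z V N where
  aux := ⟨Unit⟩
  G := ⟨((Unit ⊕ U) ⊕ (Z ⊕ V)) ⊕ G⟩
  Θ := coinΘ U Z V Θ χ
  inp := inp.trans inr
  out := inl
  ψ := bitL (Sum.inl (Sum.inl ()))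
  st := coinSt U Z V Θ inp χ
  impl := ((Impl.answer (Test.reduce hχ _) _).comp (hΘ.act _)).mono (by
    simp only [card_sum, Fintype.card_unit]; omega)
  test := (Test.bit _).mono (Nat.zero_le _)
  card_G := by
    change card (((Unit ⊕ U) ⊕ (Z ⊕ V)) ⊕ G) ≤ N; simp only [card_sum, Fintype.card_unit]; omega
  eq := coinΘ_eq Θ inp χ
  lines w z := ⟨cut z z (ket zeros), fun a u => by
    rw [coinSt]; split_ifs
    · rw [map_smul]; exact Submodule.smul_mem _ _ (mem_span_singleton_self _)
    · rw [map_smul]; exact Submodule.smul_mem _ _ (mem_span_singleton_self _)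
    rw [map_zero]
    exact zero_mem _⟩

theorem coinTrial_value (Θ : LM G G) (inp : Ω ↪ G) (χ : Op G →ₗ[ℂ] ℂ) {n : ℕ} (hΘ : Impl Θ n)
    (hχ : Test χ n) (hN) (Ex : Bits Ω → Bits U → Bits X → LM (Z ⊕ V) V) (p : Bits Ω → ℂ)
    (hp : ∀ w, ∑ x, (Ex w zeros x (ket zeros)).trace = p w) :
    (coinTrial (X := X) (N := N) Θ inp χ hΘ hχ hN).value Ex
      = ∑ w, p w * χ (Θ (ket (write inp w zeros))) := by
  change bitL (Sum.inl (Sum.inl ())) (∑ a : Bits Unit, ∑ x,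
    tensor (ket (elim a x)) (∑ w, ∑ u, Ex w u x (coinSt U Z V Θ inp χ w a u))) = _
  have h1 : ∀ (a : Bits Unit) (x : Bits X) (ρ : Op V),
      bitL (Sum.inl (Sum.inl ())) (tensor (ket (elim a x)) ρ) = if a () then ρ.trace else 0 :=
    fun a x ρ => by
    have h := maskL_ket_tensor (fun y : Bits (Unit ⊕ X) => y (Sum.inl ()) = true)
      (elim a x) ρ
    refine (congrArg trace h).trans ?_; change trace (if a () = true then _ else _) = _; split_ifs
    · rw [trace_tensor_ket]
    exact Matrix.trace_zero _ _
  have h2 : ∀ (a : Bits Unit) (x : Bits X) w, ∑ u, Ex w u x (coinSt U Z V Θ inp χ w a u)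
      = Ex w zeros x (coinSt U Z V Θ inp χ w a zeros) := fun a x w =>
    sum_eq_single _ (fun u _ hu => by rw [coinSt, if_neg hu, map_zero]) (by simp)
  simp only [map_sum, h1, h2]; rw [sum_eq_single (fun _ => true)]
  · simp only [if_true, trace_sum]; rw [sum_comm]; refine sum_ext fun w => ?_
    rw [← hp, sum_mul]; refine sum_ext fun x => ?_
    rw [coinSt, if_pos rfl, if_pos rfl, map_smul, trace_smul, smul_eq_mul, mul_comm]
  · intro a _ ha; have : a () = false := by by_contra h; exact ha (funext fun _ => by simpa using h)
    simp [this]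
  simp

end Coins

namespace OracleParty

variable {ℓ : ℕ} {In Out : Fin ℓ → Reg} {U X C : Reg} (P : OracleParty In Out U X C)

theorem calledL_eq (i : Fin ℓ) (call : Bits (In i) → Bits (Out i) → LM W W) : P.calledL i call =
    callL (P.callIn i) (P.callOut i) call ∘ₗ (selL (fun s => P.callee s = some i) : LM _ (P.St
    W)) := by
  ext1 ρ
  rw [comp_apply, callL_selL]; simp only [calledL, LinearMap.sum_apply]
  refine sum_ext fun s => sum_ext fun c => ?_; split_ifs
  · simp only [LinearMap.sum_apply]; rfl
  rfl

theorem testRest (i₀ : Fin ℓ) {call : Calls In Out W} {ψ : Op (A ⊕ (P.St W)) →ₗ[ℂ] ℂ} {k kψ N : ℕ}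
    (hN : ∀ i, card U + card P.anc + card C + card (In i) + card (Out i) ≤ N) (h : ∀ i, Impl (instL
    (call i)) k) (hψ : Test ψ kψ) (b : A ⊕ (P.St W)) : Test (ψ ∘ₗ ext A (P.restL i₀ call)) ((ℓ + 1)
    * (4 * (kψ + (k + 10 * N + 10) + 2 * card (A ⊕ (P.St W)) + 2) + 4 * card (A ⊕ (P.St W)) +
    8)) := by
  have h1 := Test.chain (fun i => Sum.inr (Sum.inl (P.flag i))) b
    (φ := fun i => if i = i₀ then 0 else ψ ∘ₗ act inr (callL (P.callIn i) (P.callOut i) (call i)))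
    (φ₀ := ψ) (k := kψ + (k + 10 * N + 10)
      + 2 * card (A ⊕ (P.St W)) + 2) (fun i => ?_) (hψ.mono (by omega))
  · have h2 : ∀ F : Fin ℓ → LM (A ⊕ (P.St W)) (A ⊕ (P.St W)),
        ψ ∘ₗ ∑ i, F i = ∑ i, ψ ∘ₗ F i := fun F => by
      ext1 ρ
      simp only [comp_apply, LinearMap.sum_apply, map_sum]
    convert h1 using 1
    rw [restL, ← act_inr, act_add, act_sum, LinearMap.comp_add, h2, act_inr, ext_selL]; congr 1
    refine sum_ext fun i => ?_; split_ifs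
    · ext1 ρ
      refine (congrArg ψ ?_).trans (map_zero ψ); ext; rfl
    rw [calledL_eq, act_comp, act_inr (selL _), ext_selL]; rfl
  split_ifs
  · exact (Test.zero b).mono (by omega)
  exact (hψ.comp ((Impl.call (N := N) _ _ _ (by rw [card_sum]; exact hN i)
    (h i)).act _)).mono (by omega)

end OracleParty

theorem ext_tensorL_eq_emb (z : Bits A) (ρ : Op (M ⊕ B)) : ext M (tensorL (ket z)) ρ = emb (onSnd M
    inr) (elim zeros (elim z zeros)) ρ := by
  refine op_ext_cut fun c c' => ?_; rw [cut_emb_onSnd, cut_ext, emb_inr]; rfl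

theorem projectL_emb (f : A ↪ W) (b : Bits W) (w : W) (hw : ∀ a, f a ≠ w) (c : Bool) (β : Op A) :
    projectL w c (emb f b β) = if b w = c then emb f b β else 0 := by
  ext x y; change (if x w = c ∧ y w = c then emb f b β x y else 0) = _; rw [emb_apply]
  split_ifs with h1 h2 h3 h3 h2 h3
  · rw [emb_apply, if_pos h2]
  · exact absurd ((h2 w hw).1.symm.trans h1.1) h3
  · rw [emb_apply, if_neg h2]
  · rfl
  · rw [emb_apply]; split_ifs with h4
    · exact absurd ⟨(h4 w hw).1.trans h2, (h4 w hw).2.trans h2⟩ h1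
    rfl
  rfl

def dispatchC {R : ℕ} (f : A ↪ W) (sel : Fin R → W) (b : Fin R → Circuit A) : Circuit W :=
  Circuit.ofList ((finRange R).map fun r => .branch (sel r) .skip ((b r).map f))

theorem size_dispatchC {R : ℕ} (f : A ↪ W) (sel : Fin R → W) (b : Fin R → Circuit A) :
    (dispatchC f sel b).size = ∑ r, (1 + (b r).size) := by
  rw [dispatchC, Circuit.size_ofList, List.map_map, ← List.ofFn_eq_map, List.sum_ofFn]
  refine sum_ext fun r => ?_; simp [Circuit.size, size_map]

theorem runL_dispatchC {R : ℕ} (f : A ↪ W) (sel : Fin R → W) (hs : ∀ r a, f a ≠ sel r)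
    (b : Fin R → Circuit A) (c : Bits W) (r : Fin R) (hc : ∀ r', c (sel r') = decide (r' = r))
    (β : Op A) : (dispatchC f sel b).runL (emb f c β) = emb f c ((b r).runL β) := by
  have h : ∀ (l : List (Fin R)), l.Nodup → ∀ β, listL (l.map fun r =>
      (Circuit.branch (sel r) .skip ((b r).map f)).runL) (emb f c β)
      = emb f c (if r ∈ l then (b r).runL β else β) := fun l => by
    induction l with
    | nil => exact fun _ β => by simp [listL]
    | cons r' l ih =>
      intro hl β; obtain ⟨h1, h2⟩ := List.nodup_cons.1 hl; rw [map_cons, listL, comp_apply]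
      have h3 : (Circuit.branch (sel r') .skip ((b r').map f)).runL (emb f c β)
          = emb f c (if r' = r then (b r).runL β else β) := by
        change projectL (sel r') false (emb f c β)
          + ((b r').map f).runL (projectL (sel r') true (emb f c β)) = _
        rw [projectL_emb f c _ (hs r'), projectL_emb f c _ (hs r'), hc]; by_cases h : r' = r
        · subst h; simp [runL_map, act_emb]
        simp [h]
      rw [h3, ih h2]; by_cases h : r' = r
      · subst h; simp [h1]
      simp [h, Ne.symm h]
  rw [dispatchC, runL_ofList, List.map_map]; refine (h _ (List.nodup_finRange R) β).trans ?_
  rw [if_pos (List.mem_finRange r)]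

theorem sum_maskL (f : A ↪ W) (ρ : Op W) : ∑ t, maskL (fun x => x ∘ f = t) ρ = dephaseL f ρ := by
  ext x y; rw [Matrix.sum_apply, dephaseL_apply, sum_eq_single (x ∘ f)]
  · rw [maskL_apply]; exact if_congr ⟨fun h => h.2.symm, fun h => ⟨rfl, h.symm⟩⟩ rfl rfl
  · intro t _ ht; rw [maskL_apply, if_neg fun h => ht h.1.symm]
  simp

theorem cut_reduceL_sumMap (f : X ↪ S) (h : Y ↪ B) (x : Bits X) (τ : Op (S ⊕ B)) :
    cut x x (reduceL (f.sumMap h) τ) = ∑ s, if s ∘ f = x then reduceL h (cut s s τ) else 0 := by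
  have h1 : ∀ σ : Op (S ⊕ Y), cut x x (reduceL (f.sumMap (refl Y)) σ)
      = ∑ s, if s ∘ f = x then cut s s σ else 0 := fun σ => by
    ext b b'; rw [Matrix.sum_apply]; refine (sum_bits _).trans (sum_ext fun s => ?_)
    by_cases hs : s ∘ f = x
    · rw [if_pos hs, sum_eq_single b, if_pos, cut_apply]
      · congr 1; refine bits_ext_wire (f.sumMap (refl Y)) ?_ fun w hw => ?_
        · rw [write_comp, ← hs]; funext w; rcases w with w | w <;> rfl
        rw [write_notMem _ _ _ hw]; rcases w with w | w
        · rfl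
        exact absurd rfl (hw (Sum.inr w))
      · rw [← hs]; funext w; rcases w with w | w <;> rfl
      · intro b₀ _ hb; rw [if_neg]; rintro h; exact hb (funext fun y => congrFun h (Sum.inr y))
      simp
    rw [if_neg hs, sum_eq_zero]
    · rfl
    intro b₀ _; rw [if_neg]; rintro h; exact hs (funext fun y => congrFun h (Sum.inl y))
  have h2 : f.sumMap h = (f.sumMap (refl Y)).trans (onSnd S h) := by
    ext w; rcases w with w | w <;> rfl
  rw [h2, reduceL_trans, h1, reduceL_onSnd]; simp only [cut_ext]

theorem reduceL_onSnd_tensor (f : A ↪ B) (σ : Op C) (ρ : Op B) :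
    reduceL (onSnd C f) (tensor σ ρ) = tensor σ (reduceL f ρ) := by
  rw [reduceL_onSnd, ext_tensor]

def jointOut (A : Type) (f : X ↪ S) (h : Y ↪ W) : (A ⊕ X) ⊕ Y ↪ A ⊕ (S ⊕ (C ⊕ W)) :=
  (Equiv.sumAssoc A X Y).toEmbedding.trans
    (onSnd A (f.sumMap (h.trans inr)))

theorem dephaseL_jointOut (f : X ↪ S) (h : Y ↪ W) (a : Bits A) (τ : Op (S ⊕ (C ⊕ W))) : dephaseL inl
    (reduceL (jointOut A f h) (tensor (ket a) τ)) = ∑ x, tensor (ket (elim a x)) (reduceL h (∑ s, if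
    s ∘ f = x then reduceL inr (cut s s τ) else 0)) := by
  rw [jointOut, reduceL_trans, reduceL_onSnd, ext_tensor, tensor_cut_ket zeros, sum_bits,
    sum_eq_single a]
  · refine sum_ext fun x => congrArg _ ?_; rw [map_sum]
    refine Eq.trans ?_ ((cut_reduceL_sumMap f (h.trans inr) x τ).trans (sum_ext fun s => ?_))
    · ext y y'; rw [cut_apply, reduceL_equiv]; change (ket a : Op A) a a * _ = _
      rw [ket, of_apply, if_pos ⟨rfl, rfl⟩, one_mul, cut_apply]
      refine congrArg₂ _ ?_ ?_ <;> (funext w; rcases w with w | w <;> rfl)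
    rw [apply_ite (reduceL h), map_zero, reduceL_trans]
  · intro a' _ ha; refine sum_eq_zero fun x _ => ?_
    have : cut (elim a' x) (elim a' x) (reduceL (Equiv.sumAssoc A X Y).toEmbedding
        (tensor (ket a) (reduceL (f.sumMap (h.trans inr)) τ))) = 0 := by
      ext y y'; rw [cut_apply, reduceL_equiv]; change (ket a : Op A) a' a' * _ = _
      rw [ket, of_apply, if_neg fun h => ha h.1, zero_mul]; rfl
    rw [this, tensor_eq, map_zero]
  simp

theorem OracleParty.roundL_front {ℓ : ℕ} {In Out : Fin ℓ → Reg} {U X C : Reg} (P : OracleParty In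
    Out U X C) (r : ℕ) (b : LM (C ⊕ W) (C ⊕ W)) (K : LM W W) (call : Calls In Out W) : P.roundL r (b
    ∘ₗ ext C K) call = P.roundL r b call ∘ₗ ext _ (ext C K) := by
  have h : dephaseL inl ∘ₗ (b ∘ₗ ext C K) ∘ₗ dephaseL inl
      = (dephaseL inl ∘ₗ b ∘ₗ dephaseL inl)
        ∘ₗ ext C K := by
    simp only [comp_assoc, dephaseL_inl_ext]
  ext1 ρ
  simp only [roundL, preL, h, ext_comp, comp_apply, act_front_ext]

end

/-! ### The data of the hybrid argument for one security parameter -/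

theorem nontrivial_of_bool {H : Type} (f : Bool ↪ H) : Nontrivial H :=
  ⟨f true, f false, fun h => by simpa using f.injective h⟩

def pairEmb {A B : Type} (a : A) : B ↪ A × B := ⟨Prod.mk a, Prod.mk_right_injective a⟩

/-- The registers. -/
structure Regs (ℓ : ℕ) where
  R : ℕ
  (In Out VI YO ΩO MO : Fin ℓ → Reg)
  (U X C Z V BA : Reg)

namespace Regs

variable {ℓ : ℕ} (g : Regs ℓ)

abbrev Q : Type := Fin g.R × Fin ℓ

def Ω : Reg := ⟨Fin g.R × (Σ i, g.ΩO i)⟩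

def adv : Reg := ⟨(g.Z ⊕ g.V) ⊕ (g.Ω ⊕ g.BA)⟩

/-- One round of a transcript. -/
def Slot : Reg := ⟨(g.C ⊕ g.C) ⊕ (Fin ℓ ⊕ (Σ i, g.VI i ⊕ g.YO i))⟩

/-- The transcript of all classical information that the adversary has got. -/
def T : Reg := ⟨g.Ω ⊕ (g.Z ⊕ (Bool ⊕ (Fin g.R × g.Slot)))⟩

/-- The classical input to the simulators of the sub-protocols: a round and a transcript. -/
def ZI : Reg := ⟨Fin g.R ⊕ g.T⟩

def MEM : Reg := ⟨g.adv ⊕ g.T⟩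

def slot (r : Fin g.R) : g.Slot ↪ g.T :=
  (((pairEmb r).trans inr).trans inr).trans
    inr

def slotA : g.C ↪ g.Slot := inl.trans inl

def slotB : g.C ↪ g.Slot := inr.trans inl

def slotF : Fin ℓ ↪ g.Slot := inl.trans inr

def slotV (i : Fin ℓ) : g.VI i ↪ g.Slot :=
  (((inl : _ ↪ g.VI i ⊕ g.YO i).trans (Function.Embedding.sigmaMk (β := fun i => g.VI i ⊕ g.YO i)
    i)).trans inr).trans inr

def slotY (i : Fin ℓ) : g.YO i ↪ g.Slot :=
  (((inr : _ ↪ g.VI i ⊕ g.YO i).trans (Function.Embedding.sigmaMk (β := fun i => g.VI i ⊕ g.YO i)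
    i)).trans inr).trans inr

def tΩ : g.Ω ↪ g.T := inl

def tZ : g.Z ↪ g.T := inl.trans inr

def advZ : g.Z ↪ g.adv := inl.trans inl

def memA : g.adv ↪ g.MEM := inl

def memT : g.T ↪ g.MEM := inr

def memD : Bool ↪ g.MEM :=
  ((inl.trans inr).trans inr).trans g.memT

instance {A : Type} : Nontrivial (A ⊕ g.MEM) :=
  nontrivial_of_bool (g.memD.trans inr)

instance : Nontrivial g.MEM := nontrivial_of_bool g.memD

def part (ω : Bits g.Ω) (r : ℕ) (i : Fin ℓ) : Bits (g.ΩO i) :=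
  fun w => if h : r < g.R then ω (⟨r, h⟩, ⟨i, w⟩) else false

def ωPart (q : g.Q) : g.ΩO q.2 ↪ g.Ω :=
  (Function.Embedding.sigmaMk (β := fun i => g.ΩO i) q.2).trans (pairEmb q.1)

end Regs

/-- The game: Alice, the attack, and the simulators of the sub-protocols. -/
structure Game (ℓ : ℕ) extends Regs ℓ where
  E : Fin ℓ → Reg
  P : OracleParty In Out U X C
  alice : ∀ i, Party (In i) (Out i) (ΩO i) (MO i)
  len : Fin ℓ → ℕ
  step : ℕ → Circuit (C ⊕ toRegs.adv)
  bcall : ℕ → ∀ i, ℕ → Circuit (MO i ⊕ toRegs.adv)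
  init : ∀ i, Circuit (ΩO i ⊕ E i)
  query : ∀ i, Circuit (VI i ⊕ ((toRegs.ZI ⊕ toRegs.adv) ⊕ E i))
  reply : ∀ i, Circuit (YO i ⊕ ((toRegs.ZI ⊕ toRegs.adv) ⊕ E i))

namespace Game

variable {ℓ : ℕ} (g : Game ℓ)

abbrev St : Type := g.P.St g.adv

abbrev Input (AUX : Reg) : Type := Bits g.Ω → Bits AUX → Bits g.U → Op (g.Z ⊕ g.V)

/-- The private memories of all simulators. -/
def ES : Reg := ⟨Σ q : g.Q, g.E q.2⟩

def anc : Reg := ⟨(g.Ω ⊕ g.BA) ⊕ (g.T ⊕ (g.ZI ⊕ g.ES))⟩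

/-- The memory of the composed simulator. -/
def W : Reg := ⟨(g.Z ⊕ g.V) ⊕ g.anc⟩

abbrev Exp : Type := g.P.St g.W

def wAdv : g.adv ↪ g.W :=
  (refl (g.Z ⊕ g.V)).sumMap inl

def wT : g.T ↪ g.W :=
  (inl.trans inr).trans inr

def wZI : g.ZI ↪ g.W :=
  (inl.trans (inr.trans inr)).trans
    inr

def wES : g.ES ↪ g.W :=
  (inr.trans (inr.trans inr)).trans
    inr

def eES (q : g.Q) : g.E q.2 ↪ g.ES :=
  Function.Embedding.sigmaMk (β := fun q : g.Q => g.E q.2) q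

def wE (q : g.Q) : g.E q.2 ↪ g.W := (g.eES q).trans g.wES

theorem wAdv_ne_wT (a : g.adv) (t : g.T) : g.wAdv a ≠ g.wT t := by
  rcases a with z | b
  · exact nofun
  exact nofun

theorem wAdv_ne_wZI (a : g.adv) (t : g.ZI) : g.wAdv a ≠ g.wZI t := by
  rcases a with z | b
  · exact nofun
  exact nofun

theorem wAdv_ne_wE (a : g.adv) (q) (t : g.E q.2) : g.wAdv a ≠ g.wE q t := by
  rcases a with z | b
  · exact nofun
  exact nofun

theorem wT_ne_wZI (a : g.T) (t : g.ZI) : g.wT a ≠ g.wZI t := nofun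

theorem wT_ne_wE (a : g.T) (q) (t : g.E q.2) : g.wT a ≠ g.wE q t := nofun

theorem wZI_ne_wE (a : g.ZI) (q) (t : g.E q.2) : g.wZI a ≠ g.wE q t := nofun

theorem wE_ne_wE {q q' : g.Q} (h : q ≠ q') (a : g.E q.2) (b : g.E q'.2) :
    g.wE q a ≠ g.wE q' b := fun e => h (by
  have e1 : (Sum.inr (Sum.inr (Sum.inr (Sum.inr (⟨q, a⟩ : Σ q : g.Q, g.E q.2)))) :
    (g.Z ⊕ g.V) ⊕ ((g.Ω ⊕ g.BA) ⊕ (g.T ⊕ (g.ZI ⊕ (Σ q : g.Q, g.E q.2)))))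
    = Sum.inr (Sum.inr (Sum.inr (Sum.inr (⟨q', b⟩ : Σ q : g.Q, g.E q.2)))) := e
  simp only [Sum.inr.injEq, Sigma.mk.injEq] at e1
  exact e1.1)

def wMEM : g.MEM ↪ g.W := joint g.wAdv g.wT g.wAdv_ne_wT

abbrev KQ (q : g.Q) : Type := g.MEM ⊕ (g.ZI ⊕ g.E q.2)

def wKQ (q : g.Q) : g.KQ q ↪ g.W :=
  joint g.wMEM (joint g.wZI (g.wE q) fun a b => g.wZI_ne_wE a q b) fun a b => by
    rcases a with a | a <;> rcases b with b | b
    · exact g.wAdv_ne_wZI a b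
    · exact g.wAdv_ne_wE a q b
    · exact g.wT_ne_wZI a b
    exact g.wT_ne_wE a q b

abbrev JQ (q : g.Q) : Type := (g.ZI ⊕ g.adv) ⊕ g.E q.2

def kJ (q : g.Q) : g.JQ q ↪ g.KQ q :=
  joint (joint (inl.trans inr) (g.memA.trans inl) nofun)
    (inr.trans inr)
    fun a b h => by rcases a with a | a <;> cases h

def kT (q : g.Q) : g.T ↪ g.KQ q := g.memT.trans inl

def kZI (q : g.Q) : g.ZI ↪ g.KQ q :=
  inl.trans inr

instance (q : g.Q) : Nontrivial (g.KQ q) :=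
  nontrivial_of_bool (g.memD.trans inl)

instance {A : Type} (q : g.Q) : Nontrivial (A ⊕ g.KQ q) :=
  nontrivial_of_bool ((g.memD.trans inl).trans inr)

def oneHot {K : Type} [DecidableEq K] (i : K) : Bits K := fun j => decide (j = i)

/-! ### The circuits of the composed simulator -/

def copyC : Circuit g.MEM :=
  .seq (measureC (g.advZ.trans g.memA))
    (loadC (g.tZ.trans g.memT) fun z => .inl (g.memA (g.advZ z)))

/-- One action of the adversary, with a transcript. -/
def stepC (r : ℕ) : Circuit (g.C ⊕ g.MEM) :=
  if h : r < g.R then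
    .seq (loadC (((g.slotA.trans (g.slot ⟨r, h⟩)).trans g.memT).trans inr)
        fun c => .inl (Sum.inl c))
      (.seq ((g.step r).map (onSnd g.C g.memA)) (.seq (loadC (((g.slotB.trans (g.slot ⟨r, h⟩)).trans
        g.memT).trans inr) fun c => .inl (Sum.inl c)) (loadC (((g.slotF.trans (g.slot ⟨r, h⟩)).trans
        g.memT).trans inr) fun _ => .inr false)))
  else (g.step r).map (onSnd g.C g.memA)

/-- Prepare the classical input of a simulator. -/
def setC (q : g.Q) : Circuit (g.KQ q) :=
  .seq (loadC (g.kZI q) (elim (fun r => .inr (oneHot q.1 r)) fun t => .inl (g.kT q t)))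
    (measureC (g.kZI q))

def queryC (q : g.Q) : Circuit (g.VI q.2 ⊕ g.KQ q) :=
  .seq ((g.setC q).map inr)
    (.seq ((g.query q.2).map (onSnd _ (g.kJ q))) (.seq (loadC ((((g.slotV q.2).trans (g.slot
      q.1)).trans (g.kT q)).trans inr) fun v => .inl (Sum.inl v)) (loadC (((g.slotF.trans (g.slot
      q.1)).trans (g.kT q)).trans inr) fun j => .inr (oneHot q.2 j))))

def replyC (q : g.Q) : Circuit (g.YO q.2 ⊕ g.KQ q) :=
  .seq (loadC ((((g.slotY q.2).trans (g.slot q.1)).trans (g.kT q)).trans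
      inr) fun v => .inl (Sum.inl v))
    ((g.reply q.2).map (onSnd _ (g.kJ q)))

def wS {A : Type} (r : Fin g.R) (f : A ↪ g.Slot) : A ↪ g.W := (f.trans (g.slot r)).trans g.wT

def wJ (q : g.Q) : g.JQ q ↪ g.W := (g.kJ q).trans (g.wKQ q)

def sendL (r : ℕ) (c c' : Bits g.C) : LM g.adv g.adv :=
  cut c' c' ∘ₗ (g.step r).runL ∘ₗ tensorL (ket c)

def stepL (r : Fin g.R) (c c' : Bits g.C) : LM g.W g.W :=
  act (g.wS r g.slotF) (replaceL (ket zeros)) ∘ₗ act (g.wS r g.slotB) (replaceL (ket c')) ∘ₗ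
    act g.wAdv (g.sendL r c c') ∘ₗ act (g.wS r g.slotA) (replaceL (ket c))

theorem dephase_stepC (r : Fin g.R) (ρ : Op (g.C ⊕ g.W)) : dephaseL inl (act (onSnd g.C g.wMEM)
    (g.stepC r).runL (dephaseL inl ρ)) = ∑ c, ∑ c', tensor (ket c') (g.stepL r c c' (cut c c
    ρ)) := by
  rw [tensor_cut_ket zeros ρ]; simp only [map_sum]; refine sum_ext fun c => ?_
  rw [tensor_cut_ket zeros]; refine sum_congr rfl fun c' _ => ?_; congr 1
  have h1 : (g.stepC r).runL
      = loadL (((g.slotF.trans (g.slot r)).trans g.memT).trans inr)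
          (fun _ : Bits (g.C ⊕ g.MEM) => zeros) ∘ₗ
        loadL (((g.slotB.trans (g.slot r)).trans g.memT).trans inr)
          (fun x : Bits (g.C ⊕ g.MEM) => x ∘ Sum.inl) ∘ₗ
        act (onSnd g.C g.memA) (g.step r).runL ∘ₗ
        loadL (((g.slotA.trans (g.slot r)).trans g.memT).trans inr)
          (fun x : Bits (g.C ⊕ g.MEM) => x ∘ Sum.inl) := by
    rw [stepC, dif_pos r.2]; simp only [Circuit.runL]
    rw [runL_loadC _ _ nofun, runL_loadC _ _ nofun, runL_loadC _ _ nofun, runL_map]; rfl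
  have h2 : ∀ {A : Type} [Fintype A] [DecidableEq A] (f : A ↪ g.Slot) (v : Bits g.C → Bits A),
      act (onSnd g.C g.wMEM) (loadL (((f.trans (g.slot r)).trans g.memT).trans
        inr) (fun x : Bits (g.C ⊕ g.MEM) => v (x ∘ Sum.inl)))
      = loadL ((g.wS r f).trans inr)
        (fun x : Bits (g.C ⊕ g.W) => v (x ∘ Sum.inl)) := fun f v => (loadL_trans _ _ _).symm
  have h4 : act (onSnd g.C g.wMEM) (act (onSnd g.C g.memA) (g.step r).runL)
      = act (onSnd g.C g.wAdv) (g.step r).runL := by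
    rw [← act_trans]; congr 1; ext x; rcases x with x | x <;> rfl
  rw [h1]; simp only [act_comp, comp_apply]; have e1 := h2 g.slotA id; have e2 := h2 g.slotB id
  have e3 := h2 g.slotF fun _ => zeros; simp only [id] at e1 e2; rw [e1, e2, e3, h4]
  have l1 := cut_loadL (C := g.C) (g.wS r g.slotF) (fun _ => zeros) c'
  have l2 := cut_loadL (C := g.C) (g.wS r g.slotB) id c'
  have l3 := loadL_tensor_ket (C := g.C) (g.wS r g.slotA) id c; simp only [id] at l2 l3
  rw [l1, l2, l3]; simp only [stepL, comp_apply]; congr 2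
  exact LinearMap.congr_fun (cut_act_tensorL g.wAdv (g.step r).runL c' c' (ket c)) _

/-- The simulator of a sub-protocol sends `v` to the functionality and gets `y`. -/
def branchL (q : g.Q) (v : Bits (g.VI q.2)) (y : Bits (g.YO q.2)) : LM (g.JQ q) (g.JQ q) :=
  (reduceL inr ∘ₗ (g.reply q.2).runL ∘ₗ tensorL (ket y)) ∘ₗ
    (cut v v ∘ₗ (g.query q.2).runL ∘ₗ tensorL (ket zeros))

theorem fexecL_branchL (q : g.Q) (L : Bits (g.In q.2) → Bits (g.VI q.2) → Bits (g.Out q.2) → Bits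
    (g.YO q.2) → ℝ) (u : Bits (g.In q.2)) (x : Bits (g.Out q.2)) : fexecL L (g.query q.2).runL
    (g.reply q.2).runL u x = ∑ v, ∑ y, (L u v x y : ℂ) • g.branchL q v y := rfl

/-- The same in the memory of the composed simulator, with a transcript. -/
def callL (q : g.Q) (v : Bits (g.VI q.2)) (y : Bits (g.YO q.2)) : LM g.W g.W :=
  act (g.wS q.1 (g.slotY q.2)) (replaceL (ket y)) ∘ₗ
    act (g.wS q.1 g.slotF) (replaceL (ket (oneHot q.2))) ∘ₗ
    act (g.wS q.1 (g.slotV q.2)) (replaceL (ket v)) ∘ₗ act (g.wJ q) (g.branchL q v y) ∘ₗ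
    act (g.wKQ q) (g.setC q).runL

theorem fexecL_queryC (q : g.Q) (L : Bits (g.In q.2) → Bits (g.VI q.2) → Bits (g.Out q.2) → Bits
    (g.YO q.2) → ℝ) (u : Bits (g.In q.2)) (x : Bits (g.Out q.2)) : act (g.wKQ q) (fexecL L (g.queryC
    q).runL (g.replyC q).runL u x) = ∑ v, ∑ y, (L u v x y : ℂ) • g.callL q v y := by
  simp only [fexecL, act_sum, act_smul]; refine sum_ext fun v => sum_ext fun y => ?_; congr 1
  let kS : ∀ {A : Type}, (A ↪ g.Slot) → (A ↪ g.KQ q) := fun f => (f.trans (g.slot q.1)).trans (g.kT q)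
  have hq : cut v v ∘ₗ (g.queryC q).runL ∘ₗ tensorL (ket zeros)
      = act (kS g.slotF) (replaceL (ket (oneHot q.2))) ∘ₗ
        act (kS (g.slotV q.2)) (replaceL (ket v)) ∘ₗ
        act (g.kJ q) (cut v v ∘ₗ (g.query q.2).runL ∘ₗ tensorL (ket zeros)) ∘ₗ (g.setC q).runL := by
    ext1 ρ
    rw [queryC]; simp only [Circuit.runL, comp_apply, runL_map]
    rw [runL_loadC _ _ nofun, runL_loadC _ _ nofun]
    have l1 := cut_loadL (C := g.VI q.2) (kS g.slotF) (fun _ => oneHot q.2) v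
    have l2 := cut_loadL (C := g.VI q.2) (kS (g.slotV q.2)) id v
    refine (l1 _).trans (congrArg _ ((l2 _).trans (congrArg _ ?_)))
    rw [act_inr, ← tensor_eq, ext_tensor]
    exact LinearMap.congr_fun (cut_act_tensorL (g.kJ q) (g.query q.2).runL v v (ket zeros)) _
  have hr : reduceL inr ∘ₗ (g.replyC q).runL ∘ₗ tensorL (ket y)
      = act (g.kJ q) (reduceL inr ∘ₗ (g.reply q.2).runL ∘ₗ tensorL (ket y)) ∘ₗ
        act (kS (g.slotY q.2)) (replaceL (ket y)) := by
    ext1 ρ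
    rw [replyC]; simp only [Circuit.runL, comp_apply, runL_map]; rw [runL_loadC _ _ nofun]
    have l1 := loadL_tensor_ket (C := g.YO q.2) (kS (g.slotY q.2)) id y ρ
    refine (congrArg _ (congrArg _ l1)).trans ?_
    exact LinearMap.congr_fun (reduce_act_tensorL (g.kJ q) (g.reply q.2).runL (ket y)) _
  have hd : ∀ {A : Type} (f : A ↪ g.Slot) (j : g.JQ q) (a : A), g.kJ q j ≠ kS f a := by
    rintro A f ((j | j) | j) a h <;> cases h
  have e : reduceL inr ∘ₗ (g.replyC q).runL ∘ₗ tensorL (ket y) ∘ₗ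
      cut v v ∘ₗ (g.queryC q).runL ∘ₗ tensorL (ket zeros)
      = (reduceL inr ∘ₗ (g.replyC q).runL ∘ₗ tensorL (ket y)) ∘ₗ
        (cut v v ∘ₗ (g.queryC q).runL ∘ₗ tensorL (ket zeros)) := rfl
  rw [e, hq, hr]
  have e2 : ∀ {A : Type} [Fintype A] [DecidableEq A] (f : A ↪ g.Slot) (Φ : LM A A),
      act (g.wS q.1 f) Φ = act (g.wKQ q) (act (kS f) Φ) := fun f Φ => act_trans (kS f) (g.wKQ q) Φ
  rw [callL, e2, e2, e2, wJ, act_trans (g.kJ q) (g.wKQ q)]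
  rw [← act_comp, ← act_comp, ← act_comp, ← act_comp]; refine congrArg _ ?_
  ext1 ρ; simp only [comp_apply]
  rw [act_comm (g.kJ q) (kS (g.slotY q.2)) (hd _), act_comm (g.kJ q) (kS g.slotF) (hd _),
    act_comm (g.kJ q) (kS (g.slotV q.2)) (hd _), branchL, act_comp, comp_apply]

/-! ### Hybrid executions -/

/-- Kernels for all calls. -/
abbrev Ker : Type :=
  ℕ → ∀ i, Bits (g.In i) → Bits (g.VI i) → Bits (g.Out i) → Bits (g.YO i) → ℝ

def rcall (ω : Bits g.Ω) (r : ℕ) (i : Fin ℓ) (u : Bits (g.In i)) (x : Bits (g.Out i)) :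
    LM g.adv g.adv :=
  (g.alice i).execL (g.len i) (fun t => (g.bcall r i t).runL) (g.part ω r i) u x

/-- A call in the hybrid world in which the first `n` possible calls are ideal. -/
def hcall (L : g.Ker) (n : ℕ) (ω : Bits g.Ω) (r : ℕ) (i : Fin ℓ) (u : Bits (g.In i))
    (x : Bits (g.Out i)) : LM g.W g.W :=
  if h : r < g.R ∧ r * ℓ + i < n then
    act (g.wKQ (⟨r, h.1⟩, i))
      (fexecL (L r i) (g.queryC (⟨r, h.1⟩, i)).runL (g.replyC (⟨r, h.1⟩, i)).runL u x)
  else act g.wAdv (g.rcall ω r i u x)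

def hstep (r : ℕ) : LM (g.C ⊕ g.W) (g.C ⊕ g.W) := act (onSnd g.C g.wMEM) (g.stepC r).runL

def hround (L : g.Ker) (n : ℕ) (ω : Bits g.Ω) (r : ℕ) : LM g.Exp g.Exp :=
  g.P.roundL r (g.hstep r) (g.hcall L n ω r)

def rround (ω : Bits g.Ω) (r : ℕ) : LM g.St g.St :=
  g.P.roundL r (g.step r).runL (g.rcall ω r)

def redL : LM g.Exp g.St :=
  ext _ (ext _ (reduceL g.wAdv))

theorem reduce_stepL (r : Fin g.R) (c c' : Bits g.C) (ρ : Op g.W) :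
    reduceL g.wAdv (g.stepL r c c' ρ) = g.sendL r c c' (reduceL g.wAdv ρ) := by
  have hd : ∀ {A : Type} (f : A ↪ g.Slot) (a : A) (b : g.adv), g.wS r f a ≠ g.wAdv b :=
    fun f a b => (g.wAdv_ne_wT b _).symm
  simp only [stepL, comp_apply]
  rw [reduceL_disjoint _ _ (hd _) (replaceL_ket_tp _), reduceL_disjoint _ _ (hd _) (replaceL_ket_tp
    _), reduceL_act, reduceL_disjoint _ _ (hd _) (replaceL_ket_tp _)]

theorem send_intertwine {W' : Type} [Fintype W'] [DecidableEq W'] (r : Fin g.R) (R : LM g.W W')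
    (b' : LM (g.C ⊕ W') (g.C ⊕ W')) (h : ∀ c c', R ∘ₗ g.stepL r c c' = (cut c' c' ∘ₗ b' ∘ₗ tensorL
    (ket c)) ∘ₗ R) : ext g.C R ∘ₗ (dephaseL inl ∘ₗ g.hstep r ∘ₗ dephaseL inl) = (dephaseL inl ∘ₗ b'
    ∘ₗ dephaseL inl) ∘ₗ ext g.C R := by
  ext1 ρ
  simp only [comp_apply]; rw [hstep, dephase_stepC, dephase_send]; simp only [map_sum, cut_ext]
  refine sum_ext fun c => sum_congr rfl fun c' _ => ?_; rw [ext_tensor]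
  exact congrArg _ (LinearMap.congr_fun (h c c') _)

theorem send_stepL (r : Fin g.R) (c c' : Bits g.C) :
    cut c' c' ∘ₗ g.hstep r ∘ₗ tensorL (ket c) = g.stepL r c c' := by
  ext1 ρ
  have h := dephase_stepC g r (tensor (ket c) ρ)
  have h1 : dephaseL inl (tensor (ket c) ρ) = (tensor (ket c) ρ : Op (g.C ⊕ g.W)) := by
    refine op_ext_cut fun a a' => ?_; rw [cut_dephaseL_inl, cut_tensor]; split_ifs with e
    · rfl
    have : (ket c : Op g.C) a a' = 0 := by
      simp only [ket, of_apply]; rw [if_neg]; rintro ⟨rfl, rfl⟩; exact e rfl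
    rw [this, zero_smul]
  rw [h1] at h; have h2 := congrArg (cut c' c') h; rw [cut_dephaseL_inl, if_pos rfl] at h2
  refine h2.trans ?_; simp only [map_sum, cut_tensor]; rw [sum_eq_single c, sum_eq_single c']
  · simp [ket]
  · intro b _ hb; simp [ket, Ne.symm hb]
  · simp
  · intro b _ hb; have : (ket c : Op g.C) b b = 0 := by simp [ket, hb]
    simp [this]
  simp

theorem hcall_real {L : g.Ker} {n : ℕ} {ω : Bits g.Ω} {r : ℕ} {i : Fin ℓ}
    (h : ¬ (r < g.R ∧ r * ℓ + i < n)) (u : Bits (g.In i)) (x : Bits (g.Out i)) :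
    g.hcall L n ω r i u x = act g.wAdv (g.rcall ω r i u x) := dif_neg h

theorem redL_hcall {L : g.Ker} {n : ℕ} {ω : Bits g.Ω} {r : ℕ} {i : Fin ℓ}
    (h : ¬ (r < g.R ∧ r * ℓ + i < n)) (u : Bits (g.In i)) (x : Bits (g.Out i)) :
    reduceL g.wAdv ∘ₗ g.hcall L n ω r i u x = g.rcall ω r i u x ∘ₗ reduceL g.wAdv := by
  rw [g.hcall_real h]; exact LinearMap.ext fun ρ => reduceL_act g.wAdv (g.rcall ω r i u x) ρ

theorem redL_send (r : Fin g.R) : ext g.C (reduceL g.wAdv) ∘ₗ (dephaseL inl ∘ₗ g.hstep r ∘ₗ dephaseL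
    inl) = (dephaseL inl ∘ₗ (g.step r).runL ∘ₗ dephaseL inl) ∘ₗ ext g.C (reduceL g.wAdv) :=
  g.send_intertwine r _ _ fun c c' => LinearMap.ext fun ρ => g.reduce_stepL r c c' ρ

theorem redL_hround {L : g.Ker} {n : ℕ} {ω : Bits g.Ω} {r : ℕ} (hr : r < g.R)
    (hn : n ≤ r * ℓ) : g.redL ∘ₗ g.hround L n ω r = g.rround ω r ∘ₗ g.redL :=
  g.P.roundL_intertwine r (reduceL g.wAdv) (g.redL_send ⟨r, hr⟩) fun i u x =>
    g.redL_hcall (fun h => absurd h.2 (not_lt.2 (hn.trans (Nat.le_add_right _ _)))) u x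

theorem redL_iter {L : g.Ker} {n : ℕ} {ω : Bits g.Ω} {r k : ℕ} (hk : r + k ≤ g.R) (hn : n ≤ r * ℓ) :
    g.redL ∘ₗ iter (fun t => g.hround L n ω (r + t)) k = iter (fun t => g.rround ω (r + t)) k ∘ₗ
    g.redL :=
  iter_intertwine fun t ht => g.redL_hround (by omega)
    (hn.trans (Nat.mul_le_mul_right _ (Nat.le_add_right _ _)))

/-! ### Replacing the private memory of a simulator -/

def setE (q : g.Q) (κ : Op (g.E q.2)) : LM g.W g.W := act (g.wE q) (replaceL κ)

theorem setE_comm_act {A : Type} [Fintype A] [DecidableEq A] {f : A ↪ g.W} (Φ : LM A A)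
    (q : g.Q) (h : ∀ a b, g.wE q b ≠ f a) (κ : Op (g.E q.2)) :
    g.setE q κ ∘ₗ act f Φ = act f Φ ∘ₗ g.setE q κ := by
  ext1 ρ
  exact act_comm _ _ (fun b a => h a b) _ _ ρ

theorem setE_comm_stepL (q : g.Q) (κ : Op (g.E q.2)) (r : Fin g.R)
    (c c' : Bits g.C) : g.setE q κ ∘ₗ g.stepL r c c' = g.stepL r c c' ∘ₗ g.setE q κ := by
  have hS : ∀ {A : Type} [Fintype A] [DecidableEq A] (f : A ↪ g.Slot) (Φ : LM A A) (ρ : Op g.W),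
      g.setE q κ (act (g.wS r f) Φ ρ) = act (g.wS r f) Φ (g.setE q κ ρ) := fun f Φ ρ =>
    LinearMap.congr_fun (g.setE_comm_act (f := g.wS r f) Φ q
      (fun a b => (g.wT_ne_wE (g.slot r (f a)) q b).symm) κ) ρ
  have hA : ∀ (Φ : LM g.adv g.adv) (ρ : Op g.W),
      g.setE q κ (act g.wAdv Φ ρ) = act g.wAdv Φ (g.setE q κ ρ) := fun Φ ρ =>
    LinearMap.congr_fun (g.setE_comm_act Φ q (fun a b => (g.wAdv_ne_wE a q b).symm) κ) ρ
  ext1 ρ; simp only [stepL, comp_apply]; rw [hS, hS, hA, hS]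

theorem wKQ_ne_wE {q q' : g.Q} (h : q' ≠ q) (a : g.KQ q') (b : g.E q.2) :
    g.wE q b ≠ g.wKQ q' a := by
  rcases a with (a | a) | (a | a)
  · exact (g.wAdv_ne_wE a q b).symm
  · exact (g.wT_ne_wE a q b).symm
  · exact (g.wZI_ne_wE a q b).symm
  exact (g.wE_ne_wE h a b).symm

theorem setE_comm_hcall (q : g.Q) (κ : Op (g.E q.2)) (L : g.Ker) (n : ℕ) (ω : Bits g.Ω) (r : ℕ) (i :
    Fin ℓ) (h : ¬ (r = q.1 ∧ i = q.2)) (u : Bits (g.In i)) (x : Bits (g.Out i)) : g.setE q κ ∘ₗ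
    g.hcall L n ω r i u x = g.hcall L n ω r i u x ∘ₗ g.setE q κ := by
  unfold hcall; split_ifs with hc
  · exact g.setE_comm_act _ q (g.wKQ_ne_wE fun e => h (by subst e; exact ⟨rfl, rfl⟩)) κ
  exact g.setE_comm_act _ q (fun a b => (g.wAdv_ne_wE a q b).symm) κ

def setEL (q : g.Q) (κ : Op (g.E q.2)) : LM g.Exp g.Exp :=
  ext _ (ext _ (g.setE q κ))

theorem setE_comm_send (q : g.Q) (κ : Op (g.E q.2)) {r : ℕ} (hr : r < g.R) : ext g.C (g.setE q κ) ∘ₗ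
    (dephaseL inl ∘ₗ g.hstep r ∘ₗ dephaseL inl) = (dephaseL inl ∘ₗ g.hstep r ∘ₗ dephaseL inl) ∘ₗ ext
    g.C (g.setE q κ) :=
  g.send_intertwine ⟨r, hr⟩ _ _ fun c c' => by
    rw [g.setE_comm_stepL]; congr 1; exact (g.send_stepL ⟨r, hr⟩ c c').symm

theorem setEL_preL (q : g.Q) (κ : Op (g.E q.2)) {r : ℕ} (hr : r < g.R) :
    g.setEL q κ ∘ₗ g.P.preL r (g.hstep r) = g.P.preL r (g.hstep r) ∘ₗ g.setEL q κ :=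
  OracleParty.preL_intertwine _ _ _ (g.setE_comm_send q κ hr)

theorem setEL_hround (q : g.Q) (κ : Op (g.E q.2)) (L : g.Ker) (n : ℕ) (ω : Bits g.Ω) {r : ℕ} (hr : r
    < g.R) (h : r ≠ q.1) : g.setEL q κ ∘ₗ g.hround L n ω r = g.hround L n ω r ∘ₗ g.setEL q κ :=
  OracleParty.roundL_intertwine _ _ _ (g.setE_comm_send q κ hr)
    fun i u x => g.setE_comm_hcall q κ L n ω r i (fun e => h e.1) u x

theorem redL_setEL (q : g.Q) (κ : Op (g.E q.2)) (ρ : Op g.Exp) : g.redL (g.setEL q κ ρ) = κ.trace •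
    g.redL ρ := by
  refine op_ext_cut fun a a' => op_ext_cut fun c c' => ?_
  simp only [redL, setEL, cut_ext, map_smul]
  exact act_replaceL_reduceL _ _ (fun b a => (g.wAdv_ne_wE a q b).symm) κ _

/-! ### The challenge call -/

def wZA : g.ZI ⊕ g.adv ↪ g.W := joint g.wZI g.wAdv fun a b h => g.wAdv_ne_wZI b a h.symm

def inputL (q : g.Q) : LM g.W (g.ZI ⊕ g.adv) :=
  reduceL g.wZA ∘ₗ act (g.wKQ q) (g.setC q).runL

theorem wJ_eq (q : g.Q) : g.wJ q = joint g.wZA (g.wE q) (fun a b => by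
    rcases a with a | a
    · exact g.wZI_ne_wE a q b
    exact g.wAdv_ne_wE a q b) := by
  ext x; rcases x with (x | x) | x <;> rfl

theorem wAdv_eq_wJ (q : g.Q) : g.wAdv = (inr.trans inl).trans (g.wJ q) := by
  ext x; rfl

theorem setC_eq (q : g.Q) : (g.setC q).runL = dephaseL (g.kZI q) ∘ₗ
    loadL (g.kZI q) fun x => elim (oneHot q.1) (x ∘ g.kT q) := by
  have h : ∀ a b, (elim (fun r => Sum.inr (oneHot q.1 r)) fun t => Sum.inl (g.kT q t) :
      g.ZI → g.KQ q ⊕ Bool) a ≠ .inl (g.kZI q b) := by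
    rintro (a | a) b h
    · cases h
    simp only [elim_inr, Sum.inl.injEq] at h
    cases h
  rw [setC, Circuit.runL, runL_measureC]; congr 1; refine (runL_loadC _ _ h).trans ?_; congr 1
  funext x a; rcases a with a | a <;> rfl

def zin (r : Fin g.R) (t : Bits g.T) : Bits g.ZI := elim (oneHot r) t

theorem zin_injective (r : Fin g.R) : Function.Injective (g.zin r) := fun t t' h =>
  funext fun w => congrFun h (Sum.inr w)

def maskT (t : Bits g.T) : LM g.W g.W := maskL fun x => x ∘ g.wT = t

theorem act_setC (q : g.Q) (ρ : Op g.W) : act (g.wKQ q) (g.setC q).runL ρ = ∑ t, act g.wZI (replaceL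
    (ket (g.zin q.1 t))) (g.maskT t ρ) := by
  have h1 : act (g.wKQ q) (loadL (g.kZI q) fun x => g.zin q.1 (x ∘ g.kT q))
      = loadL g.wZI (fun x => g.zin q.1 (x ∘ g.wT)) :=
    (loadL_trans (g.kZI q) (g.wKQ q) fun x => g.zin q.1 (x ∘ g.kT q)).symm
  have h2 : act (g.wKQ q) (dephaseL (g.kZI q)) = dephaseL g.wZI :=
    (dephaseL_trans (g.kZI q) (g.wKQ q)).symm
  have h3 : (g.setC q).runL = dephaseL (g.kZI q) ∘ₗ
    loadL (g.kZI q) fun x => g.zin q.1 (x ∘ g.kT q) := g.setC_eq q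
  rw [h3, act_comp, h1, h2]
  exact dephase_loadL_eq g.wZI g.wT (fun a b => (g.wT_ne_wZI b a).symm) (g.zin_injective q.1) ρ

theorem setE_maskT (q : g.Q) (κ : Op (g.E q.2)) (t : Bits g.T) (ρ : Op g.W) :
    g.maskT t (g.setE q κ ρ) = g.setE q κ (g.maskT t ρ) :=
  maskL_act_comm _ _ _ (fun b x => by
    rw [write_disjoint _ _ fun a b => (g.wT_ne_wE b q a).symm]) ρ

theorem setE_setC (q : g.Q) (κ : Op (g.E q.2)) (ρ : Op g.W) : act (g.wKQ q) (g.setC q).runL (g.setE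
    q κ ρ) = g.setE q κ (act (g.wKQ q) (g.setC q).runL ρ) := by
  rw [act_setC, act_setC, map_sum]; refine sum_ext fun t => ?_; rw [setE_maskT]
  exact (act_comm (g.wE q) g.wZI (fun a b => (g.wZI_ne_wE b q a).symm) _ _ _).symm

theorem inputL_apply (q : g.Q) (ρ : Op g.W) :
    g.inputL q ρ = ∑ t, tensor (ket (g.zin q.1 t)) (reduceL g.wAdv (g.maskT t ρ)) := by
  rw [inputL, comp_apply, act_setC, map_sum]
  exact sum_ext fun t => reduceL_joint_replaceL' _ _ _ _ _

theorem reduce_callL (q : g.Q) (v : Bits (g.VI q.2)) (y : Bits (g.YO q.2)) (κ : Op (g.E q.2)) (ρ :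
    Op g.W) : reduceL (g.wJ q) (g.callL q v y (g.setE q κ ρ)) = g.branchL q v y (tensor (g.inputL q
    ρ) κ) := by
  have hd : ∀ {A : Type} (f : A ↪ g.Slot) (a : A) (b : g.JQ q), g.wS q.1 f a ≠ g.wJ q b := by
    rintro A f a ((b | b) | b)
    · exact g.wT_ne_wZI (g.slot q.1 (f a)) b
    · exact (g.wAdv_ne_wT b (g.slot q.1 (f a))).symm
    exact g.wT_ne_wE (g.slot q.1 (f a)) q b
  simp only [callL, comp_apply]
  rw [reduceL_disjoint _ _ (hd _) (replaceL_ket_tp _), reduceL_disjoint _ _ (hd _) (replaceL_ket_tp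
    _), reduceL_disjoint _ _ (hd _) (replaceL_ket_tp _), reduceL_act (g.wJ q) (g.branchL q v y),
    setE_setC, wJ_eq]
  congr 1; exact reduceL_joint_replaceL _ _ _ _ _

theorem hcall_ideal {L : g.Ker} {n : ℕ} {ω : Bits g.Ω} (q : g.Q)
    (h : q.1 * ℓ + q.2 < n) (u : Bits (g.In q.2)) (x : Bits (g.Out q.2)) :
    g.hcall L n ω q.1 q.2 u x = ∑ v, ∑ y, (L q.1 q.2 u v x y : ℂ) • g.callL q v y := by
  rw [hcall, dif_pos ⟨q.1.2, h⟩]; exact g.fexecL_queryC q _ u x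

theorem reduce_challenge {L : g.Ker} {n : ℕ} {ω : Bits g.Ω} (q : g.Q) (h : q.1 * ℓ + q.2 < n) (κ :
    Op (g.E q.2)) (u : Bits (g.In q.2)) (x : Bits (g.Out q.2)) (ρ : Op g.W) : reduceL g.wAdv
    (g.hcall L n ω q.1 q.2 u x (g.setE q κ ρ)) = reduceL (inr.trans inl) (fexecL (L q.1 q.2)
    (g.query q.2).runL (g.reply q.2).runL u x (tensor (g.inputL q ρ) κ)) := by
  rw [hcall_ideal g q h, fexecL_branchL, wAdv_eq_wJ g q, reduceL_trans]; congr 1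
  simp only [LinearMap.sum_apply, LinearMap.smul_apply, map_sum, map_smul]
  exact sum_ext fun v => sum_ext fun y =>
    congrArg _ (g.reduce_callL q v y κ ρ)

theorem slices_send {S : Submodule ℂ (Op g.W)} {τ : Op g.Exp} (h : Slices S τ) (r : Fin g.R) :
    Slices (⨆ c : Bits g.C × Bits g.C, S.map (g.stepL r c.1 c.2)) (g.P.preL r (g.hstep r) τ) := by
  intro s s' d d'
  rw [OracleParty.preL, comp_apply, cut_ext, comp_apply, comp_apply, hstep, dephase_stepC]
  simp only [map_sum, cut_tensor]
  refine sum_mem fun c _ => sum_mem fun c' _ => Submodule.smul_mem _ _ ?_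
  exact Submodule.mem_iSup_of_mem (c, c')
    (Submodule.mem_map_of_mem (h.act_front (g.P.step r).runL s s' c c))

/-- What happens in one round. -/
abbrev Label : Type :=
  (Bits g.C × Bits g.C) × Option (Σ i : Fin ℓ, Bits (g.VI i) × Bits (g.YO i))

def labelL (r : Fin g.R) : g.Label → LM g.W g.W
  | (c, none) => g.stepL r c.1 c.2
  | (c, some ⟨i, v, y⟩) => g.callL (r, i) v y ∘ₗ g.stepL r c.1 c.2

theorem slices_pre {S : Submodule ℂ (Op g.W)} {τ : Op g.Exp} (h : Slices S τ) (r : Fin g.R) : Slices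
    (⨆ l, S.map (g.labelL r l)) (g.P.preL r (g.hstep r) τ) :=
  (g.slices_send h r).mono (iSup_le fun c => le_iSup_of_le (c, none) le_rfl)

theorem slices_hround {S : Submodule ℂ (Op g.W)} {τ : Op g.Exp} (h : Slices S τ) {L : g.Ker} {n : ℕ}
    {ω : Bits g.Ω} (r : Fin g.R) (hn : ∀ i : Fin ℓ, r * ℓ + i < n) : Slices (⨆ l, S.map (g.labelL r
    l)) (g.hround L n ω r τ) := by
  have h1 := g.slices_send h r; intro s s' d d'
  rw [hround, OracleParty.roundL, comp_apply, OracleParty.callRoundL,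
    LinearMap.add_apply, map_add, map_add, cut_selL]
  refine Submodule.add_mem _ ?_ ?_
  · split_ifs
    · exact g.slices_pre h r s s' d d'
    rw [map_zero]; exact zero_mem _
  simp only [LinearMap.sum_apply, map_sum, OracleParty.calledL]
  refine sum_mem fun i _ => sum_mem fun s0 _ =>
    sum_mem fun c0 _ => ?_
  split_ifs
  · simp only [LinearMap.sum_apply, map_sum]; refine sum_mem fun x _ => ?_
    have e : ∀ ρ : Op g.W, cut d d' (cut s s' ((tensorL (ket (write (g.P.callOut i) x s0)) ∘ₗ
        tensorL (ket c0)) ρ)) = (ket (write (g.P.callOut i) x s0) : Op (g.U ⊕ g.P.anc)) s s' •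
        (ket c0 : Op g.C) d d' • ρ := by
      intro ρ; simp only [comp_apply, ← tensor_eq, cut_tensor, map_smul]
    refine (congrArg (· ∈ _) (e _)).mpr ?_
    refine Submodule.smul_mem _ _ (Submodule.smul_mem _ _ ?_)
    rw [comp_apply, hcall_ideal g (r, i) (hn i)]
    simp only [LinearMap.sum_apply, LinearMap.smul_apply]
    refine sum_mem fun v _ => sum_mem fun y _ =>
      Submodule.smul_mem _ _ ?_
    have h2 : (⨆ c : Bits g.C × Bits g.C, S.map (g.stepL r c.1 c.2)).map (g.callL (r, i) v y)
        ≤ ⨆ l, S.map (g.labelL r l) := by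
      rw [Submodule.map_iSup]; refine iSup_le fun c => le_iSup_of_le (c, some ⟨i, v, y⟩) ?_
      rw [← Submodule.map_comp]; exact le_rfl
    exact h2 (Submodule.mem_map_of_mem (h1 s0 s0 c0 c0))
  simp

/-! ### Transcripts -/

def SlotEq (a b : Bits g.Slot) : Prop :=
  b ∘ g.slotA = a ∘ g.slotA ∧ b ∘ g.slotB = a ∘ g.slotB ∧ b ∘ g.slotF = a ∘ g.slotF ∧
    ∀ i, a ∘ g.slotF = oneHot i → b ∘ g.slotV i = a ∘ g.slotV i ∧ b ∘ g.slotY i = a ∘ g.slotY i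

/-- Agreement on the transcript of the rounds before `r`. -/
def TEq (r : ℕ) (ξ t : Bits g.T) : Prop :=
  t ∘ g.tΩ = ξ ∘ g.tΩ ∧ t ∘ g.tZ = ξ ∘ g.tZ ∧
    ∀ r' : Fin g.R, r'.1 < r → g.SlotEq (ξ ∘ g.slot r') (t ∘ g.slot r')

open Classical in
def maskTEq (r : ℕ) (ξ : Bits g.T) : LM g.W g.W := maskL fun x => g.TEq r ξ (x ∘ g.wT)

theorem slot_disjoint {r r' : Fin g.R} (h : r ≠ r') (a b : g.Slot) : g.slot r a ≠ g.slot r' b :=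
  fun e => h (by
    have e1 : (Sum.inr (Sum.inr (Sum.inr (r, a))) : g.Ω ⊕ (g.Z ⊕ (Bool ⊕ (Fin g.R × g.Slot))))
      = Sum.inr (Sum.inr (Sum.inr (r', b))) := e
    simp only [Sum.inr.injEq, Prod.mk.injEq] at e1
    exact e1.1)

theorem tEq_write (r : Fin g.R) (ξ : Bits g.T) {A : Type} (f : A ↪ g.Slot) (b : Bits A)
    (t : Bits g.T) : g.TEq r ξ (write (f.trans (g.slot r)) b t) ↔ g.TEq r ξ t := by
  have h1 : write (f.trans (g.slot r)) b t ∘ g.tΩ = t ∘ g.tΩ :=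
    write_disjoint _ _ nofun _ _
  have h2 : write (f.trans (g.slot r)) b t ∘ g.tZ = t ∘ g.tZ :=
    write_disjoint _ _ nofun _ _
  have h3 : ∀ r' : Fin g.R, r'.1 < r.1 →
      write (f.trans (g.slot r)) b t ∘ g.slot r' = t ∘ g.slot r' := fun r' hr =>
    write_disjoint _ _ (fun a w => g.slot_disjoint (fun e => by
      subst e; exact absurd hr (lt_irrefl _)) (f a) w) _ _
  unfold TEq; rw [h1, h2]
  refine and_congr_right fun _ => and_congr_right fun _ => forall_congr' fun r' =>
    forall_congr' fun hr => ?_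
  rw [h3 r' hr]

section Masks

variable (p : Bits g.T → Prop) [DecidablePred p]

theorem mask_act {A : Type} [Fintype A] [DecidableEq A] (f : A ↪ g.W) (Φ : LM A A)
    (h : ∀ a b, f a ≠ g.wT b) (ρ : Op g.W) :
    maskL (fun x => p (x ∘ g.wT)) (act f Φ ρ) = act f Φ (maskL (fun x => p (x ∘ g.wT)) ρ) :=
  maskL_act_comm _ _ _ (fun b x => by rw [write_disjoint _ _ h]) ρ

theorem mask_wS {A : Type} [Fintype A] [DecidableEq A] (r : Fin g.R) (f : A ↪ g.Slot) (Φ : LM A A)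
    (h : ∀ b t, p (write (f.trans (g.slot r)) b t) ↔ p t) (ρ : Op g.W) : maskL (fun x => p (x ∘
    g.wT)) (act (g.wS r f) Φ ρ) = act (g.wS r f) Φ (maskL (fun x => p (x ∘ g.wT)) ρ) :=
  maskL_act_comm _ _ _ (fun b x => by
    have : write (g.wS r f) b x ∘ g.wT = write (f.trans (g.slot r)) b (x ∘ g.wT) := by
      rw [wS, write_trans, write_comp]
    rw [this, h]) ρ

theorem mask_setC (q : g.Q) (ρ : Op g.W) : maskL (fun x => p (x ∘ g.wT)) (act (g.wKQ q) (g.setC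
    q).runL ρ) = act (g.wKQ q) (g.setC q).runL (maskL (fun x => p (x ∘ g.wT)) ρ) := by
  rw [act_setC, act_setC, map_sum]; refine sum_ext fun t => ?_
  rw [g.mask_act p _ _ (fun a b => (g.wT_ne_wZI b a).symm), maskT, maskL_maskL, maskL_maskL]
  exact congrArg _ (LinearMap.congr_fun (maskL_congr fun x => and_comm) ρ)

theorem mask_stepL (r : Fin g.R) (c c' : Bits g.C) (h : ∀ {A : Type} (f : A ↪ g.Slot) b t, p (write
    (f.trans (g.slot r)) b t) ↔ p t) (ρ : Op g.W) : maskL (fun x => p (x ∘ g.wT)) (g.stepL r c c'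
    ρ) = g.stepL r c c' (maskL (fun x => p (x ∘ g.wT)) ρ) := by
  simp only [stepL, comp_apply]
  rw [g.mask_wS p r _ _ (h _), g.mask_wS p r _ _ (h _), g.mask_act p _ _ g.wAdv_ne_wT,
    g.mask_wS p r _ _ (h _)]

theorem mask_callL (q : g.Q) (v : Bits (g.VI q.2)) (y : Bits (g.YO q.2)) (hY : ∀ b t, p (write
    ((g.slotY q.2).trans (g.slot q.1)) b t) ↔ p t) (hF : ∀ b t, p (write (g.slotF.trans (g.slot
    q.1)) b t) ↔ p t) (hV : ∀ b t, p (write ((g.slotV q.2).trans (g.slot q.1)) b t) ↔ p t) (ρ : Op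
    g.W) : maskL (fun x => p (x ∘ g.wT)) (g.callL q v y ρ) = g.callL q v y (maskL (fun x => p (x ∘
    g.wT)) ρ) := by
  have hJ : ∀ (a : g.JQ q) (b : g.T), g.wJ q a ≠ g.wT b := by
    rintro ((a | a) | a) b
    · exact (g.wT_ne_wZI b a).symm
    · exact g.wAdv_ne_wT a b
    exact (g.wT_ne_wE b q a).symm
  simp only [callL, comp_apply]
  rw [g.mask_wS p q.1 _ _ hY, g.mask_wS p q.1 _ _ hF, g.mask_wS p q.1 _ _ hV,
    g.mask_act p (g.wJ q) _ hJ, g.mask_setC p q]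

end Masks

theorem supp_stepL (r : Fin g.R) (c c' : Bits g.C) (ρ : Op g.W) : maskL (fun x => ((x ∘ g.wT) ∘
    (g.slotA.trans (g.slot r)) = c ∧ (x ∘ g.wT) ∘ (g.slotB.trans (g.slot r)) = c')) (g.stepL r c c'
    ρ) = g.stepL r c c' ρ ∧ maskL (fun x => (x ∘ g.wT) ∘ (g.slotF.trans (g.slot r)) = zeros)
    (g.stepL r c c' ρ) = g.stepL r c c' ρ := by
  have hd : ∀ {A B : Type} (f : A ↪ g.Slot) (e : B ↪ g.Slot), (∀ a b, e b ≠ f a) → ∀ v b t,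
      write (e.trans (g.slot r)) b t ∘ (f.trans (g.slot r)) = v ↔ t ∘ (f.trans (g.slot r)) = v :=
    fun f e h v b t => by rw [write_disjoint _ _ fun a b h' => h b a ((g.slot r).injective h')]
  refine ⟨maskL_and ?_ ?_, ?_⟩
  · simp only [stepL, comp_apply]
    rw [g.mask_wS (fun t => t ∘ (g.slotA.trans (g.slot r)) = c) r _ _ (hd _ _ nofun _), g.mask_wS
        (fun t => t ∘ (g.slotA.trans (g.slot r)) = c) r _ _ (hd _ _ nofun _), g.mask_act (fun t => t
        ∘ (g.slotA.trans (g.slot r)) = c) _ _ g.wAdv_ne_wT]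
    exact congrArg _ (congrArg _ (congrArg _ (maskL_replaceL (g.wS r g.slotA) c _)))
  · simp only [stepL, comp_apply]
    rw [g.mask_wS (fun t => t ∘ (g.slotB.trans (g.slot r)) = c') r _ _ (hd _ _ nofun _)]
    exact congrArg _ (maskL_replaceL (g.wS r g.slotB) c' _)
  simp only [stepL, comp_apply]; exact maskL_replaceL (g.wS r g.slotF) zeros _

theorem oneHot_injective {K : Type} [DecidableEq K] : Function.Injective (oneHot : K → Bits K) :=
  fun i j h => by
    have := congrFun h i; simpa [oneHot] using this

theorem oneHot_ne_zeros {K : Type} [DecidableEq K] (i : K) : oneHot i ≠ zeros := fun h => by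
  have := congrFun h i; simp [oneHot, zeros] at this

theorem supp_callL (r : Fin g.R) (i : Fin ℓ) (v : Bits (g.VI i)) (y : Bits (g.YO i)) (c c' : Bits
    g.C) (ρ : Op g.W) : maskL (fun x => ((x ∘ g.wT) ∘ (g.slotA.trans (g.slot r)) = c ∧ (x ∘ g.wT) ∘
    (g.slotB.trans (g.slot r)) = c') ∧ ((x ∘ g.wT) ∘ ((g.slotY i).trans (g.slot r)) = y ∧ (x ∘ g.wT)
    ∘ (g.slotF.trans (g.slot r)) = oneHot i ∧ (x ∘ g.wT) ∘ ((g.slotV i).trans (g.slot r)) = v))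
    (g.callL (r, i) v y (g.stepL r c c' ρ)) = g.callL (r, i) v y (g.stepL r c c' ρ) := by
  have hd : ∀ {A B : Type} (f : A ↪ g.Slot) (e : B ↪ g.Slot), (∀ a b, e b ≠ f a) → ∀ v b t,
      write (e.trans (g.slot r)) b t ∘ (f.trans (g.slot r)) = v ↔ t ∘ (f.trans (g.slot r)) = v :=
    fun f e h v b t => by rw [write_disjoint _ _ fun a b h' => h b a ((g.slot r).injective h')]
  have hAB : ∀ {B : Type} (e : B ↪ g.Slot), (∀ a b, e b ≠ g.slotA a) → (∀ a b, e b ≠ g.slotB a) →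
      ∀ (b : Bits B) t,
      (write (e.trans (g.slot r)) b t ∘ (g.slotA.trans (g.slot r)) = c ∧
        write (e.trans (g.slot r)) b t ∘ (g.slotB.trans (g.slot r)) = c') ↔
      (t ∘ (g.slotA.trans (g.slot r)) = c ∧ t ∘ (g.slotB.trans (g.slot r)) = c') :=
    fun e h h' b t => and_congr (hd _ _ h _ _ _) (hd _ _ h' _ _ _)
  refine maskL_and ?_ (maskL_and ?_ (maskL_and ?_ ?_))
  · rw [g.mask_callL (fun t => t ∘ (g.slotA.trans (g.slot r)) = c ∧ t ∘ (g.slotB.trans (g.slot r)) =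
      c') (r, i) v y (hAB _ nofun nofun) (hAB _ nofun nofun) (hAB _ nofun nofun), (g.supp_stepL r c
      c' ρ).1]
  · simp only [callL, comp_apply]; exact maskL_replaceL (g.wS r (g.slotY i)) y _
  · simp only [callL, comp_apply]
    rw [g.mask_wS (fun t => t ∘ (g.slotF.trans (g.slot r)) = oneHot i) r _ _ (hd _ _ nofun _)]
    exact congrArg _ (maskL_replaceL (g.wS r g.slotF) (oneHot i) _)
  simp only [callL, comp_apply]
  rw [g.mask_wS (fun t => t ∘ ((g.slotV i).trans (g.slot r)) = v) r _ _ (hd _ _ nofun _), g.mask_wS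
      (fun t => t ∘ ((g.slotV i).trans (g.slot r)) = v) r _ _ (hd _ _ nofun _)]
  exact congrArg _ (congrArg _ (maskL_replaceL (g.wS r (g.slotV i)) v _))

theorem tEq_succ (r : Fin g.R) (ξ t : Bits g.T) :
    g.TEq (r + 1) ξ t ↔ g.TEq r ξ t ∧ g.SlotEq (ξ ∘ g.slot r) (t ∘ g.slot r) := by
  unfold TEq; constructor
  · rintro ⟨h1, h2, h3⟩
    exact ⟨⟨h1, h2, fun r' h => h3 r' (h.trans (Nat.lt_succ_self _))⟩, h3 r (Nat.lt_succ_self _)⟩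
  rintro ⟨⟨h1, h2, h3⟩, h4⟩; refine ⟨h1, h2, fun r' h => ?_⟩
  rcases Nat.lt_succ_iff_lt_or_eq.1 h with h' | h'
  · exact h3 r' h'
  rw [Fin.ext h']; exact h4

theorem maskTEq_stepL (r : Fin g.R) (ξ : Bits g.T) (c c' : Bits g.C) (ρ : Op g.W) :
    g.maskTEq r ξ (g.stepL r c c' ρ) = g.stepL r c c' (g.maskTEq r ξ ρ) := by
  classical
  exact g.mask_stepL (g.TEq r ξ) r c c' (fun f b t => g.tEq_write r ξ f b t) ρ

theorem maskTEq_callL (r : Fin g.R) (i : Fin ℓ) (ξ : Bits g.T) (v : Bits (g.VI i))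
    (y : Bits (g.YO i)) (ρ : Op g.W) :
    g.maskTEq r ξ (g.callL (r, i) v y ρ) = g.callL (r, i) v y (g.maskTEq r ξ ρ) := by
  classical
  exact g.mask_callL (g.TEq r ξ) (r, i) v y (fun b t => g.tEq_write r ξ _ b t)
    (fun b t => g.tEq_write r ξ _ b t) (fun b t => g.tEq_write r ξ _ b t) ρ

/-- The transcript determines what happened. -/
theorem maskTEq_labelL (r : Fin g.R) (ξ : Bits g.T) : ∃ Θ : LM g.W g.W, ∀ l, g.maskTEq (r + 1) ξ ∘ₗ
    g.labelL r l = 0 ∨ g.maskTEq (r + 1) ξ ∘ₗ g.labelL r l = Θ ∘ₗ g.maskTEq r ξ := by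
  classical
  let a := ξ ∘ g.slotA.trans (g.slot r); let b := ξ ∘ g.slotB.trans (g.slot r)
  let F := ξ ∘ g.slotF.trans (g.slot r)
  have key0 : ∀ c c', F = zeros → c = a → c' = b → g.maskTEq (r + 1) ξ ∘ₗ g.stepL r c c'
      = g.stepL r a b ∘ₗ g.maskTEq r ξ := by
    rintro c c' hF rfl rfl; ext1 ρ
    rw [comp_apply, comp_apply, ← maskTEq_stepL]
    refine maskL_congr_of_supp (maskL_and (g.supp_stepL r a b ρ).1 (g.supp_stepL r a b ρ).2) ?_
    rintro x ⟨⟨h1, h2⟩, h3⟩; rw [tEq_succ]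
    exact and_iff_left ⟨h1, h2, h3.trans hF.symm, fun i hi =>
      absurd (hi.symm.trans hF) (oneHot_ne_zeros i)⟩
  have key0' : ∀ c c', ¬ (F = zeros ∧ c = a ∧ c' = b) →
      g.maskTEq (r + 1) ξ ∘ₗ g.stepL r c c' = 0 := by
    intro c c' h; ext1 ρ
    refine (maskL_congr_of_supp (q := fun _ => False)
      (maskL_and (g.supp_stepL r c c' ρ).1 (g.supp_stepL r c c' ρ).2) ?_).trans
        (maskL_false (fun _ h => h) _)
    rintro x ⟨⟨h1, h2⟩, h3⟩; rw [tEq_succ]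
    exact iff_of_false (fun e => h ⟨e.2.2.2.1.symm.trans h3, h1.symm.trans e.2.1,
      h2.symm.trans e.2.2.1⟩) not_false
  have key1 : ∀ i v y c c', F = oneHot i → v = ξ ∘ (g.slotV i).trans (g.slot r) →
      y = ξ ∘ (g.slotY i).trans (g.slot r) → c = a → c' = b →
      g.maskTEq (r + 1) ξ ∘ₗ g.callL (r, i) v y ∘ₗ g.stepL r c c'
      = (g.callL (r, i) v y ∘ₗ g.stepL r a b) ∘ₗ g.maskTEq r ξ := by
    rintro i v y c c' hF hv hy rfl rfl; ext1 ρ; simp only [comp_apply]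
    rw [← maskTEq_stepL, ← maskTEq_callL]
    refine maskL_congr_of_supp (g.supp_callL r i v y a b ρ) ?_; rintro x ⟨⟨h1, h2⟩, h3, h4, h5⟩
    rw [tEq_succ]; refine and_iff_left ⟨h1, h2, h4.trans hF.symm, fun j hj => ?_⟩
    obtain rfl := oneHot_injective (hF.symm.trans hj); exact ⟨h5.trans hv, h3.trans hy⟩
  have key1' : ∀ i v y c c', ¬ (F = oneHot i ∧ v = ξ ∘ (g.slotV i).trans (g.slot r) ∧
      y = ξ ∘ (g.slotY i).trans (g.slot r) ∧ c = a ∧ c' = b) →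
      g.maskTEq (r + 1) ξ ∘ₗ g.callL (r, i) v y ∘ₗ g.stepL r c c' = 0 := by
    intro i v y c c' h; ext1 ρ
    refine (maskL_congr_of_supp (q := fun _ => False) (g.supp_callL r i v y c c' ρ) ?_).trans
        (maskL_false (fun _ h => h) _)
    rintro x ⟨⟨h1, h2⟩, h3, h4, h5⟩; rw [tEq_succ]; refine iff_of_false (fun e => ?_) not_false
    have hF : F = oneHot i := e.2.2.2.1.symm.trans h4; have := e.2.2.2.2 i hF
    exact h ⟨hF, h5.symm.trans this.1, h3.symm.trans this.2, h1.symm.trans e.2.1,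
      h2.symm.trans e.2.2.1⟩
  by_cases hF : ∃ i, F = oneHot i
  · obtain ⟨i, hi⟩ := hF
    refine ⟨g.callL (r, i) (ξ ∘ (g.slotV i).trans (g.slot r)) (ξ ∘ (g.slotY i).trans (g.slot r)) ∘ₗ
      g.stepL r a b, ?_⟩
    rintro ⟨⟨c, c'⟩, _ | ⟨j, v, y⟩⟩
    · exact Or.inl (key0' c c' fun h => oneHot_ne_zeros i (hi.symm.trans h.1))
    by_cases h : F = oneHot j ∧ v = ξ ∘ (g.slotV j).trans (g.slot r) ∧
      y = ξ ∘ (g.slotY j).trans (g.slot r) ∧ c = a ∧ c' = b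
    · obtain rfl := oneHot_injective (hi.symm.trans h.1); obtain ⟨h0, rfl, rfl, h3, h4⟩ := h
      exact Or.inr (key1 i _ _ c c' h0 rfl rfl h3 h4)
    exact Or.inl (key1' j v y c c' h)
  refine ⟨g.stepL r a b, ?_⟩; rintro ⟨⟨c, c'⟩, _ | ⟨j, v, y⟩⟩
  · by_cases h : F = zeros ∧ c = a ∧ c' = b
    · exact Or.inr (key0 c c' h.1 h.2.1 h.2.2)
    exact Or.inl (key0' c c' h)
  exact Or.inl (key1' j v y c c' fun h => hF ⟨j, h.1⟩)

theorem lines_round (r : Fin g.R) {S : Submodule ℂ (Op g.W)} (h : Lines (g.maskTEq r) S) :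
    Lines (g.maskTEq (r + 1)) (⨆ l, S.map (g.labelL r l)) :=
  h.step (g.labelL r) le_rfl (g.maskTEq_labelL r)

/-! ### The initial state -/

def ancSt (ω : Bits g.Ω) (κ : Op g.ES) : Op g.anc :=
  (tensor (ket (elim ω zeros) : Op (g.Ω ⊕ g.BA)) (tensor (ket (elim ω zeros) : Op (g.Ω ⊕ (g.Z ⊕
    (Bool ⊕ (Fin g.R × g.Slot))))) (tensor (ket zeros : Op g.ZI) κ)) : Op ((g.Ω ⊕ g.BA) ⊕ ((g.Ω ⊕
    (g.Z ⊕ (Bool ⊕ (Fin g.R × g.Slot)))) ⊕ (g.ZI ⊕ g.ES))))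

def startW (ω : Bits g.Ω) (κ : Op g.ES) (st : Op (g.Z ⊕ g.V)) : Op g.W :=
  act g.wMEM g.copyC.runL (tensor st (g.ancSt ω κ) : Op ((g.Z ⊕ g.V) ⊕ g.anc))

def wZ : g.Z ↪ g.W := inl.trans inl

theorem startW_eq (ω : Bits g.Ω) (κ : Op g.ES) (st : Op (g.Z ⊕ g.V)) : g.startW ω κ st = ∑ z, act
    (g.tZ.trans g.wT) (replaceL (ket z)) (tensor (tensor (ket z) (cut z z st)) (g.ancSt ω κ) : Op
    ((g.Z ⊕ g.V) ⊕ g.anc)) := by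
  have h1 : act g.wMEM g.copyC.runL
      = loadL (g.tZ.trans g.wT) (fun x => x ∘ g.wZ) ∘ₗ dephaseL g.wZ := by
    have e : ∀ a b, (Sum.inl (g.memA (g.advZ a)) : g.MEM ⊕ Bool)
        ≠ .inl ((g.tZ.trans g.memT) b) := nofun
    have e1 : g.copyC.runL = loadL (g.tZ.trans g.memT) (fun x => x ∘ (g.advZ.trans g.memA)) ∘ₗ
        dephaseL (g.advZ.trans g.memA) := by
      rw [copyC, Circuit.runL, runL_measureC]; congr 1; exact runL_loadC _ _ e
    rw [e1, act_comp, ← loadL_trans, ← dephaseL_trans]; rfl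
  rw [startW, h1]; refine (loadL_dephaseL_eq (g.tZ.trans g.wT) g.wZ nofun id _).trans ?_
  refine sum_ext fun z => congrArg _ ?_
  have h2 := maskL_tensor (fun x : Bits (g.Z ⊕ g.V) => x ∘ Sum.inl = z) (fun _ => True) st
    (g.ancSt ω κ)
  rw [maskL_true] at h2
  have h3 : maskL (fun x : Bits (g.Z ⊕ g.V) => x ∘ Sum.inl = z) st = tensor (ket z) (cut z z st) := by
    ext x y; simp only [maskL_apply, tensor, ket, of_apply, cut_apply]; split_ifs with h
    · rw [one_mul, ← h.1, elim_comp]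
      conv_rhs => rw [h.1, ← h.2, elim_comp]
    simp
  rw [← h3, ← h2]
  exact LinearMap.congr_fun (maskL_congr fun x => ⟨fun h => ⟨h, trivial⟩, fun h => h.1⟩) _

theorem lines_start (κ : Bits g.Ω → Op g.ES) {ι : Type} (st : Bits g.Ω → ι → Op (g.Z ⊕ g.V)) (hst :
    ∀ ω z, ∃ σ, ∀ a, cut z z (st ω a) ∈ span ℂ {σ}) : Lines (g.maskTEq 0) (span
    ℂ (Set.range fun p : Bits g.Ω × ι => g.startW p.1 (κ p.1) (st p.1 p.2))) := by
  classical
  intro ξ; obtain ⟨σ, hσ⟩ := hst (ξ ∘ g.tΩ) (ξ ∘ g.tZ)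
  let J : LM g.V g.W := act (g.tZ.trans g.wT) (replaceL (ket (ξ ∘ g.tZ))) ∘ₗ
    tensorR (g.ancSt (ξ ∘ g.tΩ) (κ (ξ ∘ g.tΩ))) ∘ₗ tensorL (ket (ξ ∘ g.tZ))
  refine ⟨J σ, fun ρ hρ => ?_⟩
  have : span ℂ (Set.range fun p : Bits g.Ω × ι => g.startW p.1 (κ p.1) (st p.1 p.2))
      ≤ (span ℂ {J σ}).comap (g.maskTEq 0 ξ) := by
    refine Submodule.span_le.2 ?_; rintro _ ⟨⟨ω, a⟩, rfl⟩
    change g.maskTEq 0 ξ (g.startW ω (κ ω) (st ω a)) ∈ span ℂ {J σ}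
    rw [startW_eq, map_sum]; refine sum_mem fun z _ => ?_
    let X : Op g.W := act (g.tZ.trans g.wT) (replaceL (ket z))
      (tensor (tensor (ket z) (cut z z (st ω a))) (g.ancSt ω (κ ω)) : Op ((g.Z ⊕ g.V) ⊕ g.anc))
    have hΩ : maskL (fun x => (x ∘ g.wT) ∘ g.tΩ = ω) X = X := by
      refine (maskL_act_comm (g.tZ.trans g.wT) (replaceL (ket z)) (fun x => (x ∘ g.wT) ∘ g.tΩ = ω)
        (fun b x => by
          rw [write_trans, write_comp, write_disjoint _ _ nofun])
        _).trans (congrArg _ ?_)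
      ext x y; refine (maskL_apply _ _ x y).trans ?_; split_ifs with h
      · rfl
      have e : g.ancSt ω (κ ω) (x ∘ Sum.inr) (y ∘ Sum.inr) = 0 := by
        unfold ancSt
        refine mul_eq_zero_of_right _ (mul_eq_zero_of_left (if_neg fun e => h ⟨?_, ?_⟩) _)
        · exact congrArg (fun t => t ∘ Sum.inl) e.1
        exact congrArg (fun t => t ∘ Sum.inl) e.2
      exact (mul_eq_zero_of_right _ e).symm
    have hZ : maskL (fun x => (x ∘ g.wT) ∘ g.tZ = z) X = X := maskL_replaceL (g.tZ.trans g.wT) z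
      (tensor (tensor (ket z) (cut z z (st ω a))) (g.ancSt ω (κ ω)) : Op ((g.Z ⊕ g.V) ⊕ g.anc))
    by_cases h : ω = ξ ∘ g.tΩ ∧ z = ξ ∘ g.tZ
    · obtain ⟨rfl, rfl⟩ := h
      have e : g.maskTEq 0 ξ (act (g.tZ.trans g.wT) (replaceL (ket (ξ ∘ g.tZ))) (tensor (tensor (ket
          (ξ ∘ g.tZ)) (cut (ξ ∘ g.tZ) (ξ ∘ g.tZ) (st (ξ ∘ g.tΩ) a))) (g.ancSt (ξ ∘ g.tΩ) (κ (ξ ∘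
          g.tΩ))) : Op ((g.Z ⊕ g.V) ⊕ g.anc)))
          = J (cut (ξ ∘ g.tZ) (ξ ∘ g.tZ) (st (ξ ∘ g.tΩ) a)) := by
        refine (maskL_congr_of_supp (q := fun _ => True) (maskL_and hΩ hZ) ?_).trans
          (maskL_true _)
        rintro x ⟨h1, h2⟩
        exact iff_of_true ⟨h1, h2, fun r' h => absurd h (Nat.not_lt_zero _)⟩ trivial
      rw [e]; obtain ⟨k, hk⟩ := Submodule.mem_span_singleton.1 (hσ a); rw [← hk, map_smul]
      exact Submodule.smul_mem _ _ (mem_span_singleton_self _)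
    rw [show g.maskTEq 0 ξ _ = 0 from
      (maskL_congr_of_supp (q := fun _ => False) (maskL_and hΩ hZ) (by
        rintro x ⟨h1, h2⟩
        exact iff_of_false (fun e => h ⟨h1.symm.trans e.1, h2.symm.trans e.2.1⟩)
          not_false)).trans (maskL_false (fun _ h => h) _)]
    exact zero_mem _
  exact this hρ

/-! ### Preparation of the initial state -/

def memES (κ : ∀ q : g.Q, Op (g.ΩO q.2 ⊕ g.E q.2)) (ω : Bits g.Ω) : Op g.ES :=
  prodOp g.eES fun q => cut (ω ∘ g.ωPart q) (ω ∘ g.ωPart q) (κ q)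

def xE (q : g.Q) : g.ΩO q.2 ⊕ g.E q.2 ↪ g.Ω ⊕ g.ES := (g.ωPart q).sumMap (g.eES q)

def aES : g.ES ↪ g.anc :=
  inr.trans (inr.trans inr)

def aΩ : g.Ω ↪ g.anc := inl.trans inl

def aT : g.Ω ↪ g.anc :=
  inl.trans (inl.trans inr)

theorem ωPart_ne {q q' : g.Q} (h : q ≠ q') (a : g.ΩO q.2) (b : g.ΩO q'.2) :
    g.ωPart q a ≠ g.ωPart q' b := fun e => h (by
  have e1 : ((q.1, ⟨q.2, a⟩) : Fin g.R × (Σ i, g.ΩO i)) = (q'.1, ⟨q'.2, b⟩) := e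
  simp only [Prod.mk.injEq, Sigma.mk.injEq] at e1
  exact Prod.ext e1.1 e1.2.1)

theorem eES_ne {q q' : g.Q} (h : q ≠ q') (a : g.E q.2) (b : g.E q'.2) :
    g.eES q a ≠ g.eES q' b := fun e => g.wE_ne_wE h a b (congrArg g.wES e)

theorem xE_ne (q q' : g.Q) (h : q ≠ q') (a : g.ΩO q.2 ⊕ g.E q.2)
    (b : g.ΩO q'.2 ⊕ g.E q'.2) : g.xE q a ≠ g.xE q' b := by
  rcases a with a | a <;> rcases b with b | b
  · exact fun e => g.ωPart_ne h a b (Sum.inl_injective e)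
  · exact nofun
  · exact nofun
  exact fun e => g.eES_ne h a b (Sum.inr_injective e)

theorem xE_surj (w : g.Ω ⊕ g.ES) : ∃ q a, g.xE q a = w := by
  rcases w with ⟨r, i, w⟩ | ⟨q, w⟩
  · exact ⟨(r, i), Sum.inl w, rfl⟩
  exact ⟨q, Sum.inr w, rfl⟩

theorem eES_surj (w : g.ES) : ∃ q a, g.eES q a = w := by rcases w with ⟨q, w⟩; exact ⟨q, w, rfl⟩

theorem ωPart_surj (w : g.Ω) : ∃ q a, g.ωPart q a = w := by
  rcases w with ⟨r, i, w⟩; exact ⟨(r, i), w, rfl⟩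

theorem cut_prodOp (κ : ∀ q : g.Q, Op (g.ΩO q.2 ⊕ g.E q.2)) (ω : Bits g.Ω) :
    cut ω ω (prodOp g.xE κ) = g.memES κ ω := by
  ext x y; rw [cut_apply]; refine Finset.prod_congr rfl fun q _ => ?_
  have e : ∀ x : Bits g.ES, (elim ω x : Bits (g.Ω ⊕ g.ES)) ∘ g.xE q
      = elim (ω ∘ g.ωPart q) (x ∘ g.eES q) := fun x => by
    funext p; rcases p with p | p <;> rfl
  rw [e, e]; rfl

def aD : Bool ↪ g.anc :=
  ((inl.trans inr).trans inr).trans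
    (inl.trans inr)

instance : Nontrivial (g.Ω ⊕ g.anc) := nontrivial_of_bool (g.aD.trans inr)

def initC (Φ : ∀ q : g.Q, Circuit (g.ΩO q.2 ⊕ g.E q.2)) : Circuit (g.Ω ⊕ g.anc) :=
  .seq (Circuit.ofList ((univ : Finset g.Q).toList.map fun q =>
      (Φ q).map ((g.xE q).trans (onSnd g.Ω g.aES))))
    (.seq (loadC (g.aΩ.trans inr) fun w => .inl (Sum.inl w))
      (loadC (g.aT.trans inr) fun w => .inl (Sum.inl w)))

theorem emb_aES (ω : Bits g.Ω) (κ : Op g.ES) :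
    emb g.aES (write g.aT ω (write g.aΩ ω zeros)) κ = g.ancSt ω κ := by
  let b : Bits g.anc := write g.aT ω (write g.aΩ ω zeros)
  have h1 : b ∘ Sum.inl = elim ω zeros := by
    funext w; rcases w with w | w
    · exact (congrFun (write_disjoint g.aT g.aΩ nofun _ _) w).trans
        (congrFun (write_comp g.aΩ ω zeros) w)
    exact (write_notMem _ _ _ nofun).trans
      (write_notMem _ _ _ nofun)
  have h2 : (b ∘ Sum.inr) ∘ Sum.inl = (elim ω zeros :
      Bits (g.Ω ⊕ (g.Z ⊕ (Bool ⊕ (Fin g.R × g.Slot))))) := by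
    funext w; rcases w with w | w
    · exact congrFun (write_comp g.aT ω _) w
    exact (write_notMem _ _ _ nofun).trans
      (write_notMem _ _ _ nofun)
  have h3 : ((b ∘ Sum.inr) ∘ Sum.inr) ∘ Sum.inl = (zeros : Bits g.ZI) := by
    funext w
    exact (write_notMem _ _ _ nofun).trans
        (write_notMem _ _ _ nofun)
  exact emb_inr_inr_inr (A := g.Ω ⊕ g.BA) (B := g.Ω ⊕ (g.Z ⊕ (Bool ⊕ (Fin g.R × g.Slot))))
    (C := g.ZI) (D := g.ES) h1 h2 h3 κ

theorem initC_eq (Φ : ∀ q : g.Q, Circuit (g.ΩO q.2 ⊕ g.E q.2)) (b ω : Bits g.Ω) : cut ω ω ((g.initC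
    Φ).runL (ket (elim b zeros))) = g.ancSt ω (g.memES (fun q => (Φ q).runL (ket (elim (b ∘ g.ωPart
    q) zeros))) ω) := by
  rw [initC]; simp only [Circuit.runL, comp_apply]
  rw [runL_loadC _ _ nofun, runL_loadC _ _ nofun, runL_ofList, List.map_map]
  have l1 := cut_loadL (C := g.Ω) g.aT id ω; have l2 := cut_loadL (C := g.Ω) g.aΩ id ω
  refine (l1 _).trans ((congrArg _ (l2 _)).trans ?_)
  have h0 : (ket (elim b zeros) : Op (g.Ω ⊕ g.anc))
      = emb (onSnd g.Ω g.aES) zeros (prodOp g.xE fun q => ket (elim (b ∘ g.ωPart q) zeros)) := by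
    have e : (fun q : g.Q => (ket (elim (b ∘ g.ωPart q) zeros) : Op (g.ΩO q.2 ⊕ g.E q.2)))
        = fun q => ket ((elim b zeros : Bits (g.Ω ⊕ g.ES)) ∘ g.xE q) := by
      funext q; congr 1; funext p; rcases p with p | p <;> rfl
    rw [e, prodOp_ket g.xE g.xE_surj, emb_ket]; congr 1; funext w; rcases w with w | w
    · exact (write_mem (onSnd g.Ω g.aES) (elim b zeros) zeros (Sum.inl w)).symm
    by_cases h : ∀ p, onSnd g.Ω g.aES p ≠ Sum.inr w
    · rw [write_notMem _ _ _ h]; rfl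
    push Not at h; obtain ⟨p, hp⟩ := h; rcases p with p | p
    · cases hp
    rw [← hp]; exact (write_mem (onSnd g.Ω g.aES) (elim b zeros) zeros (Sum.inr p)).symm
  have h1 : ((univ : Finset g.Q).toList.map
      (Circuit.runL ∘ fun q => (Φ q).map ((g.xE q).trans (onSnd g.Ω g.aES))))
      = ((univ : Finset g.Q).toList.map fun q =>
        act (g.xE q) (Φ q).runL).map (act (onSnd g.Ω g.aES)) := by
    rw [List.map_map]; refine List.map_congr_left fun q _ => ?_; simp only [Function.comp_apply]
    rw [runL_map, act_trans]
  rw [h0, h1, listL_emb, listL_prodOp g.xE g.xE_ne _ _ (Finset.nodup_toList _), cut_emb_onSnd,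
    cut_prodOp]
  have h2 : ∀ (f : g.Ω ↪ g.anc) (v : Bits g.Ω) (c : Bits g.anc) (κ : Op g.ES),
      (∀ b a, g.aES b ≠ f a) → act f (replaceL (ket v)) (emb g.aES c κ)
        = emb g.aES (write f v c) κ := fun f v c κ h => by
    rw [← loadL_const, loadL_emb g.aES f h _ (fun _ _ _ => rfl)]
  simp only [Finset.mem_toList, mem_univ, if_true]; rw [h2 g.aΩ _ _ _ nofun, h2 g.aT _ _ _ nofun]
  exact g.emb_aES ω _

theorem size_initC (Φ : ∀ q : g.Q, Circuit (g.ΩO q.2 ⊕ g.E q.2)) :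
    (g.initC Φ).size ≤ ∑ q, (Φ q).size + 4 * card g.Ω := by
  rw [initC]
  simp only [Circuit.size, Circuit.size_ofList, List.map_map, Function.comp_def, size_map]
  rw [Finset.sum_map_toList]
  have h1 := size_loadC (g.aΩ.trans inr)
    (fun w => (.inl (Sum.inl w) : (g.Ω ⊕ g.anc) ⊕ Bool))
  have h2 := size_loadC (g.aT.trans inr)
    (fun w => (.inl (Sum.inl w) : (g.Ω ⊕ g.anc) ⊕ Bool))
  omega

theorem hcall_congr (L : g.Ker) {n n' : ℕ} {ω ω' : Bits g.Ω} {r : ℕ} {i : Fin ℓ}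
    (h : g.part ω r i = g.part ω' r i) (hn : r * ℓ + i < n ↔ r * ℓ + i < n') :
    g.hcall L n ω r i = g.hcall L n' ω' r i := by
  funext u x; by_cases h1 : r < g.R ∧ r * ℓ + i < n
  · have h2 : r < g.R ∧ r * ℓ + i < n' := ⟨h1.1, hn.1 h1.2⟩
    rw [hcall, dif_pos h1, hcall, dif_pos h2]
  have h2 : ¬ (r < g.R ∧ r * ℓ + i < n') := fun h2 => h1 ⟨h2.1, hn.2 h2.2⟩
  rw [g.hcall_real h1, g.hcall_real h2, rcall, rcall, h]

theorem part_write (q : g.Q) (w : Bits (g.ΩO q.2)) (ω : Bits g.Ω) {r : ℕ}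
    {i : Fin ℓ} (h : ¬ (r = q.1 ∧ i = q.2)) : g.part (write (g.ωPart q) w ω) r i = g.part ω r i := by
  funext v
  change (if h : r < g.R then write (g.ωPart q) w ω (⟨r, h⟩, ⟨i, v⟩) else false)
    = if h : r < g.R then ω (⟨r, h⟩, ⟨i, v⟩) else false
  split_ifs with hr
  · refine write_notMem (g.ωPart q) w ω fun a ha => h ?_
    have h1 : ((q.1, ⟨q.2, a⟩) : Fin g.R × (Σ i, g.ΩO i)) = (⟨r, hr⟩, ⟨i, v⟩) := ha
    rw [Prod.mk.injEq, Sigma.mk.injEq] at h1; exact ⟨by rw [h1.1], h1.2.1.symm⟩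
  rfl

theorem part_write_self (q : g.Q) (w : Bits (g.ΩO q.2)) (ω : Bits g.Ω) :
    g.part (write (g.ωPart q) w ω) q.1 q.2 = w := by
  funext v; exact (dif_pos q.1.2).trans (write_mem (g.ωPart q) w ω v)

theorem hround_congr (L : g.Ker) {n n' : ℕ} {ω ω' : Bits g.Ω} {r : ℕ}
    (h : ∀ i, g.part ω r i = g.part ω' r i) (hn : ∀ i : Fin ℓ, r * ℓ + i < n ↔ r * ℓ + i < n') :
    g.hround L n ω r = g.hround L n' ω' r := by
  exact congrArg (g.P.roundL r (g.hstep r)) (funext fun i => g.hcall_congr L (h i) (hn i))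

theorem rround_congr {ω ω' : Bits g.Ω} {r : ℕ} (h : ∀ i, g.part ω r i = g.part ω' r i) :
    g.rround ω r = g.rround ω' r := by
  rw [rround, rround]; congr 1; funext i u x; rw [rcall, rcall, h]

def crop (n : ℕ) (ω : Bits g.Ω) : Bits g.Ω :=
  fun w : Fin g.R × (Σ i, g.ΩO i) => if w.1 * ℓ + w.2.1 < n then false else ω w

def inits (n : ℕ) (q : g.Q) : Circuit (g.ΩO q.2 ⊕ g.E q.2) :=
  if q.1 * ℓ + q.2 < n then g.init q.2 else .skip

/-- The state of one part of the reference string jointly with the simulator's memory. -/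
def refSt (n : ℕ) (ω : Bits g.Ω) (q : g.Q) : Op (g.ΩO q.2 ⊕ g.E q.2) :=
  (g.inits n q).runL (ket (elim (g.crop n ω ∘ g.ωPart q) zeros))

def refMem (i : Fin ℓ) (w : Bits (g.ΩO i)) : Op (g.E i) := cut w w ((g.init i).runL (ket zeros))

theorem crop_ωPart (n : ℕ) (ω : Bits g.Ω) (q : g.Q) :
    g.crop n ω ∘ g.ωPart q = if q.1 * ℓ + q.2 < n then zeros else ω ∘ g.ωPart q := by
  funext w; change (if q.1 * ℓ + q.2 < n then false else ω (g.ωPart q w)) = _; split_ifs <;> rfl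

theorem refSt_ideal {n : ℕ} {ω : Bits g.Ω} {q : g.Q} (h : q.1 * ℓ + q.2 < n) :
    g.refSt n ω q = (g.init q.2).runL (ket zeros) := by
  rw [refSt, inits, if_pos h, crop_ωPart, if_pos h, elim_zeros]

theorem refSt_real {n : ℕ} {ω : Bits g.Ω} {q : g.Q} (h : ¬ q.1 * ℓ + q.2 < n) :
    g.refSt n ω q = tensor (ket (ω ∘ g.ωPart q)) (ket zeros) := by
  rw [refSt, inits, if_neg h, crop_ωPart, if_neg h, tensor_ket_ket]; rfl

theorem refSt_congr {n : ℕ} {ω : Bits g.Ω} {q q' : g.Q} (w : Bits (g.ΩO q.2)) (hq : q.1 * ℓ + q.2 =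
    n) (h : q' ≠ q) : g.refSt (n + 1) ω q' = g.refSt n (write (g.ωPart q) w ω) q' := by
  have h1 : (q'.1 * ℓ + q'.2 : ℕ) ≠ n := fun e => h (by
    have := index_injective (e.trans hq.symm)
    exact Prod.ext (Fin.ext this.1) this.2)
  by_cases h2 : q'.1 * ℓ + q'.2 < n
  · rw [refSt_ideal _ h2, refSt_ideal _ (by omega)]
  rw [refSt_real _ h2, refSt_real _ (by omega),
    write_disjoint _ _ fun a b => g.ωPart_ne h.symm a b]

theorem memES_succ {n : ℕ} (ω η : Bits g.Ω) (q : g.Q) (hq : q.1 * ℓ + q.2 = n) : g.memES (g.refSt (n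
    + 1) ω) η = ∑ w, act (g.eES q) (replaceL (g.refMem q.2 w)) (g.memES (g.refSt n (write (g.ωPart
    q) w ω)) η) := by
  have h : ∀ w, act (g.eES q) (replaceL (g.refMem q.2 w))
      (g.memES (g.refSt n (write (g.ωPart q) w ω)) η)
      = prodOp g.eES (update (fun q' => cut (η ∘ g.ωPart q') (η ∘ g.ωPart q')
          (g.refSt (n + 1) ω q')) q
            ((if η ∘ g.ωPart q = w then (1 : ℂ) else 0) • g.refMem q.2 w)) := fun w => by
    refine (act_prodOp g.eES (fun q q' => g.eES_ne) _ q _).trans ?_; congr 1; funext q'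
    by_cases hq' : q' = q
    · subst hq'
      rw [update_self, update_self, replaceL_apply,
        refSt_real _ (by omega), cut_tensor, trace_smul, trace_ket, write_comp]
      congr 1; simp [ket]
    rw [update_of_ne hq', update_of_ne hq', g.refSt_congr w hq hq']
  rw [sum_eq_single (η ∘ g.ωPart q), h, if_pos rfl, one_smul]
  · refine congrArg (prodOp g.eES) (Function.eq_update_iff.2 ⟨?_, fun _ _ => rfl⟩)
    rw [refSt_ideal _ (by omega), refMem]
  · intro w _ hw; rw [h, if_neg (Ne.symm hw), zero_smul]; ext x y
    exact Finset.prod_eq_zero (mem_univ q) (by rw [update_self]; rfl)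
  simp

theorem setE_startW (q : g.Q) (κ : Op (g.E q.2)) (η : Bits g.Ω) (ρ : Op g.ES) (σ : Op (g.Z ⊕ g.V)) :
    g.setE q κ (g.startW η ρ σ) = g.startW η (act (g.eES q) (replaceL κ) ρ) σ := by
  have h1 : g.setE q κ ∘ₗ act g.wMEM g.copyC.runL = act g.wMEM g.copyC.runL ∘ₗ g.setE q κ :=
    g.setE_comm_act _ q (fun a b => by
      rcases a with a | a
      · exact fun e => g.wAdv_ne_wE a q b e.symm
      exact fun e => g.wT_ne_wE a q b e.symm) κ
  refine (LinearMap.congr_fun h1 _).trans (congrArg (act g.wMEM g.copyC.runL) ?_)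
  have h2 : g.setE q κ = ext _ (ext _ (ext _ (ext _ (act (g.eES q) (replaceL κ))))) := by
    rw [← act_inr, ← act_inr, ← act_inr, ← act_inr, ← act_trans, ← act_trans, ← act_trans,
      ← act_trans]
    rfl
  rw [h2]; refine (ext_tensor _ _ _).trans (congrArg (tensor σ) ?_)
  refine (ext_tensor _ _ _).trans (congrArg (tensor _) ?_)
  refine (ext_tensor _ _ _).trans (congrArg (tensor _) ?_); exact ext_tensor _ _ _

theorem startW_sum {ι : Type} [Fintype ι] (η : Bits g.Ω) (ρ : ι → Op g.ES)
    (σ : Op (g.Z ⊕ g.V)) : g.startW η (∑ w, ρ w) σ = ∑ w, g.startW η (ρ w) σ := by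
  have : ∀ ρ, g.startW η ρ σ = (act g.wMEM g.copyC.runL ∘ₗ tensorL σ ∘ₗ tensorL (ket (elim η
      zeros) : Op (g.Ω ⊕ g.BA)) ∘ₗ tensorL (ket (elim η zeros) : Op (g.Ω ⊕ (g.Z ⊕ (Bool ⊕ (Fin g.R ×
      g.Slot))))) ∘ₗ tensorL (ket zeros : Op g.ZI)) ρ := fun ρ => rfl
  simp only [this, map_sum]

end Game

theorem comp_congr {A B C D : Type} {Φ : LM B D} {Ψ : LM A B} {Φ' : LM C D} {Ψ' : LM A C}
    (h : Φ ∘ₗ Ψ = Φ' ∘ₗ Ψ') (ρ : Op A) : Φ (Ψ ρ) = Φ' (Ψ' ρ) := LinearMap.congr_fun h ρ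

theorem comp_congr_left {A B D : Type} {Φ : LM B D} {Ψ : LM A B} {Φ' : LM A D}
    (h : Φ ∘ₗ Ψ = Φ') (ρ : Op A) : Φ (Ψ ρ) = Φ' ρ := LinearMap.congr_fun h ρ

namespace Game

variable {ℓ : ℕ} (g : Game ℓ)

section

variable {AUX : Reg} (L : g.Ker) (st : g.Input AUX) (φ : Op (AUX ⊕ g.St) →ₗ[ℂ] ℂ)

/-- The initial state of the hybrid experiment, jointly with the event that the sampler's
auxiliary information is `a`. -/
def startL (n : ℕ) (ω : Bits g.Ω) (a : Bits AUX) : Op g.Exp :=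
  ∑ η, ∑ u, g.P.initL u (g.startW η (g.memES (g.refSt n ω) η) (st η a u))

/-- The state just before the call at the end of round `r`. -/
def pendL (n : ℕ) (ω : Bits g.Ω) (r : ℕ) (a : Bits AUX) : Op g.Exp :=
  g.P.preL r (g.hstep r) (iter (g.hround L n ω) r (g.startL st n ω a))

/-- What remains to be done after round `r`. -/
def contL (ω : Bits g.Ω) (r : ℕ) : Op (AUX ⊕ g.St) →ₗ[ℂ] ℂ :=
  φ ∘ₗ ext AUX (iter (fun t => g.rround ω (r + 1 + t)) (g.R - (r + 1)))

/-- The result of the experiment in which the first `n` calls are ideal. -/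
def val (n : ℕ) (ω : Bits g.Ω) : ℂ :=
  ∑ a, φ (tensor (ket a) (g.redL (iter (g.hround L n ω) g.R (g.startL st n ω a))))

theorem val_eq {n : ℕ} (ω : Bits g.Ω) (r : Fin g.R) (hn : n ≤ (r + 1) * ℓ) : g.val L st φ n ω = ∑ a,
    g.contL φ ω r (tensor (ket a) (g.redL (g.P.callRoundL (g.hcall L n ω r) (g.pendL L st n ω r
    a)))) := by
  have hR : g.R = r + 1 + (g.R - (r + 1)) := by omega
  have e : iter (g.hround L n ω) g.R = iter (g.hround L n ω) (r + 1 + (g.R - (r + 1))) :=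
    congrArg _ hR
  have e2 : iter (g.hround L n ω) (r + 1) = g.P.callRoundL (g.hcall L n ω r)
      ∘ₗ g.P.preL r (g.hstep r) ∘ₗ iter (g.hround L n ω) r := rfl
  refine sum_ext fun a => ?_; rw [contL, comp_apply, ext_tensor, e, iter_add, e2]
  exact congrArg φ (congrArg (tensor (ket a))
    (comp_congr (g.redL_iter (r := r + 1) (by omega) hn) _))

variable (q : g.Q) {n : ℕ} (hq : q.1 * ℓ + q.2 = n) (ω : Bits g.Ω)
include hq

theorem startL_succ (a : Bits AUX) : g.startL st (n + 1) ω a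
    = ∑ w, g.setEL q (g.refMem q.2 w) (g.startL st n (write (g.ωPart q) w ω) a) := by
  have h : ∀ η u, g.P.initL u (g.startW η (g.memES (g.refSt (n + 1) ω) η) (st η a u))
      = ∑ w, g.setEL q (g.refMem q.2 w) (g.P.initL u (g.startW η
        (g.memES (g.refSt n (write (g.ωPart q) w ω)) η) (st η a u))) := fun η u => by
    rw [g.memES_succ ω η q hq, startW_sum, map_sum]; refine sum_ext fun w => ?_; rw [← setE_startW]
    exact (comp_congr (g.P.initL_intertwine u (g.setE q (g.refMem q.2 w))) _).symm
  simp only [startL, h, map_sum]; rw [sum_comm (γ := Bits (g.ΩO q.2))]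
  exact sum_ext fun η => sum_comm

theorem part_write_ne {r : ℕ} (hr : r ≠ q.1) (w : Bits (g.ΩO q.2)) (i : Fin ℓ) :
    g.part (write (g.ωPart q) w ω) r i = g.part ω r i :=
  g.part_write q w ω fun h => hr h.1

theorem index_lt {r : ℕ} {i : Fin ℓ} (h : ¬ (r = q.1 ∧ i = q.2)) :
    r * ℓ + i < n + 1 ↔ r * ℓ + i < n := by
  have : r * ℓ + i ≠ n := fun e => h (index_injective (e.trans hq.symm)); omega

theorem iter_hround_succ (w : Bits (g.ΩO q.2)) (κ : Op (g.E q.2)) : g.setEL q κ ∘ₗ iter (g.hround L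
    n (write (g.ωPart q) w ω)) q.1 = iter (g.hround L (n + 1) ω) q.1 ∘ₗ g.setEL q κ := by
  refine iter_intertwine fun r hr => ?_; have hr' : r ≠ q.1 := Nat.ne_of_lt hr
  have h := g.hround_congr L (n := n) (n' := n + 1)
    (fun i => g.part_write_ne q hq ω hr' w i)
    fun i => (g.index_lt q hq fun h => hr' h.1).symm
  rw [← h]; exact g.setEL_hround q κ L n _ (hr.trans q.1.2) hr'

theorem pendL_succ (a : Bits AUX) : g.pendL L st (n + 1) ω q.1 a = ∑ w, g.setEL q (g.refMem q.2 w)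
    (g.pendL L st n (write (g.ωPart q) w ω) q.1 a) := by
  have h : ∀ w, g.setEL q (g.refMem q.2 w) (g.pendL L st n (write (g.ωPart q) w ω) q.1 a)
      = (g.P.preL q.1 (g.hstep q.1) ∘ₗ iter (g.hround L (n + 1) ω) q.1)
        (g.setEL q (g.refMem q.2 w) (g.startL st n (write (g.ωPart q) w ω) a)) := fun w =>
    (comp_congr (g.setEL_preL q _ q.1.2) _).trans
      (congrArg (g.P.preL q.1 (g.hstep q.1)) (comp_congr (g.iter_hround_succ L q hq ω w _) _))
  rw [sum_ext fun w => h w, ← map_sum, ← g.startL_succ st q hq]; rfl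

theorem restL_succ (w : Bits (g.ΩO q.2)) (κ : Op (g.E q.2)) (σ : Op g.Exp) : g.redL (g.P.restL q.2
    (g.hcall L (n + 1) ω q.1) (g.setEL q κ σ)) = κ.trace • g.redL (g.P.restL q.2 (g.hcall L n (write
    (g.ωPart q) w ω) q.1) σ) := by
  rw [← redL_setEL]; refine congrArg g.redL ?_
  refine (comp_congr (g.P.restL_intertwine q.2 (g.setE q κ) fun i hi u x => ?_) σ).symm
  have hi' : ¬ (q.1.1 = q.1 ∧ i = q.2) := fun h => hi h.2
  rw [g.setE_comm_hcall q κ L n _ q.1 i hi', g.hcall_congr L (g.part_write q w ω hi')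
    (g.index_lt q hq hi').symm]

/-- The contribution of calls to the oracle in question, with execution `Ex`. -/
def valCall (n : ℕ) (Ex : Bits (g.ΩO q.2) → Bits (g.In q.2) → Bits (g.Out q.2) →
    LM (g.ZI ⊕ g.adv) g.adv) : ℂ :=
  ∑ a, g.contL φ ω q.1 (tensor (ket a) (∑ w, g.P.calledL q.2
    (fun u x => Ex w u x ∘ₗ g.inputL q) (g.pendL L st n (write (g.ωPart q) w ω) q.1 a)))

/-- The contribution of the other cases, for the value `w` of the reference string. -/
def valRest (n : ℕ) (w : Bits (g.ΩO q.2)) : ℂ :=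
  ∑ a, g.contL φ ω q.1 (tensor (ket a) (g.redL (g.P.restL q.2 (g.hcall L n ω q.1)
    (g.pendL L st n (write (g.ωPart q) w ω) q.1 a))))

theorem restL_write (w : Bits (g.ΩO q.2)) : g.P.restL q.2 (g.hcall L n (write (g.ωPart q) w ω)
    q.1) = g.P.restL q.2 (g.hcall L n ω q.1) := by
  refine congrArg (selL (fun s => g.P.callee s = none) + ·)
    (sum_ext fun i => ?_)
  split_ifs with hi
  · rfl
  exact congrArg (g.P.calledL i)
    (g.hcall_congr L (g.part_write q w ω fun h => hi h.2) Iff.rfl)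

theorem val_ideal : g.val L st φ (n + 1) ω = g.valCall L st φ q ω n (fun w u x => reduceL (inr.trans
    inl) ∘ₗ fexecL (L q.1 q.2) (g.query q.2).runL (g.reply q.2).runL u x ∘ₗ tensorR (g.refMem q.2
    w)) + ∑ w, (g.refMem q.2 w).trace * g.valRest L st φ q ω n w := by
  have h0 : n + 1 ≤ (q.1 + 1) * ℓ := by
    have := q.2.2; rw [add_mul]; omega
  rw [g.val_eq L st φ ω q.1 h0, valCall]; simp only [valRest, mul_sum]
  rw [sum_comm (f := fun w a => (g.refMem q.2 w).trace * _), ← sum_add_distrib]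
  refine sum_ext fun a => ?_; rw [g.pendL_succ L st q hq, g.P.callRoundL_split q.2]
  simp only [map_sum, LinearMap.add_apply, map_add, sum_add_distrib, tensor_eq]; congr 1
  · refine sum_ext fun w => congrArg _ (congrArg _ ?_)
    refine (comp_congr_left (g.P.calledL_comp q.2 _ (reduceL g.wAdv)) _).trans ?_
    refine (comp_congr_left (g.P.calledL_ext q.2 _ (g.setE q (g.refMem q.2 w))) _).trans ?_
    refine LinearMap.congr_fun (congrArg (g.P.calledL q.2) ?_) _
    refine (funext fun u => funext fun x => LinearMap.ext fun ρ => ?_)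
    exact g.reduce_challenge q (by omega) _ u x ρ
  refine sum_ext fun w => ?_
  rw [g.restL_succ L q hq ω w, g.restL_write L q hq ω w, map_smul, map_smul, smul_eq_mul]

theorem val_real (p : Bits (g.ΩO q.2) → ℝ) (Ex : Bits (g.ΩO q.2) → Bits (g.In q.2) → Bits (g.Out
    q.2) → LM (g.ZI ⊕ g.adv) g.adv) (hEx : ∀ w u x ρ, Ex w u x (g.inputL q ρ) = (p w : ℂ) • g.rcall
    (write (g.ωPart q) w ω) q.1 q.2 u x (reduceL g.wAdv ρ)) : ∑ w, (p w : ℂ) * g.val L st φ n (write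
    (g.ωPart q) w ω) = g.valCall L st φ q ω n Ex + ∑ w, (p w : ℂ) * g.valRest L st φ q ω n w := by
  have h0 : n ≤ (q.1 + 1) * ℓ := by
    have := q.2.2; rw [add_mul]; omega
  simp only [valCall, valRest, tensor_eq, map_sum]; rw [sum_comm, ← sum_add_distrib]
  refine sum_ext fun w => ?_; rw [g.val_eq L st φ _ q.1 h0, mul_sum, mul_sum, ← sum_add_distrib]
  refine sum_ext fun a => ?_
  have hc : g.contL φ (write (g.ωPart q) w ω) q.1 = g.contL φ ω q.1 :=
    congrArg (fun Φ => φ ∘ₗ ext AUX Φ) (iter_congr fun t _ => g.rround_congr fun i =>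
      g.part_write_ne q hq ω (Nat.ne_of_gt (Nat.lt_of_lt_of_le (Nat.lt_succ_self _)
        (Nat.le_add_right _ t))) w i)
  rw [hc, g.P.callRoundL_split q.2, LinearMap.add_apply, map_add, tensor_eq, map_add, map_add,
    mul_add, g.restL_write L q hq]
  congr 1; rw [← smul_eq_mul, ← map_smul, ← map_smul]; refine congrArg _ (congrArg _ ?_)
  have h1 : g.redL (g.P.calledL q.2 (g.hcall L n (write (g.ωPart q) w ω) q.1 q.2)
      (g.pendL L st n (write (g.ωPart q) w ω) q.1 a)) = _ :=
    comp_congr_left (g.P.calledL_comp q.2 _ (reduceL g.wAdv)) _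
  rw [h1, ← LinearMap.smul_apply]; refine LinearMap.congr_fun ?_ _
  have h2 : (fun u x => Ex w u x ∘ₗ g.inputL q) = fun u x => (p w : ℂ) •
      (reduceL g.wAdv ∘ₗ g.hcall L n (write (g.ωPart q) w ω) q.1 q.2 u x) := by
    funext u x; refine LinearMap.ext fun ρ => (hEx w u x ρ).trans ?_; rw [g.redL_hcall (by omega)]
    rfl
  rw [h2]
  simp only [OracleParty.calledL, smul_sum, smul_ite, smul_zero, LinearMap.smul_comp,
    LinearMap.comp_smul]

end

section

variable {AUX : Reg} {K : Type} [Fintype K] [DecidableEq K] (L : g.Ker) (st : g.Input AUX)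

def outSt (η : Bits g.Ω) : Op ((AUX ⊕ g.U) ⊕ (g.Z ⊕ g.V)) :=
  ∑ a, ∑ u, tensor (ket (elim a u)) (st η a u)

def setupL (n : ℕ) : LM (g.Ω ⊕ (K ⊕ (AUX ⊕ g.Exp))) (g.Ω ⊕ (K ⊕ (AUX ⊕ g.Exp))) :=
  act (onSnd g.Ω (outEmb K AUX g.U g.P.anc g.C (g.Z ⊕ g.V) g.anc)) (prepL (g.outSt st))
    ∘ₗ act (onSnd g.Ω (ancEmb K AUX g.U g.P.anc g.C (g.Z ⊕ g.V) g.anc))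
      (g.initC (g.inits n)).runL

def advanceL (n : ℕ) (ω : Bits g.Ω) (r : ℕ) : LM g.Exp g.Exp :=
  g.P.preL r (g.hstep r) ∘ₗ iter (g.hround L n ω) r
    ∘ₗ ext _ (ext g.C (act g.wMEM g.copyC.runL))

theorem setupL_eq (n : ℕ) (ω : Bits g.Ω) (k : Bits K) : reduceL inr (g.setupL st n (ket (elim
    (g.crop n ω) (elim k zeros)))) = ∑ η, ∑ a, ∑ u, tensor (ket k) (tensor (ket a) (g.P.initL u
    (tensor (st η a u) (g.ancSt η (g.memES (g.refSt n ω) η))))) := by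
  have h : ∀ η, cut η η ((g.initC (g.inits n)).runL (ket (elim (g.crop n ω) zeros)))
      = g.ancSt η (g.memES (g.refSt n ω) η) := fun η => g.initC_eq _ _ _
  simp only [← h]; exact setup_eq st _ _ _

theorem crop_write {n : ℕ} (q : g.Q) (hq : q.1 * ℓ + q.2 = n) (w : Bits (g.ΩO q.2)) (ω : Bits g.Ω) :
    g.crop n (write (g.ωPart q) w ω) = write (g.ωPart q) w (g.crop n ω) := by
  refine bits_ext_wire (g.ωPart q) ?_ fun v hv => ?_
  · rw [crop_ωPart, if_neg (by omega), write_comp, write_comp]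
  rw [write_notMem _ _ _ hv]; exact congrArg (ite _ false) (write_notMem _ _ _ hv)

theorem advanceL_eq {n : ℕ} (q : g.Q) (w : Bits (g.ΩO q.2)) (ω : Bits g.Ω) (k : Bits K) : ext K (ext
    AUX (g.advanceL L n ω q.1)) (∑ η, ∑ a, ∑ u, tensor (ket k) (tensor (ket a) (g.P.initL u (tensor
    (st η a u) (g.ancSt η (g.memES (g.refSt n (write (g.ωPart q) w ω)) η)))))) = tensor (ket k) (∑
    a, tensor (ket a) (g.pendL L st n (write (g.ωPart q) w ω) q.1 a)) := by
  have h : g.advanceL L n ω q.1 = g.advanceL L n (write (g.ωPart q) w ω) q.1 := by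
    rw [advanceL, advanceL, iter_congr fun r hr => g.hround_congr L
      (fun i => (g.part_write q w ω fun h => (Nat.ne_of_lt hr) h.1).symm) fun i => Iff.rfl]
  rw [h]
  have hp : ∀ a, g.pendL L st n (write (g.ωPart q) w ω) q.1 a
      = ∑ η, ∑ u, g.advanceL L n (write (g.ωPart q) w ω) q.1 (g.P.initL u (tensor (st η a u)
        (g.ancSt η (g.memES (g.refSt n (write (g.ωPart q) w ω)) η)))) := fun a => by
    simp only [pendL, startL, map_sum]; refine sum_ext fun η => sum_ext fun u => ?_
    exact (congrArg (fun ρ => g.P.preL q.1 (g.hstep q.1) (iter (g.hround L n (write (g.ωPart q) w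
      ω)) q.1 ρ)) (comp_congr (g.P.initL_intertwine u (act g.wMEM g.copyC.runL)) _)).symm
  have ht : ∀ a ρ, ext K (ext AUX (g.advanceL L n (write (g.ωPart q) w ω) q.1))
      (tensor (ket k) (tensor (ket a) ρ)) = (tensorL (ket k) ∘ₗ tensorL (ket a))
        (g.advanceL L n (write (g.ωPart q) w ω) q.1 ρ) := fun a ρ => by
    rw [ext_tensor, ext_tensor]; rfl
  refine Eq.trans ?_ (map_sum (tensorL (ket k)) _ _).symm
  change _ = ∑ a, (tensorL (ket k) ∘ₗ tensorL (ket a)) _; simp only [map_sum, ht, hp]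
  exact sum_comm

/-- Load the reference string, with one part taken from the input, and run the experiment up to
the call in question. -/
def simL {I : Type} [Fintype I] [DecidableEq I] (n : ℕ) (q : g.Q) (ω : Bits g.Ω) :
    LM (g.Ω ⊕ ((g.ΩO q.2 ⊕ I) ⊕ (AUX ⊕ g.Exp))) (g.Ω ⊕ ((g.ΩO q.2 ⊕ I) ⊕ (AUX ⊕ g.Exp))) :=
  ext g.Ω (ext (g.ΩO q.2 ⊕ I) (ext AUX (g.advanceL L n ω q.1))) ∘ₗ g.setupL st n
    ∘ₗ loadL inl fun x =>
      write (g.ωPart q) ((x ∘ Sum.inr) ∘ Sum.inl ∘ Sum.inl) (g.crop n ω)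

def simIn {I : Type} (q : g.Q) : g.ΩO q.2 ↪ g.Ω ⊕ ((g.ΩO q.2 ⊕ I) ⊕ (AUX ⊕ g.Exp)) :=
  (inl.trans inl).trans inr

theorem simL_eq {I : Type} [Fintype I] [DecidableEq I] {n : ℕ} (q : g.Q)
    (hq : q.1 * ℓ + q.2 = n) (ω : Bits g.Ω) (w : Bits (g.ΩO q.2)) :
    reduceL inr (g.simL L st (I := I) n q ω (ket (write (g.simIn q) w zeros)))
      = tensor (ket (elim w zeros))
        (∑ a, tensor (ket a) (g.pendL L st n (write (g.ωPart q) w ω) q.1 a)) := by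
  have h1 : (write (g.simIn q) w zeros : Bits (g.Ω ⊕ ((g.ΩO q.2 ⊕ I) ⊕ (AUX ⊕ g.Exp))))
      = elim zeros (elim (elim w zeros) zeros) := by
    refine bits_ext_wire (g.simIn q) (by rw [write_comp]; rfl) fun v hv => ?_
    rw [write_notMem _ _ _ hv]; rcases v with v | (v | v) | v
    · rfl
    · exact absurd rfl (hv v)
    · rfl
    rfl
  rw [h1, simL, comp_apply, comp_apply, reduceL_inr_ext]
  have h2 := loadL_inl_ket (A := g.Ω) (fun y : Bits ((g.ΩO q.2 ⊕ I) ⊕ (AUX ⊕ g.Exp)) =>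
    write (g.ωPart q) (y ∘ Sum.inl ∘ Sum.inl) (g.crop n ω)) zeros
      (elim (elim w zeros) zeros)
  refine (congrArg (fun ρ => ext (g.ΩO q.2 ⊕ I) (ext AUX (g.advanceL L n ω q.1))
    (reduceL inr (g.setupL st n ρ))) h2).trans ?_
  have h3 : write (g.ωPart q) ((elim (elim w zeros) zeros :
      Bits ((g.ΩO q.2 ⊕ I) ⊕ (AUX ⊕ g.Exp))) ∘ Sum.inl ∘ Sum.inl) (g.crop n ω)
      = g.crop n (write (g.ωPart q) w ω) := (g.crop_write q hq w ω).symm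
  rw [h3, g.setupL_eq]; exact g.advanceL_eq L st q w ω _

end

section

variable {AUX : Reg} (L : g.Ker) (st : g.Input AUX) (φ : Op (AUX ⊕ g.St) →ₗ[ℂ] ℂ)

theorem slices_start (n : ℕ) (ω : Bits g.Ω) (a : Bits AUX) : Slices (span ℂ (Set.range
    fun p : Bits g.Ω × (Bits AUX × Bits g.U) => g.startW p.1 (g.memES (g.refSt n ω) p.1) (st p.1
    p.2.1 p.2.2))) (g.startL st n ω a) := by
  intro s s' c c'; simp only [startL, map_sum]
  refine sum_mem fun η _ => sum_mem fun u _ => ?_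
  have h : ∀ β : Op g.W, cut c c' (cut s s' (g.P.initL u β))
      = (ket (elim u zeros) s s' * ket zeros c c' : ℂ) • β := fun β => by
    change cut c c' (cut s s' (tensor _ (tensor _ β))) = _
    rw [cut_tensor, map_smul, cut_tensor, smul_smul]
  rw [h]; exact Submodule.smul_mem _ _ (Submodule.subset_span ⟨(η, a, u), rfl⟩)

theorem exists_lines (hst : ∀ η z, ∃ σ, ∀ p : Bits AUX × Bits g.U, cut z z (st η p.1 p.2) ∈
    span ℂ {σ}) (n : ℕ) (ω : Bits g.Ω) (r : ℕ) (hr : r ≤ g.R) (hn : r * ℓ ≤ n) : ∃ S :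
    Submodule ℂ (Op g.W), Lines (g.maskTEq r) S ∧ ∀ a, Slices S (iter (g.hround L n ω) r (g.startL
    st n ω a)) := by
  induction r with
  | zero => exact ⟨_, g.lines_start (fun η => g.memES (g.refSt n ω) η)
      (fun η (p : Bits AUX × Bits g.U) => st η p.1 p.2) hst, fun a => g.slices_start st n ω a⟩
  | succ r ih =>
    obtain ⟨S, h1, h2⟩ := ih (by omega) (by rw [add_mul] at hn; omega)
    refine ⟨_, g.lines_round ⟨r, hr⟩ h1, fun a => ?_⟩
    exact g.slices_hround (h2 a) ⟨r, hr⟩ fun i => by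
      have := i.2; rw [add_mul] at hn; change r * ℓ + i < n; omega

theorem cut_inputL (q : g.Q) (ρ : Op g.W) (z : Bits g.ZI) :
    cut z z (g.inputL q ρ) = ∑ t, if z = g.zin q.1 t then reduceL g.wAdv (g.maskT t ρ) else 0 := by
  rw [inputL_apply, map_sum]; refine sum_ext fun t => ?_; rw [cut_tensor]
  by_cases h : z = g.zin q.1 t <;> simp [ket, h]

theorem lines_input (hst : ∀ η z, ∃ σ, ∀ p : Bits AUX × Bits g.U, cut z z (st η p.1 p.2) ∈
    span ℂ {σ}) (q : g.Q) {n : ℕ} (hq : q.1 * ℓ + q.2 = n) (ω : Bits g.Ω) (z : Bits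
    g.ZI) : ∃ σ, ∀ a s c, cut z z (g.inputL q (cut c c (cut s s (g.pendL L st n ω q.1 a)))) ∈
    span ℂ {σ} := by
  obtain ⟨S, h1, h2⟩ := g.exists_lines L st hst n ω q.1 (Nat.le_of_lt q.1.2) (by omega)
  have h3 := g.lines_round q.1 h1; by_cases hz : ∃ t, z = g.zin q.1 t
  · obtain ⟨t, rfl⟩ := hz; obtain ⟨σ, hσ⟩ := h3 t
    refine ⟨reduceL g.wAdv (g.maskT t σ), fun a s c => ?_⟩
    rw [cut_inputL, sum_eq_single t (fun t' _ ht => if_neg fun h =>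
      ht (g.zin_injective q.1 h).symm) (by simp), if_pos rfl]
    have h4 := hσ _ (g.slices_pre (h2 a) q.1 s s c c)
    obtain ⟨k, hk⟩ := Submodule.mem_span_singleton.1 h4
    have h5 : ∀ ρ, g.maskT t (g.maskTEq (q.1 + 1) t ρ) = g.maskT t ρ := fun ρ => by
      ext x y; rw [maskT, maskL_apply, maskL_apply]; refine ite_congr rfl (fun h => ?_) fun _ => rfl
      rw [maskTEq, maskL_apply, if_pos]; rw [h.1, h.2]
      exact ⟨⟨rfl, rfl, fun _ _ => ⟨rfl, rfl, rfl, fun _ _ => ⟨rfl, rfl⟩⟩⟩,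
        ⟨rfl, rfl, fun _ _ => ⟨rfl, rfl, rfl, fun _ _ => ⟨rfl, rfl⟩⟩⟩⟩
    have hk' : g.maskTEq (q.1 + 1) t (cut c c (cut s s (g.pendL L st n ω q.1 a)))
      = k • σ := hk.symm
    change reduceL g.wAdv (g.maskT t (cut c c (cut s s (g.pendL L st n ω q.1 a)))) ∈ _
    rw [← h5 (cut c c (cut s s (g.pendL L st n ω q.1 a)))]; rw [hk', map_smul, map_smul]
    exact Submodule.smul_mem _ _ (mem_span_singleton_self _)
  refine ⟨0, fun a s c => ?_⟩; rw [cut_inputL, sum_eq_zero fun t _ => if_neg fun h => hz ⟨t, h⟩]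
  exact zero_mem _

theorem dephaseL_inputL (q : g.Q) (ρ : Op g.W) : dephaseL inl (g.inputL q ρ) = g.inputL q ρ := by
  rw [inputL_apply, map_sum]; exact sum_ext fun t => dephaseL_ket_tensor _ _

def callSt (q : g.Q) (n : ℕ) (ω : Bits g.Ω) (w : Bits (g.ΩO q.2))
    (a : Bits (AUX ⊕ ((g.U ⊕ g.P.anc) ⊕ g.C))) (u : Bits (g.In q.2)) : Op (g.ZI ⊕ g.adv) :=
  if u = ((a ∘ Sum.inr) ∘ Sum.inl) ∘ g.P.callIn q.2 then
    g.inputL q (cut ((a ∘ Sum.inr) ∘ Sum.inr) ((a ∘ Sum.inr) ∘ Sum.inr) (cut ((a ∘ Sum.inr) ∘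
      Sum.inl) ((a ∘ Sum.inr) ∘ Sum.inl) (g.pendL L st n (write (g.ωPart q) w ω) q.1 (a ∘
      Sum.inl))))
  else 0

def callΘ (q : g.Q) (n : ℕ) (ω : Bits g.Ω) : LM (g.Ω ⊕ ((g.ΩO q.2 ⊕ g.In q.2) ⊕ (AUX ⊕ g.Exp)))
    (g.Ω ⊕ ((g.ΩO q.2 ⊕ g.In q.2) ⊕ (AUX ⊕ g.Exp))) :=
  ext g.Ω (loadL (inl.trans ((inr : g.In q.2 ↪ g.ΩO q.2 ⊕ g.In q.2).sumMap (refl _))) (fun x i => x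
      (Sum.inr (Sum.inr (Sum.inl (g.P.callIn q.2 i))))) ∘ₗ ext (g.ΩO q.2 ⊕ g.In q.2) (ext AUX (ext
      (g.U ⊕ g.P.anc) (ext g.C (act (g.wKQ q) (g.setC q).runL))))) ∘ₗ g.simL L st n q ω

def callOutE (AUX : Reg) (q : g.Q) : ((AUX ⊕ ((g.U ⊕ g.P.anc) ⊕ g.C)) ⊕ g.In q.2) ⊕ (g.ZI ⊕ g.adv) ↪
    g.Ω ⊕ ((g.ΩO q.2 ⊕ g.In q.2) ⊕ (AUX ⊕ g.Exp)) :=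
  ((onSnd ((AUX ⊕ ((g.U ⊕ g.P.anc) ⊕ g.C)) ⊕ g.In q.2) g.wZA).trans ((gatherEquiv AUX (g.U ⊕
    g.P.anc) g.C (g.In q.2) g.W).toEmbedding.trans ((inr : g.In q.2 ↪ g.ΩO q.2 ⊕ g.In q.2).sumMap
    (refl _)))).trans inr

theorem callΘ_eq (q : g.Q) {n : ℕ} (hq : q.1 * ℓ + q.2 = n) (ω : Bits g.Ω) (w : Bits (g.ΩO q.2))
    (a : Bits (AUX ⊕ ((g.U ⊕ g.P.anc) ⊕ g.C))) (u : Bits (g.In q.2)) : dephaseL inl (cut (elim a u)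
    (elim a u) (reduceL (g.callOutE AUX q) (g.callΘ L st q n ω (ket (write (g.simIn q) w
    zeros))))) = g.callSt L st q n ω w a u := by
  have h1 : reduceL inr
      (g.callΘ L st q n ω (ket (write (g.simIn q) w zeros)))
      = loadL (inl.trans ((inr : g.In q.2 ↪ g.ΩO q.2 ⊕ g.In q.2).sumMap (refl _)))
        (fun x i => x (Sum.inr (Sum.inr (Sum.inl (g.P.callIn q.2 i)))))
        (tensor (ket (elim w zeros)) (ext AUX (ext (g.U ⊕ g.P.anc) (ext g.C
          (act (g.wKQ q) (g.setC q).runL)))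
            (∑ a, tensor (ket a) (g.pendL L st n (write (g.ωPart q) w ω) q.1 a)))) := by
    rw [callΘ, comp_apply, reduceL_inr_ext, g.simL_eq L st q hq, comp_apply, ext_tensor]
  have h2 : ∀ a', cut a' a' (∑ a, tensor (ket a)
      (g.pendL L st n (write (g.ωPart q) w ω) q.1 a) : Op (AUX ⊕ g.Exp))
      = g.pendL L st n (write (g.ωPart q) w ω) q.1 a' := fun a' => by
    rw [map_sum, sum_eq_single a']
    · rw [cut_tensor]; simp [ket]
    · intro b _ hb; rw [cut_tensor]; simp [ket, hb.symm]
    simp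
  obtain ⟨b, s, c, rfl⟩ : ∃ b s c, a = elim b (elim s c) :=
    ⟨a ∘ Sum.inl, (a ∘ Sum.inr) ∘ Sum.inl, (a ∘ Sum.inr) ∘ Sum.inr, by simp⟩
  rw [callOutE, reduceL_trans, h1, reduceL_trans, reduceL_onSnd, cut_ext]
  refine (congrArg (fun ρ => dephaseL inl (reduceL g.wZA ρ))
    (cut_gather (g.P.callIn q.2) w _ b s c u)).trans ?_
  rw [cut_ext, cut_ext, cut_ext, h2]
  change _ = if u = s ∘ g.P.callIn q.2 then g.inputL q (cut c c (cut s s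
    (g.pendL L st n (write (g.ωPart q) w ω) q.1 b))) else 0
  split_ifs with hu
  · exact g.dephaseL_inputL q _
  rw [map_zero, map_zero]

def callψ (q : g.Q) (ω : Bits g.Ω) :
    Op (((AUX ⊕ ((g.U ⊕ g.P.anc) ⊕ g.C)) ⊕ g.Out q.2) ⊕ g.adv) →ₗ[ℂ] ℂ :=
  (0 : _ →ₗ[ℂ] ℂ) ∘ₗ maskL (fun x => (finRange ℓ).find? (fun i =>
      x (Sum.inl (Sum.inl (Sum.inr (Sum.inl (g.P.flag i)))))) = none)
    + ∑ i, (if i = q.2 then g.contL φ ω q.1 ∘ₗ reduceL (spreadEmb AUX _ g.C (g.Out q.2) g.adv)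
      ∘ₗ loadL ((((g.P.callOut q.2).trans inl).trans
        inr).trans (spreadEmb AUX _ g.C (g.Out q.2) g.adv))
          (fun y i => y (Sum.inl (Sum.inr i)))
      else 0) ∘ₗ maskL (fun x => (finRange ℓ).find? (fun i =>
        x (Sum.inl (Sum.inl (Sum.inr (Sum.inl (g.P.flag i)))))) = some i)

theorem callψ_eq (q : g.Q) (ω : Bits g.Ω) (a : Bits AUX) (s : Bits (g.U ⊕ g.P.anc)) (c : Bits g.C)
    (x : Bits (g.Out q.2)) (β : Op g.adv) : g.callψ φ q ω (tensor (ket (elim (elim a (elim s c)) x))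
    β) = if g.P.callee s = some q.2 then g.contL φ ω q.1 (tensor (ket a) (tensor (ket (write
    (g.P.callOut q.2) x s)) (tensor (ket c) β))) else 0 := by
  rw [callψ, LinearMap.add_apply, LinearMap.zero_comp, LinearMap.zero_apply, zero_add,
    LinearMap.sum_apply, sum_eq_single q.2]
  · rw [if_pos rfl, comp_apply]
    have h := maskL_ket_tensor (fun x : Bits ((AUX ⊕ ((g.U ⊕ g.P.anc) ⊕ g.C)) ⊕ g.Out q.2) =>
      (finRange ℓ).find? (fun i => x (Sum.inl (Sum.inr (Sum.inl (g.P.flag i)))))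
        = some q.2) (elim (elim a (elim s c)) x) β
    refine (congrArg _ h).trans ?_
    change _ = if (finRange ℓ).find? (fun i => s (g.P.flag i)) = some q.2 then _ else _
    refine (apply_ite _ _ _ _).trans ?_; refine if_congr Iff.rfl ?_ (map_zero _)
    exact congrArg (g.contL φ ω q.1) (spread_load (g.P.callOut q.2) a s c x β)
  · intro i _ hi; rw [if_neg hi, LinearMap.zero_comp, LinearMap.zero_apply]
  simp

set_option maxRecDepth 10000 in
/-- The trial for a call. -/
def callTrial (q : g.Q) {n : ℕ} (hq : q.1 * ℓ + q.2 = n) (ω : Bits g.Ω) (hst : ∀ η z, ∃ σ, ∀ p :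
    Bits AUX × Bits g.U, cut z z (st η p.1 p.2) ∈ span ℂ {σ}) {N : ℕ} (hΘ : Impl (g.callΘ
    L st q n ω) N) (hψ : Test (g.callψ φ q ω) N) (hN : card (g.Ω ⊕ ((g.ΩO q.2 ⊕ g.In q.2) ⊕ (AUX ⊕
    g.Exp))) ≤ N) : Trial (g.ΩO q.2) (g.In q.2) (g.Out q.2) g.ZI g.adv N where
  aux := ⟨AUX ⊕ ((g.U ⊕ g.P.anc) ⊕ g.C)⟩
  G := ⟨g.Ω ⊕ ((g.ΩO q.2 ⊕ g.In q.2) ⊕ (AUX ⊕ g.Exp))⟩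
  Θ := g.callΘ L st q n ω
  inp := g.simIn q
  out := g.callOutE AUX q
  ψ := g.callψ φ q ω
  st := g.callSt L st q n ω
  impl := hΘ
  test := hψ
  card_G := hN
  eq := g.callΘ_eq L st q hq ω
  lines w z := by
    obtain ⟨σ, hσ⟩ := g.lines_input L st hst q hq (write (g.ωPart q) w ω) z
    refine ⟨σ, fun a u => ?_⟩; rw [callSt]; split_ifs
    · exact hσ _ _ _
    rw [map_zero]; exact zero_mem _

theorem callTrial_value (q : g.Q) {n : ℕ} (hq : q.1 * ℓ + q.2 = n) (ω : Bits g.Ω)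
    (hst) {N : ℕ} (hΘ) (hψ) (hN)
    (Ex : Bits (g.ΩO q.2) → Bits (g.In q.2) → Bits (g.Out q.2) → LM (g.ZI ⊕ g.adv) g.adv) :
    (g.callTrial L st φ q hq ω hst (N := N) hΘ hψ hN).value Ex = g.valCall L st φ q ω n Ex := by
  change g.callψ φ q ω (∑ a : Bits (AUX ⊕ ((g.U ⊕ g.P.anc) ⊕ g.C)), ∑ x,
    tensor (ket (elim a x)) (∑ w, ∑ u, Ex w u x (g.callSt L st q n ω w a u))) = _
  have h1 : ∀ (a : Bits (AUX ⊕ ((g.U ⊕ g.P.anc) ⊕ g.C))) x w,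
      ∑ u, Ex w u x (g.callSt L st q n ω w a u)
      = Ex w (((a ∘ Sum.inr) ∘ Sum.inl) ∘ g.P.callIn q.2) x (g.inputL q
        (cut ((a ∘ Sum.inr) ∘ Sum.inr) ((a ∘ Sum.inr) ∘ Sum.inr)
          (cut ((a ∘ Sum.inr) ∘ Sum.inl) ((a ∘ Sum.inr) ∘ Sum.inl)
            (g.pendL L st n (write (g.ωPart q) w ω) q.1 (a ∘ Sum.inl))))) := fun a x w => by
    rw [sum_eq_single (((a ∘ Sum.inr) ∘ Sum.inl) ∘ g.P.callIn q.2)]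
    · rw [callSt, if_pos rfl]
    · intro u _ hu; rw [callSt, if_neg hu, map_zero]
    simp
  simp only [h1, map_sum]; rw [sum_bits]; refine sum_ext fun a => ?_
  rw [sum_bits, g.P.sum_calledL q.2 (fun w u x => Ex w u x ∘ₗ g.inputL q)]
  change _ = (g.contL φ ω q.1 ∘ₗ tensorL (ket a)) _; rw [map_sum]; refine sum_ext fun s => ?_
  rw [map_sum]; refine sum_ext fun c => ?_; rw [map_sum]; refine sum_ext fun x => ?_
  refine (g.callψ_eq φ q ω a s c x _).trans ?_; refine Eq.trans ?_ (apply_ite _ _ _ _).symm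
  exact if_congr Iff.rfl rfl (map_zero _).symm

end

section

variable {AUX : Reg} (L : g.Ker) (st : g.Input AUX) (φ : Op (AUX ⊕ g.St) →ₗ[ℂ] ℂ)

theorem ext_redL : ext AUX g.redL
    = reduceL (onSnd AUX (onSnd (g.U ⊕ g.P.anc) (onSnd g.C g.wAdv))) := by
  rw [reduceL_onSnd, reduceL_onSnd, reduceL_onSnd]; rfl

def restχ (q : g.Q) (n : ℕ) (ω : Bits g.Ω) (I : Type) [Fintype I] [DecidableEq I] :
    Op (g.Ω ⊕ ((g.ΩO q.2 ⊕ I) ⊕ (AUX ⊕ g.Exp))) →ₗ[ℂ] ℂ :=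
  (g.contL φ ω q.1 ∘ₗ ext AUX g.redL ∘ₗ ext AUX (g.P.restL q.2 (g.hcall L n ω q.1)))
    ∘ₗ reduceL (inr.trans inr)

theorem restχ_eq (q : g.Q) {n : ℕ} (hq : q.1 * ℓ + q.2 = n) (ω : Bits g.Ω) (I : Type) [Fintype I]
    [DecidableEq I] (w : Bits (g.ΩO q.2)) : g.restχ L φ q n ω I (g.simL L st n q ω (ket (write
    (g.simIn q) w zeros))) = g.valRest L st φ q ω n w := by
  rw [restχ, comp_apply, reduceL_trans, g.simL_eq L st q hq, reduceL_inr_ket_tensor,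
    comp_apply, comp_apply, map_sum, map_sum, map_sum]
  refine sum_ext fun a => ?_; rw [ext_tensor, ext_tensor]

end

def attackC (i : Fin ℓ) (t : ℕ) : Circuit (g.MO i ⊕ (g.ZI ⊕ g.adv)) :=
  dispatchC (onSnd (g.MO i) (inr : g.adv ↪ g.ZI ⊕ g.adv))
    (fun r : Fin g.R => Sum.inr (Sum.inl (Sum.inl r : Fin g.R ⊕ g.T))) fun r => g.bcall r i t

theorem attackC_zin (i : Fin ℓ) (t : ℕ) (r : Fin g.R) (τ : Bits g.T) : ext (g.MO i) (tensorL (ket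
    (g.zin r τ))) ∘ₗ (g.bcall r i t).runL = (g.attackC i t).runL ∘ₗ ext (g.MO i) (tensorL (ket
    (g.zin r τ))) := by
  ext1 ρ
  rw [comp_apply, comp_apply, ext_tensorL_eq_emb, ext_tensorL_eq_emb]
  refine (runL_dispatchC _ _ (fun r a => ?_) (fun r => g.bcall r i t) _ r (fun _ => rfl) ρ).symm
  rcases a with a | a <;> exact nofun

def exR (i : Fin ℓ) (p : Bits (g.ΩO i) → ℝ) (w : Bits (g.ΩO i)) (u : Bits (g.In i))
    (x : Bits (g.Out i)) : LM (g.ZI ⊕ g.adv) g.adv :=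
  (p w : ℂ) • (reduceL inr ∘ₗ (g.alice i).execL (g.len i) (fun t => (g.attackC i t).runL) w u x)

def exI (i : Fin ℓ) (L : Bits (g.In i) → Bits (g.VI i) → Bits (g.Out i) → Bits (g.YO i) → ℝ) (w :
    Bits (g.ΩO i)) (u : Bits (g.In i)) (x : Bits (g.Out i)) : LM (g.ZI ⊕ g.adv) g.adv :=
  reduceL (inr.trans inl)
    ∘ₗ fexecL L (g.query i).runL (g.reply i).runL u x ∘ₗ tensorR (g.refMem i w)

theorem sum_maskT (ρ : Op g.W) : ∑ t, reduceL g.wAdv (g.maskT t ρ) = reduceL g.wAdv ρ := by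
  rw [← map_sum]; refine (congrArg _ (sum_maskL g.wT ρ)).trans ?_
  have h : dephaseL g.wT = act g.wT (dephaseL (refl g.T)) :=
    dephaseL_trans (refl g.T) g.wT
  rw [h, reduceL_disjoint g.wT g.wAdv (fun a b h => g.wAdv_ne_wT b a h.symm) (dephaseL_tp _)]

theorem exR_inputL (q : g.Q) (ω : Bits g.Ω) (p : Bits (g.ΩO q.2) → ℝ) (w : Bits (g.ΩO q.2)) (u :
    Bits (g.In q.2)) (x : Bits (g.Out q.2)) (ρ : Op g.W) : g.exR q.2 p w u x (g.inputL q ρ) = (p w :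
    ℂ) • g.rcall (write (g.ωPart q) w ω) q.1 q.2 u x (reduceL g.wAdv ρ) := by
  rw [rcall, part_write_self, exR, LinearMap.smul_apply, inputL_apply, map_sum, ← g.sum_maskT ρ,
    map_sum]
  congr 1; refine sum_ext fun t => ?_
  have h := comp_congr ((g.alice q.2).execL_intertwine (g.len q.2)
    (fun t => (g.bcall q.1 q.2 t).runL) (fun t => (g.attackC q.2 t).runL)
    (tensorL (ket (g.zin q.1 t))) (fun t' _ => g.attackC_zin q.2 t' q.1 t) w u x)
      (reduceL g.wAdv (g.maskT t ρ))
  rw [comp_apply]; refine (congrArg (reduceL inr) h.symm).trans ?_; exact reduceL_inr_ket_tensor _ _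

theorem sum_trace_exR (i : Fin ℓ) (p : Bits (g.ΩO i) → ℝ) (w : Bits (g.ΩO i)) (u : Bits (g.In i))
    (ρ : Op (g.ZI ⊕ g.adv)) : ∑ x, (g.exR i p w u x ρ).trace = p w * ρ.trace := by
  simp only [exR, LinearMap.smul_apply, comp_apply, trace_smul, trace_reduceL]
  rw [← smul_sum, Party.sum_trace_execL]; rfl

theorem sum_trace_exI (i : Fin ℓ) {L : Bits (g.In i) → Bits (g.VI i) → Bits (g.Out i) → Bits (g.YO
    i) → ℝ} (hL : Markov L) (w : Bits (g.ΩO i)) (u : Bits (g.In i)) (ρ : Op (g.ZI ⊕ g.adv)) : ∑ x,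
    (g.exI i L w u x ρ).trace = (g.refMem i w).trace * ρ.trace := by
  simp only [exI, comp_apply, trace_reduceL]; rw [sum_trace_fexecL hL]
  exact (trace_tensor _ _).trans (mul_comm _ _)

end Game

theorem act_refl {A : Type} [Fintype A] [DecidableEq A] (Φ : LM A A) : act (refl A) Φ = Φ := by
  ext1 ρ
  ext x y; rw [act_apply]
  have h : sect (refl A) x y ρ = ρ := by
    ext a b; rw [sect_apply]
    exact congrArg₂ ρ (write_comp (refl A) a x)
      (write_comp (refl A) b y)
  rw [h]; rfl

namespace Game

variable {ℓ : ℕ} (g : Game ℓ)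

section

variable {AUX : Reg} (L : g.Ker) (st : g.Input AUX) (φ : Op (AUX ⊕ g.St) →ₗ[ℂ] ℂ)

/-- All registers and circuits of the game have size at most `N`. -/
structure SizeLE (T : Fin ℓ → Reg)
    (Cf : ∀ i, Circuit ((g.In i ⊕ g.VI i) ⊕ ((g.Out i ⊕ g.YO i) ⊕ T i))) (AUX : Reg)
    (N : ℕ) : Prop where
  party : ∀ i, card (g.In i) + card (g.Out i) + card (g.VI i)
    + card (g.YO i) + card (g.ΩO i) + card (g.MO i)
    + card (g.alice i).anc + g.len i + card (T i) + (Cf i).size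
    + (card g.U + card g.P.anc + card g.C) ≤ N
  total : card g.Ω + card g.W + card AUX + g.R
    + (card g.U + card g.P.anc + card g.C) ≤ N
  adv : card g.adv ≤ N
  alice : ∀ i, ∀ t < g.len i, ((g.alice i).step t).size ≤ N
  pstep : ∀ r < g.R, 2 * card g.C + (g.P.step r).size ≤ N
  step : ∀ r < g.R, (g.step r).size ≤ N
  stepC : ∀ r < g.R, (g.stepC r).size ≤ N
  bcall : ∀ r < g.R, ∀ i, ∀ t < g.len i, (g.bcall r i t).size ≤ N
  query : ∀ q, (g.queryC q).size + (g.replyC q).size ≤ N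
  set : ∀ q, (g.setC q).size ≤ N
  copy : g.copyC.size ≤ N
  init : ∀ n, (g.initC (g.inits n)).size ≤ N

def callBound (N : ℕ) : ℕ := (N + 1) * (2 * N + 20 * (N + 1))

def roundBound (ℓ N : ℕ) : ℕ := (ℓ + 2) * (callBound N + 10 * N + 11)

theorem le_callBound (N : ℕ) : 20 * (2 * N + 1) + 2 * N ≤ callBound N := by
  unfold callBound; nlinarith

theorem callBound_le (ℓ N : ℕ) : callBound N + 10 * N + 11 ≤ roundBound ℓ N :=
  Nat.le_mul_of_pos_left _ (by omega)

variable {g L} {T : Fin ℓ → Reg} {Cf : ∀ i, Circuit ((g.In i ⊕ g.VI i) ⊕ ((g.Out i ⊕ g.YO i) ⊕ T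
  i))} {N : ℕ} (hg : g.SizeLE T Cf AUX N)
include hg

theorem implRcall {W : Type} [Fintype W] [DecidableEq W] (f : g.adv ↪ W) (ω : Bits g.Ω) {r : ℕ}
    (hr : r < g.R) (i : Fin ℓ) :
    Impl (instL fun u x => act f (g.rcall ω r i u x)) (callBound N) := by
  have h := Impl.party (g.alice i) (g.len i)
    (fun t => act (onSnd (g.MO i) f) (g.bcall r i t).runL) (g.part ω r i) (N := N) (k := 2 * N)
    (by have := hg.party i; omega) (hg.alice i) fun t ht =>
      ((Impl.circuit _).act _).mono ((hg.bcall r hr i t ht).trans (by omega))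
  simp only [Party.execL_act] at h; exact h

theorem implHcall {n : ℕ} (hL : ∀ r (i : Fin ℓ), r * ℓ + i < n → L r i = circKernel (Cf i))
    (ω : Bits g.Ω) {r : ℕ} (hr : r < g.R) (i : Fin ℓ) :
    Impl (instL (g.hcall L n ω r i)) (callBound N) := by
  by_cases h : r < g.R ∧ r * ℓ + i < n
  · have e : g.hcall L n ω r i = fexecL (circKernel (Cf i))
        ((g.queryC (⟨r, h.1⟩, i)).map (onSnd _ (g.wKQ (⟨r, h.1⟩, i)))).runL
        ((g.replyC (⟨r, h.1⟩, i)).map (onSnd _ (g.wKQ (⟨r, h.1⟩, i)))).runL := by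
      funext u x; rw [runL_map, runL_map, fexecL_act, hcall, dif_pos h, hL r i h.2]
    rw [e]
    refine (Impl.fexec (N := 2 * N) _ _ _ ?_).mono
      (le_trans (by omega) (le_callBound N))
    rw [size_map, size_map]; have h1 := hg.party i; have h2 := hg.query (⟨r, h.1⟩, i); omega
  have e : g.hcall L n ω r i = fun u x => act g.wAdv (g.rcall ω r i u x) :=
    funext fun u => funext fun x => g.hcall_real h u x
  rw [e]; exact implRcall hg _ ω hr i

theorem implHstep {r : ℕ} (hr : r < g.R) : Impl (g.hstep r) (callBound N) :=
  ((Impl.circuit _).act _).mono ((hg.stepC r hr).trans (by have := le_callBound N; omega))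

theorem implHround {n : ℕ} (hL : ∀ r (i : Fin ℓ), r * ℓ + i < n → L r i = circKernel (Cf i))
    (ω : Bits g.Ω) {r : ℕ} (hr : r < g.R) : Impl (g.hround L n ω r) (roundBound ℓ N) :=
  g.P.implRound (fun i => by have := hg.party i; omega) (hg.pstep r hr) (implHstep hg hr)
    fun i => implHcall hg hL ω hr i

theorem implRround (ω : Bits g.Ω) {r : ℕ} (hr : r < g.R) : Impl (g.rround ω r) (roundBound ℓ N) :=
  g.P.implRound (fun i => by have := hg.party i; omega) (hg.pstep r hr)
    ((Impl.circuit _).mono ((hg.step r hr).trans (by have := le_callBound N; omega))) fun i => by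
      have h := implRcall hg (refl _) ω hr i; convert h using 3 with u
      exact funext fun x => (act_refl _).symm

theorem implAdvance {n : ℕ} (hL : ∀ r (i : Fin ℓ), r * ℓ + i < n → L r i = circKernel (Cf i)) (ω :
    Bits g.Ω) (r : Fin g.R) : Impl (g.advanceL L n ω r) ((N + 1) * roundBound ℓ N + N) := by
  have h1 : Impl (g.P.preL r (g.hstep r)) (roundBound ℓ N) :=
    (g.P.implPre (implHstep hg r.2)).mono (by
      have := hg.pstep r r.2; have := callBound_le ℓ N
      omega)
  have h2 : Impl (iter (g.hround L n ω) r) (N * roundBound ℓ N) :=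
    (Impl.iter fun t ht => implHround hg hL ω (ht.trans r.2)).mono
      (Nat.mul_le_mul_right _ (by have := hg.total; omega))
  have h3 : Impl (ext (g.U ⊕ g.P.anc) (ext g.C (act g.wMEM g.copyC.runL))) N := by
    rw [← act_inr, ← act_inr]; exact ((((Impl.circuit _).act _).act _).act _).mono hg.copy
  refine (h1.comp (h2.comp h3)).mono (le_of_eq ?_); ring

theorem testCont (ω : Bits g.Ω) (r : ℕ) (hφ : Test φ N) :
    Test (g.contL φ ω r) (N + N * roundBound ℓ N) := by
  refine hφ.comp ?_; rw [← act_inr]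
  exact ((Impl.iter fun t ht => implRround hg ω (by omega)).mono
    (Nat.mul_le_mul_right _ (by have := hg.total; omega))).act _

theorem implSim {n : ℕ} (hL : ∀ r (i : Fin ℓ), r * ℓ + i < n → L r i = circKernel (Cf i)) (ω : Bits
    g.Ω) (q : g.Q) (hst : Impl (prepL (g.outSt st)) N) (I : Type) [Fintype I] [DecidableEq I] : Impl
    (g.simL L st (I := I) n q ω) ((N + 1) * roundBound ℓ N + 5 * N + 2) := by
  have h1 : Impl (ext g.Ω (ext (g.ΩO q.2 ⊕ I) (ext AUX (g.advanceL L n ω q.1))))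
      ((N + 1) * roundBound ℓ N + N) := by
    rw [← act_inr, ← act_inr, ← act_inr]; exact (((implAdvance hg hL ω q.1).act _).act _).act _
  have h2 : Impl (g.setupL st n (K := g.ΩO q.2 ⊕ I)) (N + N) :=
    (hst.act _).comp (((Impl.circuit _).act _).mono (hg.init n))
  have h3 : Impl (loadL (inl : g.Ω ↪ g.Ω ⊕ ((g.ΩO q.2 ⊕ I) ⊕ (AUX ⊕ g.Exp)))
      fun x => write (g.ωPart q) ((x ∘ Sum.inr) ∘ Sum.inl ∘ Sum.inl) (g.crop n ω)) (2 * N + 2) := by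
    refine (Impl.load fun a => ?_).mono (by have := hg.total; omega)
    by_cases h : ∃ b, g.ωPart q b = a
    · obtain ⟨b, rfl⟩ := h
      exact ⟨.inl (Sum.inr (Sum.inl (Sum.inl b))), by rintro _ ⟨⟩,
        fun x => write_mem _ _ _ _⟩
    exact ⟨.inr (g.crop n ω a), by rintro _ ⟨⟩,
      fun x => write_notMem _ _ _ fun b hb => h ⟨b, hb⟩⟩
  exact (h1.comp (h2.comp h3)).mono (by omega)

def partBound (ℓ N : ℕ) : ℕ := (ℓ + 1) * (8 * ((N + 1) * roundBound ℓ N) + 100 * (N + 1))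

def trialBound (ℓ N : ℕ) : ℕ := 5 * partBound ℓ N + 100 * (N + 1)

omit hg in
theorem le_partBound (ℓ N : ℕ) : 8 * ((N + 1) * roundBound ℓ N) + 100 * (N + 1) ≤ partBound ℓ N :=
  Nat.le_mul_of_pos_left _ (by omega)

theorem implCallΘ {n : ℕ} (hL : ∀ r (i : Fin ℓ), r * ℓ + i < n → L r i = circKernel (Cf i))
    (ω : Bits g.Ω) (q : g.Q) (hst : Impl (prepL (g.outSt st)) N) :
    Impl (g.callΘ L st q n ω) (trialBound ℓ N) := by
  have h1 : Impl (ext (g.ΩO q.2 ⊕ g.In q.2) (ext AUX (ext (g.U ⊕ g.P.anc) (ext g.C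
      (act (g.wKQ q) (g.setC q).runL))))) N := by
    rw [← act_inr, ← act_inr, ← act_inr, ← act_inr]
    exact ((((((Impl.circuit _).act _).act _).act _).act _).act _).mono (hg.set q)
  have h2 : Impl (loadL (inl.trans ((inr : g.In q.2 ↪ g.ΩO q.2 ⊕ g.In q.2).sumMap (refl (AUX ⊕
      g.Exp)))) (fun x i => x (Sum.inr (Sum.inr (Sum.inl (g.P.callIn q.2 i)))))) (2 * N + 2) :=
    (Impl.load (Sourced.comp (fun i => Sum.inr (Sum.inr (Sum.inl (g.P.callIn q.2 i))))
      fun a b h => by cases h)).mono (by have := hg.party q.2; omega)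
  rw [callΘ, ← act_inr]; refine (((h2.comp h1).act _).comp (implSim st hg hL ω q hst _)).mono ?_
  have := le_partBound ℓ N; unfold trialBound; omega

theorem testCallψ (q : g.Q) (ω : Bits g.Ω) (hφ : Test φ N) :
    Test (g.callψ φ q ω) (trialBound ℓ N) := by
  have hG : card (((AUX ⊕ ((g.U ⊕ g.P.anc) ⊕ g.C)) ⊕ g.Out q.2) ⊕ g.adv) ≤ 3 * N := by
    have h1 := hg.party q.2; have h2 := hg.total; have h3 := hg.adv; simp only [card_sum]; omega
  have b : ((AUX ⊕ ((g.U ⊕ g.P.anc) ⊕ g.C)) ⊕ g.Out q.2) ⊕ g.adv :=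
    Sum.inl (Sum.inl (Sum.inr (Sum.inl (g.P.flag q.2))))
  have h := Test.chain (fun i => Sum.inl (Sum.inl (Sum.inr (Sum.inl (g.P.flag i))))) b
    (k := N + N * roundBound ℓ N + 8 * N + 4)
    (φ := fun i => if i = q.2 then g.contL φ ω q.1 ∘ₗ reduceL (spreadEmb AUX _ g.C (g.Out q.2)
      g.adv) ∘ₗ loadL ((((g.P.callOut q.2).trans inl).trans inr).trans (spreadEmb AUX _ g.C (g.Out
      q.2) g.adv)) (fun y i => y (Sum.inl (Sum.inr i))) else 0)
    (fun i => ?_) ((Test.zero b).mono (by omega))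
  · refine h.mono ?_
    have h1 : 4 * (N + N * roundBound ℓ N + 8 * N + 4) + 4 * (3 * N) + 8
        ≤ 8 * ((N + 1) * roundBound ℓ N) + 100 * (N + 1) := by
      rw [add_mul N 1]; omega
    refine (Nat.mul_le_mul_left _ ((by omega : _ ≤ _).trans h1)).trans (?_ : partBound ℓ N ≤ _)
    unfold trialBound; omega
  split_ifs
  · have h1 := (Test.reduce (testCont φ hg ω q.1 hφ) (spreadEmb AUX _ g.C (g.Out q.2) g.adv)).comp
      (Impl.load (g := (((g.P.callOut q.2).trans inl).trans inr).trans (spreadEmb AUX _ g.C (g.Out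
      q.2) g.adv)) (Sourced.comp (fun i => Sum.inl (Sum.inr i)) nofun))
    exact h1.mono (by have := hg.party q.2; omega)
  exact (Test.zero b).mono (by omega)

theorem testRestχ {n : ℕ} (hL : ∀ r (i : Fin ℓ), r * ℓ + i < n → L r i = circKernel (Cf i))
    (ω : Bits g.Ω) (q : g.Q) (hφ : Test φ N) (I : Type) [Fintype I] [DecidableEq I] :
    Test (g.restχ L φ q n ω I) (partBound ℓ N) := by
  have hG : card (AUX ⊕ g.Exp) ≤ N := by
    have h2 := hg.total; simp only [card_sum]; omega
  have h1 : Test (g.contL φ ω q.1 ∘ₗ ext AUX g.redL) (N + N * roundBound ℓ N) := by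
    rw [ext_redL]; exact Test.reduce (testCont φ hg ω q.1 hφ) _
  refine (Test.reduce (g.P.testRest q.2 (N := N) (fun i => by have := hg.party i; omega)
    (fun i => implHcall hg hL ω q.1.2 i) h1
    (Sum.inr (Sum.inr (Sum.inr (g.wMEM (g.memD true)))))) _).mono ?_
  refine Nat.mul_le_mul_left _ ?_; have h3 := callBound_le ℓ N; rw [add_mul N 1]
  change 4 * (_ + 2 * card (AUX ⊕ g.Exp) + 2) + 4 * card (AUX ⊕ g.Exp) + 8 ≤ _; omega

end

section

variable {AUX : Reg} (L L' : g.Ker) (st : g.Input AUX) (φ : Op (AUX ⊕ g.St) →ₗ[ℂ] ℂ)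

theorem hcall_eq (n : ℕ) (ω : Bits g.Ω) (r : ℕ) (i : Fin ℓ) (u : Bits (g.In i)) (x : Bits (g.Out
    i)) : g.hcall L n ω r i u x = if h : r < g.R ∧ r * ℓ + i < n then fexecL (L r i) ((g.queryC (⟨r,
    h.1⟩, i)).map (onSnd _ (g.wKQ (⟨r, h.1⟩, i)))).runL ((g.replyC (⟨r, h.1⟩, i)).map (onSnd _
    (g.wKQ (⟨r, h.1⟩, i)))).runL u x else (g.alice i).execL (g.len i) (fun t => ((g.bcall r i t).map
    (onSnd _ g.wAdv)).runL) (g.part ω r i) u x := by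
  simp only [runL_map, fexecL_act, Party.execL_act]; rfl

variable {L L'} (hL : ∀ r i, Markov (L r i)) (hL' : ∀ r i, Markov (L' r i))

theorem hstep_eq (r : ℕ) : g.hstep r = ((g.stepC r).map (onSnd g.C g.wMEM)).runL :=
  (runL_map _ _).symm

include hL in
theorem pp_hround (n : ℕ) (ω : Bits g.Ω) (r : ℕ) : PP (g.hround L n ω r) := by
  rw [hround, hstep_eq]; refine (g.P.pp_callRoundL fun i u x => ?_).comp (g.P.pp_preL r _)
  rw [hcall_eq]; split_ifs
  · exact pp_fexecL (hL r i) _ _ u x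
  exact Party.pp_execL _ _ _ _ u x

include hL in
theorem hround_tp (n : ℕ) (ω : Bits g.Ω) (r : ℕ) : TP (g.hround L n ω r) := by
  rw [hround, hstep_eq]; refine (g.P.callRoundL_tp fun i u β => ?_).comp (g.P.preL_tp r _)
  simp only [hcall_eq]; split_ifs
  · exact sum_trace_fexecL (hL r i) _ _ u β
  exact Party.sum_trace_execL _ _ _ _ u β

theorem hround_close {ε : ℝ} (hε : 0 ≤ ε) (h : ∀ r i u v, ∑ x, ∑ y, |L r i u v x y - L' r i u v x y|
    ≤ ε) (n : ℕ) (ω : Bits g.Ω) (r : ℕ) (f : Op g.Exp →ₗ[ℂ] ℂ) (hf : Bounded f) (ρ : Op g.Exp) (hρ :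
    ρ.PosSemidef) : ‖f (g.hround L n ω r ρ) - f (g.hround L' n ω r ρ)‖ ≤ ε * ρ.trace.re := by
  rw [hround, hround, hstep_eq]; refine g.P.roundL_close _ (fun i u k hk β hβ => ?_) hε f hf ρ hρ
  simp only [hcall_eq]; split_ifs
  · exact fexecL_close (h r i) _ _ u k hk β hβ
  simp only [sub_self, norm_zero, sum_const_zero]; exact mul_nonneg hε (trace_nonneg hβ)

theorem posSemidef_refSt (n : ℕ) (ω : Bits g.Ω) (q : g.Q) :
    (g.refSt n ω q).PosSemidef := pp_runL _ _ (posSemidef_ket _)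

theorem trace_refSt (n : ℕ) (ω : Bits g.Ω) (q : g.Q) : (g.refSt n ω q).trace = 1 := by
  rw [refSt, runL_tp, trace_ket]

theorem posSemidef_memES (n : ℕ) (ω η : Bits g.Ω) : (g.memES (g.refSt n ω) η).PosSemidef :=
  posSemidef_prodOp g.eES (fun _ _ => g.eES_ne) g.eES_surj
    fun q => pp_cut _ _ (g.posSemidef_refSt n ω q)

theorem sum_trace_memES (n : ℕ) (ω : Bits g.Ω) : ∑ η, (g.memES (g.refSt n ω) η).trace = 1 := by
  have h := trace_split (prodOp g.xE (g.refSt n ω)); rw [trace_prodOp g.xE g.xE_ne g.xE_surj] at h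
  simp only [g.cut_prodOp, trace_refSt, Finset.prod_const_one] at h; exact h.symm

theorem trace_startW (η : Bits g.Ω) (κ : Op g.ES) (σ : Op (g.Z ⊕ g.V)) :
    (g.startW η κ σ).trace = σ.trace * κ.trace := by
  have h : TP (act g.wMEM g.copyC.runL) := (runL_tp _).act
  refine (h _).trans ((trace_tensor _ _).trans ?_); congr 1
  refine (trace_tensor_ket _ _).trans ((trace_tensor_ket _ _).trans (trace_tensor_ket _ _))

theorem posSemidef_startW (η : Bits g.Ω) {κ : Op g.ES} {σ : Op (g.Z ⊕ g.V)} (hκ : κ.PosSemidef)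
    (hσ : σ.PosSemidef) : (g.startW η κ σ).PosSemidef :=
  pp_act_runL _ _ _ (posSemidef_tensor hσ (posSemidef_tensor (posSemidef_ket _)
    (posSemidef_tensor (posSemidef_ket _) (posSemidef_tensor (posSemidef_ket _) hκ))))

variable {st} (hst : ∀ η a u, (st η a u).PosSemidef) (hst1 : ∀ η, ∑ a, ∑ u, (st η a u).trace = 1)

include hst in
theorem posSemidef_startL (n : ℕ) (ω : Bits g.Ω) (a : Bits AUX) :
    (g.startL st n ω a).PosSemidef := by
  refine Matrix.posSemidef_sum _ fun η _ => Matrix.posSemidef_sum _ fun u _ => ?_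
  exact posSemidef_tensor (posSemidef_ket _) (posSemidef_tensor (posSemidef_ket _)
    (g.posSemidef_startW η (g.posSemidef_memES n ω η) (hst η a u)))

include hst1 in
theorem sum_trace_startL (n : ℕ) (ω : Bits g.Ω) : ∑ a, (g.startL st n ω a).trace = 1 := by
  have h : ∀ u β, (g.P.initL u β : Op g.Exp).trace = β.trace :=
    fun u β => (trace_tensor_ket _ _).trans (trace_tensor_ket _ _)
  simp only [startL, trace_sum, h, trace_startW]; rw [sum_comm, ← g.sum_trace_memES n ω]
  refine sum_ext fun η => ?_; simp only [← sum_mul]; rw [hst1, one_mul]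

include hL hL' hst hst1 in
theorem val_close {ε : ℝ} (hε : 0 ≤ ε)
    (h : ∀ r i u v, ∑ x, ∑ y, |L r i u v x y - L' r i u v x y| ≤ ε) (hφ : Bounded φ) (n : ℕ)
    (ω : Bits g.Ω) : ‖g.val L st φ n ω - g.val L' st φ n ω‖ ≤ g.R * ε := by
  rw [val, val, ← sum_sub_distrib]
  have h1 : ∀ a, Bounded (φ ∘ₗ tensorL (ket a) ∘ₗ g.redL) := fun a => by
    have e : g.redL = reduceL (onSnd (g.U ⊕ g.P.anc) (onSnd g.C g.wAdv)) := by
      rw [reduceL_onSnd, reduceL_onSnd]; rfl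
    rw [e]
    exact hφ.comp ((pp_tensorL (posSemidef_ket a)).comp (pp_reduceL _))
      fun ρ => (trace_tensor_ket _ _).trans (trace_reduceL _ _)
  refine (norm_sum_le _ _).trans ((sum_le_sum fun a _ => iter_close (g.pp_hround hL n ω)
    (g.hround_tp hL n ω) (g.pp_hround hL' n ω) (g.hround_tp hL' n ω)
    (g.hround_close hε h n ω) g.R _ (h1 a) _ (g.posSemidef_startL hst n ω a)).trans ?_)
  rw [← mul_sum, ← Complex.re_sum, g.sum_trace_startL hst1]; simp

end

section

variable {AUX : Reg}

def prob (p : ∀ i, Bits (g.ΩO i) → ℝ) (ω : Bits g.Ω) : ℝ := ∏ q, p q.2 (ω ∘ g.ωPart q)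

section Resampling

variable {p : ∀ i, Bits (g.ΩO i) → ℝ} (hp : ∀ i, ∑ w, p i w = 1)

include hp in
theorem sum_prob : ∑ ω, g.prob p ω = 1 := by
  refine (sum_prod_bits g.ωPart (fun _ _ => g.ωPart_ne) g.ωPart_surj fun q => p q.2).trans ?_
  simp [hp]

theorem prob_write (q : g.Q) (ω : Bits g.Ω) (w : Bits (g.ΩO q.2)) :
    g.prob p (write (g.ωPart q) w ω) * p q.2 (ω ∘ g.ωPart q) = g.prob p ω * p q.2 w := by
  rw [prob, prob, ← Finset.mul_prod_erase _ _ (mem_univ q),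
    ← Finset.mul_prod_erase _ (fun q => p q.2 (ω ∘ g.ωPart q)) (mem_univ q), write_comp]
  have h : ∏ q' ∈ Finset.univ.erase q, p q'.2 (write (g.ωPart q) w ω ∘ g.ωPart q')
      = ∏ q' ∈ Finset.univ.erase q, p q'.2 (ω ∘ g.ωPart q') :=
    Finset.prod_congr rfl fun q' hq' => by
      rw [write_disjoint _ _ fun a b => g.ωPart_ne (Finset.ne_of_mem_erase hq').symm a b]
  rw [h]; ring

include hp in
theorem sum_resample (q : g.Q) (f : Bits g.Ω → ℂ) : ∑ ω, (g.prob p ω : ℂ) * f ω = ∑ ω, (g.prob p ω :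
    ℂ) * ∑ w, (p q.2 w : ℂ) * f (write (g.ωPart q) w ω) := by
  let σ : Bits g.Ω × Bits (g.ΩO q.2) → Bits g.Ω × Bits (g.ΩO q.2) :=
    fun x => (write (g.ωPart q) x.2 x.1, x.1 ∘ g.ωPart q)
  have hσ : Function.Involutive σ := fun x => by simp only [σ, write_write, write_self, write_comp]
  have h1 : ∑ x : Bits g.Ω × Bits (g.ΩO q.2), (g.prob p x.1 : ℂ) * p q.2 x.2 * f x.1
      = ∑ ω, (g.prob p ω : ℂ) * f ω := by
    rw [Fintype.sum_prod_type]; refine sum_ext fun ω => ?_; dsimp only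
    rw [← sum_mul, ← mul_sum, ← Complex.ofReal_sum, hp, Complex.ofReal_one, mul_one]
  rw [← h1, ← Equiv.sum_comp hσ.toPerm, Fintype.sum_prod_type]; refine sum_ext fun ω => ?_
  rw [mul_sum]; refine sum_ext fun w => ?_
  change (g.prob p (write (g.ωPart q) w ω) : ℂ) * (p q.2 (ω ∘ g.ωPart q) : ℂ) * _ = _
  rw [← Complex.ofReal_mul, g.prob_write, Complex.ofReal_mul, mul_assoc]; rfl

end Resampling

variable {T : Fin ℓ → Reg} {Cf : ∀ i, Circuit ((g.In i ⊕ g.VI i) ⊕ ((g.Out i ⊕ g.YO i) ⊕ T i))} {N :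
  ℕ} {st : g.Input AUX} {φ : Op (AUX ⊕ g.St) →ₗ[ℂ] ℂ} (hg : g.SizeLE T Cf AUX N) (hφ : Test φ N)
  (hst : Impl (prepL (g.outSt st)) N) (hlines : ∀ η z, ∃ σ, ∀ a : Bits AUX × Bits g.U, cut z z (st η
  a.1 a.2) ∈ span ℂ {σ}) {Fk : ∀ i, Bits (g.In i) → Bits (g.VI i) → Bits (g.Out i) → Bits
  (g.YO i) → ℝ} (hF : ∀ i, Markov (Fk i)) {p : ∀ i, Bits (g.ΩO i) → ℝ} (hp : ∀ i, ∑ w, p i w = 1)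

abbrev GameTrial (i : Fin ℓ) (N : ℕ) : Type 1 :=
  Trial (g.ΩO i) (g.In i) (g.Out i) g.ZI g.adv (trialBound ℓ N)

variable (Fk p) in
def gap {i : Fin ℓ} (T : g.GameTrial i N) : ℝ :=
  |(T.value (g.exR i (p i))).re - (T.value (g.exI i (Fk i))).re|

include hg hφ hst hlines hF in
theorem exists_trials (L : g.Ker) {n : ℕ} (q : g.Q) (hq : q.1 * ℓ + q.2 = n) (hL : ∀ r (i : Fin ℓ),
    r * ℓ + i < n → L r i = circKernel (Cf i)) (hLq : L q.1 q.2 = Fk q.2) (ω : Bits g.Ω) : ∃ T₁ T₂ :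
    g.GameTrial q.2 N, |(∑ w, (p q.2 w : ℂ) * g.val L st φ n (write (g.ωPart q) w ω) - g.val L st φ
    (n + 1) ω).re| ≤ g.gap Fk p T₁ + g.gap Fk p T₂ := by
  have h1 := le_partBound ℓ N; have hZ : card g.ZI ≤ card g.W := card_le_of_embedding g.wZI
  have hc1 := hg.party q.2; have hc2 := hg.total; have hc3 := hg.adv
  have hE : card (g.Ω ⊕ ((g.ΩO q.2 ⊕ g.In q.2) ⊕ (AUX ⊕ g.Exp))) ≤ 3 * N := by
    simp only [card_sum]; omega
  refine ⟨g.callTrial L st φ q hq ω hlines (implCallΘ st hg hL ω q hst) (testCallψ φ hg q ω hφ)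
    (hE.trans (by unfold trialBound; omega)),
    coinTrial (G := ⟨g.Ω ⊕ ((g.ΩO q.2 ⊕ g.In q.2) ⊕ (AUX ⊕ g.Exp))⟩) (g.simL L st n q ω)
      (g.simIn q) (g.restχ L φ q n ω (g.In q.2))
      ((implSim st hg hL ω q hst _).mono (by omega) : Impl _ (partBound ℓ N))
      (testRestχ φ hg hL ω q hφ _) ?_, ?_⟩
  · change 5 * partBound ℓ N + 4 * (_ + card (g.Ω ⊕ ((g.ΩO q.2 ⊕ g.In q.2)
      ⊕ (AUX ⊕ g.Exp)))) + 7 ≤ _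
    unfold trialBound; omega
  rw [g.val_real L st φ q hq ω (p q.2) (g.exR q.2 (p q.2)) (g.exR_inputL q ω (p q.2)),
    g.val_ideal L st φ q hq ω, gap, gap, callTrial_value, callTrial_value,
    coinTrial_value _ _ _ _ _ _ _ (fun w => (p q.2 w : ℂ)) fun w => by
      rw [g.sum_trace_exR, trace_ket, mul_one],
    coinTrial_value _ _ _ _ _ _ _ (fun w => (g.refMem q.2 w).trace) fun w => by
      rw [g.sum_trace_exI _ (hF q.2), trace_ket, mul_one], hLq]
  simp only [g.restχ_eq L st φ q hq]; refine le_trans (le_of_eq (congrArg _ ?_)) (abs_add_le _ _)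
  simp only [Complex.sub_re, Complex.add_re]
  change _ + _ - (Complex.re (g.valCall L st φ q ω n (g.exI q.2 (Fk q.2))) + _) = _; ring

variable (st φ p) in
/-- The acceptance probability in the `n`-th hybrid. -/
def hybrid (L : g.Ker) (n : ℕ) : ℝ := (∑ ω, (g.prob p ω : ℂ) * g.val L st φ n ω).re

def kernels (Cf : ∀ i, Circuit ((g.In i ⊕ g.VI i) ⊕ ((g.Out i ⊕ g.YO i) ⊕ T i)))
    (Fk : ∀ i, Bits (g.In i) → Bits (g.VI i) → Bits (g.Out i) → Bits (g.YO i) → ℝ)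
    (n : ℕ) : g.Ker := fun r i => if r * ℓ + i < n then circKernel (Cf i) else Fk i

include hF in
theorem markov_kernels (n r : ℕ) (i : Fin ℓ) : Markov (g.kernels Cf Fk n r i) := by
  rw [kernels]; split_ifs
  · exact markov_circKernel _
  exact hF i

variable (hp0 : ∀ i w, 0 ≤ p i w)

include hp hp0 in
theorem abs_re_sum_le {f : Bits g.Ω → ℂ} {c : ℝ} (hf : ∀ ω, |(f ω).re| ≤ c) :
    |(∑ ω, (g.prob p ω : ℂ) * f ω).re| ≤ c := by
  rw [Complex.re_sum]; refine (abs_sum_le_sum_abs _ _).trans ?_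
  have h0 : ∀ ω, 0 ≤ g.prob p ω := fun ω => Finset.prod_nonneg fun q _ => hp0 _ _
  calc ∑ ω, |((g.prob p ω : ℂ) * f ω).re| ≤ ∑ ω, g.prob p ω * c := by
        refine sum_le_sum fun ω _ => ?_; rw [Complex.re_ofReal_mul, abs_mul, abs_of_nonneg (h0 ω)]
        exact mul_le_mul_of_nonneg_left (hf ω) (h0 ω)
    _ = c := by rw [← sum_mul, g.sum_prob hp, one_mul]

include hp hp0 hF hφ in
theorem hybrid_close (hst0 : ∀ η a u, (st η a u).PosSemidef) (hst1 : ∀ η, ∑ a, ∑ u, (st η a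
    u).trace = 1) {L L' : g.Ker} (hL : ∀ r i, Markov (L r i)) (hL' : ∀ r i, Markov (L' r i)) {ε : ℝ}
    (hε : 0 ≤ ε) (h : ∀ r i u v, ∑ x, ∑ y, |L r i u v x y - L' r i u v x y| ≤ ε) (n : ℕ) : |g.hybrid
    st φ p L n - g.hybrid st φ p L' n| ≤ g.R * ε := by
  rw [hybrid, hybrid, ← Complex.sub_re, ← sum_sub_distrib]; simp only [← mul_sub]
  exact g.abs_re_sum_le hp hp0 fun ω => (Complex.abs_re_le_norm _).trans
    (g.val_close φ hL hL' hst0 hst1 hε h hφ.bounded n ω)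

theorem kernels_close {ε : ℝ} (hε : 0 ≤ ε) (hCf : ∀ i u v, ∑ x, ∑ y, |circKernel (Cf i) u v x y - Fk
    i u v x y| ≤ ε) (n n' r : ℕ) (i : Fin ℓ) (u : Bits (g.In i)) (v : Bits (g.VI i)) : ∑ x, ∑ y,
    |g.kernels Cf Fk n r i u v x y - g.kernels Cf Fk n' r i u v x y| ≤ ε := by
  rw [kernels, kernels]; split_ifs
  · simpa using hε
  · exact hCf i u v
  · simp only [abs_sub_comm (Fk i u v _ _)]; exact hCf i u v
  simpa using hε

include hg hφ hst hlines hF in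
theorem exists_gap (i : Fin ℓ) : ∃ S : g.GameTrial i N, ∀ (r : Fin g.R) (ω : Bits g.Ω), |(∑ w, (p i
    w : ℂ) * g.val (g.kernels Cf Fk (r * ℓ + i)) st φ (r * ℓ + i) (write (g.ωPart (r, i)) w ω) -
    g.val (g.kernels Cf Fk (r * ℓ + i)) st φ (r * ℓ + i + 1) ω).re| ≤ 2 * g.gap Fk p S := by
  have h : ∀ (r : Fin g.R) (ω : Bits g.Ω), ∃ T₁ T₂ : g.GameTrial i N, _ := fun r ω =>
    exists_trials g hg hφ hst hlines hF (p := p) (g.kernels Cf Fk (r * ℓ + i)) (r, i) rfl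
      (fun r' i' hn => if_pos hn) (if_neg (lt_irrefl _)) ω
  choose T₁ T₂ hT using h
  have hZ : card g.ZI ≤ card g.W := card_le_of_embedding g.wZI; have hc1 := hg.party i
  have hc2 := hg.total; have hc3 := hg.adv
  let S₀ : g.GameTrial i N := coinTrial (G := ⟨Bool ⊕ g.ΩO i⟩) LinearMap.id
    inr (bitL (Sum.inl true)) Impl.id (Test.bit _) (by
      change 5 * 0 + 4 * (_ + card (Bool ⊕ g.ΩO i)) + 7 ≤ _; simp only [card_sum, Fintype.card_bool]
      unfold trialBound
      omega)
  obtain ⟨k, hk⟩ := Finite.exists_max fun k : Option (Bool × Fin g.R × Bits g.Ω) =>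
    g.gap Fk p (k.elim S₀ fun k => if k.1 then T₁ k.2.1 k.2.2 else T₂ k.2.1 k.2.2)
  refine ⟨_, fun r ω => (hT r ω).trans ((add_le_add (hk (some (true, r, ω)))
    (hk (some (false, r, ω)))).trans_eq (two_mul _).symm)⟩

include hg hφ hst hlines hF hp hp0 in
theorem hybrid_total (hst0 : ∀ η a u, (st η a u).PosSemidef) (hst1 : ∀ η, ∑ a, ∑ u, (st η a
    u).trace = 1) {ε : ℝ} (hε : 0 ≤ ε) (hCf : ∀ i u v, ∑ x, ∑ y, |circKernel (Cf i) u v x y - Fk i u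
    v x y| ≤ ε) : ∃ S : ∀ i, g.GameTrial i N, |g.hybrid st φ p (fun _ => Fk) 0 - g.hybrid st φ p
    (fun _ => Fk) (g.R * ℓ)| ≤ g.R * (∑ i, 2 * g.gap Fk p (S i) + (ℓ + 1) * (g.R * ε)) + g.R *
    ε := by
  choose S hS using fun i => exists_gap g hg hφ hst hlines hF (p := p) i
  refine ⟨S, ?_⟩
  have hclose := fun n n' => g.hybrid_close (st := st) hφ hF hp hp0 hst0 hst1
    (g.markov_kernels (Cf := Cf) hF n) (g.markov_kernels (Cf := Cf) hF n') hε
    (g.kernels_close hε hCf n n')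
  have hLF : (fun _ => Fk) = g.kernels Cf Fk 0 := by
    funext r i; exact (if_neg (Nat.not_lt_zero _)).symm
  let a : ℕ → ℝ := fun n => g.hybrid st φ p (g.kernels Cf Fk n) n
  have hstep : ∀ x : g.Q, |a (x.2 + ℓ * x.1) - a (x.2 + ℓ * x.1 + 1)|
      ≤ 2 * g.gap Fk p (S x.2) + g.R * ε := fun x => by
    have e : (x.2 + ℓ * x.1 : ℕ) = x.1 * ℓ + x.2 := by ring
    rw [e]
    refine (abs_sub_le _ (g.hybrid st φ p (g.kernels Cf Fk (x.1 * ℓ + x.2)) (x.1 * ℓ + x.2 + 1))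
      _).trans (add_le_add ?_ (hclose _ _ _))
    change |g.hybrid st φ p (g.kernels Cf Fk (x.1 * ℓ + x.2)) (x.1 * ℓ + x.2) - _| ≤ _
    rw [hybrid, hybrid, g.sum_resample hp x, ← Complex.sub_re, ← sum_sub_distrib]
    simp only [← mul_sub]; exact g.abs_re_sum_le hp hp0 fun ω => hS x.2 x.1 ω
  have htot : |a 0 - a (g.R * ℓ)| ≤ g.R * ∑ i, (2 * g.gap Fk p (S i) + g.R * ε) := by
    have h := dist_le_range_sum_dist a (g.R * ℓ); rw [Real.dist_eq] at h; refine h.trans ?_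
    rw [Finset.sum_range, ← Equiv.sum_comp finProdFinEquiv]
    refine (sum_le_sum fun x _ => hstep x).trans (le_of_eq ?_); rw [Fintype.sum_prod_type]
    dsimp only; rw [sum_const, card_univ, card_fin, nsmul_eq_mul]
  have h1 : |a 0 - g.hybrid st φ p (g.kernels Cf Fk 0) (g.R * ℓ)|
      ≤ |a 0 - a (g.R * ℓ)| + g.R * ε := (abs_sub_le _ _ _).trans
    (add_le_add le_rfl (hclose _ _ _))
  rw [hLF]
  refine h1.trans ((add_le_add htot le_rfl).trans (add_le_add (mul_le_mul_of_nonneg_left ?_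
    (Nat.cast_nonneg _)) le_rfl))
  rw [sum_add_distrib, sum_const, card_univ, card_fin, nsmul_eq_mul]
  have : (0 : ℝ) ≤ g.R * ε := by positivity
  nlinarith

end

section

variable {AUX Y : Reg} (L : g.Ker) (st : g.Input AUX) (ψ : Op ((AUX ⊕ g.X) ⊕ Y) →ₗ[ℂ] ℂ) (out : Y ↪
  g.adv)

def outφ : Op (AUX ⊕ g.St) →ₗ[ℂ] ℂ :=
  (ψ ∘ₗ dephaseL inl) ∘ₗ reduceL (jointOut AUX g.P.out out)

theorem val_outφ (n : ℕ) (ω : Bits g.Ω) : g.val L st (g.outφ ψ out) n ω = ψ (∑ a, ∑ x, tensor (ket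
    (elim a x)) (reduceL out (g.P.finL x (g.redL (iter (g.hround L n ω) g.R (g.startL st n ω
    a)))))) := by
  rw [val, map_sum]; refine sum_ext fun a => ?_
  rw [outφ, comp_apply, comp_apply, dephaseL_jointOut]
  refine congrArg ψ (sum_ext fun x => congrArg (fun ρ => tensor _ (reduceL out ρ)) ?_)
  rw [OracleParty.finL, LinearMap.sum_apply]; refine sum_ext fun s => ?_; split_ifs <;> rfl

theorem reduce_ancSt (η : Bits g.Ω) (κ : Op g.ES) (σ : Op (g.Z ⊕ g.V)) : reduceL g.wAdv (tensor σ
    (g.ancSt η κ) : Op ((g.Z ⊕ g.V) ⊕ g.anc)) = κ.trace • (tensor σ (ket (elim η zeros)) : Op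
    ((g.Z ⊕ g.V) ⊕ (g.Ω ⊕ g.BA))) := by
  refine (reduceL_onSnd_tensor (inl : g.Ω ⊕ g.BA ↪ g.anc) σ (g.ancSt η κ)).trans ?_
  have h2 : reduceL (inl : g.Ω ⊕ g.BA ↪ g.anc) (g.ancSt η κ)
      = κ.trace • ket (elim η zeros) := by
    refine (reduceL_inl_tensor _ _).trans (congrArg (· • _) ?_)
    exact (trace_tensor_ket _ _).trans (trace_tensor_ket _ _)
  rw [h2, tensor_eq, map_smul]; rfl

theorem reduce_startW (η : Bits g.Ω) (κ : Op g.ES) (σ : Op (g.Z ⊕ g.V)) : reduceL g.wAdv (g.startW η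
    κ σ) = κ.trace • (tensor (dephaseL inl σ) (ket (elim η zeros)) : Op ((g.Z ⊕ g.V) ⊕ (g.Ω ⊕
    g.BA))) := by
  rw [startW_eq, map_sum, tensor_cut_ket zeros, tensor_eq', map_sum, smul_sum]
  refine sum_ext fun z => ?_
  refine (reduceL_disjoint _ _ (fun a b h => g.wAdv_ne_wT b (g.tZ a) h.symm)
    (replaceL_ket_tp z) _).trans ?_
  exact g.reduce_ancSt η κ _

theorem trace_memES_zero (ω η : Bits g.Ω) :
    (g.memES (g.refSt 0 ω) η).trace = if η = ω then 1 else 0 := by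
  rw [memES, trace_prodOp g.eES (fun _ _ => g.eES_ne) g.eES_surj]
  have h : ∀ q, (cut (η ∘ g.ωPart q) (η ∘ g.ωPart q) (g.refSt 0 ω q)).trace
      = if η ∘ g.ωPart q = ω ∘ g.ωPart q then 1 else 0 := fun q => by
    rw [g.refSt_real (Nat.not_lt_zero _), tensor_ket_ket, cut_ket]; split_ifs
    · exact trace_ket _
    exact Matrix.trace_zero _ _
  simp only [h]; split_ifs with h1
  · simp [h1]
  obtain ⟨w, hw⟩ := Function.ne_iff.1 h1; obtain ⟨q, a, rfl⟩ := g.ωPart_surj w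
  exact Finset.prod_eq_zero (mem_univ q) (if_neg fun h => hw (congrFun h a))

theorem redL_initL (u : Bits g.U) (β : Op g.W) :
    g.redL (g.P.initL u β) = g.P.initL u (reduceL g.wAdv β) :=
  comp_congr (g.P.initL_intertwine u (reduceL g.wAdv)) β

theorem val_zero (hst : ∀ η a u, dephaseL inl (st η a u) = st η a u) (ω : Bits g.Ω) : g.val L st
    (g.outφ ψ out) 0 ω = ψ (∑ a, ∑ x, tensor (ket (elim a x)) (∑ u, reduceL out (g.P.finL x (iter
    (g.rround ω) g.R (g.P.initL u (tensor (st ω a u) (ket (elim ω zeros)) : Op ((g.Z ⊕ g.V) ⊕ (g.Ω ⊕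
    g.BA)))))))) := by
  rw [val_outφ]
  refine congrArg ψ (sum_ext fun a => sum_ext fun x =>
    congrArg (tensor _) ?_)
  have h1 := g.redL_iter (L := L) (n := 0) (ω := ω) (r := 0) (k := g.R) (by omega) (by omega)
  simp only [Nat.zero_add] at h1; rw [← map_sum, ← map_sum, ← map_sum, comp_congr h1]
  refine congrArg (fun ρ => reduceL out (g.P.finL x (iter (g.rround ω) g.R ρ))) ?_
  rw [startL, map_sum, sum_eq_single ω]
  · rw [map_sum]; refine sum_ext fun u => ?_
    rw [redL_initL, reduce_startW, trace_memES_zero, if_pos rfl, one_smul, hst]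
  · intro η _ hη; rw [map_sum]; refine sum_eq_zero fun u _ => ?_
    rw [redL_initL, reduce_startW, trace_memES_zero, if_neg hη, zero_smul]; exact map_zero _
  simp

end

section

variable {AUX Y : Reg}

/-- What the composed simulator does in a round; before the first one he copies his classical
input. -/
def simStep (r : ℕ) : Circuit (g.C ⊕ g.W) :=
  .seq (if r = 0 then g.copyC.map (g.wMEM.trans inr) else .skip)
    ((g.stepC r).map (onSnd g.C g.wMEM))

def simQuery (r : ℕ) (i : Fin ℓ) : Circuit (g.VI i ⊕ g.W) :=
  if h : r < g.R then (g.queryC (⟨r, h⟩, i)).map (onSnd _ (g.wKQ (⟨r, h⟩, i))) else .skip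

def simReply (r : ℕ) (i : Fin ℓ) : Circuit (g.YO i ⊕ g.W) :=
  if h : r < g.R then (g.replyC (⟨r, h⟩, i)).map (onSnd _ (g.wKQ (⟨r, h⟩, i))) else .skip

variable (Fk : ∀ i, Bits (g.In i) → Bits (g.VI i) → Bits (g.Out i) → Bits (g.YO i) → ℝ) (st :
  g.Input AUX) (ψ : Op ((AUX ⊕ g.X) ⊕ Y) →ₗ[ℂ] ℂ) (out : Y ↪ g.adv)

def simRound (r : ℕ) : LM g.Exp g.Exp :=
  g.P.roundL r (g.simStep r).runL
    fun i => fexecL (Fk i) (g.simQuery r i).runL (g.simReply r i).runL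

theorem index_bound (r : Fin g.R) (i : Fin ℓ) : r * ℓ + i < g.R * ℓ := by
  have := i.2; have := Nat.mul_le_mul_right ℓ (Nat.succ_le_of_lt r.2); rw [Nat.succ_mul] at this
  omega

theorem hcall_sim (ω : Bits g.Ω) {r : ℕ} (hr : r < g.R) : g.hcall (fun _ => Fk) (g.R * ℓ) ω r
    = fun i => fexecL (Fk i) (g.simQuery r i).runL (g.simReply r i).runL := by
  funext i u x
  rw [hcall_eq, dif_pos ⟨hr, g.index_bound ⟨r, hr⟩ i⟩, simQuery, simReply, dif_pos hr, dif_pos hr]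

theorem simRound_succ (ω : Bits g.Ω) {r : ℕ} (hr : r + 1 < g.R) :
    g.simRound Fk (1 + r) = g.hround (fun _ => Fk) (g.R * ℓ) ω (1 + r) := by
  rw [simRound, hround, g.hcall_sim Fk ω (by omega), hstep_eq, simStep, if_neg (by omega)]
  rfl

theorem simStep_zero : (g.simStep 0).runL = g.hstep 0 ∘ₗ ext g.C (act g.wMEM g.copyC.runL) := by
  rw [simStep, if_pos rfl, hstep_eq, ← act_inr, ← act_trans, ← runL_map]; rfl

theorem simRound_zero (ω : Bits g.Ω) (hR : 0 < g.R) : g.simRound Fk 0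
    = g.hround (fun _ => Fk) (g.R * ℓ) ω 0 ∘ₗ ext _ (ext g.C (act g.wMEM g.copyC.runL)) := by
  rw [simRound, hround, g.hcall_sim Fk ω hR, simStep_zero]; exact g.P.roundL_front _ _ _ _

theorem redL_sim (hst : ∀ η a u, dephaseL inl (st η a u) = st η a u) (ω η : Bits g.Ω) (κ : Op g.ES)
    (a : Bits AUX) (u : Bits g.U) : g.redL (iter (g.simRound Fk) g.R (g.P.initL u (tensor (st η a u)
    (g.ancSt η κ) : Op ((g.Z ⊕ g.V) ⊕ g.anc)))) = g.redL (iter (g.hround (fun _ => Fk) (g.R * ℓ) ω)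
    g.R (g.P.initL u (g.startW η κ (st η a u)))) := by
  obtain h | ⟨k, hk⟩ : g.R = 0 ∨ ∃ k, g.R = 1 + k := by
    rcases g.R with _ | k
    · exact Or.inl rfl
    exact Or.inr ⟨k, by omega⟩
  · rw [h]; refine (g.redL_initL _ _).trans (Eq.trans ?_ (g.redL_initL _ _).symm)
    rw [reduce_startW, hst]; exact congrArg _ (g.reduce_ancSt η κ _)
  have h1 : iter (g.simRound Fk) g.R = iter (g.hround (fun _ => Fk) (g.R * ℓ) ω) g.R
      ∘ₗ ext _ (ext g.C (act g.wMEM g.copyC.runL)) := by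
    have e : ∀ Φ : ℕ → LM g.Exp g.Exp,
        iter Φ g.R = iter (fun t => Φ (1 + t)) k ∘ₗ (Φ 0 ∘ₗ LinearMap.id) := fun Φ => by
      rw [hk, iter_add]; rfl
    rw [e, e, iter_congr fun t ht => g.simRound_succ Fk ω (by omega),
      g.simRound_zero Fk ω (by omega)]
    rfl
  rw [h1]; refine congrArg (fun ρ => g.redL (iter (g.hround (fun _ => Fk) (g.R * ℓ) ω) g.R ρ)) ?_
  exact comp_congr (g.P.initL_intertwine u (act g.wMEM g.copyC.runL)) _

theorem val_last (hst : ∀ η a u, dephaseL inl (st η a u) = st η a u) (ω : Bits g.Ω) : g.val (fun _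
    => Fk) st (g.outφ ψ out) (g.R * ℓ) ω = ψ (∑ a, ∑ x, tensor (ket (elim a x)) (∑ η, ∑ u, reduceL
    (out.trans g.wAdv) (g.P.finL x (iter (g.simRound Fk) g.R (g.P.initL u (tensor (st η a u)
    (g.ancSt η (g.memES (fun q : g.Q => (g.init q.2).runL (ket zeros)) η)) : Op ((g.Z ⊕ g.V) ⊕
    g.anc))))))) := by
  rw [val_outφ]
  refine congrArg ψ (sum_ext fun a => sum_ext fun x =>
    congrArg (tensor _) ?_)
  have h1 : ∀ τ, reduceL (out.trans g.wAdv) (g.P.finL x τ)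
      = reduceL out (g.P.finL x (g.redL τ)) := fun τ => by
    rw [reduceL_trans]
    exact congrArg (reduceL out) (comp_congr (g.P.finL_intertwine x (reduceL g.wAdv)) τ)
  have h2 : g.refSt (g.R * ℓ) ω = fun q : g.Q => (g.init q.2).runL (ket zeros) :=
    funext fun q => g.refSt_ideal (q := q) (g.index_bound q.1 q.2)
  simp only [h1, g.redL_sim Fk st hst ω]; rw [startL, h2]; simp only [map_sum]

end

end Game

structure Regs.Le {ℓ : ℕ} (g : Regs ℓ) (b : ℕ) : Prop where
  sub : ∀ i, card (g.In i) + card (g.Out i) + card (g.VI i) + card (g.YO i) + card (g.ΩO i)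
    + card (g.MO i) ≤ b
  top : g.R + card g.U + card g.C + card g.Z + card g.V + card g.BA ≤ b

namespace Regs

variable {ℓ : ℕ} {g : Regs ℓ} {b : ℕ} (h : g.Le b)
include h

theorem Le.R_le : g.R ≤ b := by
  have := h.top; omega

theorem card_Ω : card g.Ω ≤ b * (ℓ * b) := by
  have h1 := h.top; change card (Fin g.R × (Σ i, g.ΩO i)) ≤ _
  rw [Fintype.card_prod, card_fin, Fintype.card_sigma]
  refine Nat.mul_le_mul (by omega) ((sum_le_card_nsmul _ _ b fun i _ => ?_).trans ?_)
  · have := h.sub i; omega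
  simp

theorem card_adv : card g.adv ≤ b * (ℓ * b) + 3 * b := by
  have h1 := h.top; have h2 := card_Ω h; change card ((g.Z ⊕ g.V) ⊕ (g.Ω ⊕ g.BA)) ≤ _
  simp only [card_sum]; omega

theorem card_T : card g.T ≤ b * (ℓ * b) + b + 2 + b * (2 * b + ℓ + ℓ * b) := by
  have h1 := h.top; have h2 := card_Ω h
  have h3 : card g.Slot ≤ 2 * b + ℓ + ℓ * b := by
    change card ((g.C ⊕ g.C) ⊕ (Fin ℓ ⊕ (Σ i, g.VI i ⊕ g.YO i))) ≤ _
    have h4 : ∑ i, card (g.VI i ⊕ g.YO i) ≤ ℓ * b := by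
      refine (sum_le_card_nsmul _ _ b fun i _ => ?_).trans (by simp)
      have := h.sub i; rw [card_sum]; omega
    rw [card_sum, card_sum, card_sum, card_fin, Fintype.card_sigma]; omega
  have h4 : g.R * card g.Slot ≤ b * (2 * b + ℓ + ℓ * b) := Nat.mul_le_mul (by omega) h3
  change card (g.Ω ⊕ (g.Z ⊕ (Bool ⊕ (Fin g.R × g.Slot)))) ≤ _
  simp only [card_sum, Fintype.card_prod, card_fin, Fintype.card_bool]; omega

theorem card_ZI : card g.ZI ≤ b + (b * (ℓ * b) + b + 2 + b * (2 * b + ℓ + ℓ * b)) := by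
  have h1 := h.top; have h2 := card_T h; change card (Fin g.R ⊕ g.T) ≤ _
  simp only [card_sum, card_fin]; omega

end Regs

def memBound (ℓ b : ℕ) : ℕ :=
  b + ℓ + (b * (ℓ * b) + b + 2 + b * (2 * b + ℓ + ℓ * b)) + (b * ℓ) * b

namespace Game

variable {ℓ : ℕ} (g : Game ℓ)

section

variable {g}

structure Le (g : Game ℓ) (b : ℕ) : Prop where
  regs : g.toRegs.Le b
  sub : ∀ i, card (g.E i) + (g.init i).size + (g.query i).size + (g.reply i).size ≤ b
  party : ∀ i, card (g.alice i).anc + g.len i ≤ b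
  anc : card g.P.anc ≤ b
  alice : ∀ i, ∀ t < g.len i, ((g.alice i).step t).size ≤ b
  pstep : ∀ r < g.R, (g.P.step r).size ≤ b
  step : ∀ r < g.R, (g.step r).size ≤ b
  bcall : ∀ r < g.R, ∀ i, ∀ t < g.len i, (g.bcall r i t).size ≤ b

variable {b : ℕ} (h : g.Le b)
include h

theorem Le.sum_le (f : g.Q → ℕ) (hf : ∀ q, f q ≤ b) : ∑ q, f q ≤ (b * ℓ) * b := by
  have := h.regs.top; refine (sum_le_card_nsmul _ _ b fun q _ => hf q).trans ?_
  rw [card_univ, Fintype.card_prod, card_fin, card_fin, smul_eq_mul]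
  exact Nat.mul_le_mul_right _ (Nat.mul_le_mul_right _ (by omega))

theorem card_W : card g.W ≤ 10 * memBound ℓ b := by
  have h1 := h.regs.top; have h2 := Regs.card_Ω h.regs; have h3 := Regs.card_T h.regs
  have h4 := Regs.card_ZI h.regs
  have h5 : ∑ q : g.Q, card (g.E q.2) ≤ (b * ℓ) * b :=
    h.sum_le _ fun q => by have := h.sub q.2; omega
  change card ((g.Z ⊕ g.V) ⊕ ((g.Ω ⊕ g.BA) ⊕ (g.T ⊕ (g.ZI ⊕ (Σ q : g.Q, g.E q.2))))) ≤ _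
  simp only [card_sum, Fintype.card_sigma]; unfold memBound; omega

theorem size_setC (q : g.Q) : (g.setC q).size ≤ 6 * memBound ℓ b := by
  have h1 := Regs.card_ZI h.regs
  have h2 : (g.setC q).size ≤ 2 * card g.ZI + card g.ZI :=
    add_le_add (size_loadC _ _) (size_measureC _).le
  unfold memBound; omega

theorem size_queryC (q : g.Q) : (g.queryC q).size + (g.replyC q).size ≤ 20 * memBound ℓ b := by
  have h1 := h.regs.sub q.2; have h2 := h.sub q.2; have h3 := size_setC h q
  have h4 : (g.queryC q).size ≤ (g.setC q).size
      + ((g.query q.2).size + (2 * card (g.VI q.2) + 2 * card (Fin ℓ))) :=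
    add_le_add (size_map _ _).le (add_le_add (size_map _ _).le
      (add_le_add (size_loadC _ _) (size_loadC _ _)))
  have h5 : (g.replyC q).size ≤ 2 * card (g.YO q.2) + (g.reply q.2).size :=
    add_le_add (size_loadC _ _) (size_map _ _).le
  rw [card_fin] at h4; unfold memBound at *; omega

theorem size_stepC (r : ℕ) (hr : r < g.R) : (g.stepC r).size ≤ 5 * memBound ℓ b := by
  have h1 := h.regs.top; have h2 := h.step r hr
  have h3 : (g.stepC r).size ≤ 2 * card g.C + ((g.step r).size
      + (2 * card g.C + 2 * card (Fin ℓ))) := by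
    rw [stepC, dif_pos hr]
    exact add_le_add (size_loadC _ _) (add_le_add (size_map _ _).le
      (add_le_add (size_loadC _ _) (size_loadC _ _)))
  rw [card_fin] at h3; unfold memBound; omega

theorem size_copyC : g.copyC.size ≤ 3 * memBound ℓ b := by
  have h1 := h.regs.top
  have h2 : g.copyC.size ≤ card g.Z + 2 * card g.Z :=
    add_le_add (size_measureC _).le (size_loadC _ _)
  unfold memBound; omega

theorem size_initC_inits (n : ℕ) : (g.initC (g.inits n)).size ≤ 5 * memBound ℓ b := by
  have h2 := Regs.card_Ω h.regs
  have h3 := h.sum_le (fun q => (g.inits n q).size) fun q => by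
    have := h.sub q.2; rw [inits]; split_ifs
    · omega
    exact Nat.zero_le _
  have h4 := g.size_initC (g.inits n); unfold memBound; omega

theorem Le.sizeLE {T : Fin ℓ → Reg} {Cf : ∀ i, Circuit ((g.In i ⊕ g.VI i) ⊕ ((g.Out i ⊕ g.YO i) ⊕ T
    i))} {AUX : Reg} (hC : ∀ i, card (T i) + (Cf i).size ≤ b) (hA : card AUX ≤ b) : g.SizeLE T Cf
    AUX (20 * memBound ℓ b) := by
  have h1 := h.regs.top; have h2 := h.anc; have h3 : b ≤ memBound ℓ b := by unfold memBound; omega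
  exact
  { party := fun i => by
      have := h.regs.sub i; have := h.party i; have := hC i; omega
    total := by
      have := Regs.card_Ω h.regs; have := card_W h; unfold memBound at *; omega
    adv := by
      have := Regs.card_adv h.regs; unfold memBound at *; omega
    alice := fun i t ht => by have := h.alice i t ht; omega
    pstep := fun r hr => by have := h.pstep r hr; omega
    step := fun r hr => by have := h.step r hr; omega
    stepC := fun r hr => by have := size_stepC h r hr; omega
    bcall := fun r hr i t ht => by have := h.bcall r hr i t ht; omega
    query := fun q => size_queryC h q
    set := fun q => by have := size_setC h q; omega
    copy := by have := size_copyC h; omega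
    init := fun n => by have := size_initC_inits h n; omega }

theorem size_simStep (r : ℕ) (hr : r < g.R) : (g.simStep r).size ≤ 8 * memBound ℓ b := by
  have h1 := size_stepC h r hr; have h2 := size_copyC h
  have h3 : (g.simStep r).size ≤ g.copyC.size + (g.stepC r).size := by
    refine add_le_add ?_ (size_map _ _).le; split_ifs
    · exact (size_map _ _).le
    exact Nat.zero_le _
  omega

theorem size_simQuery (r : ℕ) (i : Fin ℓ) :
    (g.simQuery r i).size + (g.simReply r i).size ≤ 20 * memBound ℓ b := by
  unfold simQuery simReply; split_ifs with hr
  · rw [size_map, size_map]; exact size_queryC h (⟨r, hr⟩, i)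
  exact Nat.zero_le _

end

end Game

theorem PolyBounded.memBound (ℓ : ℕ) {b : ℕ → ℕ} (h : PolyBounded b) :
    PolyBounded fun m => memBound ℓ (b m) := by
  have hc := PolyBounded.const ℓ; have h2 := PolyBounded.const 2; have h3 := h.mul (hc.mul h)
  exact ((h.add hc).add (((h3.add h).add h2).add (h.mul (((h2.mul h).add hc).add
    (hc.mul h))))).add ((h.mul hc).mul h)

theorem PolyBounded.trialBound (ℓ : ℕ) {N : ℕ → ℕ} (h : PolyBounded N) :
    PolyBounded fun m => Game.trialBound ℓ (N m) := by
  have c := PolyBounded.const; have h1 := h.add (c 1)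
  have h2 : PolyBounded fun m => Game.callBound (N m) :=
    h1.mul (((c 2).mul h).add ((c 20).mul h1))
  have h3 : PolyBounded fun m => Game.roundBound ℓ (N m) :=
    (c (ℓ + 2)).mul ((h2.add ((c 10).mul h)).add (c 11))
  have h4 : PolyBounded fun m => Game.partBound ℓ (N m) :=
    (c (ℓ + 1)).mul (((c 8).mul (h1.mul h3)).add ((c 100).mul h1))
  exact ((c 5).mul h4).add ((c 100).mul h1)

theorem Negligible.add {ε δ : ℕ → ℝ} (h : Negligible ε) (h' : Negligible δ) :
    Negligible fun m => ε m + δ m := Asymptotics.SuperpolynomialDecay.add h h'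

theorem Negligible.sum {ι : Type*} (s : Finset ι) {ε : ι → ℕ → ℝ} (h : ∀ i ∈ s, Negligible (ε i)) :
    Negligible fun m => ∑ i ∈ s, ε i m := by
  induction s using Finset.cons_induction with
  | empty =>
    simp only [Finset.sum_empty]; exact Asymptotics.superpolynomialDecay_zero _ _
  | cons a s ha ih =>
    simp only [Finset.sum_cons]
    exact (h a (Finset.mem_cons_self a s)).add (ih fun i hi => h i (Finset.mem_cons_of_mem hi))

theorem Negligible.abs {ε : ℕ → ℝ} (h : Negligible ε) : Negligible fun m => |ε m| :=
  h.mono fun m => (abs_abs _).le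

theorem Negligible.mul_poly {ε : ℕ → ℝ} (h : Negligible ε) {N : ℕ → ℕ} (hN : PolyBounded N) :
    Negligible fun m => N m * ε m := by
  obtain ⟨p, hp⟩ := hN
  have h1 : Negligible fun m => (p.map (Nat.castRingHom ℝ)).eval (m : ℝ) * ε m :=
    Asymptotics.SuperpolynomialDecay.polynomial_mul h _
  refine h1.mono fun m => ?_; rw [abs_mul, abs_mul]
  refine mul_le_mul_of_nonneg_right ?_ (abs_nonneg _)
  have h2 : (p.map (Nat.castRingHom ℝ)).eval (m : ℝ) = ((p.eval m : ℕ) : ℝ) := by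
    rw [Polynomial.eval_natCast_map]; rfl
  rw [h2, Nat.abs_cast, Nat.abs_cast]
  exact_mod_cast hp m

section Sampler

variable {Ω U Z V : ℕ → Reg} (S : Sampler Ω U Z V) (m : ℕ)

theorem Sampler.dephaseL_state (ω : Bits (Ω m)) (a : Bits (S.aux m)) (u : Bits (U m)) :
    dephaseL inl (S.state m ω a u) = S.state m ω a u := by
  rw [Sampler.state, dephase_eq]; ext x y; rw [dephaseL_apply]; split_ifs with h
  · rfl
  rw [dephaseL_apply, if_neg h]

theorem Sampler.trace_state (ω : Bits (Ω m)) : ∑ a, ∑ u, (S.state m ω a u).trace = 1 := by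
  have h : ∀ a u, (S.state m ω a u).trace = (cut (elim a u) (elim a u)
      (reduceL inr ((S.circ m).runL
        (tensor (ket (elim ω zeros)) (ket zeros))))).trace := fun a u => by
    rw [Sampler.state, dephase_eq, run_eq]; exact dephaseL_tp _ _
  simp only [h]
  rw [← sum_bits fun c => (cut c c _).trace, ← trace_split, trace_reduceL, runL_tp,
    trace_tensor_ket, trace_ket]

theorem Sampler.sum_state (ω : Bits (Ω m)) : ∑ a, ∑ u, tensor (ket (elim a u)) (S.state m ω a u) =
    (dephaseL inl ∘ₗ ext _ (dephaseL inl)) (reduceL inr ((S.circ m).runL (tensor (ket (elim ω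
    zeros)) (ket zeros)))) := by
  rw [comp_apply, tensor_cut_ket zeros, sum_bits]
  simp only [cut_ext, Sampler.state, dephase_eq, run_eq]; rfl

theorem Sampler.impl_prep : Impl (prepL fun ω => ∑ a, ∑ u, tensor (ket (elim a u)) (S.state m ω a
    u)) (10 * (card (Ω m) + card (S.anc m) + (card (S.aux m) + card (U m) + (card (Z m) + card (V
    m))) + (S.circ m).size + (card (S.aux m) + card (U m) + card (Z m)) + 1)) := by
  have h := Impl.prep (Ω := Ω m) (A := S.anc m) (S.circ m) _
    ((Impl.dephase (inl : _ ↪ (S.aux m ⊕ U m) ⊕ (Z m ⊕ V m))).comp ((Impl.dephase (inl : Z m ↪ Z m ⊕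
      V m)).act (inr : _ ↪ (S.aux m ⊕ U m) ⊕ (Z m ⊕ V m))))
  simp only [act_inr, ← S.sum_state m, card_sum] at h; exact h

end Sampler

section Distinguisher

variable {A X Y : ℕ → Reg} (D : Distinguisher A X Y) (m : ℕ)

def Distinguisher.accept : Op ((A m ⊕ X m) ⊕ Y m) →ₗ[ℂ] ℂ :=
  (bitL (D.bit m) ∘ₗ (D.circ m).runL) ∘ₗ tensorR (ket zeros)

theorem Distinguisher.prob_eq (ρ : Bits (A m) → Bits (X m) → Op (Y m)) :
    D.prob m ρ = (D.accept m (∑ a, ∑ x, tensor (ket (elim a x)) (ρ a x))).re := by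
  rw [Distinguisher.prob, run_eq]; rfl

theorem Distinguisher.test_accept :
    Test (D.accept m) ((D.circ m).size + 3 * card (D.anc m) + 2) := by
  have h := ((Test.bit (D.bit m)).comp (Impl.circuit (D.circ m))).fresh (φ := D.accept m)
    fun ρ => by rw [emb_inl]; rfl
  exact h.mono (by omega)

end Distinguisher

def OracleParty.execL {ℓ : ℕ} {In Out : Fin ℓ → Reg} {U X C : Reg} {W : Type} [Fintype W]
    [DecidableEq W] (P : OracleParty In Out U X C) (n : ℕ) (b : ℕ → LM (C ⊕ W) (C ⊕ W))
    (call : ℕ → Calls In Out W) (u : Bits U) (x : Bits X) : LM W W :=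
  P.finL x ∘ₗ iter (fun r => P.roundL r (b r) (call r)) n ∘ₗ P.initL u

theorem Sampler.prob_output {Ω U X Z V Y : ℕ → Reg} (S : Sampler Ω U Z V) (m : ℕ) {E : Type}
    [Fintype E] [DecidableEq E] (D : Distinguisher S.aux X Y) (c : Bits (Ω m) → ℝ) (κ : Bits (Ω m) →
    Op E) (out : Y m ↪ (Z m ⊕ V m) ⊕ E) (Φ : Bits (Ω m) → Bits (U m) → Bits (X m) → LM ((Z m ⊕ V
    m) ⊕ E) ((Z m ⊕ V m) ⊕ E)) : D.prob m (S.output m (fun ω => (c ω : ℂ) • κ ω) (fun ω u β x => Φ ω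
    u x β) out) = (∑ ω, (c ω : ℂ) * D.accept m (∑ a, ∑ x, tensor (ket (elim a x)) (∑ u, reduceL out
    (Φ ω u x (tensor (S.state m ω a u) (κ ω)))))).re := by
  rw [D.prob_eq]; congr 1
  have h : ∀ a x, S.output m (fun ω => (c ω : ℂ) • κ ω) (fun ω u β x => Φ ω u x β) out a x
      = ∑ ω, (c ω : ℂ) • ∑ u, reduceL out (Φ ω u x (tensor (S.state m ω a u) (κ ω))) := by
    intro a x; refine sum_ext fun ω => ?_; rw [smul_sum]; refine sum_ext fun u => ?_; dsimp only
    rw [reduce_eq, tensor_eq, map_smul, map_smul, map_smul]; rfl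
  have h2 : ∀ τ : Bits (Ω m) → Bits (S.aux m) → Bits (X m) → Op (Y m),
      ∑ a, ∑ x, tensor (ket (elim a x)) (∑ ω, (c ω : ℂ) • τ ω a x)
        = ∑ ω, (c ω : ℂ) • ∑ a, ∑ x, tensor (ket (elim a x)) (τ ω a x) := fun τ => by
    simp only [tensor_eq, map_sum, map_smul, smul_sum]
    exact (sum_ext fun a => sum_comm).trans sum_comm
  simp only [h, h2, map_sum (D.accept m), map_smul (D.accept m), smul_eq_mul]

section Composition

variable {ℓ : ℕ} {F : Fin ℓ → Functionality} {Pr : OracleProtocol F}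
  {π : ∀ i, QProtocol (F i)} {Z V Y : ℕ → Reg}

namespace ComposedAttack

def regs (B : ComposedAttack Pr π Z V Y) (m : ℕ) : Regs ℓ where
  R := Pr.rounds m
  In i := (F i).U m
  Out i := (F i).X m
  VI i := (F i).V m
  YO i := (F i).Y m
  ΩO i := (π i).Ω m
  MO i := (π i).M m
  U := Pr.U m
  X := Pr.X m
  C := Pr.C m
  Z := Z m
  V := V m
  BA := B.anc m

/-- The composed protocol under attack, with simulators for the sub-protocols. -/
def game (B : ComposedAttack Pr π Z V Y) (m : ℕ) (E : Fin ℓ → Reg) (init : ∀ i, Circuit ((π i).Ω m ⊕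
    E i)) (query : ∀ i, Circuit ((F i).V m ⊕ (((B.regs m).ZI ⊕ (B.regs m).adv) ⊕ E i))) (reply :
    ∀ i, Circuit ((F i).Y m ⊕ (((B.regs m).ZI ⊕ (B.regs m).adv) ⊕ E i))) : Game ℓ where
  toRegs := B.regs m
  E := E
  P := Pr.alice m
  alice i := (π i).alice m
  len i := (π i).rounds m
  step := B.step m
  bcall := B.call m
  init := init
  query := query
  reply := reply

variable (B : ComposedAttack Pr π Z V Y)

/-- The attack on sub-protocol `i` that the composed attack induces. -/
def subAttack (i : Fin ℓ) (m t : ℕ) : Circuit ((π i).M m ⊕ ((B.regs m).ZI ⊕ (B.regs m).adv)) :=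
  (B.game m (fun _ => ⟨Empty⟩) (fun _ => .skip) (fun _ => .skip) fun _ => .skip).attackC i t

variable (m : ℕ) {E : Fin ℓ → Reg} {init : ∀ i, Circuit ((π i).Ω m ⊕ E i)} {query : ∀ i, Circuit ((F
  i).V m ⊕ (((B.regs m).ZI ⊕ (B.regs m).adv) ⊕ E i))} {reply : ∀ i, Circuit ((F i).Y m ⊕ (((B.regs
  m).ZI ⊕ (B.regs m).adv) ⊕ E i))}

theorem crsProb_eq (ω : Bits (Pr.Ω π m)) : Pr.crsProb π ω
    = (B.game m E init query reply).prob (fun i w => ((π i).crs m w).toReal) ω := by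
  rw [OracleProtocol.crsProb, Finset.prod_range]
  refine Eq.trans ?_ (Fintype.prod_prod_type' (f := fun (r : Fin (Pr.rounds m)) (i : Fin ℓ) =>
    ((π i).crs m fun w => ω (r, ⟨i, w⟩)).toReal)).symm
  refine Finset.prod_congr rfl fun r _ => Finset.prod_congr rfl fun i _ => ?_; congr 2; funext w
  exact dif_pos r.2

variable (init query reply)

theorem prob_realOut (S : Sampler (Pr.Ω π) Pr.U Z V) (D : Distinguisher S.aux Pr.X Y) (L : (B.game m
    E init query reply).Ker) : D.prob m (B.realOut S m) = (B.game m E init query reply).hybrid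
    (S.state m) ((B.game m E init query reply).outφ (D.accept m) (B.out m)) (fun i w => ((π i).crs m
    w).toReal) L 0 := by
  have h : ∀ a x, B.realOut S m a x = S.output m
      (fun ω => (Pr.crsProb π ω : ℂ) • ket (elim ω zeros)) (fun ω u β x =>
        (Pr.alice m).execL (Pr.rounds m) (fun r => (B.step m r).runL) (fun r i u x =>
          ((π i).alice m).execL ((π i).rounds m) (fun t => (B.call m r i t).runL)
            (Pr.part π ω r i) u x) u x β) (B.out m) a x := fun a x => by
    refine sum_ext fun ω => sum_ext fun u => congrArg (reduce _) ?_
    exact OracleParty.exec_eq _ _ _ _ _ (fun r i u x β => Party.exec_eq _ _ _ _ _ _ _) _ _ _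
  rw [funext fun a => funext fun x => h a x, S.prob_output m D (fun ω => Pr.crsProb π ω)]
  refine congrArg Complex.re (sum_ext fun ω => ?_)
  refine congrArg₂ _ (congrArg _ (B.crsProb_eq m ω)) ?_
  exact ((B.game m E init query reply).val_zero L _ _ _ (S.dephaseL_state m) ω).symm

end ComposedAttack

end Composition

theorem sum_convex {ι : Type*} [Fintype ι] {c : ι → ℝ} (h : ∑ i, c i = 1) (z : ℂ) :
    ∑ i, (c i : ℂ) * z = z := by
  rw [← sum_mul, ← Complex.ofReal_sum, h, Complex.ofReal_one, one_mul]

section Composition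

variable {ℓ : ℕ} {F : Fin ℓ → Functionality} {Pr : OracleProtocol F}
  {π : ∀ i, QProtocol (F i)} {Z V Y : ℕ → Reg}

namespace ComposedAttack

variable (B : ComposedAttack Pr π Z V Y) (E : Fin ℓ → ℕ → Reg) (init : ∀ i m, Circuit ((π i).Ω m ⊕ E
  i m)) (query : ∀ i m, Circuit ((F i).V m ⊕ (((B.regs m).ZI ⊕ (B.regs m).adv) ⊕ E i m))) (reply :
  ∀ i m, Circuit ((F i).Y m ⊕ (((B.regs m).ZI ⊕ (B.regs m).adv) ⊕ E i m)))

def games (m : ℕ) : Game ℓ :=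
  B.game m (fun i => E i m) (fun i => init i m) (fun i => query i m) fun i => reply i m

local notation "𝒢" => B.games E init query reply

/-- The composed simulator. -/
def simulator : ComposedSimulator Pr (Pr.Ω π) Z V Y where
  anc m := (𝒢 m).anc
  init m := (𝒢 m).initC fun q => init q.2 m
  step m r := (𝒢 m).simStep r
  query m r i := (𝒢 m).simQuery r i
  reply m r i := (𝒢 m).simReply r i
  out m := (B.out m).trans (𝒢 m).wAdv

theorem prob_idealOut (S : Sampler (Pr.Ω π) Pr.U Z V) (D : Distinguisher S.aux Pr.X Y) (m : ℕ) :
    D.prob m ((B.simulator E init query reply).idealOut S m) = (𝒢 m).hybrid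
    (S.state m) ((𝒢 m).outφ (D.accept m) (B.out m)) (fun i w => ((π i).crs
    m w).toReal) (fun _ i => (F i).kernel m) (Pr.rounds m * ℓ) := by
  have hp : ∀ i, ∑ w, ((π i).crs m w).toReal = 1 := fun i => by
    rw [← ENNReal.toReal_sum fun w _ => ((π i).crs m).apply_ne_top w,
      ← tsum_fintype (L := .unconditional _), PMF.tsum_coe, ENNReal.toReal_one]
  have h1 : ∀ ω : Bits (Pr.Ω π m), (𝒢 m).val (fun _ i => (F i).kernel m)
      (S.state m) ((𝒢 m).outφ (D.accept m) (B.out m)) (Pr.rounds m * ℓ) ω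
      = D.accept m (∑ a, ∑ x, tensor (ket (elim a x))
        ((B.simulator E init query reply).idealOut S m a x)) := fun ω => by
    refine ((𝒢 m).val_last (fun i => (F i).kernel m) (S.state m)
      (D.accept m) (B.out m) (S.dephaseL_state m) ω).trans (congrArg _ ?_)
    refine sum_ext fun a => sum_ext fun x => congrArg (tensor _) ?_
    refine sum_ext fun η => sum_ext fun u =>
      congrArg (reduce _) (Eq.symm ?_)
    refine (OracleParty.exec_eq _ _ _ _ (fun r i u x => fexecL ((F i).kernel m) ((𝒢 m).simQuery
      r i).runL ((𝒢 m).simReply r i).runL u x) (fun r i u x β => Functionality.exec_eq _ _ _ _ _ _ _) _ _ _).trans ?_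
    refine congrArg (fun κ => (Pr.alice m).finL x (iter ((𝒢 m).simRound
      fun i => (F i).kernel m) (Pr.rounds m) ((Pr.alice m).initL u (tensor (S.state m η a u) κ))))
      ?_
    refine Eq.trans ?_ ((𝒢 m).initC_eq (fun q => init q.2 m) zeros η)
      |>.trans ?_
    · rw [elim_zeros]
      exact congrArg (cut η η) (run_eq ((B.simulator E init query reply).init m) (ket zeros))
    refine congrArg ((𝒢 m).ancSt η) (congrArg (fun κ =>
      (𝒢 m).memES κ η) (funext fun q => ?_))
    exact congrArg (fun b => ((init q.2 m).runL (ket b))) elim_zeros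
  have h2 := (𝒢 m).sum_prob hp; rw [D.prob_eq]
  refine congrArg Complex.re (Eq.symm ((sum_ext fun ω =>
    congrArg _ (h1 ω)).trans ?_))
  exact sum_convex h2 _

end ComposedAttack

end Composition

theorem le_sum_of_mem {ι : Type*} {s : Finset ι} (f : ι → ℕ) {i : ι} (hi : i ∈ s) :
    f i ≤ ∑ i ∈ s, f i :=
  single_le_sum (fun _ _ => Nat.zero_le _) hi

section Composition

variable {ℓ : ℕ} {F : Fin ℓ → Functionality} {Pr : OracleProtocol F}
  {π : ∀ i, QProtocol (F i)} {Z V Y : ℕ → Reg}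

namespace ComposedAttack

variable (B : ComposedAttack Pr π Z V Y) {T : Fin ℓ → ℕ → Reg}
  (Cf : ∀ i m, Circuit (((F i).U m ⊕ (F i).V m) ⊕ (((F i).X m ⊕ (F i).Y m) ⊕ T i m)))

/-- The size of the protocols, the functionalities and the attack. -/
def load (m : ℕ) : ℕ :=
  (∑ i, (card ((F i).U m) + card ((π i).Ω m) + card ((π i).M m) + card ((π i).alice m).anc + (π
    i).rounds m + ∑ t ∈ Finset.range ((π i).rounds m), (((π i).alice m).step t).size))
  + (∑ i, (card ((F i).U m) + card ((F i).V m) + card ((F i).X m) + card ((F i).Y m)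
    + card (T i m) + (Cf i m).size))
  + (card (Pr.U m) + card (Pr.C m) + card (Pr.alice m).anc + Pr.rounds m
    + ∑ r ∈ Finset.range (Pr.rounds m), ((Pr.alice m).step r).size)
  + (card (Z m) + card (V m) + card (B.anc m) + ∑ r ∈ Finset.range (Pr.rounds m),
    ((B.step m r).size + ∑ i, ∑ t ∈ Finset.range ((π i).rounds m), (B.call m r i t).size))

variable {B Cf} {m b : ℕ} (hb : B.load Cf m ≤ b)
include hb

theorem load_sub (i : Fin ℓ) : (card ((F i).U m) + card ((π i).Ω m) + card ((π i).M m) + card ((π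
    i).alice m).anc + (π i).rounds m + ∑ t ∈ Finset.range ((π i).rounds m), (((π i).alice m).step
    t).size) + (card ((F i).U m) + card ((F i).V m) + card ((F i).X m) + card ((F i).Y m) + card (T
    i m) + (Cf i m).size) ≤ b :=
  (add_le_add (le_sum_of_mem _ (mem_univ i)) (le_sum_of_mem _ (mem_univ i))).trans
    (((Nat.le_add_right _ _).trans (Nat.le_add_right _ _)).trans hb)

theorem load_step {r : ℕ} (hr : r < Pr.rounds m) : (B.step m r).size
    + ∑ i, ∑ t ∈ Finset.range ((π i).rounds m), (B.call m r i t).size ≤ b := by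
  have h1 := le_sum_of_mem (fun r => (B.step m r).size
    + ∑ i, ∑ t ∈ Finset.range ((π i).rounds m), (B.call m r i t).size) (Finset.mem_range.2 hr)
  unfold load at hb; dsimp only at h1; omega

theorem load_call {r : ℕ} (hr : r < Pr.rounds m) (i : Fin ℓ) {t : ℕ}
    (ht : t < (π i).rounds m) : (B.call m r i t).size ≤ b :=
  (le_sum_of_mem (fun t => (B.call m r i t).size) (Finset.mem_range.2 ht)).trans
    ((le_sum_of_mem (fun i => ∑ t ∈ Finset.range ((π i).rounds m), (B.call m r i t).size)
      (mem_univ i)).trans ((Nat.le_add_left _ _).trans (load_step hb hr)))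

theorem regs_le : (B.regs m).Le b where
  sub i := by
    have := load_sub hb i
    change card ((F i).U m) + card ((F i).X m) + card ((F i).V m) + card ((F i).Y m)
      + card ((π i).Ω m) + card ((π i).M m) ≤ b
    omega
  top := by
    unfold load at hb
    change Pr.rounds m + card (Pr.U m) + card (Pr.C m) + card (Z m) + card (V m)
      + card (B.anc m) ≤ b
    omega

theorem size_subAttack (i : Fin ℓ) {t : ℕ} (ht : t < (π i).rounds m) :
    (B.subAttack i m t).size ≤ b * (1 + b) := by
  refine (size_dispatchC _ _ _).le.trans ((sum_le_card_nsmul _ _ (1 + b)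
    fun r _ => Nat.add_le_add_left (load_call hb r.2 i ht) _).trans ?_)
  rw [card_univ, card_fin, smul_eq_mul]; exact Nat.mul_le_mul_right _ (regs_le hb).R_le

theorem game_le {E : Fin ℓ → Reg} {init : ∀ i, Circuit ((π i).Ω m ⊕ E i)} {query : ∀ i, Circuit ((F
    i).V m ⊕ (((B.regs m).ZI ⊕ (B.regs m).adv) ⊕ E i))} {reply : ∀ i, Circuit ((F i).Y m ⊕ (((B.regs
    m).ZI ⊕ (B.regs m).adv) ⊕ E i))} (hE : ∀ i, card (E i) + (init i).size + (query i).size + (reply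
    i).size ≤ b) : (B.game m E init query reply).Le b where
  regs := regs_le hb
  sub := hE
  party i := by
    have := load_sub hb i; change card ((π i).alice m).anc + (π i).rounds m ≤ b; omega
  anc := by
    unfold load at hb; change card (Pr.alice m).anc ≤ b; omega
  alice i t ht := by
    have h1 := load_sub hb i
    have h2 := le_sum_of_mem (s := Finset.range ((π i).rounds m))
      (fun t => (((π i).alice m).step t).size) (Finset.mem_range.2 ht)
    change (((π i).alice m).step t).size ≤ b; omega
  pstep r hr := by
    have h2 := le_sum_of_mem (s := Finset.range (Pr.rounds m))
      (fun r => ((Pr.alice m).step r).size) (Finset.mem_range.2 hr)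
    unfold load at hb; change ((Pr.alice m).step r).size ≤ b; omega
  step r hr := (Nat.le_add_right _ _).trans (load_step hb hr)
  bcall r hr i t ht := load_call hb hr i ht

omit hb

theorem polyBounded_load (hF : ∀ i, PolyBounded fun m => card ((F i).U m) + card ((F i).V m) + card
    ((F i).X m) + card ((F i).Y m) + card (T i m) + (Cf i m).size) (hπ : ∀ i, (π i).PolyAlice)
    (hPr : Pr.PolyAlice) (hB : B.Poly) : PolyBounded (B.load Cf) :=
  (((PolyBounded.sum _ fun i _ => hπ i).add (PolyBounded.sum _ fun i _ => hF i)).add hPr).add hB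

theorem polyBounded_subAttack (h : PolyBounded (B.load Cf)) (i : Fin ℓ) : PolyBounded fun m => card
    (B.regs m).ZI + card (B.regs m).adv + ∑ t ∈ Finset.range ((π i).rounds m), (B.subAttack i m
    t).size := by
  have c := PolyBounded.const
  refine (((c 20).mul (h.memBound ℓ)).add (h.mul (h.mul ((c 1).add h)))).mono fun m => ?_
  have h1 := Regs.card_ZI (regs_le (le_refl (B.load Cf m)))
  have h2 := Regs.card_adv (regs_le (le_refl (B.load Cf m)))
  have h3 := load_sub (le_refl (B.load Cf m)) i
  have h4 : ∑ t ∈ Finset.range ((π i).rounds m), (B.subAttack i m t).size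
      ≤ B.load Cf m * (B.load Cf m * (1 + B.load Cf m)) := by
    refine (sum_le_card_nsmul _ _ _ fun t ht =>
      size_subAttack (le_refl (B.load Cf m)) i (Finset.mem_range.1 ht)).trans ?_
    rw [Finset.card_range, smul_eq_mul]; exact Nat.mul_le_mul_right _ (by omega)
  unfold memBound; omega

variable {E : Fin ℓ → ℕ → Reg} {init : ∀ i m, Circuit ((π i).Ω m ⊕ E i m)} {query : ∀ i m, Circuit
  ((F i).V m ⊕ (((B.regs m).ZI ⊕ (B.regs m).adv) ⊕ E i m))} {reply : ∀ i m, Circuit ((F i).Y m ⊕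
  (((B.regs m).ZI ⊕ (B.regs m).adv) ⊕ E i m))}

local notation "𝒢" => B.games E init query reply

theorem poly_simulator {b : ℕ → ℕ} (hb : PolyBounded b) (h : ∀ m, (𝒢 m).Le
    (b m)) : (B.simulator E init query reply).Poly := by
  have c := PolyBounded.const; have hM := hb.memBound ℓ
  refine (((c 10).mul hM).add ((c 5).mul hM)).add (hb.mul (((c 8).mul hM).add
    ((c ℓ).mul ((c 20).mul hM)))) |>.mono fun m => ?_
  refine add_le_add (add_le_add ?_ ?_) ?_
  · exact (card_le_of_embedding (inr :
      (𝒢 m).anc ↪ (𝒢 m).W)).trans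
        (Game.card_W (h m))
  · have h1 := Game.size_initC_inits (h m) (Pr.rounds m * ℓ)
    have h2 : (𝒢 m).inits (Pr.rounds m * ℓ)
        = fun q : Fin (Pr.rounds m) × Fin ℓ => init q.2 m := funext fun q =>
      if_pos ((𝒢 m).index_bound q.1 q.2)
    rw [h2] at h1; exact h1
  refine (sum_le_card_nsmul _ _ (8 * memBound ℓ (b m) + ℓ * (20 * memBound ℓ (b m)))
    fun r hr => add_le_add (Game.size_simStep (h m) r (Finset.mem_range.1 hr))
      ((sum_le_card_nsmul _ _ _ fun i _ => Game.size_simQuery (h m) r i).trans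
        (le_of_eq (by simp)))).trans ?_
  rw [Finset.card_range, smul_eq_mul]; exact Nat.mul_le_mul_right _ (h m).regs.R_le

end ComposedAttack

end Composition

theorem negligible_of_le {ℓ : ℕ} {gap : Fin ℓ → ℕ → ℝ} {R : ℕ → ℕ} {ε δ : ℕ → ℝ} (hgap : ∀ i,
    Negligible (gap i)) (hR : PolyBounded R) (hε : Negligible ε) (h : ∀ m, |δ m| ≤ R m * (∑ i, 2 *
    gap i m + (ℓ + 1) * (R m * ε m)) + R m * ε m) : Negligible δ := by
  have hn := Negligible.add (Negligible.mul_poly (Negligible.add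
    (Negligible.sum univ fun i _ => (hgap i).mul_poly (PolyBounded.const 2))
    ((hε.mul_poly hR).mul_poly (PolyBounded.const (ℓ + 1)))) hR) (hε.mul_poly hR)
  refine hn.mono fun m => ((h m).trans (le_of_eq ?_)).trans (le_abs_self _)
  push_cast
  rfl

section Composition

variable {ℓ : ℕ} {F : Fin ℓ → Functionality} {Pr : OracleProtocol F} {π : ∀ i, QProtocol (F i)} {Z V
  Y : ℕ → Reg} {B : ComposedAttack Pr π Z V Y} {T : Fin ℓ → ℕ → Reg} {Cf : ∀ i m, Circuit (((F i).U
  m ⊕ (F i).V m) ⊕ (((F i).X m ⊕ (F i).Y m) ⊕ T i m))} {E : Fin ℓ → ℕ → Reg} {init : ∀ i m, Circuit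
  ((π i).Ω m ⊕ E i m)} {query : ∀ i m, Circuit ((F i).V m ⊕ (((B.regs m).ZI ⊕ (B.regs m).adv) ⊕ E i
  m))} {reply : ∀ i m, Circuit ((F i).Y m ⊕ (((B.regs m).ZI ⊕ (B.regs m).adv) ⊕ E i m))}

local notation "𝒢" => B.games E init query reply

/-- The trials to which the advantage of a distinguisher is reduced. -/
theorem ComposedAttack.exists_trials (S : Sampler (Pr.Ω π) Pr.U Z V) (hS : S.Legitimate) (D :
    Distinguisher S.aux Pr.X Y) {m b : ℕ} (hb : (𝒢 m).Le b) (hC : ∀ i, card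
    (T i m) + (Cf i m).size ≤ b) (hSb : 10 * (card (Pr.Ω π m) + card (S.anc m) + (card (S.aux m) +
    card (Pr.U m) + (card (Z m) + card (V m))) + (S.circ m).size + (card (S.aux m) + card (Pr.U m) +
    card (Z m)) + 1) ≤ b) (hDb : (D.circ m).size + 3 * card (D.anc m) + 2 + card (S.aux m) + card
    (Pr.X m) ≤ b) {ε : ℝ} (hε : 0 ≤ ε) (hCf : ∀ i u v, ∑ x, ∑ y, |circKernel (Cf i m) u v x y - (F
    i).kernel m u v x y| ≤ ε) : ∃ S' : ∀ i, (𝒢 m).GameTrial i (20 *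
    memBound ℓ b), |D.prob m (B.realOut S m) - D.prob m ((B.simulator E init query reply).idealOut S
    m)| ≤ Pr.rounds m * (∑ i, 2 * (𝒢 m).gap (fun i => (F i).kernel m) (fun
    i w => ((π i).crs m w).toReal) (S' i) + (ℓ + 1) * (Pr.rounds m * ε)) + Pr.rounds m * ε := by
  have hM : b ≤ 20 * memBound ℓ b := by unfold memBound; omega
  have hp : ∀ i, ∑ w, ((π i).crs m w).toReal = 1 := fun i => by
    rw [← ENNReal.toReal_sum fun w _ => ((π i).crs m).apply_ne_top w,
      ← tsum_fintype (L := .unconditional _), PMF.tsum_coe, ENNReal.toReal_one]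
  have hφ : Test ((𝒢 m).outφ (D.accept m) (B.out m))
      (20 * memBound ℓ b) :=
    (((D.test_accept m).comp (Impl.dephase _)).reduce _).mono (by
      rw [card_sum]; change _ + (card (S.aux m) + card (Pr.X m)) ≤ _
      omega)
  have h := (𝒢 m).hybrid_total
    (hb.sizeLE (Cf := fun i => Cf i m) hC (AUX := S.aux m) (by omega))
    hφ ((S.impl_prep m).mono (hSb.trans hM)) (S.lines_of_legitimate hS m)
    (fun i => markov_kernel (F i) m) hp (fun i w => ENNReal.toReal_nonneg)
    (S.posSemidef_state m) (S.trace_state m) hε hCf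
  rw [prob_idealOut, B.prob_realOut m (fun i => init i m) (fun i => query i m)
    (fun i => reply i m) S D fun _ i => (F i).kernel m]
  exact h

end Composition

end

end SeqComp

open SeqComp in
theorem mainTheorem10 {ℓ : ℕ} (F : Fin ℓ → SeqComp.Functionality)
    (π : ∀ i, SeqComp.QProtocol (F i)) (Pr : SeqComp.OracleProtocol F)
    (hF : ∀ i, (F i).Efficient) (hπ : ∀ i, (π i).PolyAlice) (hPr : Pr.PolyAlice)
    (hsec : ∀ i, SeqComp.CompSecure (F i) (π i)) :
    ∀ (Z V Y : ℕ → SeqComp.Reg) (B : SeqComp.ComposedAttack Pr π Z V Y), B.Poly →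
      ∃ B' : SeqComp.ComposedSimulator Pr (Pr.Ω π) Z V Y, B'.Poly ∧
        ∀ S : SeqComp.Sampler (Pr.Ω π) Pr.U Z V, S.Poly → S.Legitimate →
          SeqComp.QIndist (B.realOut S) (B'.idealOut S) := by
  intro Z V Y B hB
  choose T Cf ε hFp hε hCf using hF
  simp only [run_eq] at hCf
  have hload : PolyBounded (B.load Cf) := B.polyBounded_load hFp hπ hPr hB
  choose E init query reply hE htr using fun i =>
    (hsec i).trials (B.subAttack i) (B.polyBounded_subAttack hload i)
  let b₀ : ℕ → ℕ := fun m => B.load Cf m + ∑ i, (Fintype.card (E i m) + (init i m).size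
    + (query i m).size + (reply i m).size)
  have hb₀ : PolyBounded b₀ := hload.add (PolyBounded.sum _ fun i _ => hE i)
  have hgame : ∀ m b, b₀ m ≤ b → (B.games E init query reply m).Le b := fun m b h =>
    ComposedAttack.game_le (Cf := Cf) ((Nat.le_add_right _ _).trans h) fun i =>
      (le_sum_of_mem (fun i => Fintype.card (E i m) + (init i m).size + (query i m).size
        + (reply i m).size) (Finset.mem_univ i)).trans ((Nat.le_add_left _ _).trans h)
  refine ⟨B.simulator E init query reply,
    ComposedAttack.poly_simulator hb₀ fun m => hgame m _ le_rfl, fun S hS hSl D hD => ?_⟩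
  have c := PolyBounded.const
  let b : ℕ → ℕ := fun m => 100 * memBound ℓ (b₀ m) + 100 * (Fintype.card (S.aux m)
    + Fintype.card (S.anc m) + (S.circ m).size)
    + 100 * (Fintype.card (D.anc m) + (D.circ m).size) + 100
  have hb : PolyBounded b := ((((c 100).mul (hb₀.memBound ℓ)).add ((c 100).mul hS)).add
    ((c 100).mul hD)).add (c 100)
  have hbb : ∀ m, b₀ m ≤ b m := fun m => by
    change _ ≤ 100 * memBound ℓ (b₀ m) + _ + _ + 100
    unfold memBound
    omega
  have key := fun m => ComposedAttack.exists_trials (Cf := Cf) S hSl D (hgame m (b m) (hbb m))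
    (fun i => by
      have h := ComposedAttack.load_sub ((Nat.le_add_right _ _).trans (hbb m)) i
      omega)
    (by
      have h1 := (hgame m (b₀ m) le_rfl).regs.top
      have h2 := Regs.card_Ω (hgame m (b₀ m) le_rfl).regs
      change Pr.rounds m + Fintype.card (Pr.U m) + Fintype.card (Pr.C m) + Fintype.card (Z m)
        + Fintype.card (V m) + Fintype.card (B.anc m) ≤ _ at h1
      change Fintype.card (Pr.Ω π m) ≤ _ at h2
      change _ ≤ 100 * memBound ℓ (b₀ m) + _ + _ + 100
      unfold memBound
      omega)
    (by
      have h1 := (hgame m (b₀ m) le_rfl).regs.top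
      have h2 := (hgame m (b₀ m) le_rfl).anc
      have h3 := Fintype.card_le_of_embedding (Pr.alice m).out
      rw [Fintype.card_sum] at h3
      change Pr.rounds m + Fintype.card (Pr.U m) + Fintype.card (Pr.C m) + Fintype.card (Z m)
        + Fintype.card (V m) + Fintype.card (B.anc m) ≤ _ at h1
      change Fintype.card (Pr.alice m).anc ≤ _ at h2
      change _ ≤ 100 * memBound ℓ (b₀ m) + _ + _ + 100
      unfold memBound
      omega)
    (ε := ∑ i, |ε i m|) (Finset.sum_nonneg fun i _ => abs_nonneg _) fun i u v =>
      ((hCf i m u v).trans (le_abs_self _)).trans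
        (Finset.single_le_sum (fun i _ => abs_nonneg (ε i m)) (Finset.mem_univ i))
  choose S' hS' using key
  have hgap : ∀ i, Negligible fun m => (B.games E init query reply m).gap
      (fun i => (F i).kernel m) (fun i w => ((π i).crs m w).toReal) (S' m i) := fun i =>
    htr i _ (((c 20).mul (hb.memBound ℓ)).trialBound ℓ) _ fun m => ⟨S' m i, (abs_abs _).le⟩
  exact negligible_of_le (gap := fun i m => (B.games E init query reply m).gap
    (fun i => (F i).kernel m) (fun i w => ((π i).crs m w).toReal) (S' m i)) hgap
    (hPr.mono fun m => by omega) (Negligible.sum _ fun i _ => (hε i).abs)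
    fun m => (abs_abs _).le.trans (hS' m)
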